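/- **Setting.** Fix $m\ge 1$. Let $\langle u,v\rangle=-u_0v_0+\sum_{i=1}^m u_iv_i$ on $\mathbf R^{1+m}$, and let $\mathbf H=\{(t,x)\in\mathbf R^{1+m}: t=+\sqrt{1+|x|^2}\}$ be hyperbolic space with the induced Riemannian metric $h$. Let $G$ be the group of linear isometries of $(\mathbf R^{1+m},\langle\cdot,\cdot\rangle)$ of determinant one that preserve $\mathbf H$. On $\mathbf R^{1+2}$ let $g=\mathrm{diag}(-1,1,1)$, with indices raised by $g$. *Classical data* are pairs $\Phi=(\phi_0,\phi_1)$, where $\phi_0:\mathbf R^2\to\mathbf H$ differs from a constant of $\mathbf H$ by a Schwartz function, and $\phi_1:\mathbf R^2\to\mathbf R^{1+m}$ is Schwartz with $\phi_1(x)\in T_{\phi_0(x)}\mathbf H$; $\mathcal S$ is the space of classical data with the Schwartz topology. A *classical wave map* $(\phi,I)$ on an open interval $I$ is a smooth $\phi:I\times\mathbf R^2\to\mathbf H$ which differs from a constant of $\mathbf H$ by a function that is Schwartz in space (all spacetime derivatives, locally uniformly in time), with $(\phi^*\nabla)^\alpha\partial_\alpha\phi=0$, $\nabla$ being the Levi-Civita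 connection of $\mathbf H$. Put $\phi[t]=(\phi(t),\partial_t\phi(t))\in\mathcal S$. For $\Phi\in\mathcal S$ put $$T_{\alpha\beta}(\Phi)=\langle\partial_\alpha\phi,\partial_\beta\phi\rangle_h-\tfrac12 g_{\alpha\beta}\langle\partial^\gamma\phi,\partial_\gamma\phi\rangle_h,\qquad \partial_0\phi:=\phi_1,\quad \partial_i\phi:=\partial_i\phi_0 .$$ For $x_0\in\mathbf R^2$, $\lambda>0$, $U\in G$ put $\mathrm{Trans}_{x_0}\Phi=(\phi_0(\cdot-x_0),\phi_1(\cdot-x_0))$, $\mathrm{Rev}\,\Phi=(\phi_0,-\phi_1)$, $\mathrm{Rot}_U\Phi=(U\phi_0,U\phi_1)$, $\mathrm{Dil}_\lambda\Phi=(\phi_0(\cdot/\lambda),\lambda^{-1}\phi_1(\cdot/\lambda))$. **Claim 1 (energy space).** There are a complete metric space $\mathcal E$ and a continuous $\iota:\mathcal S\to\mathcal E$ such that: (i) $\iota(\mathcal S)$ is dense; (ii) $\iota(\mathrm{Rot}_U\Phi)=\iota(\Phi)$ for all $U\in G$, and $\iota(\Phi)=\iota(\Psi)$ implies $\Psi=\mathrm{Rot}_U\Phi$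 for some $U\in G$; (iii) $\mathrm{Trans}_{x_0}$, $\mathrm{Rev}$, $\mathrm{Dil}_\lambda$ extend through $\iota$ to a continuous isometric action on $\mathcal E$; (iv) $T$ extends through $\iota$ to a continuous map $T:\mathcal E\to L^1(\mathbf R^2\to\mathrm{Sym}^2(\mathbf R^{1+2}))$; put $E(\Phi)=\int_{\mathbf R^2}T_{00}(\Phi)\,dx$; (v) if $E(\Phi)=0$ then $\Phi=\iota(p,0)$ for every $p\in\mathbf H$. For $\Phi\in\mathcal E$ and a vector $w^\alpha$ (possibly depending on $x$), the expression $|w^\alpha\partial_\alpha\phi|_h^2$ means $w^\alpha w^\beta(T_{\alpha\beta}-g_{\alpha\beta}g^{\gamma\delta}T_{\gamma\delta})$, with $T=T(\Phi)$; identities between such expressions hold almost everywhere. **Claim 2 (local well-posedness).** To each $t_0\in\mathbf R$ and $\Phi_0\in\mathcal E$ there are assigned a maximal lifespan $I\subset\mathbf R$ and a maximal Cauchy development $\phi:I\to\mathcal E$, $t\mapsto\phi[t]$, with $\phi[t_0]=\Phi_0$, such that: (i) $I$ is an open interval containing $t_0$; (ii) $\phi$ is continuous; (iii) if $\Phi_0=\iota(\tilde\Phi_0)$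 with $\tilde\Phi_0\in\mathcal S$, there is a classical wave map $(\tilde\phi,I)$ with $\tilde\phi[t_0]=\tilde\Phi_0$ and $\phi[t]=\iota(\tilde\phi[t])$ for all $t\in I$; (iv) if $\Phi_{0,n}\to\Phi_{0,\infty}$ in $\mathcal E$, with developments $\phi_n:I_n\to\mathcal E$ and $\phi_\infty:I_\infty\to\mathcal E$ from time $t_0$, then for every compact interval $K\subset I_\infty$ one has $K\subset I_n$ for all large $n$, and $\phi_n\to\phi_\infty$ uniformly on $K$; (v) if $t_*\in\mathbf R$ is a finite endpoint of $I$ and $t_n\in I$, $t_n\to t_*$, then $\phi[t_n]$ does not converge in $\mathcal E$. An *energy class solution* is the restriction of a maximal Cauchy development to an interval. A solution $\phi:I\to\mathcal E$ is *almost periodic* if there are $N:I\to(0,\infty)$, $x:I\to\mathbf R^2$ and a compact $K\subset\mathcal E$ with $\mathrm{Dil}_{N(t)}\mathrm{Trans}_{-x(t)}\phi[t]\in K$ for all $t\in I$. It is *travelling* with velocity $v\in\mathbf R^2$ if $|\partial_t\phi+v\cdot\nabla_x\phi|_h^2=0$ on $I\times\mathbf R^2$, and *self-similar* if $T=0$ outside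 $\{|x|\le|t|\}$ and $|t\partial_t\phi+x\cdot\nabla_x\phi|_h^2=0$ on $I\times\mathbf R^2$. **Global well-posedness in the energy class** is the assertion that $I=\mathbf R$ for every maximal Cauchy development in Claim 2. **Claim 3.** If global well-posedness in the energy class fails, there is an almost periodic maximal Cauchy development of non-zero energy. **Claim 4.** (i) Every almost periodic energy class solution $\phi:\mathbf R\to\mathcal E$ that is travelling with some velocity $v$, $|v|<1$, has zero energy. (ii) Every almost periodic, self-similar energy class solution $\phi:(-\infty,0)\to\mathcal E$ has zero energy. **Claim 5.** Let $v\in\mathbf R^2$, $|v|=1$, and $\Phi=(\phi_0,\phi_1)\in\mathcal E$ be such that $|\phi_1+v\cdot\nabla\phi_0|_h^2=0$, and $|w\cdot\nabla\phi_0|_h^2=0$ for every $w\in\mathbf R^2$ orthogonal to $v$. Then $E(\Phi)=0$. **Theorem.** Assume that Claims 1–5 hold, with the same energy space and the same maximal Cauchy developments throughout. Then global well-posedness in the energy class holds: every maximal Cauchy development has lifespan $\mathbf R$. Consequently, for every $\Phi_0\in\mathcal S$ there is a unique global classical wave map $(\phi,\mathbf R)$ with $\phi[0]=\Phi_0$.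 -/

import Mathlib

open Filter Topology MeasureTheory
open scoped ContDiff SchwartzMap

noncomputable section

namespace WaveMap

/-! ### Minkowski space and the hyperboloid model of hyperbolic space -/

/-- The spatial domain `ℝ²` with its Euclidean norm. -/
abbrev Plane : Type := EuclideanSpace ℝ (Fin 2)

/-- The vector space `ℝ^{1+m}` in which the target is embedded; coordinate `0` is the time
coordinate. -/
abbrev Ambient (m : ℕ) : Type := EuclideanSpace ℝ (Fin (m + 1))

variable {m : ℕ}

/-- The Minkowski form of `ℝ^{1+m}`, of signature `(-, +, …, +)`. -/
def mink (u v : Ambient m) : ℝ := -(u 0 * v 0) + ∑ i : Fin m, u i.succ * v i.succ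

/-- Hyperbolic space `H^m`: the upper sheet `t = +√(1 + |x|²)` of the unit hyperboloid. -/
def hyperboloid (m : ℕ) : Set (Ambient m) :=
  {p | p 0 = √(1 + ∑ i : Fin m, p i.succ ^ 2)}

/-- The tangent space `T_p H^m`, as a subset of `ℝ^{1+m}`. The Riemannian metric `h` of `H^m` is
the restriction of `mink` to it. -/
def tangent (p : Ambient m) : Set (Ambient m) := {v | mink p v = 0}

/-- The orthogonal projection of `ℝ^{1+m}` onto `T_p H^m`, for `p` in the hyperboloid
(where `mink p p = -1`). -/
def tangentProj (p w : Ambient m) : Ambient m := w + mink p w • p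

/-- The rotation group of `H^m`: the linear isometries of Minkowski space `ℝ^{1+m}` of determinant
one which map the upper sheet of the hyperboloid to itself. -/
structure Rotation (m : ℕ) where
  toCLM : Ambient m →L[ℝ] Ambient m
  isometry : ∀ u v, mink (toCLM u) (toCLM v) = mink u v
  det_eq_one : toCLM.det = 1
  maps_hyperboloid : ∀ p ∈ hyperboloid m, toCLM p ∈ hyperboloid m

/-! ### Classical wave maps -/

/-- The metric `g = diag (-1, 1, 1)` of `ℝ^{1+2}`; the inverse metric has the same components. -/
def g (α β : Fin 3) : ℝ := if α = β then (if α = 0 then -1 else 1) else 0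

/-- The standard basis of `ℝ^{1+2} = ℝ × ℝ²`; index `0` is time. -/
def basisVec : Fin 3 → ℝ × Plane :=
  Fin.cons (1, 0) fun i : Fin 2 => (0, EuclideanSpace.single i 1)

/-- The partial derivative `∂_α F` on `ℝ^{1+2}`. -/
def pd (α : Fin 3) (F : ℝ × Plane → Ambient m) (z : ℝ × Plane) : Ambient m :=
  fderiv ℝ F z (basisVec α)

/-- The covariant derivative `(φ^*∇)_α X` of a section `X` of `φ^*(T H)`, where `∇` is the
Levi-Civita connection of `H^m`, i.e. the tangential part of the flat derivative. -/
def covD (φ : ℝ × Plane → Ambient m) (α : Fin 3) (X : ℝ × Plane → Ambient m) (z : ℝ × Plane) :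
    Ambient m :=
  tangentProj (φ z) (pd α X z)

/-- Classical wave maps `(φ, I)` on an open interval `I`; the values of `φ` at times outside `I`
are irrelevant. -/
structure IsClassicalWaveMap (I : Set ℝ) (φ : ℝ × Plane → Ambient m) : Prop where
  isOpen : IsOpen I
  ordConnected : I.OrdConnected
  smooth : ContDiffOn ℝ ∞ φ (I ×ˢ Set.univ)
  mem_hyperboloid : ∀ t ∈ I, ∀ x, φ (t, x) ∈ hyperboloid m
  /-- `φ` differs from a constant `φ(∞) ∈ H^m` by a function which is Schwartz in space (all
  spacetime derivatives decay rapidly in space, locally uniformly in time). -/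
  schwartz : ∃ p ∈ hyperboloid m, ∀ J : Set ℝ, IsCompact J → J ⊆ I → ∀ k n : ℕ, ∃ C : ℝ,
    ∀ t ∈ J, ∀ x : Plane, ‖x‖ ^ k * ‖iteratedFDeriv ℝ n (fun z => φ z - p) (t, x)‖ ≤ C
  /-- The wave map equation `(φ^*∇)^α ∂_α φ = 0`. -/
  equation : ∀ t ∈ I, ∀ x, ∑ α, ∑ β, g α β • covD φ α (pd β φ) (t, x) = 0

/-! ### Classical data -/

/-- Classical data `(φ₀, φ₁)`, with `φ₀ = base + dev`. The constant `base = φ₀(∞)` is determined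
by `φ₀`, since `dev` tends to zero at infinity. -/
@[ext]
structure ClassicalData (m : ℕ) where
  base : Ambient m
  dev : 𝓢(Plane, Ambient m)
  vel : 𝓢(Plane, Ambient m)
  base_mem : base ∈ hyperboloid m
  pos_mem : ∀ x, base + dev x ∈ hyperboloid m
  vel_mem : ∀ x, vel x ∈ tangent (base + dev x)

/-- The Schwartz topology on classical data. -/
instance : TopologicalSpace (ClassicalData m) :=
  TopologicalSpace.induced
    (fun Φ => ((Φ.base, Φ.dev, Φ.vel) : Ambient m × 𝓢(Plane, Ambient m) × 𝓢(Plane, Ambient m)))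
    inferInstance

theorem mink_smul_right (u v : Ambient m) (c : ℝ) : mink u (c • v) = c * mink u v := by
  simp only [mink, PiLp.smul_apply, smul_eq_mul, mul_add, Finset.mul_sum]
  congr 1
  · ring
  · exact Finset.sum_congr rfl fun i _ => by ring

namespace ClassicalData

/-- The position component `φ₀ : ℝ² → H^m` of the data. -/
def pos (Φ : ClassicalData m) (x : Plane) : Ambient m := Φ.base + Φ.dev x

/-- The constant data `(p, 0)`. -/
def const (p : Ambient m) (hp : p ∈ hyperboloid m) : ClassicalData m where
  base := p
  dev := 0
  vel := 0
  base_mem := hp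
  pos_mem x := by simpa using hp
  vel_mem x := by simp [tangent, mink]

/-- `(φ₀(x), φ₁(x)) ↦ (φ₀(x - x₀), φ₁(x - x₀))`. -/
def trans (x₀ : Plane) (Φ : ClassicalData m) : ClassicalData m where
  base := Φ.base
  dev := SchwartzMap.compSubConstCLM ℝ x₀ Φ.dev
  vel := SchwartzMap.compSubConstCLM ℝ x₀ Φ.vel
  base_mem := Φ.base_mem
  pos_mem x := Φ.pos_mem (x - x₀)
  vel_mem x := Φ.vel_mem (x - x₀)

/-- `(φ₀(x), φ₁(x)) ↦ (φ₀(x), -φ₁(x))`. -/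
def rev (Φ : ClassicalData m) : ClassicalData m where
  base := Φ.base
  dev := Φ.dev
  vel := -Φ.vel
  base_mem := Φ.base_mem
  pos_mem := Φ.pos_mem
  vel_mem x := by
    have h : mink (Φ.base + Φ.dev x) (Φ.vel x) = 0 := Φ.vel_mem x
    have h2 := mink_smul_right (Φ.base + Φ.dev x) (Φ.vel x) (-1)
    rw [h, mul_zero, neg_one_smul] at h2
    exact h2

/-- `(φ₀(x), φ₁(x)) ↦ (U φ₀(x), U φ₁(x))`; as `U` is linear, `dU = U`. -/
def rot (U : Rotation m) (Φ : ClassicalData m) : ClassicalData m where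
  base := U.toCLM Φ.base
  dev := SchwartzMap.postcompCLM U.toCLM Φ.dev
  vel := SchwartzMap.postcompCLM U.toCLM Φ.vel
  base_mem := U.maps_hyperboloid _ Φ.base_mem
  pos_mem x := by
    have h := U.maps_hyperboloid _ (Φ.pos_mem x)
    rw [map_add] at h
    exact h
  vel_mem x := by
    have h : mink (Φ.base + Φ.dev x) (Φ.vel x) = 0 := Φ.vel_mem x
    rw [← U.isometry, map_add] at h
    exact h

/-- The dilation of the plane by the factor `1 / l`. -/
def scaleInv (l : Set.Ioi (0 : ℝ)) : Plane ≃L[ℝ] Plane :=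
  ContinuousLinearEquiv.smulLeft (Units.mk0 (l : ℝ)⁻¹ (inv_ne_zero (ne_of_gt l.2)))

/-- `(φ₀(x), φ₁(x)) ↦ (φ₀(x / l), (1 / l) φ₁(x / l))`. -/
def dil (l : Set.Ioi (0 : ℝ)) (Φ : ClassicalData m) : ClassicalData m where
  base := Φ.base
  dev := SchwartzMap.compCLMOfContinuousLinearEquiv ℝ (scaleInv l) Φ.dev
  vel := (l : ℝ)⁻¹ • SchwartzMap.compCLMOfContinuousLinearEquiv ℝ (scaleInv l) Φ.vel
  base_mem := Φ.base_mem
  pos_mem x := Φ.pos_mem (scaleInv l x)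
  vel_mem x := by
    have h : mink (Φ.base + Φ.dev (scaleInv l x)) (Φ.vel (scaleInv l x)) = 0 :=
      Φ.vel_mem (scaleInv l x)
    have h2 := mink_smul_right (Φ.base + Φ.dev (scaleInv l x)) (Φ.vel (scaleInv l x)) (l : ℝ)⁻¹
    rw [h, mul_zero] at h2
    exact h2

/-- The derivatives `(∂_0 φ, ∂_1 φ, ∂_2 φ) = (φ₁, ∂_1 φ₀, ∂_2 φ₀)` determined by the data. -/
def partialD (Φ : ClassicalData m) (α : Fin 3) (x : Plane) : Ambient m :=
  Fin.cons (α := fun _ => Ambient m) (Φ.vel x)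
    (fun i : Fin 2 => fderiv ℝ Φ.pos x (EuclideanSpace.single i 1)) α

/-- The stress-energy tensor
`T_{αβ} = ⟨∂_α φ, ∂_β φ⟩ - (1/2) g_{αβ} ⟨∂^γ φ, ∂_γ φ⟩` of classical data. -/
def stressEnergy (Φ : ClassicalData m) (x : Plane) (α β : Fin 3) : ℝ :=
  mink (Φ.partialD α x) (Φ.partialD β x)
    - 1 / 2 * g α β * ∑ γ, ∑ δ, g γ δ * mink (Φ.partialD γ x) (Φ.partialD δ x)

end ClassicalData

/-- `φ[t] = Φ`, i.e. `(φ(t), ∂_t φ(t)) = (φ₀, φ₁)`. -/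
def HasData (φ : ℝ × Plane → Ambient m) (t : ℝ) (Φ : ClassicalData m) : Prop :=
  ∀ x, φ (t, x) = Φ.pos x ∧ pd 0 φ (t, x) = Φ.vel x

/-- Global regularity for wave maps: all classical data at time `0` are the initial data of
exactly one global classical wave map. -/
def GlobalRegularity (m : ℕ) : Prop :=
  ∀ Φ₀ : ClassicalData m, ∃! φ : ℝ × Plane → Ambient m,
    IsClassicalWaveMap Set.univ φ ∧ HasData φ 0 Φ₀

/-! ### The energy space -/

/-- The quadratic expression `|w^α ∂_α φ|²_h = w^α w^β ⟨∂_α φ, ∂_β φ⟩_h`, defined through the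
stress-energy tensor by `⟨∂_α φ, ∂_β φ⟩_h = T_{αβ} - g_{αβ} tr T`, `tr T = g^{γδ} T_{γδ}`. -/
def quad (T : Fin 3 → Fin 3 → ℝ) (w : Fin 3 → ℝ) : ℝ :=
  ∑ α, ∑ β, w α * w β * (T α β - g α β * ∑ γ, ∑ δ, g γ δ * T γ δ)

/-- The vector `(s, v)` of `ℝ^{1+2}`, by components. -/
def spacetimeVec (s : ℝ) (v : Plane) : Fin 3 → ℝ := Fin.cons s fun i : Fin 2 => v i

/-- An energy space for wave maps into `H^m`: a metric space `E` (which will be assumed complete)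
with a continuous map `ι` from the classical data, having the properties listed below. The
symmetries and the stress-energy tensor on `E` are the continuous extensions from the dense set
`ι(S)`, hence uniquely determined by their values there. -/
structure EnergySpace (m : ℕ) (E : Type*) [MetricSpace E] where
  ι : ClassicalData m → E
  continuous_ι : Continuous ι
  denseRange_ι : DenseRange ι
  /-- `ι` identifies exactly the data which differ by a rotation. -/
  ι_rot : ∀ (U : Rotation m) (Φ : ClassicalData m), ι (Φ.rot U) = ι Φ
  exists_rot_of_ι_eq : ∀ Φ Ψ : ClassicalData m, ι Φ = ι Ψ → ∃ U : Rotation m, Ψ = Φ.rot U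
  /-- Spatial translations, time reversal and scaling extend to a continuous isometric action. -/
  trans : Plane → E → E
  rev : E → E
  dil : Set.Ioi (0 : ℝ) → E → E
  trans_ι : ∀ x₀ Φ, trans x₀ (ι Φ) = ι (Φ.trans x₀)
  rev_ι : ∀ Φ, rev (ι Φ) = ι Φ.rev
  dil_ι : ∀ l Φ, dil l (ι Φ) = ι (Φ.dil l)
  isometry_trans : ∀ x₀, Isometry (trans x₀)
  isometry_rev : Isometry rev
  isometry_dil : ∀ l, Isometry (dil l)
  continuous_trans : Continuous fun q : Plane × E => trans q.1 q.2
  continuous_dil : Continuous fun q : Set.Ioi (0 : ℝ) × E => dil q.1 q.2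
  /-- The stress-energy tensor extends to a continuous map into `L¹`. (Symmetry of the tensors is
  automatic by density.) -/
  stress : E → (Plane →₁[(volume : Measure Plane)] (Fin 3 → Fin 3 → ℝ))
  stress_ι : ∀ Φ : ClassicalData m, ∀ᵐ x : Plane, stress (ι Φ) x = Φ.stressEnergy x
  continuous_stress : Continuous stress
  /-- Elements of zero energy `∫ T_{00} dx` are constant. -/
  eq_const_of_energy_eq_zero : ∀ Φ : E, ∫ x : Plane, stress Φ x 0 0 = 0 →
    ∀ (p : Ambient m) (hp : p ∈ hyperboloid m), Φ = ι (ClassicalData.const p hp)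

/-- The energy `∫ T_{00} dx`. -/
def EnergySpace.energy {E : Type*} [MetricSpace E] (X : EnergySpace m E) (Φ : E) : ℝ :=
  ∫ x : Plane, X.stress Φ x 0 0

/-! ### Local well-posedness, and the energy class solutions -/

/-- Large data local well-posedness in the energy space: an assignment of a maximal lifespan
`life t₀ Φ₀` and a maximal Cauchy development `dev t₀ Φ₀ : life t₀ Φ₀ → E` to every initial time
`t₀` and initial data `Φ₀ ∈ E`, with the properties listed below. The values of `dev t₀ Φ₀` outside
`life t₀ Φ₀` are irrelevant. -/
structure LocalWellPosedness {E : Type*} [MetricSpace E] (X : EnergySpace m E) where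
  life : ℝ → E → Set ℝ
  dev : ℝ → E → ℝ → E
  /-- Local existence. -/
  isOpen_life : ∀ t₀ Φ₀, IsOpen (life t₀ Φ₀)
  ordConnected_life : ∀ t₀ Φ₀, (life t₀ Φ₀).OrdConnected
  mem_life : ∀ t₀ Φ₀, t₀ ∈ life t₀ Φ₀
  dev_init : ∀ t₀ Φ₀, dev t₀ Φ₀ t₀ = Φ₀
  /-- Strong solution. -/
  continuousOn_dev : ∀ t₀ Φ₀, ContinuousOn (dev t₀ Φ₀) (life t₀ Φ₀)
  /-- Persistence of regularity. -/
  classical : ∀ (t₀ : ℝ) (Φ₀ : ClassicalData m), ∃ φ : ℝ × Plane → Ambient m,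
    IsClassicalWaveMap (life t₀ (X.ι Φ₀)) φ ∧ HasData φ t₀ Φ₀ ∧
    ∀ t ∈ life t₀ (X.ι Φ₀), ∃ Φ : ClassicalData m, HasData φ t Φ ∧ dev t₀ (X.ι Φ₀) t = X.ι Φ
  /-- Continuous dependence. -/
  continuous_dependence : ∀ (t₀ : ℝ) (Φ : ℕ → E) (Φinf : E), Tendsto Φ atTop (𝓝 Φinf) →
    ∀ a b : ℝ, Set.Icc a b ⊆ life t₀ Φinf →
      (∀ᶠ n in atTop, Set.Icc a b ⊆ life t₀ (Φ n)) ∧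
      TendstoUniformlyOn (fun n => dev t₀ (Φ n)) (dev t₀ Φinf) atTop (Set.Icc a b)
  /-- Maximality: there is no convergent subsequence as `t` tends to a finite endpoint. -/
  maximality : ∀ (t₀ : ℝ) (Φ₀ : E), ∀ tstar ∈ frontier (life t₀ Φ₀), ∀ s : ℕ → ℝ,
    (∀ n, s n ∈ life t₀ Φ₀) → Tendsto s atTop (𝓝 tstar) →
    ∀ Ψ : E, ¬ Tendsto (fun n => dev t₀ Φ₀ (s n)) atTop (𝓝 Ψ)

section

variable {E : Type*} [MetricSpace E] {X : EnergySpace m E}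

/-- Global well-posedness in the energy space: every maximal Cauchy development is global. -/
def LocalWellPosedness.IsGlobal (L : LocalWellPosedness X) : Prop :=
  ∀ t₀ Φ₀, L.life t₀ Φ₀ = Set.univ

/-- `φ : I → E` is an energy class solution: the restriction of a maximal Cauchy development to
an interval `I`. -/
def LocalWellPosedness.IsEnergySolution (L : LocalWellPosedness X) (I : Set ℝ) (φ : ℝ → E) :
    Prop :=
  I.OrdConnected ∧ ∃ t₀ Φ₀, I ⊆ L.life t₀ Φ₀ ∧ Set.EqOn φ (L.dev t₀ Φ₀) I

/-- `φ : I → E` is almost periodic (modulo dilations and translations). -/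
def EnergySpace.AlmostPeriodic (X : EnergySpace m E) (I : Set ℝ) (φ : ℝ → E) : Prop :=
  ∃ (N : ℝ → Set.Ioi (0 : ℝ)) (y : ℝ → Plane) (K : Set E), IsCompact K ∧
    ∀ t ∈ I, X.dil (N t) (X.trans (-y t) (φ t)) ∈ K

/-- `φ : I → E` is travelling with velocity `v`: `|∂_t φ + v · ∇_x φ|²_h = 0`. -/
def EnergySpace.Travelling (X : EnergySpace m E) (I : Set ℝ) (φ : ℝ → E) (v : Plane) : Prop :=
  ∀ t ∈ I, ∀ᵐ x : Plane, quad (X.stress (φ t) x) (spacetimeVec 1 v) = 0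

/-- `φ : I → E` is self-similar: `T = 0` outside of the light cone `|x| ≤ |t|`, and
`|t ∂_t φ + x · ∇_x φ|²_h = 0`. -/
def EnergySpace.SelfSimilar (X : EnergySpace m E) (I : Set ℝ) (φ : ℝ → E) : Prop :=
  (∀ t ∈ I, ∀ᵐ x : Plane, |t| < ‖x‖ → X.stress (φ t) x = 0) ∧
  ∀ t ∈ I, ∀ᵐ x : Plane, quad (X.stress (φ t) x) (spacetimeVec t x) = 0

/-- Minimal energy blowup solution: if global well-posedness in the energy space fails, then there
is an almost periodic maximal Cauchy development of non-zero energy. -/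
def LocalWellPosedness.MinimalBlowupClaim (L : LocalWellPosedness X) : Prop :=
  ¬ L.IsGlobal → ∃ t₀ Φ₀, X.AlmostPeriodic (L.life t₀ Φ₀) (L.dev t₀ Φ₀) ∧ X.energy Φ₀ ≠ 0

/-- No non-trivial travelling or self-similar almost periodic energy class solutions. -/
def LocalWellPosedness.NoTravellingOrSelfSimilarClaim (L : LocalWellPosedness X) : Prop :=
  (∀ (φ : ℝ → E) (v : Plane), L.IsEnergySolution Set.univ φ → X.AlmostPeriodic Set.univ φ →
    ‖v‖ < 1 → X.Travelling Set.univ φ v → ∀ t, X.energy (φ t) = 0) ∧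
  (∀ φ : ℝ → E, L.IsEnergySolution (Set.Iio 0) φ → X.AlmostPeriodic (Set.Iio 0) φ →
    X.SelfSimilar (Set.Iio 0) φ → ∀ t < 0, X.energy (φ t) = 0)

/-- No non-trivial shift-invariant finite energy data. -/
def EnergySpace.NoShiftInvariantClaim (X : EnergySpace m E) : Prop :=
  ∀ (v : Plane) (Φ : E), ‖v‖ = 1 →
    (∀ᵐ x : Plane, quad (X.stress Φ x) (spacetimeVec 1 v) = 0) →
    (∀ w : Plane, inner ℝ w v = 0 → ∀ᵐ x : Plane, quad (X.stress Φ x) (spacetimeVec 0 w) = 0) →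
    X.energy Φ = 0

end

end WaveMap

end

open WaveMap

/-! By Claim 3 it is enough to exclude an almost periodic maximal solution of positive energy
(`APSol.elim`). Uniqueness of classical wave maps is an energy estimate for the difference, closed
by Gronwall (`IsClassicalWaveMap.unique`).

The main tool is the conservation law ∂^α T_{αβ} = 0, tested against C¹ vector fields. It holds for
classical wave maps and passes to the energy class by density, continuous dependence and continuity
of T in L¹ (`MaxSol.law`). Positivity of the Gram matrix ⟨∂_α φ, ∂_β φ⟩ passes to the limit as well
(`EnergySpace.physical_ae`); it gives the dominant energy condition and finite speed of propagation
(`MaxSol.tail_le`). So that solutions can be moved by symmetries, maximal solutions are described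
intrinsically (`MaxSol`), as limits of classical wave maps that cannot be continued; classical
uniqueness identifies them with Cauchy developments (`MaxSol.life_eq`, `MaxSol.dev_eqOn`).

Claim 4 is first strengthened: velocities |v| ≤ 1 and arbitrary lifespans are allowed in
`APSol.not_travelling`, and lifespans that do not contain all negative times in
`APSol.not_selfSimilar`. The reason is that the Lagrangian density L = ⟨∂^γ φ, ∂_γ φ⟩ is transported
along the null field of the Gram matrix. If the lifespan has a finite endpoint, compactness and
finite speed confine the solution to a light cone with its tip there (`APSol.exists_cone`), and
transport towards the tip forces L = 0. For global solutions with |v| = 1 a momentum multiplier also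
gives L = 0 (`MaxSol.lagr_eq_zero_of_travelling`). Once L = 0, the energy vanishes pointwise if |v|
< 1, and by Claim 5 if |v| = 1.

Now let N(t) be the frequency scale of an almost periodic solution. Near a singularity placed at the
origin of spacetime, N(t)|t| tends to infinity: along times where it stays bounded, rescaled limits
exist, and a Morawetz identity makes them self-similar (`MaxSol.integral_radInt_le`,
`APSol.eventually_le_scale`). If on the other hand N(t)|t| is large throughout some interval [-4τ,
-τ], a virial identity shows that in time average the solution nearly moves with the velocity of its
centre of energy (`APSol.exists_integral_drift_le`). A covering argument then finds long windows at
the natural scale with small drift, and limits of these are travelling (`APSol.false_of_scale`).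
Hence there are no finite singularities, and almost periodic solutions are global.

For a global solution it remains to treat times t_n → -∞ with N(t_n)|t_n| bounded. After rescaling
at t_n, time 0 sits at a bounded rescaled time, and limits are global too; so a sequence of
symmetries applied to the fixed state φ(0) converges. This bounds N(t_n) from below, and N(t_n)|t_n|
would be unbounded. -/

noncomputable section

namespace WaveMap

variable {m : ℕ}

/-! ### Algebra of the Minkowski form and of stress-energy tensors -/

theorem mink_comm (u v : Ambient m) : mink u v = mink v u := by
  simp only [mink, mul_comm]

theorem mink_add_right (u v w : Ambient m) : mink u (v + w) = mink u v + mink u w := by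
  simp only [mink, PiLp.add_apply, mul_add, Finset.sum_add_distrib]
  ring

theorem mink_add_left (u v w : Ambient m) : mink (u + v) w = mink u w + mink v w := by
  rw [mink_comm, mink_add_right, mink_comm w u, mink_comm w v]

theorem mink_smul_left (u v : Ambient m) (c : ℝ) : mink (c • u) v = c * mink u v := by
  rw [mink_comm, mink_smul_right, mink_comm]

/-- The Minkowski form as a continuous bilinear map. -/
def minkL (m : ℕ) : Ambient m →L[ℝ] Ambient m →L[ℝ] ℝ :=
  (LinearMap.mk₂ ℝ (mink (m := m)) mink_add_left (fun c u v => mink_smul_left u v c)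
    mink_add_right (fun c u v => mink_smul_right u v c)).toContinuousBilinearMap

@[simp] theorem minkL_apply (u v : Ambient m) : minkL m u v = mink u v := rfl

theorem mink_sum_right {ι : Type*} (s : Finset ι) (u : Ambient m) (f : ι → Ambient m) :
    mink u (∑ i ∈ s, f i) = ∑ i ∈ s, mink u (f i) := by
  simp only [← minkL_apply, map_sum]

theorem mink_sum_left {ι : Type*} (s : Finset ι) (u : Ambient m) (f : ι → Ambient m) :
    mink (∑ i ∈ s, f i) u = ∑ i ∈ s, mink (f i) u := by
  rw [mink_comm, mink_sum_right]
  exact Finset.sum_congr rfl fun i _ => mink_comm _ _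

theorem mink_self_of_mem {p : Ambient m} (hp : p ∈ hyperboloid m) : mink p p = -1 := by
  have h : p 0 * p 0 = 1 + ∑ i : Fin m, p i.succ ^ 2 := by
    rw [show p 0 = √(1 + ∑ i : Fin m, p i.succ ^ 2) from hp]
    exact Real.mul_self_sqrt (by positivity)
  simp only [mink, h, ← pow_two]
  ring

/-- Hyperbolic space is spacelike: orthogonality reads p₀v₀ = p'·v', and Cauchy–Schwarz together
with p₀² = 1 + |p'|² gives (1 + |p'|²) v₀² ≤ |p'|² |v'|². -/
theorem mink_self_nonneg {p v : Ambient m} (hp : p ∈ hyperboloid m) (hv : mink p v = 0) :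
    0 ≤ mink v v := by
  have h1 := mink_self_of_mem hp
  simp only [mink, ← pow_two] at h1 hv ⊢
  have h2 := Finset.sum_mul_sq_le_sq_mul_sq Finset.univ (fun i : Fin m => p i.succ)
    (fun i => v i.succ)
  set A := ∑ i : Fin m, p i.succ ^ 2
  set B := ∑ i : Fin m, v i.succ ^ 2
  have hB : 0 ≤ B := Finset.sum_nonneg fun i _ => sq_nonneg _
  have hA : 0 ≤ A := Finset.sum_nonneg fun i _ => sq_nonneg _
  have h3 : ∑ i : Fin m, p i.succ * v i.succ = p 0 * v 0 := by linarith
  rw [h3] at h2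
  have h4 : p 0 ^ 2 = 1 + A := by linarith
  have h5 : (1 + A) * v 0 ^ 2 ≤ (1 + A) * B := by
    rw [← h4, ← mul_pow]
    nlinarith
  have h6 := le_of_mul_le_mul_left h5 (by linarith)
  linarith

/-- The Gram matrix `⟨∂_α φ, ∂_β φ⟩_h`, recovered from the stress-energy tensor. -/
def gram (T : Fin 3 → Fin 3 → ℝ) (α β : Fin 3) : ℝ :=
  T α β - g α β * ∑ γ, ∑ δ, g γ δ * T γ δ

/-- The Lagrangian density `⟨∂^γ φ, ∂_γ φ⟩_h`, recovered from the stress-energy tensor. -/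
def lagr (T : Fin 3 → Fin 3 → ℝ) : ℝ := 2 * (T 0 0 - T 1 1 - T 2 2)

theorem quad_eq (T : Fin 3 → Fin 3 → ℝ) (w : Fin 3 → ℝ) :
    quad T w = ∑ α, ∑ β, w α * w β * gram T α β := rfl

/-- `lagr T` is -2 times the trace of `T`: in dimension 1+2, the Gram matrix minus (1/2) g L has
trace L - (3/2) L = -L/2. -/
theorem gram_eq (T : Fin 3 → Fin 3 → ℝ) (α β : Fin 3) :
    gram T α β = T α β + g α β * (lagr T / 2) := by
  simp only [gram, lagr, g, Fin.sum_univ_three]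
  simp
  split_ifs <;> ring

/-- Symmetric tensors whose Gram matrix is positive semidefinite. -/
def Physical (T : Fin 3 → Fin 3 → ℝ) : Prop :=
  (∀ α β, T α β = T β α) ∧ ∀ w, 0 ≤ quad T w

theorem continuous_quad (w : Fin 3 → ℝ) : Continuous fun T => quad T w := by
  unfold quad
  fun_prop

/-- Closedness lets pointwise positivity pass from classical data to almost everywhere limits, hence
to the whole energy space. -/
theorem isClosed_physical : IsClosed {T | Physical T} := by
  have : {T | Physical T} = (⋂ α, ⋂ β, {T : Fin 3 → Fin 3 → ℝ | T α β = T β α}) ∩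
      ⋂ w, {T | 0 ≤ quad T w} := by
    ext T
    simp [Physical]
  rw [this]
  refine IsClosed.inter ?_ (isClosed_iInter fun w => isClosed_le continuous_const
    (continuous_quad w))
  exact isClosed_iInter fun α => isClosed_iInter fun β =>
    isClosed_eq (by fun_prop) (by fun_prop)

theorem quad_explicit (T : Fin 3 → Fin 3 → ℝ) (h : ∀ α β, T α β = T β α) (w : Fin 3 → ℝ) :
    quad T w = w 0 ^ 2 * (T 1 1 + T 2 2) + w 1 ^ 2 * (T 0 0 - T 2 2) + w 2 ^ 2 * (T 0 0 - T 1 1)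
      + 2 * (w 0 * w 1 * T 0 1 + w 0 * w 2 * T 0 2 + w 1 * w 2 * T 1 2) := by
  simp only [quad_eq, gram_eq, lagr, g, Fin.sum_univ_three]
  simp
  rw [h 1 0, h 2 0, h 2 1]
  ring

namespace Physical

variable {T : Fin 3 → Fin 3 → ℝ}

theorem quad_nonneg (h : Physical T) (a b c : ℝ) :
    0 ≤ a ^ 2 * (T 1 1 + T 2 2) + b ^ 2 * (T 0 0 - T 2 2) + c ^ 2 * (T 0 0 - T 1 1)
      + 2 * (a * b * T 0 1 + a * c * T 0 2 + b * c * T 1 2) := by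
  have := h.2 ![a, b, c]
  rw [quad_explicit T h.1] at this
  simpa using this

/-- The dominant energy condition. -/
theorem dominant (h : Physical T) {a b : ℝ} (hab : a ^ 2 + b ^ 2 ≤ 1) :
    0 ≤ T 0 0 + a * T 0 1 + b * T 0 2 := by
  -- The vectors (1, a, b) and (0, -b, a) together give 2(T₀₀ + a T₀₁ + b T₀₂) ≥ (1 - a² - b²)(2T₀₀
  -- - T₁₁ - T₂₂); the last factor is the sum of the two spatial diagonal Gram entries.
  have h1 := h.quad_nonneg 1 a b
  have h2 := h.quad_nonneg 0 (-b) a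
  have h3 := h.quad_nonneg 0 1 0
  have h4 := h.quad_nonneg 0 0 1
  nlinarith

theorem energy_nonneg (h : Physical T) : 0 ≤ T 0 0 := by
  have := h.dominant (a := 0) (b := 0) (by norm_num)
  linarith

/-- The momentum components follow from lightlike directions in the dominant energy condition, the
spatial ones by testing the Gram form on coordinate vectors and (0, 1, ±1). Bounds on the energy
density thus control the whole tensor. -/
theorem abs_le (h : Physical T) (α β : Fin 3) : |T α β| ≤ T 0 0 := by
  have h0 := h.energy_nonneg
  have a1 := h.dominant (a := 1) (b := 0) (by norm_num)
  have a2 := h.dominant (a := -1) (b := 0) (by norm_num)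
  have a3 := h.dominant (a := 0) (b := 1) (by norm_num)
  have a4 := h.dominant (a := 0) (b := -1) (by norm_num)
  have b0 := h.quad_nonneg 1 0 0
  have b1 := h.quad_nonneg 0 1 0
  have b2 := h.quad_nonneg 0 0 1
  have c1 := h.quad_nonneg 0 1 1
  have c2 := h.quad_nonneg 0 1 (-1)
  have s1 := h.1 1 0
  have s2 := h.1 2 0
  have s3 := h.1 2 1
  rw [_root_.abs_le]
  fin_cases α <;> fin_cases β <;> dsimp <;> refine ⟨?_, ?_⟩ <;> linarith

theorem abs_momentum_le (h : Physical T) (a b : ℝ) :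
    |a * T 0 1 + b * T 0 2| ≤ √(a ^ 2 + b ^ 2) * T 0 0 := by
  set r := √(a ^ 2 + b ^ 2) with hr
  have hr2 : r ^ 2 = a ^ 2 + b ^ 2 := Real.sq_sqrt (by positivity)
  rcases (hr ▸ Real.sqrt_nonneg _ : 0 ≤ r).eq_or_lt with h0 | h0
  · rw [← h0] at hr2
    have ha : a = 0 := by nlinarith
    have hb : b = 0 := by nlinarith
    simp [ha, hb, ← h0]
  · have key : (a / r) ^ 2 + (b / r) ^ 2 ≤ 1 := by
      rw [div_pow, div_pow, ← add_div, ← hr2, div_self (by positivity)]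
    have h1 := h.dominant key
    have h2 := h.dominant (a := -(a / r)) (b := -(b / r)) (by simpa using key)
    have e1 : a * T 0 1 + b * T 0 2 = r * (a / r * T 0 1 + b / r * T 0 2) := by
      field_simp [h0.ne']
    rw [e1, abs_mul, abs_of_pos h0]
    refine mul_le_mul_of_nonneg_left ?_ h0.le
    rw [_root_.abs_le]
    constructor <;> linarith

theorem quad_add_smul (h : Physical T) (w u : Fin 3 → ℝ) (s : ℝ) :
    quad T (w + s • u) = quad T w + 2 * s * (∑ α, ∑ β, w α * u β * gram T α β)
      + s ^ 2 * quad T u := by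
  simp only [quad_eq, gram_eq, lagr, g, Fin.sum_univ_three, Pi.add_apply, Pi.smul_apply,
    smul_eq_mul]
  simp
  rw [h.1 1 0, h.1 2 0, h.1 2 1]
  ring

/-- Null vectors of the Gram matrix are in its kernel. -/
theorem gram_eq_zero (h : Physical T) {w : Fin 3 → ℝ} (hw : quad T w = 0) (u : Fin 3 → ℝ) :
    ∑ α, ∑ β, w α * u β * gram T α β = 0 := by
  set c := ∑ α, ∑ β, w α * u β * gram T α β
  by_contra hc
  have hu := h.2 u
  -- Along w + s u the form is 2sc + s² q(u), negative for small s of sign opposite to c. The choice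
  -- s = -c / (q(u) + 1) avoids a separate case q(u) = 0.
  have h1 := h.2 (w + (-c / (quad T u + 1)) • u)
  rw [h.quad_add_smul, hw] at h1
  have h2 : 0 + 2 * (-c / (quad T u + 1)) * c + (-c / (quad T u + 1)) ^ 2 * quad T u
      = -(c ^ 2 * (quad T u + 2)) / (quad T u + 1) ^ 2 := by
    field_simp
    ring
  rw [h2] at h1
  have h3 : 0 < c ^ 2 * (quad T u + 2) / (quad T u + 1) ^ 2 := by positivity
  rw [neg_div] at h1
  linarith

/-- If `w` is null for the Gram matrix then `T_{αβ} w^α = - (1/2) w_β ⟨∂^γ φ, ∂_γ φ⟩`. -/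
theorem contract_eq (h : Physical T) {w : Fin 3 → ℝ} (hw : quad T w = 0) :
    (w 0 * T 0 0 + w 1 * T 0 1 + w 2 * T 0 2 = w 0 * lagr T / 2) ∧
    (w 0 * T 1 0 + w 1 * T 1 1 + w 2 * T 1 2 = -(w 1 * lagr T / 2)) ∧
    (w 0 * T 2 0 + w 1 * T 2 1 + w 2 * T 2 2 = -(w 2 * lagr T / 2)) := by
  -- Pairing with the coordinate vectors says that the Gram matrix annihilates `w`; the tensor
  -- differs from it by (1/2) g L.
  have h0 := h.gram_eq_zero hw ![1, 0, 0]
  have h1 := h.gram_eq_zero hw ![0, 1, 0]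
  have h2 := h.gram_eq_zero hw ![0, 0, 1]
  simp [gram_eq, g, Fin.sum_univ_three] at h0 h1 h2
  have e1 := h.1 1 0
  have e2 := h.1 2 0
  have e3 := h.1 2 1
  rw [e1, e2] at h0
  rw [e3] at h1
  rw [e1, e2, e3]
  refine ⟨?_, ?_, ?_⟩ <;> linarith

theorem eq_zero_of_energy_eq_zero (h : Physical T) (h0 : T 0 0 = 0) : T = 0 := by
  ext α β
  have := h.abs_le α β
  rw [h0] at this
  exact abs_nonpos_iff.1 this

/-- A crude upper bound; it supplies the dominating constant when limits are taken under time
integrals of the drift. -/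
theorem abs_quad_le (h : Physical T) (w : Fin 3 → ℝ) :
    quad T w ≤ 4 * (w 0 ^ 2 + w 1 ^ 2 + w 2 ^ 2) * T 0 0 := by
  rw [quad_explicit T h.1]
  have a1 := _root_.abs_le.1 (h.abs_le 0 1)
  have a2 := _root_.abs_le.1 (h.abs_le 0 2)
  have a3 := _root_.abs_le.1 (h.abs_le 1 2)
  have a4 := _root_.abs_le.1 (h.abs_le 1 1)
  have a5 := _root_.abs_le.1 (h.abs_le 2 2)
  have key : ∀ x y t : ℝ, -T 0 0 ≤ t ∧ t ≤ T 0 0 → 2 * (x * y * t) ≤ (x ^ 2 + y ^ 2) * T 0 0 := by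
    intro x y t ht
    nlinarith [mul_nonneg (sq_nonneg (x + y)) (by linarith : 0 ≤ T 0 0 - t),
      mul_nonneg (sq_nonneg (x - y)) (by linarith : 0 ≤ T 0 0 + t)]
  have k1 := key (w 0) (w 1) _ a1
  have k2 := key (w 0) (w 2) _ a2
  have k3 := key (w 1) (w 2) _ a3
  have l0 := mul_le_mul_of_nonneg_left (by linarith : T 1 1 + T 2 2 ≤ 2 * T 0 0) (sq_nonneg (w 0))
  have l1 := mul_le_mul_of_nonneg_left (by linarith : T 0 0 - T 2 2 ≤ 2 * T 0 0) (sq_nonneg (w 1))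
  have l2 := mul_le_mul_of_nonneg_left (by linarith : T 0 0 - T 1 1 ≤ 2 * T 0 0) (sq_nonneg (w 2))
  nlinarith

end Physical

/-! ### Positivity of the stress-energy tensor of tangent vectors -/

theorem gram_stressEnergy (D : Fin 3 → Ambient m) (α β : Fin 3) :
    gram (fun α β => mink (D α) (D β)
      - 1 / 2 * g α β * ∑ γ, ∑ δ, g γ δ * mink (D γ) (D δ)) α β = mink (D α) (D β) := by
  simp only [gram, g, Fin.sum_univ_three]
  simp
  split_ifs <;> ring

/-- The Gram form at `w` is the Minkowski square of ∑ w_α D_α, which is tangent to the hyperboloid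
and hence has nonnegative square. -/
theorem physical_stressEnergy {p : Ambient m} (hp : p ∈ hyperboloid m) (D : Fin 3 → Ambient m)
    (hD : ∀ α, mink p (D α) = 0) :
    Physical (fun α β => mink (D α) (D β)
      - 1 / 2 * g α β * ∑ γ, ∑ δ, g γ δ * mink (D γ) (D δ)) := by
  refine ⟨fun α β => ?_, fun w => ?_⟩
  · dsimp only
    rw [mink_comm (D α), show g α β = g β α by simp only [g]; grind]
  · rw [quad_eq]
    simp only [gram_stressEnergy]
    have : ∑ α, ∑ β, w α * w β * mink (D α) (D β)
        = mink (∑ α, w α • D α) (∑ α, w α • D α) := by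
      simp only [mink_sum_left, mink_sum_right, mink_smul_left, mink_smul_right]
      simp only [Finset.mul_sum]
      rw [Finset.sum_comm]
      exact Finset.sum_congr rfl fun i _ => Finset.sum_congr rfl fun j _ => by ring
    rw [this]
    refine mink_self_nonneg hp ?_
    simp [mink_sum_right, mink_smul_right, hD]

namespace ClassicalData

theorem hasFDerivAt_pos (Φ : ClassicalData m) (x : Plane) :
    HasFDerivAt Φ.pos (fderiv ℝ Φ.dev x) x := by
  have := (Φ.dev.differentiableAt (x := x)).hasFDerivAt.const_add Φ.base
  exact this

/-- For the spatial derivatives, differentiate ⟨φ₀, φ₀⟩ = -1; the velocity is tangent by the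
definition of the data. -/
theorem mink_pos_partialD (Φ : ClassicalData m) (α : Fin 3) (x : Plane) :
    mink (Φ.pos x) (Φ.partialD α x) = 0 := by
  refine Fin.cases ?_ (fun i => ?_) α
  · exact Φ.vel_mem x
  · have h1 : HasFDerivAt (fun y => minkL m (Φ.pos y) (Φ.pos y)) _ x :=
      (minkL m).hasFDerivAt_of_bilinear (Φ.hasFDerivAt_pos x) (Φ.hasFDerivAt_pos x)
    have h2 : (fun y => minkL m (Φ.pos y) (Φ.pos y)) = fun _ => -1 := by
      funext y
      exact mink_self_of_mem (Φ.pos_mem y)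
    rw [h2] at h1
    have h3 := h1.unique (hasFDerivAt_const (-1 : ℝ) x)
    have h4 := congrArg (fun F : Plane →L[ℝ] ℝ => F (EuclideanSpace.single i 1)) h3
    simp at h4
    rw [mink_comm (fderiv ℝ _ _ _)] at h4
    simp only [partialD, Fin.cons_succ, (Φ.hasFDerivAt_pos x).fderiv]
    linarith

theorem physical_stressEnergy (Φ : ClassicalData m) (x : Plane) : Physical (Φ.stressEnergy x) :=
  WaveMap.physical_stressEnergy (Φ.pos_mem x) (fun α => Φ.partialD α x)
    fun α => Φ.mink_pos_partialD α x

end ClassicalData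

/-! ### Functions with controlled decay in space, locally uniformly in time -/

section Weighted

set_option linter.unusedSectionVars false


variable {V W U : Type*} [NormedAddCommGroup V] [NormedSpace ℝ V] [NormedAddCommGroup W]
  [NormedSpace ℝ W] [NormedAddCommGroup U] [NormedSpace ℝ U]

/-- `F (t, x) = O(ρ x)`, locally uniformly in `t ∈ I`. -/
def WBound (ρ : Plane → ℝ) (I : Set ℝ) (F : ℝ × Plane → V) : Prop :=
  ∀ J : Set ℝ, IsCompact J → J ⊆ I → ∃ C, ∀ t ∈ J, ∀ x, ‖F (t, x)‖ ≤ C * ρ x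

/-- `F` is of class `C¹` on `I × ℝ²`, and `F` and its derivative are `O(ρ)`. -/
structure C1W (ρ : Plane → ℝ) (I : Set ℝ) (F : ℝ × Plane → V) : Prop where
  contDiffOn : ContDiffOn ℝ 1 F (I ×ˢ Set.univ)
  bound : WBound ρ I F
  bound_fderiv : WBound ρ I (fderiv ℝ F)

/-- An integrable weight on the plane. -/
def wt (x : Plane) : ℝ := (1 + ‖x‖) ^ (-3 : ℝ)

theorem wt_nonneg (x : Plane) : 0 ≤ wt x := by unfold wt; positivity

theorem wt_le_one (x : Plane) : wt x ≤ 1 := by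
  unfold wt
  exact Real.rpow_le_one_of_one_le_of_nonpos (by linarith [norm_nonneg x]) (by norm_num)

/-- The exponent 3 exceeds the dimension 2. -/
theorem integrable_wt : Integrable wt :=
  integrable_one_add_norm (by simp; norm_num)

variable {ρ : Plane → ℝ} {I : Set ℝ}

theorem WBound.exists_nonneg {F : ℝ × Plane → V} (h : WBound ρ I F) (hρ : ∀ x, 0 ≤ ρ x)
    {J : Set ℝ} (hJ : IsCompact J) (hJI : J ⊆ I) :
    ∃ C, 0 ≤ C ∧ ∀ t ∈ J, ∀ x, ‖F (t, x)‖ ≤ C * ρ x := by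
  obtain ⟨C, hC⟩ := h J hJ hJI
  exact ⟨max C 0, le_max_right _ _, fun t ht x => (hC t ht x).trans
    (mul_le_mul_of_nonneg_right (le_max_left _ _) (hρ x))⟩

theorem WBound.mono_weight {F : ℝ × Plane → V} (h : WBound ρ I F) (hρ : ∀ x, 0 ≤ ρ x)
    {ρ' : Plane → ℝ} (hle : ∀ x, ρ x ≤ ρ' x) : WBound ρ' I F := fun J hJ hJI => by
  obtain ⟨C, hC0, hC⟩ := h.exists_nonneg hρ hJ hJI
  exact ⟨C, fun t ht x => (hC t ht x).trans (mul_le_mul_of_nonneg_left (hle x) hC0)⟩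

theorem WBound.of_le {F : ℝ × Plane → V} (h : WBound ρ I F) (hρ : ∀ x, 0 ≤ ρ x)
    {G : ℝ × Plane → W} (c : ℝ)
    (hle : ∀ t ∈ I, ∀ x, ‖G (t, x)‖ ≤ c * ‖F (t, x)‖) : WBound ρ I G := fun J hJ hJI => by
  obtain ⟨C, hC0, hC⟩ := h.exists_nonneg hρ hJ hJI
  refine ⟨|c| * C, fun t ht x => (hle t (hJI ht) x).trans ?_⟩
  rw [mul_assoc]
  exact mul_le_mul (le_abs_self c) (hC t ht x) (norm_nonneg _) (abs_nonneg c)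

theorem WBound.add {F G : ℝ × Plane → V} (hF : WBound ρ I F) (hG : WBound ρ I G) :
    WBound ρ I (fun z => F z + G z) := fun J hJ hJI => by
  obtain ⟨C, hC⟩ := hF J hJ hJI
  obtain ⟨D, hD⟩ := hG J hJ hJI
  refine ⟨C + D, fun t ht x => (norm_add_le _ _).trans ?_⟩
  rw [add_mul]
  exact add_le_add (hC t ht x) (hD t ht x)

namespace C1W

theorem differentiableAt {F : ℝ × Plane → V} (h : C1W ρ I F) (hI : IsOpen I) {z : ℝ × Plane}
    (hz : z.1 ∈ I) : DifferentiableAt ℝ F z :=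
  (h.contDiffOn.differentiableOn one_ne_zero).differentiableAt
    ((hI.prod isOpen_univ).mem_nhds ⟨hz, Set.mem_univ _⟩)

theorem continuousOn_fderiv {F : ℝ × Plane → V} (h : C1W ρ I F) (hI : IsOpen I) :
    ContinuousOn (fderiv ℝ F) (I ×ˢ Set.univ) :=
  h.contDiffOn.continuousOn_fderiv_of_isOpen (hI.prod isOpen_univ) le_rfl

theorem mono_weight {F : ℝ × Plane → V} (h : C1W ρ I F) (hρ : ∀ x, 0 ≤ ρ x)
    {ρ' : Plane → ℝ} (hle : ∀ x, ρ x ≤ ρ' x) : C1W ρ' I F :=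
  ⟨h.contDiffOn, h.bound.mono_weight hρ hle, h.bound_fderiv.mono_weight hρ hle⟩

theorem add {F G : ℝ × Plane → V} (hI : IsOpen I) (hρ : ∀ x, 0 ≤ ρ x) (hF : C1W ρ I F)
    (hG : C1W ρ I G) : C1W ρ I (fun z => F z + G z) := by
  refine ⟨hF.contDiffOn.add hG.contDiffOn, hF.bound.add hG.bound, ?_⟩
  refine (hF.bound_fderiv.add hG.bound_fderiv).of_le hρ 1 fun t ht x => ?_
  rw [one_mul]
  exact (congrArg norm (fderiv_fun_add (hF.differentiableAt hI ht)
    (hG.differentiableAt hI ht))).le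

theorem clm_comp {F : ℝ × Plane → V} (hI : IsOpen I) (hρ : ∀ x, 0 ≤ ρ x) (hF : C1W ρ I F)
    (A : V →L[ℝ] W) : C1W ρ I (fun z => A (F z)) := by
  refine ⟨A.contDiff.comp_contDiffOn hF.contDiffOn,
    hF.bound.of_le hρ ‖A‖ fun t _ x => A.le_opNorm _,
    hF.bound_fderiv.of_le hρ ‖A‖ fun t ht x => ?_⟩
  have := (A.hasFDerivAt.comp (t, x) (hF.differentiableAt hI ht).hasFDerivAt).fderiv
  rw [Function.comp_def] at this
  rw [this]
  exact A.opNorm_comp_le _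

theorem const_mul {F : ℝ × Plane → ℝ} (hI : IsOpen I) (hρ : ∀ x, 0 ≤ ρ x) (hF : C1W ρ I F)
    (c : ℝ) : C1W ρ I (fun z => c * F z) :=
  hF.clm_comp hI hρ (c • ContinuousLinearMap.id ℝ ℝ)

theorem sum {ι : Type*} (s : Finset ι) {F : ι → ℝ × Plane → V} (hI : IsOpen I)
    (hρ : ∀ x, 0 ≤ ρ x) (hF : ∀ i ∈ s, C1W ρ I (F i)) : C1W ρ I (fun z => ∑ i ∈ s, F i z) := by
  classical
  induction s using Finset.induction_on with
  | empty =>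
    refine ⟨by simpa using contDiffOn_const, fun J _ _ => ⟨0, by simp⟩, fun J _ _ => ⟨0, ?_⟩⟩
    intro t _ x
    simp
  | insert a s ha ih =>
    simp only [Finset.sum_insert ha]
    exact (hF a (Finset.mem_insert_self a s)).add hI hρ
      (ih fun i hi => hF i (Finset.mem_insert_of_mem hi))

/-- Only one factor has to decay: the multiplier fields are merely bounded, and the stress-energy
tensor carries the integrable weight. -/
theorem bilin {F : ℝ × Plane → V} {G : ℝ × Plane → W} (hI : IsOpen I) (hρ : ∀ x, 0 ≤ ρ x)
    (B : V →L[ℝ] W →L[ℝ] U) (hF : C1W (fun _ => 1) I F) (hG : C1W ρ I G) :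
    C1W ρ I (fun z => B (F z) (G z)) := by
  refine ⟨?_, fun J hJ hJI => ?_, fun J hJ hJI => ?_⟩
  · exact (B.isBoundedBilinearMap.contDiff (n := 1)).comp_contDiffOn (hF.contDiffOn.prodMk hG.contDiffOn)
  all_goals
    obtain ⟨C, hC0, hC⟩ := hF.bound.exists_nonneg (fun _ => zero_le_one) hJ hJI
    obtain ⟨D, hD0, hD⟩ := hG.bound.exists_nonneg hρ hJ hJI
    simp only [mul_one] at hC
  · refine ⟨‖B‖ * C * D, fun t ht x => (B.le_opNorm₂ _ _).trans ?_⟩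
    rw [mul_assoc (‖B‖ * C)]
    exact mul_le_mul (mul_le_mul_of_nonneg_left (hC t ht x) (norm_nonneg B)) (hD t ht x)
      (norm_nonneg _) (by positivity)
  · obtain ⟨C', hC0', hC'⟩ := hF.bound_fderiv.exists_nonneg (fun _ => zero_le_one) hJ hJI
    obtain ⟨D', hD0', hD'⟩ := hG.bound_fderiv.exists_nonneg hρ hJ hJI
    simp only [mul_one] at hC'
    refine ⟨‖B‖ * C * D' + ‖B‖ * C' * D, fun t ht x => ?_⟩
    rw [(B.hasFDerivAt_of_bilinear (hF.differentiableAt hI (hJI ht)).hasFDerivAt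
      (hG.differentiableAt hI (hJI ht)).hasFDerivAt).fderiv, add_mul]
    refine (norm_add_le _ _).trans (add_le_add ?_ ?_)
    · refine (B.norm_precompR_le (ℝ × Plane) |> fun h => (B.precompR _).le_opNorm₂ _ _ |>.trans
        (mul_le_mul_of_nonneg_right (mul_le_mul_of_nonneg_right h (norm_nonneg _))
          (norm_nonneg _))).trans ?_
      rw [mul_assoc (‖B‖ * C)]
      exact mul_le_mul (mul_le_mul_of_nonneg_left (hC t ht x) (norm_nonneg B)) (hD' t ht x)
        (norm_nonneg _) (by positivity)
    · refine (B.norm_precompL_le (ℝ × Plane) |> fun h => (B.precompL _).le_opNorm₂ _ _ |>.trans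
        (mul_le_mul_of_nonneg_right (mul_le_mul_of_nonneg_right h (norm_nonneg _))
          (norm_nonneg _))).trans ?_
      rw [mul_assoc (‖B‖ * C')]
      exact mul_le_mul (mul_le_mul_of_nonneg_left (hC' t ht x) (norm_nonneg B)) (hD t ht x)
        (norm_nonneg _) (by positivity)

end C1W

/-! ### The divergence theorem -/

theorem continuous_slice {F : ℝ × Plane → V} (h : ContinuousOn F (I ×ˢ Set.univ)) {t : ℝ}
    (ht : t ∈ I) : Continuous fun x => F (t, x) :=
  h.comp_continuous (by fun_prop) fun x => ⟨ht, Set.mem_univ _⟩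

theorem WBound.integrable {F : ℝ × Plane → V} (h : WBound wt I F)
    (hc : ContinuousOn F (I ×ˢ Set.univ)) {t : ℝ} (ht : t ∈ I) :
    Integrable fun x => F (t, x) := by
  obtain ⟨C, hC⟩ := h {t} isCompact_singleton (by simpa using ht)
  exact (integrable_wt.const_mul C).mono' (continuous_slice hc ht).aestronglyMeasurable
    (.of_forall fun x => hC t rfl x)

theorem hasFDerivAt_slice {F : ℝ × Plane → V} {t : ℝ} {x : Plane}
    (h : DifferentiableAt ℝ F (t, x)) :
    HasFDerivAt (fun y => F (t, y)) ((fderiv ℝ F (t, x)).comp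
      (ContinuousLinearMap.inr ℝ ℝ Plane)) x :=
  h.hasFDerivAt.comp x (hasFDerivAt_prodMk_right t x)

/-- Integration by parts against the constant function 1, where integrability of `F` and of its
derivative leaves no boundary term. -/
theorem integral_fderiv_space_eq_zero (hI : IsOpen I) {F : ℝ × Plane → ℝ} (hF : C1W wt I F) {t : ℝ}
    (ht : t ∈ I) (v : Plane) : ∫ x, fderiv ℝ F (t, x) (0, v) = 0 := by
  have hi : Integrable fun x => fderiv ℝ F (t, x) (0, v) :=
    (hF.bound_fderiv.integrable (hF.continuousOn_fderiv hI) ht).apply_continuousLinearMap (0, v)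
  have := integral_bilinear_hasFDerivAt_right_eq_neg_left_of_integrable
    (μ := (volume : Measure Plane)) (f := fun _ : Plane => (1 : ℝ)) (f' := fun _ => 0)
    (g := fun y => F (t, y)) (v := v) (B := ContinuousLinearMap.mul ℝ ℝ)
    (g' := fun x => (fderiv ℝ F (t, x)).comp (ContinuousLinearMap.inr ℝ ℝ Plane))
    (by simp) (by simpa using hi)
    (by simpa using hF.bound.integrable hF.contDiffOn.continuousOn ht)
    (fun x _ => hasFDerivAt_const _ _)
    (fun x _ => hasFDerivAt_slice (hF.differentiableAt hI ht))
  simpa using this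

/-- If `∂_t e = ∂_1 f_1 + ∂_2 f_2 + s`, then `∂_t ∫ e = ∫ s`. -/
theorem hasDerivAt_integral_of_divergence (hI : IsOpen I) {e : ℝ × Plane → ℝ}
    {f : Fin 2 → ℝ × Plane → ℝ} (he : C1W wt I e) (hf : ∀ i, C1W wt I (f i)) {t : ℝ}
    (ht : t ∈ I) {s : Plane → ℝ}
    (hs : ∀ x, fderiv ℝ e (t, x) (basisVec 0) = ∑ i, fderiv ℝ (f i) (t, x) (basisVec i.succ) + s x) :
    HasDerivAt (fun t' => ∫ x, e (t', x)) (∫ x, s x) t := by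
  -- On a compact neighbourhood of `t` the weighted bounds are uniform, and they dominate the time
  -- derivative.
  obtain ⟨r, hr, hrI⟩ := Metric.nhds_basis_closedBall.mem_iff.1 (hI.mem_nhds ht)
  obtain ⟨C, hC⟩ := he.bound_fderiv (Metric.closedBall t r) (isCompact_closedBall t r) hrI
  have key := hasDerivAt_integral_of_dominated_loc_of_deriv_le (μ := (volume : Measure Plane))
    (F := fun t' x => e (t', x)) (F' := fun t' x => fderiv ℝ e (t', x) (basisVec 0))
    (bound := fun x => C * wt x * ‖basisVec 0‖) (x₀ := t) (s := Metric.closedBall t r)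
    (Metric.closedBall_mem_nhds t hr)
    (by
      filter_upwards [hI.mem_nhds ht] with t' ht'
      exact (continuous_slice he.contDiffOn.continuousOn ht').aestronglyMeasurable)
    (he.bound.integrable he.contDiffOn.continuousOn ht)
    ((he.bound_fderiv.integrable (he.continuousOn_fderiv hI) ht).apply_continuousLinearMap
      _).aestronglyMeasurable
    (.of_forall fun x t' ht' => ((fderiv ℝ e (t', x)).le_opNorm _).trans
      (mul_le_mul_of_nonneg_right (hC t' ht' x) (norm_nonneg _)))
    ((integrable_wt.const_mul C).mul_const _)
    (.of_forall fun x t' ht' => by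
      have := (he.differentiableAt hI (z := (t', x)) (hrI ht')).hasFDerivAt.comp_hasDerivAt t'
        ((hasDerivAt_id t').prodMk (hasDerivAt_const t' x))
      exact this)
  have h0 : ∀ i, Integrable fun x => fderiv ℝ (f i) (t, x) (basisVec i.succ) := fun i =>
    ((hf i).bound_fderiv.integrable ((hf i).continuousOn_fderiv hI) ht).apply_continuousLinearMap _
  have hsum : Integrable fun x => ∑ i, fderiv ℝ (f i) (t, x) (basisVec i.succ) :=
    integrable_finsetSum _ fun i _ => h0 i
  -- Integrability of the source is not assumed; the identity `hs` exhibits it as a difference of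
  -- integrable functions.
  have hsi : Integrable s := by
    refine (key.1.sub hsum).congr (.of_forall fun x => ?_)
    simp only [Pi.sub_apply, hs x]
    ring
  have : ∫ x, fderiv ℝ e (t, x) (basisVec 0) = ∫ x, s x := by
    simp only [hs]
    rw [integral_add hsum hsi, integral_finsetSum _ fun i _ => h0 i]
    simp only [basisVec, Fin.cons_succ, integral_fderiv_space_eq_zero hI (hf _) ht]
    simp
  rw [← this]
  exact key.2

end Weighted

/-! ### Classical wave maps -/

/-- The Schwartz bounds with weights of order 0 and 3 combine through (1 + r)³ ≤ 4 (1 + r³). -/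
theorem le_wt_of_moments {N C₀ C₃ : ℝ} {x : Plane} (h0 : ‖x‖ ^ 0 * N ≤ C₀)
    (h3 : ‖x‖ ^ 3 * N ≤ C₃) (hN : 0 ≤ N) : N ≤ 4 * (C₀ + C₃) * wt x := by
  have hx := norm_nonneg x
  have h1 : (1 + ‖x‖) ^ 3 ≤ 4 * (1 + ‖x‖ ^ 3) := by nlinarith [sq_nonneg (‖x‖ - 1)]
  have h2 : wt x = ((1 + ‖x‖) ^ 3)⁻¹ := by
    rw [wt, Real.rpow_neg (by positivity)]
    norm_cast
  rw [h2, ← div_eq_mul_inv, le_div_iff₀ (by positivity)]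
  simp only [pow_zero, one_mul] at h0
  nlinarith [mul_le_mul_of_nonneg_left h1 hN]

theorem hasFDerivAt_mink {F G : ℝ × Plane → Ambient m} {z : ℝ × Plane}
    (hF : DifferentiableAt ℝ F z) (hG : DifferentiableAt ℝ G z) :
    DifferentiableAt ℝ (fun y => mink (F y) (G y)) z ∧ ∀ v,
      fderiv ℝ (fun y => mink (F y) (G y)) z v
        = mink (F z) (fderiv ℝ G z v) + mink (fderiv ℝ F z v) (G z) := by
  have h := (minkL m).hasFDerivAt_of_bilinear hF.hasFDerivAt hG.hasFDerivAt
  refine ⟨h.differentiableAt, fun v => ?_⟩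
  simp only [← minkL_apply]
  rw [h.fderiv]
  simp

/-- The stress-energy tensor of a map `ℝ^{1+2} → ℝ^{1+m}`. -/
def stressOf (φ : ℝ × Plane → Ambient m) (z : ℝ × Plane) (α β : Fin 3) : ℝ :=
  mink (pd α φ z) (pd β φ z) - 1 / 2 * g α β * ∑ γ, ∑ δ, g γ δ * mink (pd γ φ z) (pd δ φ z)

namespace IsClassicalWaveMap

variable {I : Set ℝ} {φ : ℝ × Plane → Ambient m}

theorem isOpen_prod (h : IsClassicalWaveMap I φ) : IsOpen (I ×ˢ (Set.univ : Set Plane)) :=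
  h.isOpen.prod isOpen_univ

theorem mem_nhds (h : IsClassicalWaveMap I φ) {z : ℝ × Plane} (hz : z.1 ∈ I) :
    I ×ˢ (Set.univ : Set Plane) ∈ 𝓝 z :=
  h.isOpen_prod.mem_nhds ⟨hz, Set.mem_univ _⟩

theorem exists_wbound (h : IsClassicalWaveMap I φ) : ∃ p ∈ hyperboloid m, ∀ n : ℕ,
    WBound wt I (iteratedFDeriv ℝ n fun z => φ z - p) := by
  obtain ⟨p, hp, H⟩ := h.schwartz
  refine ⟨p, hp, fun n J hJ hJI => ?_⟩
  obtain ⟨C₀, h0⟩ := H J hJ hJI 0 n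
  obtain ⟨C₃, h3⟩ := H J hJ hJI 3 n
  exact ⟨4 * (C₀ + C₃), fun t ht x => le_wt_of_moments (h0 t ht x) (h3 t ht x) (norm_nonneg _)⟩

theorem c1w_fderiv (h : IsClassicalWaveMap I φ) : C1W wt I (fderiv ℝ φ) := by
  obtain ⟨p, -, H⟩ := h.exists_wbound
  have e : fderiv ℝ (fun z => φ z - p) = fderiv ℝ φ := by
    funext z
    exact fderiv_sub_const p
  refine ⟨h.smooth.fderiv_of_isOpen h.isOpen_prod (by norm_cast), fun J hJ hJI => ?_,
    fun J hJ hJI => ?_⟩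
  · obtain ⟨C, hC⟩ := H 1 J hJ hJI
    refine ⟨C, fun t ht x => ?_⟩
    have := hC t ht x
    rwa [norm_iteratedFDeriv_one, e] at this
  · obtain ⟨C, hC⟩ := H 2 J hJ hJI
    refine ⟨C, fun t ht x => ?_⟩
    have := hC t ht x
    rwa [← norm_iteratedFDeriv_fderiv, e, norm_iteratedFDeriv_one] at this

theorem exists_c1w_sub (h : IsClassicalWaveMap I φ) :
    ∃ p ∈ hyperboloid m, C1W wt I fun z => φ z - p := by
  obtain ⟨p, hp, H⟩ := h.exists_wbound
  refine ⟨p, hp, (h.smooth.sub contDiffOn_const).of_le (by norm_cast), fun J hJ hJI => ?_,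
    fun J hJ hJI => ?_⟩
  · obtain ⟨C, hC⟩ := H 0 J hJ hJI
    refine ⟨C, fun t ht x => ?_⟩
    have := hC t ht x
    rwa [norm_iteratedFDeriv_zero] at this
  · obtain ⟨C, hC⟩ := H 1 J hJ hJI
    refine ⟨C, fun t ht x => ?_⟩
    have := hC t ht x
    rwa [norm_iteratedFDeriv_one] at this

theorem c1w_pd (h : IsClassicalWaveMap I φ) (α : Fin 3) : C1W wt I (pd α φ) :=
  h.c1w_fderiv.clm_comp h.isOpen wt_nonneg
    (ContinuousLinearMap.apply ℝ (Ambient m) (basisVec α))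

theorem differentiableAt (h : IsClassicalWaveMap I φ) {z : ℝ × Plane} (hz : z.1 ∈ I) :
    DifferentiableAt ℝ φ z :=
  (h.smooth.differentiableOn (by simp)).differentiableAt (h.mem_nhds hz)

theorem mink_pd (h : IsClassicalWaveMap I φ) {z : ℝ × Plane} (hz : z.1 ∈ I) (α : Fin 3) :
    mink (φ z) (pd α φ z) = 0 := by
  have h1 := (hasFDerivAt_mink (h.differentiableAt hz) (h.differentiableAt hz)).2 (basisVec α)
  have h2 : (fun y => mink (φ y) (φ y)) =ᶠ[𝓝 z] fun _ => -1 := by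
    filter_upwards [h.mem_nhds hz] with y hy
    exact mink_self_of_mem (h.mem_hyperboloid y.1 hy.1 y.2)
  rw [h2.fderiv_eq, mink_comm (fderiv ℝ φ z _)] at h1
  simp at h1
  simp only [pd]
  linarith

theorem pd_pd (h : IsClassicalWaveMap I φ) {z : ℝ × Plane} (hz : z.1 ∈ I) (α β : Fin 3) :
    pd α (pd β φ) z = fderiv ℝ (fderiv ℝ φ) z (basisVec α) (basisVec β) := by
  have := ((ContinuousLinearMap.apply ℝ (Ambient m) (basisVec β)).hasFDerivAt.comp z
    (h.c1w_fderiv.differentiableAt h.isOpen hz).hasFDerivAt).fderiv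
  rw [Function.comp_def] at this
  change fderiv ℝ (fun y => fderiv ℝ φ y (basisVec β)) z (basisVec α) = _
  rw [show (fun y => fderiv ℝ φ y (basisVec β)) = fun y =>
    (ContinuousLinearMap.apply ℝ (Ambient m) (basisVec β)) (fderiv ℝ φ y) from rfl, this]
  rfl

theorem pd_comm (h : IsClassicalWaveMap I φ) {z : ℝ × Plane} (hz : z.1 ∈ I) (α β : Fin 3) :
    pd α (pd β φ) z = pd β (pd α φ) z := by
  rw [h.pd_pd hz, h.pd_pd hz]
  exact ((h.smooth.contDiffAt (h.mem_nhds hz)).isSymmSndFDerivAt (by simp; norm_cast)) _ _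

/-- The extrinsic form `□φ = ⟨∂^γ φ, ∂_γ φ⟩ φ` of the wave map equation. -/
theorem box_eq (h : IsClassicalWaveMap I φ) {z : ℝ × Plane} (hz : z.1 ∈ I) :
    -pd 0 (pd 0 φ) z + pd 1 (pd 1 φ) z + pd 2 (pd 2 φ) z
      = (-mink (pd 0 φ z) (pd 0 φ z) + mink (pd 1 φ z) (pd 1 φ z) + mink (pd 2 φ z) (pd 2 φ z))
        • φ z := by
  -- Differentiating ⟨φ, ∂_α φ⟩ = 0 gives the normal component of ∂_α ∂_α φ, which is what the
  -- tangential projection in the covariant derivative removes.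
  have key : ∀ α, mink (φ z) (pd α (pd α φ) z) = -mink (pd α φ z) (pd α φ z) := by
    intro α
    have h1 := (hasFDerivAt_mink (h.differentiableAt hz)
      ((h.c1w_pd α).differentiableAt h.isOpen hz)).2 (basisVec α)
    have h2 : (fun y => mink (φ y) (pd α φ y)) =ᶠ[𝓝 z] fun _ => 0 := by
      filter_upwards [h.mem_nhds hz] with y hy
      exact h.mink_pd hy.1 α
    rw [h2.fderiv_eq] at h1
    simp at h1
    simp only [pd] at h1 ⊢
    linarith
  have heq := h.equation z.1 hz z.2
  simp only [Fin.sum_univ_three, g, covD, tangentProj, Prod.mk.eta, key] at heq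
  simp at heq
  rw [add_smul, add_smul]
  simp only [neg_smul]
  rw [← sub_eq_zero, ← heq]
  abel

theorem c1w_stress (h : IsClassicalWaveMap I φ) (α β : Fin 3) :
    C1W wt I fun z => stressOf φ z α β := by
  have h1 : ∀ α β, C1W wt I fun z => mink (pd α φ z) (pd β φ z) := fun α β =>
    C1W.bilin h.isOpen wt_nonneg (minkL m) ((h.c1w_pd α).mono_weight wt_nonneg wt_le_one)
      (h.c1w_pd β)
  have h2 := (h1 α β).add h.isOpen wt_nonneg ((C1W.sum Finset.univ h.isOpen wt_nonneg fun γ _ =>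
    C1W.sum Finset.univ h.isOpen wt_nonneg fun δ _ =>
      (h1 γ δ).const_mul h.isOpen wt_nonneg (g γ δ)).const_mul h.isOpen wt_nonneg
        (-(1 / 2 * g α β)))
  have e : (fun z => stressOf φ z α β) = fun z => mink (pd α φ z) (pd β φ z)
      + -(1 / 2 * g α β) * ∑ γ, ∑ δ, g γ δ * mink (pd γ φ z) (pd δ φ z) := by
    funext z
    simp only [stressOf]
    ring
  rw [e]
  exact h2

/-- Conservation of the stress-energy tensor, `∂^α T_{αβ} = 0`. -/
theorem fderiv_stress (h : IsClassicalWaveMap I φ) {z : ℝ × Plane} (hz : z.1 ∈ I) (β : Fin 3) :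
    fderiv ℝ (fun y => stressOf φ y 0 β) z (basisVec 0)
      = fderiv ℝ (fun y => stressOf φ y 1 β) z (basisVec 1)
        + fderiv ℝ (fun y => stressOf φ y 2 β) z (basisVec 2) := by
  have hd := fun α => (h.c1w_pd α).differentiableAt h.isOpen hz
  have hm : ∀ α β, HasFDerivAt (fun y => mink (pd α φ y) (pd β φ y))
      (fderiv ℝ (fun y => mink (pd α φ y) (pd β φ y)) z) z := fun α β =>
    (hasFDerivAt_mink (hd α) (hd β)).1.hasFDerivAt
  have hm' : ∀ α β γ, fderiv ℝ (fun y => mink (pd α φ y) (pd β φ y)) z (basisVec γ)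
      = mink (pd α φ z) (pd γ (pd β φ) z) + mink (pd γ (pd α φ) z) (pd β φ z) :=
    fun α β γ => (hasFDerivAt_mink (hd α) (hd β)).2 (basisVec γ)
  have hs : ∀ α β γ, fderiv ℝ (fun y => stressOf φ y α β) z (basisVec γ)
      = mink (pd α φ z) (pd γ (pd β φ) z) + mink (pd γ (pd α φ) z) (pd β φ z)
        - g α β * (-mink (pd 0 φ z) (pd γ (pd 0 φ) z) + mink (pd 1 φ z) (pd γ (pd 1 φ) z)
          + mink (pd 2 φ z) (pd γ (pd 2 φ) z)) := by
    intro α β γ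
    have e : (fun y => stressOf φ y α β) = fun y => mink (pd α φ y) (pd β φ y) - 1 / 2 * g α β *
        (-mink (pd 0 φ y) (pd 0 φ y) + mink (pd 1 φ y) (pd 1 φ y)
          + mink (pd 2 φ y) (pd 2 φ y)) := by
      funext y
      simp only [stressOf, Fin.sum_univ_three]
      simp [g]
    rw [e, ((hm α β).fun_sub (((((hm 0 0).fun_neg).fun_add (hm 1 1)).fun_add
      (hm 2 2)).const_mul (1 / 2 * g α β))).fderiv]
    simp only [sub_apply, smul_apply, add_apply, neg_apply, hm', smul_eq_mul]
    rw [mink_comm (pd γ (pd 0 φ) z) (pd 0 φ z), mink_comm (pd γ (pd 1 φ) z) (pd 1 φ z),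
      mink_comm (pd γ (pd 2 φ) z) (pd 2 φ z)]
    ring
  -- By the extrinsic equation □φ is a multiple of φ, hence orthogonal to each ∂_β φ. After
  -- commuting second derivatives, this is all that remains of the divergence.
  have hbox : ∀ β, -mink (pd 0 (pd 0 φ) z) (pd β φ z) + mink (pd 1 (pd 1 φ) z) (pd β φ z)
      + mink (pd 2 (pd 2 φ) z) (pd β φ z) = 0 := by
    intro β
    have h1 := congrArg (fun u => mink u (pd β φ z)) (h.box_eq hz)
    simp only [mink_add_left, mink_smul_left, h.mink_pd hz, mul_zero] at h1
    rw [← neg_one_smul ℝ (pd 0 (pd 0 φ) z), mink_smul_left] at h1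
    linarith
  have c10 := h.pd_comm hz 1 0
  have c20 := h.pd_comm hz 2 0
  have c21 := h.pd_comm hz 2 1
  have hb := hbox β
  rw [hs, hs, hs]
  have m0 := mink_comm (pd 0 φ z) (pd 0 (pd 0 φ) z)
  have m1 := mink_comm (pd 1 φ z) (pd 1 (pd 1 φ) z)
  have m2 := mink_comm (pd 2 φ z) (pd 2 (pd 2 φ) z)
  fin_cases β <;> simp [g] at hb ⊢ <;> simp only [c10, c20, c21] <;> linarith

end IsClassicalWaveMap

/-! ### Conservation laws and uniqueness for classical wave maps -/

theorem C1W.sub {V : Type*} [NormedAddCommGroup V] [NormedSpace ℝ V] {ρ : Plane → ℝ} {I : Set ℝ}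
    {F G : ℝ × Plane → V} (hI : IsOpen I) (hρ : ∀ x, 0 ≤ ρ x) (hF : C1W ρ I F)
    (hG : C1W ρ I G) : C1W ρ I (fun z => F z - G z) := by
  have := hF.add hI hρ (hG.clm_comp hI hρ (-ContinuousLinearMap.id ℝ V))
  simpa [sub_eq_add_neg] using this

theorem tendsto_wt : Tendsto wt (cocompact Plane) (𝓝 0) := by
  have h1 : Tendsto (fun x : Plane => 1 + ‖x‖) (cocompact Plane) atTop :=
    tendsto_atTop_add_const_left _ _ tendsto_norm_cocompact_atTop
  exact (tendsto_rpow_neg_atTop (by norm_num : (0 : ℝ) < 3)).comp h1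

theorem basisVec_zero : basisVec 0 = (1, 0) := rfl

theorem basisVec_succ (i : Fin 2) : basisVec i.succ = (0, EuclideanSpace.single i 1) := rfl

namespace IsClassicalWaveMap

variable {I : Set ℝ} {φ ψ : ℝ × Plane → Ambient m}

theorem tendsto_cocompact_aux {p : Ambient m} (hp : C1W wt I fun z => φ z - p) {t : ℝ}
    (ht : t ∈ I) : Tendsto (fun x => φ (t, x)) (cocompact Plane) (𝓝 p) := by
  obtain ⟨C, hC⟩ := hp.bound {t} isCompact_singleton (by simpa using ht)
  rw [tendsto_iff_norm_sub_tendsto_zero]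
  refine squeeze_zero (fun _ => norm_nonneg _) (fun x => hC t rfl x) ?_
  simpa using tendsto_wt.const_mul C

/-- The two constants at infinity are limits of the same initial position, so they agree and cancel
in the difference. -/
theorem c1w_difference (h : IsClassicalWaveMap I φ) (h' : IsClassicalWaveMap I ψ) {t₀ : ℝ}
    (ht₀ : t₀ ∈ I) (h0 : ∀ x, φ (t₀, x) = ψ (t₀, x)) : C1W wt I fun z => φ z - ψ z := by
  obtain ⟨p, -, hp⟩ := h.exists_c1w_sub
  obtain ⟨q, -, hq⟩ := h'.exists_c1w_sub
  have hpq : p = q := by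
    have h1 := tendsto_cocompact_aux hp ht₀
    have h2 := tendsto_cocompact_aux hq ht₀
    simp only [h0] at h1
    exact tendsto_nhds_unique h1 h2
  subst hpq
  simpa using hp.sub h.isOpen wt_nonneg hq

theorem c1w_one (h : IsClassicalWaveMap I φ) : C1W (fun _ => 1) I φ := by
  obtain ⟨p, -, hp⟩ := h.exists_c1w_sub
  have hc : C1W (fun _ => (1 : ℝ)) I fun _ : ℝ × Plane => p :=
    ⟨contDiffOn_const, fun J _ _ => ⟨‖p‖, by simp⟩, fun J _ _ => ⟨0, by simp⟩⟩
  simpa using (hp.mono_weight wt_nonneg wt_le_one).add h.isOpen (fun _ => zero_le_one) hc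

/-- The nonlinearity ⟨∂^γ φ, ∂_γ φ⟩ φ is Lipschitz on bounded sets of (φ, ∂φ): split qa a - qb b
into qa (a - b) and (qa - qb) b. Only the second term needs a bound on a value of the map, namely on
`b`. -/
theorem lagrangian_difference_bound {M B : ℝ} (hM : ∀ u v : Ambient m, |mink u v| ≤ M * ‖u‖ * ‖v‖)
    (hM0 : 0 ≤ M) (a b : Ambient m) (da db : Fin 3 → Ambient m) (hB0 : 0 ≤ B)
    (hb : ‖b‖ ≤ B) (hda : ∀ α, ‖da α‖ ≤ B) (hdb : ∀ α, ‖db α‖ ≤ B) :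
    ‖(-mink (da 0) (da 0) + mink (da 1) (da 1) + mink (da 2) (da 2)) • a
      - (-mink (db 0) (db 0) + mink (db 1) (db 1) + mink (db 2) (db 2)) • b‖
    ≤ 3 * M * B ^ 2 * (‖a - b‖ + ‖da 0 - db 0‖ + ‖da 1 - db 1‖ + ‖da 2 - db 2‖) := by
  have h1 : ∀ α, |mink (da α) (da α)| ≤ M * B ^ 2 := fun α => (hM _ _).trans (by
    rw [mul_assoc, pow_two]
    exact mul_le_mul_of_nonneg_left (mul_le_mul (hda α) (hda α) (norm_nonneg _) hB0) hM0)
  have h2 : ∀ α, |mink (da α) (da α) - mink (db α) (db α)| ≤ 2 * M * B * ‖da α - db α‖ := by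
    intro α
    have e : mink (da α) (da α) - mink (db α) (db α)
        = mink (da α - db α) (da α) + mink (db α) (da α - db α) := by
      simp only [← minkL_apply, map_sub, sub_apply]
      ring
    rw [e]
    refine (abs_add_le _ _).trans ?_
    have i1 := hM (da α - db α) (da α)
    have i2 := hM (db α) (da α - db α)
    have j1 := mul_le_mul_of_nonneg_left (hda α) (mul_nonneg hM0 (norm_nonneg (da α - db α)))
    have j2 := mul_le_mul_of_nonneg_right (mul_le_mul_of_nonneg_left (hdb α) hM0)
      (norm_nonneg (da α - db α))
    linarith
  set qa := -mink (da 0) (da 0) + mink (da 1) (da 1) + mink (da 2) (da 2)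
  set qb := -mink (db 0) (db 0) + mink (db 1) (db 1) + mink (db 2) (db 2)
  have e : qa • a - qb • b = qa • (a - b) + (qa - qb) • b := by
    rw [smul_sub, sub_smul]
    abel
  have hqa : |qa| ≤ 3 * M * B ^ 2 := by
    have := abs_le.1 (h1 0)
    have := abs_le.1 (h1 1)
    have := abs_le.1 (h1 2)
    exact abs_le.2 ⟨by linarith, by linarith⟩
  have hqab : |qa - qb| ≤ 2 * M * B * (‖da 0 - db 0‖ + ‖da 1 - db 1‖ + ‖da 2 - db 2‖) := by
    have := abs_le.1 (h2 0)
    have := abs_le.1 (h2 1)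
    have := abs_le.1 (h2 2)
    exact abs_le.2 ⟨by linarith, by linarith⟩
  rw [e]
  refine (norm_add_le _ _).trans ?_
  rw [norm_smul, norm_smul, Real.norm_eq_abs, Real.norm_eq_abs]
  have k1 := mul_le_mul_of_nonneg_right hqa (norm_nonneg (a - b))
  set D := ‖da 0 - db 0‖ + ‖da 1 - db 1‖ + ‖da 2 - db 2‖ with hD
  have hD0 : 0 ≤ D := by positivity
  have k2 := mul_le_mul hqab hb (norm_nonneg _) (by positivity)
  have k3 : 0 ≤ M * B ^ 2 * D := by positivity
  nlinarith

/-- The left side is the source in the energy identity for the difference `u` of two wave maps, with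
`d0`, `d1`, `d2` its derivatives and `b` its d'Alembertian. Cauchy–Schwarz bounds it by the energy
density. -/
theorem energy_source_bound {V : Type*} [NormedAddCommGroup V] [InnerProductSpace ℝ V]
    {C : ℝ} (hC : 0 ≤ C) (u d0 d1 d2 b : V)
    (hb : ‖b‖ ≤ C * (‖u‖ + ‖d0‖ + ‖d1‖ + ‖d2‖)) :
    |inner ℝ u d0 - inner ℝ d0 b| ≤ (1 + 5 * C) *
      (1 / 2 * (inner ℝ u u + (inner ℝ d0 d0 + inner ℝ d1 d1 + inner ℝ d2 d2))) := by
  have h1 := abs_real_inner_le_norm u d0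
  have h2 := abs_real_inner_le_norm d0 b
  simp only [real_inner_self_eq_norm_sq]
  set x := ‖u‖
  set y := ‖d0‖
  set z := ‖d1‖
  set w := ‖d2‖
  have h3 : y * ‖b‖ ≤ C * (y * (x + y + z + w)) := by
    have := mul_le_mul_of_nonneg_left hb (norm_nonneg d0)
    linarith
  have h4 : y * (x + y + z + w) ≤ 5 * (1 / 2 * (x ^ 2 + (y ^ 2 + z ^ 2 + w ^ 2))) := by
    nlinarith [sq_nonneg (x - y), sq_nonneg (z - y), sq_nonneg (w - y), sq_nonneg x, sq_nonneg y,
      sq_nonneg z, sq_nonneg w]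
  have h5 : x * y ≤ 1 / 2 * (x ^ 2 + (y ^ 2 + z ^ 2 + w ^ 2)) := by
    nlinarith [sq_nonneg (x - y), sq_nonneg z, sq_nonneg w]
  have h6 := mul_le_mul_of_nonneg_left h4 hC
  have h7 := abs_sub (inner ℝ u d0) (inner ℝ d0 b)
  linarith

/-- Vanishing propagates forwards by Gronwall's inequality, and backwards by the same inequality for
s ↦ M(-s). -/
theorem eq_zero_of_gronwall {M M' : ℝ → ℝ} {K a b : ℝ}
    (hd : ∀ t ∈ Set.uIcc a b, HasDerivAt M (M' t) t)
    (hb : ∀ t ∈ Set.uIcc a b, |M' t| ≤ K * |M t|) (h0 : M a = 0) : M b = 0 := by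
  rcases le_total a b with hab | hab
  · rw [Set.uIcc_of_le hab] at hd hb
    exact eq_zero_of_abs_deriv_le_mul_abs_self_of_eq_zero_right
      (fun t ht => (hd t ht).continuousAt.continuousWithinAt)
      (fun t ht => (hd t (Set.Ico_subset_Icc_self ht)).hasDerivWithinAt) h0
      (fun t ht => hb t (Set.Ico_subset_Icc_self ht)) b ⟨hab, le_rfl⟩
  · rw [Set.uIcc_of_ge hab] at hd hb
    have hmem : ∀ t ∈ Set.Icc (-a) (-b), -t ∈ Set.Icc b a := fun t ht =>
      ⟨by linarith [ht.2], by linarith [ht.1]⟩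
    have hd' : ∀ t ∈ Set.Icc (-a) (-b), HasDerivAt (fun s => M (-s)) (-M' (-t)) t := by
      intro t ht
      have := (hd (-t) (hmem t ht)).comp t (hasDerivAt_neg t)
      simpa [Function.comp_def] using this
    have := eq_zero_of_abs_deriv_le_mul_abs_self_of_eq_zero_right
      (f := fun s => M (-s)) (K := K)
      (fun t ht => (hd' t ht).continuousAt.continuousWithinAt)
      (fun t ht => (hd' t (Set.Ico_subset_Icc_self ht)).hasDerivWithinAt) (by simpa using h0)
      (fun t ht => by simpa using hb (-t) (hmem t (Set.Ico_subset_Icc_self ht))) (-b)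
      ⟨by linarith, le_rfl⟩
    simpa using this

/-- Uniqueness of classical wave maps with given initial data. -/
theorem unique (h : IsClassicalWaveMap I φ) (h' : IsClassicalWaveMap I ψ) {t₀ : ℝ}
    (ht₀ : t₀ ∈ I) (h0 : ∀ x, φ (t₀, x) = ψ (t₀, x))
    (h1 : ∀ x, pd 0 φ (t₀, x) = pd 0 ψ (t₀, x)) {t : ℝ} (ht : t ∈ I) (x : Plane) :
    φ (t, x) = ψ (t, x) := by
  have hI := h.isOpen
  set u : ℝ × Plane → Ambient m := fun z => φ z - ψ z with hu_def
  set d : Fin 3 → ℝ × Plane → Ambient m := fun α z => pd α φ z - pd α ψ z with hd_def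
  have hu : C1W wt I u := h.c1w_difference h' ht₀ h0
  have hdc : ∀ α, C1W wt I (d α) := fun α => (h.c1w_pd α).sub hI wt_nonneg (h'.c1w_pd α)
  have hu' : ∀ z : ℝ × Plane, z.1 ∈ I → ∀ α, fderiv ℝ u z (basisVec α) = d α z := by
    intro z hz α
    rw [hu_def, fderiv_fun_sub (h.differentiableAt hz) (h'.differentiableAt hz)]
    rfl
  have hd' : ∀ z : ℝ × Plane, z.1 ∈ I → ∀ α β, fderiv ℝ (d α) z (basisVec β)
      = pd β (pd α φ) z - pd β (pd α ψ) z := by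
    intro z hz α β
    rw [hd_def, fderiv_fun_sub ((h.c1w_pd α).differentiableAt hI hz)
      ((h'.c1w_pd α).differentiableAt hI hz)]
    rfl
  have hbil : ∀ {F G : ℝ × Plane → Ambient m}, C1W wt I F → C1W wt I G →
      C1W wt I fun z => inner ℝ (F z) (G z) := fun hF hG =>
    C1W.bilin hI wt_nonneg (innerSL ℝ) (hF.mono_weight wt_nonneg wt_le_one) hG
  have hbil' : ∀ {F G : ℝ × Plane → Ambient m}, C1W wt I F → C1W wt I G → ∀ z : ℝ × Plane,
      z.1 ∈ I → HasFDerivAt (fun z => inner ℝ (F z) (G z))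
        (fderiv ℝ (fun z => inner ℝ (F z) (G z)) z) z ∧
      ∀ v, fderiv ℝ (fun z => inner ℝ (F z) (G z)) z v
        = inner ℝ (F z) (fderiv ℝ G z v) + inner ℝ (fderiv ℝ F z v) (G z) := by
    intro F G hF hG z hz
    exact ⟨((hbil hF hG).differentiableAt hI hz).hasFDerivAt, fun v =>
      fderiv_inner_apply ℝ (hF.differentiableAt hI hz) (hG.differentiableAt hI hz) v⟩
  -- The Euclidean inner product of the ambient space is used, since the Minkowski form is
  -- indefinite on differences of maps. The term |u|² is needed because φ also occurs
  -- undifferentiated in the nonlinearity.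
  set e : ℝ × Plane → ℝ := fun z => 1 / 2 * (inner ℝ (u z) (u z)
    + (inner ℝ (d 0 z) (d 0 z) + inner ℝ (d 1 z) (d 1 z) + inner ℝ (d 2 z) (d 2 z))) with he_def
  have he : C1W wt I e := ((hbil hu hu).add hI wt_nonneg (((hbil (hdc 0) (hdc 0)).add hI wt_nonneg
    (hbil (hdc 1) (hdc 1))).add hI wt_nonneg (hbil (hdc 2) (hdc 2)))).const_mul hI wt_nonneg _
  have he0 : ∀ z, 0 ≤ e z := by
    intro z
    simp only [he_def, real_inner_self_eq_norm_sq]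
    positivity
  set s : ℝ → Plane → ℝ := fun t x => inner ℝ (u (t, x)) (d 0 (t, x)) - inner ℝ (d 0 (t, x))
    (-(pd 0 (pd 0 φ) (t, x) - pd 0 (pd 0 ψ) (t, x))
      + (pd 1 (pd 1 φ) (t, x) - pd 1 (pd 1 ψ) (t, x))
      + (pd 2 (pd 2 φ) (t, x) - pd 2 (pd 2 ψ) (t, x))) with hs_def
  have hderiv : ∀ t ∈ I, HasDerivAt (fun t' => ∫ x, e (t', x)) (∫ x, s t x) t := by
    intro t ht
    refine hasDerivAt_integral_of_divergence hI he
      (f := fun i z => inner ℝ (d 0 z) (d i.succ z)) (fun i => hbil (hdc 0) (hdc i.succ)) ht ?_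
    intro x
    have H := ((((hbil' hu hu (t, x) ht).1.fun_add (((hbil' (hdc 0) (hdc 0) (t, x) ht).1.fun_add
      (hbil' (hdc 1) (hdc 1) (t, x) ht).1).fun_add
      (hbil' (hdc 2) (hdc 2) (t, x) ht).1))).const_mul (1 / 2)).fderiv
    rw [he_def, H]
    simp only [smul_apply, add_apply, smul_eq_mul,
      (hbil' hu hu (t, x) ht).2, (hbil' (hdc _) (hdc _) (t, x) ht).2, hu' (t, x) ht,
      hd' (t, x) ht, Fin.sum_univ_two, Fin.succ_zero_eq_one, Fin.succ_one_eq_two, hs_def]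
    rw [h.pd_comm (z := (t, x)) ht 1 0, h.pd_comm (z := (t, x)) ht 2 0,
      h'.pd_comm (z := (t, x)) ht 1 0, h'.pd_comm (z := (t, x)) ht 2 0]
    rw [inner_add_right, inner_add_right, inner_neg_right,
      real_inner_comm (u (t, x)) (d 0 (t, x)), real_inner_comm (d 0 (t, x)) (pd 0 (pd 0 φ) _ - _),
      real_inner_comm (d 1 (t, x)) (pd 0 (pd 1 φ) _ - _),
      real_inner_comm (d 2 (t, x)) (pd 0 (pd 2 φ) _ - _)]
    ring
  have hsub : Set.uIcc t₀ t ⊆ I := h.ordConnected.uIcc_subset ht₀ ht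
  have hbound : ∃ K, ∀ t' ∈ Set.uIcc t₀ t, ∀ x, |s t' x| ≤ K * e (t', x) := by
    obtain ⟨B0, hB0, hB⟩ := h'.c1w_one.bound.exists_nonneg (fun _ => zero_le_one) isCompact_uIcc
      hsub
    choose Bf hBf0 hBf using fun α => ((h.c1w_pd α).mono_weight wt_nonneg
      wt_le_one).bound.exists_nonneg (fun _ => zero_le_one) isCompact_uIcc hsub
    choose Bg hBg0 hBg using fun α => ((h'.c1w_pd α).mono_weight wt_nonneg
      wt_le_one).bound.exists_nonneg (fun _ => zero_le_one) isCompact_uIcc hsub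
    simp only [mul_one] at hB hBf hBg
    set B := B0 + ∑ α, Bf α + ∑ α, Bg α
    have hf : ∀ α, Bf α ≤ ∑ α, Bf α := fun α =>
      Finset.single_le_sum (fun i _ => hBf0 i) (Finset.mem_univ α)
    have hg : ∀ α, Bg α ≤ ∑ α, Bg α := fun α =>
      Finset.single_le_sum (fun i _ => hBg0 i) (Finset.mem_univ α)
    have hf0 : 0 ≤ ∑ α, Bf α := Finset.sum_nonneg fun i _ => hBf0 i
    have hg0 : 0 ≤ ∑ α, Bg α := Finset.sum_nonneg fun i _ => hBg0 i
    have hBn : 0 ≤ B := by positivity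
    refine ⟨1 + 5 * (3 * ‖minkL m‖ * B ^ 2), fun t' ht' x => ?_⟩
    refine energy_source_bound (by positivity) _ _ _ _ _ ?_
    have hb := h.box_eq (z := (t', x)) (hsub ht')
    have hb' := h'.box_eq (z := (t', x)) (hsub ht')
    have := lagrangian_difference_bound (M := ‖minkL m‖) (B := B)
      (fun u v => (minkL m).le_opNorm₂ u v) (norm_nonneg (minkL m)) (φ (t', x)) (ψ (t', x))
      (fun α => pd α φ (t', x)) (fun α => pd α ψ (t', x)) hBn
      ((hB t' ht' x).trans (by linarith))
      (fun α => (hBf α t' ht' x).trans (by linarith [hf α]))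
      (fun α => (hBg α t' ht' x).trans (by linarith [hg α]))
    rw [← hb, ← hb'] at this
    refine le_trans (le_of_eq (congrArg norm ?_)) this
    abel
  obtain ⟨K, hK⟩ := hbound
  have hint : ∀ t ∈ I, Integrable fun x => e (t, x) := fun t ht =>
    he.bound.integrable he.contDiffOn.continuousOn ht
  have hM : ∫ x, e (t, x) = 0 := by
    refine eq_zero_of_gronwall (M := fun t => ∫ x, e (t, x)) (M' := fun t => ∫ x, s t x) (a := t₀) (K := K)
      (fun t' ht' => hderiv t' (hsub ht')) (fun t' ht' => ?_) ?_
    · rw [abs_of_nonneg (a := ∫ x, e (t', x)) (integral_nonneg fun x => he0 _), ← integral_const_mul]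
      exact norm_integral_le_of_norm_le (f := s t') ((hint t' (hsub ht')).const_mul K)
        (.of_forall fun x => hK t' ht' x)
    · have : ∀ x, e (t₀, x) = 0 := by
        intro x
        have hz : ∀ y, u (t₀, y) = 0 := fun y => sub_eq_zero.2 (h0 y)
        have hd0 : ∀ α, d α (t₀, x) = 0 := by
          intro α
          refine Fin.cases ?_ (fun i => ?_) α
          · exact sub_eq_zero.2 (h1 x)
          · rw [← hu' (t₀, x) ht₀, basisVec_succ]
            have H := hasFDerivAt_slice (hu.differentiableAt hI (z := (t₀, x)) ht₀)
            simp only [hz] at H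
            have := congrArg (fun A : Plane →L[ℝ] Ambient m => A (EuclideanSpace.single i 1))
              (H.unique (hasFDerivAt_const 0 x))
            simpa using this
        simp [he_def, hz, hd0]
      simp [this]
  -- The energy density is continuous and nonnegative, so a vanishing integral makes it vanish at
  -- every point.
  have hae := (integral_eq_zero_iff_of_nonneg (fun x => he0 (t, x)) (hint t ht)).1 hM
  have hz : e (t, x) = 0 := congrFun (Continuous.ae_eq_iff_eq volume
    (continuous_slice he.contDiffOn.continuousOn ht) continuous_const |>.1 hae) x
  simp only [he_def, real_inner_self_eq_norm_sq] at hz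
  have : ‖u (t, x)‖ ^ 2 = 0 := by
    nlinarith [sq_nonneg ‖u (t, x)‖, sq_nonneg ‖d 0 (t, x)‖, sq_nonneg ‖d 1 (t, x)‖,
      sq_nonneg ‖d 2 (t, x)‖]
  exact sub_eq_zero.1 (norm_eq_zero.1 (pow_eq_zero_iff two_ne_zero |>.1 this))

end IsClassicalWaveMap

/-! ### Symmetries of classical wave maps -/

/-- The linear map `(t, x) ↦ (a t, b x)`. -/
def scaleCLE (a b : ℝ) (ha : a ≠ 0) (hb : b ≠ 0) : (ℝ × Plane) ≃L[ℝ] (ℝ × Plane) :=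
  (ContinuousLinearEquiv.smulLeft (Units.mk0 a ha)).prodCongr
    (ContinuousLinearEquiv.smulLeft (Units.mk0 b hb))

@[simp] theorem scaleCLE_apply (a b : ℝ) (ha : a ≠ 0) (hb : b ≠ 0) (z : ℝ × Plane) :
    scaleCLE a b ha hb z = (a * z.1, b • z.2) := rfl

/-- The map `φ(a t + t₁, b x + x₁)`. -/
def affineComp (φ : ℝ × Plane → Ambient m) (a b t₁ : ℝ) (x₁ : Plane) (z : ℝ × Plane) : Ambient m :=
  φ (a * z.1 + t₁, b • z.2 + x₁)

section Affine

variable {φ : ℝ × Plane → Ambient m} {a b : ℝ} (t₁ : ℝ) (x₁ : Plane)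

theorem affineComp_eq (ha : a ≠ 0) (hb : b ≠ 0) : affineComp φ a b t₁ x₁
    = (fun z => φ (z + (t₁, x₁))) ∘ scaleCLE a b ha hb := rfl

theorem pd_affineComp (ha : a ≠ 0) (hb : b ≠ 0) (α : Fin 3) :
    pd α (affineComp φ a b t₁ x₁)
      = (if α = 0 then a else b) • affineComp (pd α φ) a b t₁ x₁ := by
  funext z
  have h1 : fderiv ℝ (affineComp φ a b t₁ x₁) z
      = (fderiv ℝ φ (a * z.1 + t₁, b • z.2 + x₁)).comp
        (scaleCLE a b ha hb : (ℝ × Plane) →L[ℝ] ℝ × Plane) := by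
    rw [affineComp_eq t₁ x₁ ha hb, ContinuousLinearEquiv.comp_right_fderiv, fderiv_comp_add_right]
    rfl
  have h2 : scaleCLE a b ha hb (basisVec α) = (if α = 0 then a else b) • basisVec α := by
    refine Fin.cases ?_ (fun i => ?_) α
    · simp [basisVec_zero]
    · simp [basisVec_succ]
  simp only [pd, h1, ContinuousLinearMap.comp_apply, ContinuousLinearEquiv.coe_coe, h2, map_smul]
  rfl

theorem norm_iteratedFDeriv_affineComp_le (ha : a ≠ 0) (hb : b ≠ 0) {V : Type*} [NormedAddCommGroup V] [NormedSpace ℝ V]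
    (F : ℝ × Plane → V) (n : ℕ) (z : ℝ × Plane) :
    ‖iteratedFDeriv ℝ n (fun z => F (a * z.1 + t₁, b • z.2 + x₁)) z‖
      ≤ ‖iteratedFDeriv ℝ n F (a * z.1 + t₁, b • z.2 + x₁)‖
        * ‖(scaleCLE a b ha hb : (ℝ × Plane) →L[ℝ] ℝ × Plane)‖ ^ n := by
  have h1 : (fun z : ℝ × Plane => F (a * z.1 + t₁, b • z.2 + x₁))
    = (fun z => F (z + (t₁, x₁))) ∘ scaleCLE a b ha hb := rfl
  have h2 := ContinuousLinearEquiv.iteratedFDerivWithin_comp_right (scaleCLE a b ha hb)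
    (fun z => F (z + (t₁, x₁))) uniqueDiffOn_univ (x := z) (Set.mem_univ _) n
  simp only [Set.preimage_univ, iteratedFDerivWithin_univ, iteratedFDeriv_comp_add_right] at h2
  rw [h1, h2]
  refine (ContinuousMultilinearMap.norm_compContinuousLinearMap_le _ _).trans ?_
  simp

end Affine

/-- The two parts of the wave operator scale by a² and b², so a² = b² is what is required. It covers
rescaling, a = b = l⁻¹, and time reversal, a = -1 and b = 1. -/
theorem IsClassicalWaveMap.comp_affine {I : Set ℝ} {φ : ℝ × Plane → Ambient m}
    (h : IsClassicalWaveMap I φ) {a b : ℝ} (ha : a ≠ 0) (hb : b ≠ 0) (hab : a ^ 2 = b ^ 2)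
    (t₁ : ℝ) (x₁ : Plane) :
    IsClassicalWaveMap ((fun t => a * t + t₁) ⁻¹' I) (affineComp φ a b t₁ x₁) where
  isOpen := h.isOpen.preimage (by fun_prop)
  ordConnected := by
    rcases ha.lt_or_gt with ha' | ha'
    · exact h.ordConnected.preimage_anti fun x y hxy => by
        have := mul_le_mul_of_nonpos_left hxy ha'.le
        linarith
    · exact h.ordConnected.preimage_mono fun x y hxy => by
        have := mul_le_mul_of_nonneg_left hxy ha'.le
        linarith
  smooth := by
    refine h.smooth.comp (g := φ) (f := fun z : ℝ × Plane => (a * z.1 + t₁, b • z.2 + x₁))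
      (t := I ×ˢ Set.univ) (ContDiff.contDiffOn (by fun_prop)) ?_
    exact fun z hz => ⟨hz.1, Set.mem_univ _⟩
  mem_hyperboloid t ht x := h.mem_hyperboloid _ ht _
  schwartz := by
    obtain ⟨p, hp, H⟩ := h.schwartz
    refine ⟨p, hp, fun J hJ hJI k n => ?_⟩
    have hJ' : IsCompact ((fun t => a * t + t₁) '' J) := hJ.image (by fun_prop)
    have hJI' : (fun t => a * t + t₁) '' J ⊆ I := Set.image_subset_iff.2 hJI
    obtain ⟨C₀, h0⟩ := H _ hJ' hJI' 0 n
    obtain ⟨C, hC⟩ := H _ hJ' hJI' k n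
    set M := ‖(scaleCLE a b ha hb : (ℝ × Plane) →L[ℝ] ℝ × Plane)‖ ^ n
    -- The bound comes from ‖x‖ ≤ |b|⁻¹ (‖b x + x₁‖ + ‖x₁‖) and convexity of the k-th power; `M`
    -- accounts for composing the n-th derivative with the linear map.
    refine ⟨|b|⁻¹ ^ k * (2 ^ (k - 1) * (C + ‖x₁‖ ^ k * C₀)) * M, fun t ht x => ?_⟩
    have h1 := norm_iteratedFDeriv_affineComp_le t₁ x₁ ha hb (fun z => φ z - p) n (t, x)
    have h2 := hC _ ⟨t, ht, rfl⟩ (b • x + x₁)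
    have h3 := h0 _ ⟨t, ht, rfl⟩ (b • x + x₁)
    dsimp only at h1 h2 h3
    set N := ‖iteratedFDeriv ℝ n (fun z => φ z - p) (a * t + t₁, b • x + x₁)‖
    have hN : 0 ≤ N := norm_nonneg _
    have h4 : ‖x‖ ≤ |b|⁻¹ * (‖b • x + x₁‖ + ‖x₁‖) := by
      rw [inv_mul_eq_div, le_div_iff₀ (abs_pos.2 hb), mul_comm, ← Real.norm_eq_abs, ← norm_smul]
      calc ‖b • x‖ = ‖(b • x + x₁) - x₁‖ := by rw [add_sub_cancel_right]
        _ ≤ _ := norm_sub_le _ _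
    have h5 : ‖x‖ ^ k ≤ |b|⁻¹ ^ k * (2 ^ (k - 1) * (‖b • x + x₁‖ ^ k + ‖x₁‖ ^ k)) := by
      refine (pow_le_pow_left₀ (norm_nonneg _) h4 k).trans ?_
      rw [mul_pow]
      exact mul_le_mul_of_nonneg_left (add_pow_le (norm_nonneg _) (norm_nonneg _) k)
        (by positivity)
    calc ‖x‖ ^ k * ‖iteratedFDeriv ℝ n (fun z => affineComp φ a b t₁ x₁ z - p) (t, x)‖
        ≤ (|b|⁻¹ ^ k * (2 ^ (k - 1) * (‖b • x + x₁‖ ^ k + ‖x₁‖ ^ k))) * (N * M) :=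
          mul_le_mul h5 h1 (norm_nonneg _) (by positivity)
      _ = |b|⁻¹ ^ k * (2 ^ (k - 1) * (‖b • x + x₁‖ ^ k * N + ‖x₁‖ ^ k * N)) * M := by ring
      _ ≤ _ := by
          have h6 : ‖x₁‖ ^ k * N ≤ ‖x₁‖ ^ k * C₀ :=
            mul_le_mul_of_nonneg_left (by simpa using h3) (by positivity)
          gcongr
  equation t ht x := by
    have h1 : ∀ α β, covD (affineComp φ a b t₁ x₁) α (pd β (affineComp φ a b t₁ x₁)) (t, x)
        = ((if α = 0 then a else b) * (if β = 0 then a else b))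
          • covD φ α (pd β φ) (a * t + t₁, b • x + x₁) := by
      intro α β
      have h2 : pd α (pd β (affineComp φ a b t₁ x₁)) (t, x)
          = ((if α = 0 then a else b) * (if β = 0 then a else b))
            • pd α (pd β φ) (a * t + t₁, b • x + x₁) := by
        rw [pd_affineComp _ _ ha hb]
        simp only [pd]
        rw [fderiv_const_smul_field]
        have := congrFun (pd_affineComp (φ := pd β φ) t₁ x₁ ha hb α) (t, x)
        simp only [pd] at this
        rw [Pi.smul_apply, smul_apply, this, mul_comm, mul_smul]
        rfl
      simp only [covD, tangentProj, h2, mink_smul_right, smul_add, mul_smul]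
      rfl
    simp only [h1]
    have h3 := congrArg (fun v => b ^ 2 • v) (h.equation _ ht (b • x + x₁))
    simp only [Fin.sum_univ_three, g] at h3 ⊢
    simp [← pow_two, hab, ← smul_neg, ← smul_add] at h3 ⊢
    exact h3

theorem hasData_dil_trans {φ : ℝ × Plane → Ambient m} {t s t₁ : ℝ} {Φ : ClassicalData m}
    (h : HasData φ t Φ) (l : Set.Ioi (0 : ℝ)) (y : Plane) (hs : t = (l : ℝ)⁻¹ * s + t₁) :
    HasData (affineComp φ (l : ℝ)⁻¹ (l : ℝ)⁻¹ t₁ (-y)) s ((Φ.trans y).dil l) := by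
  intro x
  have hl : (l : ℝ)⁻¹ ≠ 0 := inv_ne_zero (ne_of_gt l.2)
  rw [pd_affineComp _ _ hl hl]
  simp only [affineComp, Pi.smul_apply, ← hs, if_true, (h _).1, (h _).2]
  simp only [ClassicalData.pos, ClassicalData.dil, ClassicalData.trans,
    ClassicalData.scaleInv, ← sub_eq_add_neg]
  exact ⟨rfl, rfl⟩

theorem hasData_rev {φ : ℝ × Plane → Ambient m} {s : ℝ} {Φ : ClassicalData m}
    (h : HasData φ (-s) Φ) : HasData (affineComp φ (-1) 1 0 0) s Φ.rev := by
  intro x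
  rw [pd_affineComp _ _ (by norm_num) (by norm_num)]
  simp only [affineComp, Pi.smul_apply, if_true, add_zero, one_smul, neg_mul, one_mul,
    (h _).1, (h _).2, neg_smul]
  exact ⟨rfl, rfl⟩

theorem ClassicalData.tendsto_pos (Φ : ClassicalData m) :
    Tendsto Φ.pos (cocompact Plane) (𝓝 Φ.base) := by
  have := (Φ.dev.toZeroAtInfty.zero_at_infty').const_add Φ.base
  rw [add_zero] at this
  exact this

/-- The splitting of the position into base and deviation is unique, because the base is the limit
at infinity. -/
theorem HasData.eq {φ ψ : ℝ × Plane → Ambient m} {t : ℝ} {Φ Ψ : ClassicalData m}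
    (h : HasData φ t Φ) (h' : HasData ψ t Ψ) (heq : ∀ x, φ (t, x) = ψ (t, x))
    (heq' : ∀ x, pd 0 φ (t, x) = pd 0 ψ (t, x)) : Φ = Ψ := by
  have hpos : Φ.pos = Ψ.pos := by
    funext x
    rw [← (h x).1, ← (h' x).1, heq]
  have hbase : Φ.base = Ψ.base := by
    have := Φ.tendsto_pos
    rw [hpos] at this
    exact tendsto_nhds_unique this Ψ.tendsto_pos
  ext1
  · exact hbase
  · ext1 x
    have := congrFun hpos x
    simp only [ClassicalData.pos, hbase] at this
    exact add_left_cancel this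
  · ext1 x
    rw [← (h x).2, ← (h' x).2, heq']

theorem IsClassicalWaveMap.stressOf_eq {I : Set ℝ} {φ : ℝ × Plane → Ambient m}
    (h : IsClassicalWaveMap I φ) {t : ℝ} (ht : t ∈ I) {Φ : ClassicalData m} (hΦ : HasData φ t Φ)
    (x : Plane) : stressOf φ (t, x) = Φ.stressEnergy x := by
  have : ∀ α, pd α φ (t, x) = Φ.partialD α x := by
    intro α
    refine Fin.cases (hΦ x).2 (fun i => ?_) α
    have h1 := hasFDerivAt_slice (h.differentiableAt (z := (t, x)) ht)
    have h2 : (fun y => φ (t, y)) = Φ.pos := funext fun y => (hΦ y).1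
    rw [h2] at h1
    simp only [ClassicalData.partialD, Fin.cons_succ, h1.fderiv]
    rfl
  funext α β
  simp only [stressOf, ClassicalData.stressEnergy, this]

theorem IsClassicalWaveMap.mono {I J : Set ℝ} {φ : ℝ × Plane → Ambient m}
    (h : IsClassicalWaveMap I φ) (hJ : IsOpen J) (hJ' : J.OrdConnected) (hJI : J ⊆ I) :
    IsClassicalWaveMap J φ where
  isOpen := hJ
  ordConnected := hJ'
  smooth := h.smooth.mono (Set.prod_mono hJI le_rfl)
  mem_hyperboloid t ht := h.mem_hyperboloid t (hJI ht)
  schwartz := by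
    obtain ⟨p, hp, H⟩ := h.schwartz
    exact ⟨p, hp, fun K hK hKJ => H K hK (hKJ.trans hJI)⟩
  equation t ht := h.equation t (hJI ht)

/-- Classical wave maps with the same data at one time have the same data later. -/
theorem HasData.propagate {I J : Set ℝ} {φ ψ : ℝ × Plane → Ambient m}
    (h : IsClassicalWaveMap I φ) (h' : IsClassicalWaveMap J ψ) {a b : ℝ} (ha : a ∈ I ∩ J)
    (hb : b ∈ I ∩ J) {Φ Φ' Ψ' : ClassicalData m} (h0 : HasData φ a Φ) (h0' : HasData ψ a Φ)
    (h1 : HasData φ b Φ') (h1' : HasData ψ b Ψ') : Φ' = Ψ' := by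
  have k := h.mono (h.isOpen.inter h'.isOpen) (h.ordConnected.inter h'.ordConnected)
    Set.inter_subset_left
  have k' := h'.mono (h.isOpen.inter h'.isOpen) (h.ordConnected.inter h'.ordConnected)
    Set.inter_subset_right
  have heq : ∀ t ∈ I ∩ J, ∀ x, φ (t, x) = ψ (t, x) := fun t ht x =>
    k.unique k' ha (fun x => by rw [(h0 x).1, (h0' x).1]) (fun x => by rw [(h0 x).2, (h0' x).2])
      ht x
  refine h1.eq h1' (heq b hb) fun x => ?_
  have : φ =ᶠ[𝓝 (b, x)] ψ := by
    filter_upwards [k.mem_nhds (z := (b, x)) hb] with z hz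
    exact heq z.1 hz.1 z.2
  simp only [pd, this.fderiv_eq]

/-! ### Energy class solutions as limits of classical wave maps -/

section Solutions

variable {E : Type*} [MetricSpace E]

theorem coe_pos (l : Set.Ioi (0 : ℝ)) : 0 < (l : ℝ) := Set.mem_Ioi.1 l.2

/-- A positive real number as an element of `(0, ∞)`. -/
def mkPos (r : ℝ) (hr : 0 < r) : Set.Ioi (0 : ℝ) := ⟨r, Set.mem_Ioi.2 hr⟩

@[simp] theorem coe_mkPos (r : ℝ) (hr : 0 < r) : (mkPos r hr : ℝ) = r := rfl

/-! ### The action of the symmetries on the energy space -/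

namespace EnergySpace

variable (X : EnergySpace m E)

/-- By density, identities between continuous maps on the energy space need only be checked on
classical data. -/
theorem funext_of_ι {F : Type*} [TopologicalSpace F] [T2Space F] {A B : E → F} (hA : Continuous A)
    (hB : Continuous B) (h : ∀ Φ, A (X.ι Φ) = B (X.ι Φ)) (Φ : E) : A Φ = B Φ :=
  congrFun (X.denseRange_ι.equalizer hA hB (funext h)) Φ

theorem dil_dil (a b : Set.Ioi (0 : ℝ)) (Φ : E) :
    X.dil a (X.dil b Φ) = X.dil (mkPos (a * b) (mul_pos (coe_pos a) (coe_pos b))) Φ := by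
  refine X.funext_of_ι ((X.isometry_dil _).continuous.comp (X.isometry_dil _).continuous)
    (X.isometry_dil _).continuous (fun Φ => ?_) Φ
  simp only [Function.comp, X.dil_ι]
  congr 1
  ext1
  · rfl
  all_goals
    ext1 x
    simp only [ClassicalData.dil, SchwartzMap.compCLMOfContinuousLinearEquiv_apply,
      Function.comp, ClassicalData.scaleInv, ContinuousLinearEquiv.smulLeft_apply_apply,
      Units.smul_mk0, smul_apply, smul_smul, map_smul, coe_mkPos, mul_inv_rev]
    rw [mul_comm (b : ℝ)⁻¹]

theorem dil_one (Φ : E) : X.dil (mkPos 1 one_pos) Φ = Φ := by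
  refine X.funext_of_ι (X.isometry_dil _).continuous continuous_id (fun Φ => ?_) Φ
  simp only [id, X.dil_ι]
  congr 1
  ext1
  · rfl
  all_goals
    ext1 x
    simp only [ClassicalData.dil, SchwartzMap.compCLMOfContinuousLinearEquiv_apply,
      Function.comp, ClassicalData.scaleInv, ContinuousLinearEquiv.smulLeft_apply_apply,
      Units.smul_mk0, coe_mkPos, inv_one, one_smul]

theorem trans_trans (x y : Plane) (Φ : E) : X.trans x (X.trans y Φ) = X.trans (x + y) Φ := by
  refine X.funext_of_ι ((X.isometry_trans _).continuous.comp (X.isometry_trans _).continuous)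
    (X.isometry_trans _).continuous (fun Φ => ?_) Φ
  simp only [Function.comp, X.trans_ι]
  congr 1
  ext1
  · rfl
  all_goals
    ext1 z
    simp [ClassicalData.trans, add_comm]

theorem trans_zero (Φ : E) : X.trans 0 Φ = Φ := by
  refine X.funext_of_ι (X.isometry_trans _).continuous continuous_id (fun Φ => ?_) Φ
  simp only [id, X.trans_ι]
  congr 1
  ext1
  · rfl
  all_goals
    ext1 z
    simp [ClassicalData.trans]

theorem trans_dil (l : Set.Ioi (0 : ℝ)) (y : Plane) (Φ : E) :
    X.trans y (X.dil l Φ) = X.dil l (X.trans ((l : ℝ)⁻¹ • y) Φ) := by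
  refine X.funext_of_ι ((X.isometry_trans _).continuous.comp (X.isometry_dil _).continuous)
    ((X.isometry_dil _).continuous.comp (X.isometry_trans _).continuous) (fun Φ => ?_) Φ
  simp only [Function.comp, X.trans_ι, X.dil_ι]
  congr 1
  ext1
  · rfl
  all_goals
    ext1 z
    simp [ClassicalData.trans, ClassicalData.dil, ClassicalData.scaleInv, Units.smul_def, smul_sub]

theorem rev_rev (Φ : E) : X.rev (X.rev Φ) = Φ := by
  refine X.funext_of_ι (X.isometry_rev.continuous.comp X.isometry_rev.continuous)
    continuous_id (fun Φ => ?_) Φ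
  simp only [Function.comp, X.rev_ι, id]
  congr 1
  ext1
  · rfl
  · rfl
  · simp [ClassicalData.rev]

theorem rev_dil_trans (l : Set.Ioi (0 : ℝ)) (y : Plane) (Φ : E) :
    X.rev (X.dil l (X.trans y Φ)) = X.dil l (X.trans y (X.rev Φ)) := by
  refine X.funext_of_ι (X.isometry_rev.continuous.comp
    ((X.isometry_dil _).continuous.comp (X.isometry_trans _).continuous))
    ((X.isometry_dil _).continuous.comp ((X.isometry_trans _).continuous.comp
      X.isometry_rev.continuous)) (fun Φ => ?_) Φ
  simp only [Function.comp, X.trans_ι, X.dil_ι, X.rev_ι]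
  congr 1
  ext1
  · rfl
  · rfl
  · simp [ClassicalData.rev, ClassicalData.dil, ClassicalData.trans]

/-- Translation by `y` followed by dilation by `l`. -/
def act (l : Set.Ioi (0 : ℝ)) (y : Plane) (Φ : E) : E := X.dil l (X.trans y Φ)

theorem continuous_act : Continuous fun q : Set.Ioi (0 : ℝ) × Plane × E =>
    X.act q.1 q.2.1 q.2.2 :=
  X.continuous_dil.comp (continuous_fst.prodMk (X.continuous_trans.comp continuous_snd))

theorem tendsto_act {l : ℕ → Set.Ioi (0 : ℝ)} {y : ℕ → Plane} {Φ : ℕ → E} {l' y' Φ'}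
    (hl : Tendsto l atTop (𝓝 l')) (hy : Tendsto y atTop (𝓝 y')) (hΦ : Tendsto Φ atTop (𝓝 Φ')) :
    Tendsto (fun n => X.act (l n) (y n) (Φ n)) atTop (𝓝 (X.act l' y' Φ')) :=
  (X.continuous_act.tendsto (l', y', Φ')).comp (hl.prodMk_nhds (hy.prodMk_nhds hΦ))

theorem continuous_act_right (l : Set.Ioi (0 : ℝ)) (y : Plane) : Continuous (X.act l y) :=
  (X.isometry_dil _).continuous.comp (X.isometry_trans _).continuous

/-- Translations and dilations form a group, with a translation passing through a dilation by `l'`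
after being scaled by `l'`⁻¹. -/
theorem act_act (l l' : Set.Ioi (0 : ℝ)) (y y' : Plane) (Φ : E) :
    X.act l y (X.act l' y' Φ)
      = X.act (mkPos (l * l') (mul_pos (coe_pos l) (coe_pos l'))) ((l' : ℝ)⁻¹ • y + y') Φ := by
  simp only [act, X.trans_dil, X.trans_trans, X.dil_dil]

theorem act_one (Φ : E) : X.act (mkPos 1 one_pos) 0 Φ = Φ := by
  simp only [act, X.trans_zero, X.dil_one]

/-- The inverse of a positive real. -/
def invIoi (l : Set.Ioi (0 : ℝ)) : Set.Ioi (0 : ℝ) := mkPos (l : ℝ)⁻¹ (inv_pos.2 (coe_pos l))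

theorem act_inv (l : Set.Ioi (0 : ℝ)) (y : Plane) (Φ : E) :
    X.act (invIoi l) (-((l : ℝ) • y)) (X.act l y Φ) = Φ := by
  have hl : (l : ℝ) ≠ 0 := ne_of_gt l.2
  rw [act_act]
  have h1 : mkPos ((invIoi l : ℝ) * l) (mul_pos (coe_pos (invIoi l)) (coe_pos l)) = mkPos 1 one_pos :=
    Subtype.ext (inv_mul_cancel₀ hl)
  have h2 : (l : ℝ)⁻¹ • -((l : ℝ) • y) + y = 0 := by
    rw [smul_neg, smul_smul, inv_mul_cancel₀ hl, one_smul, neg_add_cancel]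
  rw [h1, h2, act_one]

end EnergySpace

variable (X : EnergySpace m E)

/-- Continuous curves in the energy space which are pointwise limits of classical wave maps. -/
structure StrongSol (I : Set ℝ) (φ : ℝ → E) : Prop where
  isOpen : IsOpen I
  ordConnected : I.OrdConnected
  continuousOn : ContinuousOn φ I
  approx : ∀ a ∈ I, ∀ b ∈ I, ∃ (J : ℕ → Set ℝ) (u : ℕ → ℝ × Plane → Ambient m)
    (A B : ℕ → ClassicalData m), (∀ n, IsClassicalWaveMap (J n) (u n) ∧ a ∈ J n ∧ b ∈ J n ∧
      HasData (u n) a (A n) ∧ HasData (u n) b (B n)) ∧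
      Tendsto (fun n => X.ι (A n)) atTop (𝓝 (φ a)) ∧ Tendsto (fun n => X.ι (B n)) atTop (𝓝 (φ b))

/-- Strong solutions which cannot be continued. -/
structure MaxSol (I : Set ℝ) (φ : ℝ → E) : Prop extends StrongSol X I φ where
  nonempty : I.Nonempty
  maximal : ∀ tstar ∈ frontier I, ∀ s : ℕ → ℝ, (∀ n, s n ∈ I) → Tendsto s atTop (𝓝 tstar) →
    ∀ Ψ : E, ¬ Tendsto (fun n => φ (s n)) atTop (𝓝 Ψ)

variable {X}

theorem exists_mem_frontier {I : Set ℝ} (hI : IsOpen I) {a b : ℝ} (ha : a ∈ I) (hb : b ∉ I) :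
    ∃ c ∈ Set.uIcc a b, c ∈ frontier I := by
  by_contra! h
  refine hb ?_
  refine isPreconnected_uIcc.subset_of_closure_inter_subset hI ⟨a, Set.left_mem_uIcc, ha⟩ ?_
    Set.right_mem_uIcc
  intro c hc
  by_contra hcI
  exact h c hc.2 ⟨hc.1, by rwa [hI.interior_eq]⟩

theorem exists_seq_tendsto_frontier {I : Set ℝ} {c : ℝ} (hc : c ∈ frontier I) :
    ∃ s : ℕ → ℝ, (∀ n, s n ∈ I) ∧ Tendsto s atTop (𝓝 c) :=
  mem_closure_iff_seq_limit.1 hc.1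

variable (L : LocalWellPosedness X)

/-! ### Identification of maximal solutions with Cauchy developments -/

namespace LocalWellPosedness

theorem strongSol (t₀ : ℝ) (Φ₀ : E) : StrongSol X (L.life t₀ Φ₀) (L.dev t₀ Φ₀) where
  isOpen := L.isOpen_life t₀ Φ₀
  ordConnected := L.ordConnected_life t₀ Φ₀
  continuousOn := L.continuousOn_dev t₀ Φ₀
  approx a ha b hb := by
    -- Approximate the initial datum by classical data. Continuous dependence on the hull of `t₀`,
    -- `a`, `b` puts `a` and `b` into all but finitely many of the lifespans, hence the shift by
    -- `N`.
    obtain ⟨s, hs, hlim⟩ := mem_closure_iff_seq_limit.1 (X.denseRange_ι Φ₀)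
    choose Φ hΦ using hs
    obtain rfl : (fun n => X.ι (Φ n)) = s := funext hΦ
    have h0 := L.mem_life t₀ Φ₀
    set lo := min t₀ (min a b)
    set hi := max t₀ (max a b)
    have hlo : lo ∈ L.life t₀ Φ₀ := by
      rcases min_choice t₀ (min a b) with h | h <;> rcases min_choice a b with h' | h' <;>
        simp only [lo, h, h'] <;> assumption
    have hhi : hi ∈ L.life t₀ Φ₀ := by
      rcases max_choice t₀ (max a b) with h | h <;> rcases max_choice a b with h' | h' <;>
        simp only [hi, h, h'] <;> assumption
    obtain ⟨h1, h2⟩ := L.continuous_dependence t₀ _ Φ₀ hlim lo hi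
      ((L.ordConnected_life t₀ Φ₀).out hlo hhi)
    obtain ⟨N, hN⟩ := eventually_atTop.1 h1
    have ma : a ∈ Set.Icc lo hi := ⟨by simp [lo], by simp [hi]⟩
    have mb : b ∈ Set.Icc lo hi := ⟨by simp [lo], by simp [hi]⟩
    choose u hu1 hu2 hu3 using fun n => L.classical t₀ (Φ n)
    have hex : ∀ n, ∃ A B : ClassicalData m, (HasData (u (n + N)) a A ∧
        L.dev t₀ (X.ι (Φ (n + N))) a = X.ι A) ∧ (HasData (u (n + N)) b B ∧
        L.dev t₀ (X.ι (Φ (n + N))) b = X.ι B) := by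
      intro n
      obtain ⟨A, hA⟩ := hu3 (n + N) a (hN (n + N) (Nat.le_add_left _ _) ma)
      obtain ⟨B, hB⟩ := hu3 (n + N) b (hN (n + N) (Nat.le_add_left _ _) mb)
      exact ⟨A, B, hA, hB⟩
    choose A B hA hB using hex
    refine ⟨fun n => L.life t₀ (X.ι (Φ (n + N))), fun n => u (n + N), A, B, fun n =>
      ⟨hu1 _, hN _ (Nat.le_add_left _ _) ma, hN _ (Nat.le_add_left _ _) mb, (hA n).1, (hB n).1⟩,
      ?_, ?_⟩
    · simp only [← (hA _).2]
      exact (h2.tendsto_at ma).comp (tendsto_add_atTop_nat N)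
    · simp only [← (hB _).2]
      exact (h2.tendsto_at mb).comp (tendsto_add_atTop_nat N)

theorem maxSol (t₀ : ℝ) (Φ₀ : E) : MaxSol X (L.life t₀ Φ₀) (L.dev t₀ Φ₀) where
  toStrongSol := L.strongSol t₀ Φ₀
  nonempty := ⟨t₀, L.mem_life t₀ Φ₀⟩
  maximal := L.maximality t₀ Φ₀

end LocalWellPosedness

/-- Uniqueness: the approximating classical maps have data converging to φ(t), so by continuous
dependence the developments of these data converge at `c` to the development of φ(t). Classical
uniqueness identifies them with the approximating maps, which converge to φ(c). -/
theorem StrongSol.dev_eq {I : Set ℝ} {φ : ℝ → E} (h : StrongSol X I φ) {t c : ℝ} (ht : t ∈ I)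
    (hc : c ∈ I) (hc' : c ∈ L.life t (φ t)) : L.dev t (φ t) c = φ c := by
  obtain ⟨J, u, A, B, hu, hA, hB⟩ := h.approx t ht c hc
  have hsub : Set.Icc (min t c) (max t c) ⊆ L.life t (φ t) :=
    (L.ordConnected_life t (φ t)).uIcc_subset (L.mem_life t (φ t)) hc'
  obtain ⟨h1, h2⟩ := L.continuous_dependence t _ (φ t) hA (min t c) (max t c) hsub
  have mc : c ∈ Set.Icc (min t c) (max t c) := ⟨min_le_right _ _, le_max_right _ _⟩
  refine tendsto_nhds_unique (h2.tendsto_at mc) (hB.congr' ?_)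
  filter_upwards [h1] with n hn
  obtain ⟨v, hv1, hv2, hv3⟩ := L.classical t (A n)
  obtain ⟨Φ, hΦ, hΦ'⟩ := hv3 c (hn mc)
  obtain ⟨k1, k2, k3, k4, k5⟩ := hu n
  rw [hΦ', HasData.propagate k1 hv1 ⟨k2, L.mem_life _ _⟩ ⟨k3, hn mc⟩ k4 hv2 k5 hΦ]

/-- If the development ended inside `I`, it would agree with φ up to the endpoint and converge there
by continuity of φ, against maximality. -/
theorem StrongSol.subset_life {I : Set ℝ} {φ : ℝ → E} (h : StrongSol X I φ) {t : ℝ} (ht : t ∈ I) :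
    I ⊆ L.life t (φ t) := by
  intro c hc
  by_contra hc'
  obtain ⟨b, hb, hbf⟩ := exists_mem_frontier (L.isOpen_life t (φ t)) (L.mem_life t (φ t)) hc'
  have hbI : b ∈ I := h.ordConnected.uIcc_subset ht hc hb
  obtain ⟨s, hs, hlim⟩ := exists_seq_tendsto_frontier hbf
  refine L.maximality t (φ t) b hbf s hs hlim (φ b) ?_
  have h1 : Tendsto (fun n => φ (s n)) atTop (𝓝 (φ b)) :=
    (h.continuousOn.continuousAt (h.isOpen.mem_nhds hbI)).tendsto.comp hlim
  refine h1.congr' ?_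
  filter_upwards [hlim (h.isOpen.mem_nhds hbI)] with n hn
  exact (h.dev_eq L ht hn (hs n)).symm

/-- The roles of the preceding lemma are exchanged: if `I` ended inside the lifespan, φ would
converge along with the development, against maximality of φ. A maximal solution is therefore the
development from any of its times. -/
theorem MaxSol.life_eq {I : Set ℝ} {φ : ℝ → E} (h : MaxSol X I φ) {t : ℝ} (ht : t ∈ I) :
    L.life t (φ t) = I := by
  refine Set.Subset.antisymm (fun c hc => ?_) (h.subset_life L ht)
  by_contra hc'
  obtain ⟨b, hb, hbf⟩ := exists_mem_frontier h.isOpen ht hc'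
  have hbI : b ∈ L.life t (φ t) :=
    (L.ordConnected_life _ _).uIcc_subset (L.mem_life t (φ t)) hc hb
  obtain ⟨s, hs, hlim⟩ := exists_seq_tendsto_frontier hbf
  refine h.maximal b hbf s hs hlim (L.dev t (φ t) b) ?_
  have h1 : Tendsto (fun n => L.dev t (φ t) (s n)) atTop (𝓝 (L.dev t (φ t) b)) :=
    ((L.continuousOn_dev _ _).continuousAt ((L.isOpen_life _ _).mem_nhds hbI)).tendsto.comp hlim
  exact h1.congr fun n => h.dev_eq L ht (hs n) (h.subset_life L ht (hs n))

theorem MaxSol.dev_eqOn {I : Set ℝ} {φ : ℝ → E} (h : MaxSol X I φ) {t : ℝ} (ht : t ∈ I) :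
    Set.EqOn (L.dev t (φ t)) φ I := fun _ hc => h.dev_eq L ht hc (h.subset_life L ht hc)

theorem MaxSol.isEnergySolution {I J : Set ℝ} {φ : ℝ → E} (h : MaxSol X I φ) (hJ : J.OrdConnected)
    (hJI : J ⊆ I) : L.IsEnergySolution J φ := by
  obtain ⟨t, ht⟩ := h.nonempty
  refine ⟨hJ, t, φ t, ?_, fun c hc => (h.dev_eqOn L ht (hJI hc)).symm⟩
  rwa [h.life_eq L ht]

/-- Continuous dependence on the data. -/
theorem MaxSol.tendsto (L : LocalWellPosedness X) {I : Set ℝ} {φ : ℝ → E} (h : MaxSol X I φ) {J : ℕ → Set ℝ}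
    {ψ : ℕ → ℝ → E} (hψ : ∀ n, MaxSol X (J n) (ψ n)) {t : ℝ} (ht : t ∈ I) (ht' : ∀ n, t ∈ J n)
    (hlim : Tendsto (fun n => ψ n t) atTop (𝓝 (φ t))) {s : ℝ} (hs : s ∈ I) :
    (∀ᶠ n in atTop, s ∈ J n) ∧ Tendsto (fun n => ψ n s) atTop (𝓝 (φ s)) := by
  have hsub : Set.Icc (min t s) (max t s) ⊆ L.life t (φ t) := by
    rw [h.life_eq L ht]
    exact h.ordConnected.uIcc_subset ht hs
  obtain ⟨h1, h2⟩ := L.continuous_dependence t _ (φ t) hlim (min t s) (max t s) hsub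
  have ms : s ∈ Set.Icc (min t s) (max t s) := ⟨min_le_right _ _, le_max_right _ _⟩
  have h3 : ∀ᶠ n in atTop, s ∈ J n := by
    filter_upwards [h1] with n hn
    rw [← (hψ n).life_eq L (ht' n)]
    exact hn ms
  refine ⟨h3, ?_⟩
  rw [← h.dev_eqOn L ht hs]
  refine (h2.tendsto_at ms).congr' ?_
  filter_upwards [h3] with n hn
  exact (hψ n).dev_eqOn L (ht' n) hn

/-- The rescaled curve `s ↦ Dil_l Trans_y φ(t₁ + s / l)`. -/
def EnergySpace.rescale (X : EnergySpace m E) (l : Set.Ioi (0 : ℝ)) (y : Plane) (t₁ : ℝ)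
    (φ : ℝ → E) (s : ℝ) : E := X.act l y (φ ((l : ℝ)⁻¹ * s + t₁))

/-- A convergent sequence of transformed states is pulled back by the continuous left inverse `B`,
and frontiers correspond under the homeomorphism of time, so maximality is inherited. -/
theorem MaxSol.transport {I : Set ℝ} {φ : ℝ → E} (h : MaxSol X I φ) (τ : ℝ ≃ₜ ℝ) {A B : E → E}
    (hB : Continuous B) (hBA : ∀ Φ, B (A Φ) = Φ) (hs : StrongSol X (τ ⁻¹' I) fun s => A (φ (τ s))) :
    MaxSol X (τ ⁻¹' I) fun s => A (φ (τ s)) where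
  toStrongSol := hs
  nonempty := h.nonempty.preimage τ.surjective
  maximal t ht s hs hlim Ψ hΨ := by
    rw [← τ.preimage_frontier] at ht
    refine h.maximal (τ t) ht (fun n => τ (s n)) hs ((τ.continuous.tendsto t).comp hlim) (B Ψ) ?_
    simpa [Function.comp_def, hBA] using (hB.tendsto Ψ).comp hΨ

theorem MaxSol.rescale {I : Set ℝ} {φ : ℝ → E} (h : MaxSol X I φ) (l : Set.Ioi (0 : ℝ))
    (y : Plane) (t₁ : ℝ) :
    MaxSol X ((fun s => (l : ℝ)⁻¹ * s + t₁) ⁻¹' I) (X.rescale l y t₁ φ) := by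
  have hl : (l : ℝ)⁻¹ ≠ 0 := inv_ne_zero (ne_of_gt l.2)
  refine h.transport ((Homeomorph.mulLeft₀ _ hl).trans (Homeomorph.addRight t₁))
    (X.continuous_act_right (EnergySpace.invIoi l) (-((l : ℝ) • y))) (X.act_inv l y) ?_
  refine ⟨h.isOpen.preimage (by fun_prop), h.ordConnected.preimage_mono fun a b hab => ?_, ?_, ?_⟩
  · have := mul_le_mul_of_nonneg_left hab (inv_nonneg.2 (le_of_lt l.2))
    simpa using this
  · exact (X.continuous_act_right l y).comp_continuousOn (h.continuousOn.comp
      (by fun_prop) fun s hs => hs)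
  · intro a ha b hb
    obtain ⟨J, u, A, B, hu, hA, hB⟩ := h.approx _ ha _ hb
    refine ⟨fun n => (fun s => (l : ℝ)⁻¹ * s + t₁) ⁻¹' J n,
      fun n => affineComp (u n) (l : ℝ)⁻¹ (l : ℝ)⁻¹ t₁ (-y),
      fun n => ((A n).trans y).dil l, fun n => ((B n).trans y).dil l, fun n => ?_, ?_, ?_⟩
    · obtain ⟨k1, k2, k3, k4, k5⟩ := hu n
      exact ⟨k1.comp_affine hl hl rfl t₁ (-y), k2, k3, hasData_dil_trans k4 l y rfl,
        hasData_dil_trans k5 l y rfl⟩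
    · simp only [← X.dil_ι, ← X.trans_ι]
      exact ((X.continuous_act_right l y).tendsto _).comp hA
    · simp only [← X.dil_ι, ← X.trans_ι]
      exact ((X.continuous_act_right l y).tendsto _).comp hB

theorem MaxSol.rev {I : Set ℝ} {φ : ℝ → E} (h : MaxSol X I φ) :
    MaxSol X (Neg.neg ⁻¹' I) fun s => X.rev (φ (-s)) := by
  refine h.transport (Homeomorph.neg ℝ) X.isometry_rev.continuous X.rev_rev ?_
  refine ⟨h.isOpen.preimage (by fun_prop), h.ordConnected.preimage_anti fun a b hab => ?_, ?_, ?_⟩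
  · simpa using hab
  · exact X.isometry_rev.continuous.comp_continuousOn (h.continuousOn.comp
      (by fun_prop) fun s hs => hs)
  · intro a ha b hb
    obtain ⟨J, u, A, B, hu, hA, hB⟩ := h.approx _ ha _ hb
    refine ⟨fun n => (fun s => -1 * s + 0) ⁻¹' J n, fun n => affineComp (u n) (-1) 1 0 0,
      fun n => (A n).rev, fun n => (B n).rev, fun n => ?_, ?_, ?_⟩
    · obtain ⟨k1, k2, k3, k4, k5⟩ := hu n
      exact ⟨k1.comp_affine (by norm_num) (by norm_num) (by norm_num) 0 0,
        by simpa using k2, by simpa using k3, hasData_rev k4, hasData_rev k5⟩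
    · simp only [← X.rev_ι]
      exact (X.isometry_rev.continuous.tendsto _).comp hA
    · simp only [← X.rev_ι]
      exact (X.isometry_rev.continuous.tendsto _).comp hB

end Solutions

/-! ### Integrals of the stress-energy tensor -/

/-- The full contraction of two 2-tensors on `ℝ^{1+2}` (as arrays). -/
@[irreducible] def contr (c T : Fin 3 → Fin 3 → ℝ) : ℝ := ∑ α, ∑ β, c α β * T α β

theorem contr_eq (c T : Fin 3 → Fin 3 → ℝ) : contr c T = ∑ α, ∑ β, c α β * T α β := by
  rw [contr]

theorem continuous_contr : Continuous fun q : (Fin 3 → Fin 3 → ℝ) × (Fin 3 → Fin 3 → ℝ) =>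
    contr q.1 q.2 := by
  unfold contr
  fun_prop

theorem aestronglyMeasurable_contr {c T : Plane → Fin 3 → Fin 3 → ℝ}
    (hc : AEStronglyMeasurable c) (hT : AEStronglyMeasurable T) :
    AEStronglyMeasurable fun x => contr (c x) (T x) := by
  have h := hc.prodMk hT
  exact Continuous.comp_aestronglyMeasurable
    (g := fun q : (Fin 3 → Fin 3 → ℝ) × (Fin 3 → Fin 3 → ℝ) => contr q.1 q.2) continuous_contr h

theorem tendsto_contr {ι : Type*} {l : Filter ι} {c T : ι → Fin 3 → Fin 3 → ℝ}
    {c' T' : Fin 3 → Fin 3 → ℝ} (hc : Tendsto c l (𝓝 c')) (hT : Tendsto T l (𝓝 T')) :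
    Tendsto (fun n => contr (c n) (T n)) l (𝓝 (contr c' T')) := by
  have h := hc.prodMk_nhds hT
  exact Tendsto.comp (g := fun q : (Fin 3 → Fin 3 → ℝ) × (Fin 3 → Fin 3 → ℝ) => contr q.1 q.2)
    (continuous_contr.tendsto (c', T')) h

theorem contr_sub (c T T' : Fin 3 → Fin 3 → ℝ) : contr c (T - T') = contr c T - contr c T' := by
  simp [contr_eq, mul_sub, Finset.sum_sub_distrib]

theorem abs_contr_le_of_le {c T : Fin 3 → Fin 3 → ℝ} {N : ℝ} (hT : ∀ α β, |T α β| ≤ N) :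
    |contr c T| ≤ 9 * ‖c‖ * N := by
  have h1 : ∀ α β, |c α β * T α β| ≤ ‖c‖ * N := by
    intro α β
    rw [abs_mul]
    exact mul_le_mul ((norm_le_pi_norm (c α) β).trans (norm_le_pi_norm c α)) (hT α β)
      (abs_nonneg _) (norm_nonneg _)
  calc |contr c T| ≤ ∑ α : Fin 3, ∑ β : Fin 3, ‖c‖ * N :=
        (congrArg _ (contr_eq c T)).le.trans <|
          (Finset.abs_sum_le_sum_abs _ _).trans (Finset.sum_le_sum fun α _ =>
          (Finset.abs_sum_le_sum_abs _ _).trans (Finset.sum_le_sum fun β _ => h1 α β))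
    _ = 9 * ‖c‖ * N := by
        simp
        ring

theorem abs_contr_le (c T : Fin 3 → Fin 3 → ℝ) : |contr c T| ≤ 9 * ‖c‖ * ‖T‖ :=
  abs_contr_le_of_le fun α β => (norm_le_pi_norm (T α) β).trans (norm_le_pi_norm T α)

theorem Physical.abs_contr_le {T : Fin 3 → Fin 3 → ℝ} (h : Physical T) (c : Fin 3 → Fin 3 → ℝ) :
    |contr c T| ≤ 9 * ‖c‖ * T 0 0 := abs_contr_le_of_le h.abs_le

section Stress

variable {E : Type*} [MetricSpace E]

namespace EnergySpace

variable (X : EnergySpace m E)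

theorem integrable_stress (Φ : E) : Integrable (X.stress Φ : Plane → Fin 3 → Fin 3 → ℝ) :=
  L1.integrable_coeFn _

/-- L¹ convergence of the tensors of approximating classical data gives almost everywhere
convergence of a subsequence, and the physical tensors form a closed set. -/
theorem physical_ae (Φ : E) : ∀ᵐ x : Plane, Physical (X.stress Φ x) := by
  obtain ⟨s, hs, hlim⟩ := mem_closure_iff_seq_limit.1 (X.denseRange_ι Φ)
  choose D hD using hs
  have h1 : TendstoInMeasure volume (fun n => (X.stress (s n) : Plane → Fin 3 → Fin 3 → ℝ))
      atTop (X.stress Φ) :=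
    tendstoInMeasure_of_tendsto_Lp ((X.continuous_stress.tendsto Φ).comp hlim)
  obtain ⟨ns, -, hns⟩ := h1.exists_seq_tendsto_ae
  have h2 : ∀ᵐ x : Plane, ∀ n, X.stress (s n) x = (D n).stressEnergy x := by
    rw [ae_all_iff]
    intro n
    rw [← hD n]
    exact X.stress_ι (D n)
  filter_upwards [hns, h2] with x hx hx2
  exact isClosed_physical.mem_of_tendsto hx (.of_forall fun n => by
    rw [hx2]
    exact (D (ns n)).physical_stressEnergy x)

/-- The integral of the contraction of the stress-energy tensor with a field of coefficients. -/
def pair (c : Plane → Fin 3 → Fin 3 → ℝ) (Φ : E) : ℝ := ∫ x, contr (c x) (X.stress Φ x)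

variable {X} {c : Plane → Fin 3 → Fin 3 → ℝ} {C : ℝ}

theorem integrable_contr (hc : AEStronglyMeasurable c) (hC : ∀ x, ‖c x‖ ≤ C) (Φ : E) :
    Integrable fun x => contr (c x) (X.stress Φ x) := by
  have hm : AEStronglyMeasurable fun x => contr (c x) (X.stress Φ x) :=
    aestronglyMeasurable_contr hc (X.integrable_stress Φ).1
  refine ((X.integrable_stress Φ).norm.const_mul (9 * C)).mono' hm (.of_forall fun x => ?_)
  refine (abs_contr_le _ _).trans ?_
  have := mul_le_mul_of_nonneg_right (hC x) (norm_nonneg (X.stress Φ x))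
  linarith

theorem integrable_entry (Φ : E) (α β : Fin 3) :
    Integrable fun x => X.stress Φ x α β := by
  have h : Integrable fun x => (X.stress Φ x) α :=
    (integrable_pi_iff.1 (X.integrable_stress Φ)) α
  exact (integrable_pi_iff.1 h) β

theorem energy_nonneg (Φ : E) : 0 ≤ X.energy Φ := by
  refine integral_nonneg_of_ae ?_
  filter_upwards [X.physical_ae Φ] with x hx using hx.energy_nonneg

theorem abs_pair_le (hC : ∀ x, ‖c x‖ ≤ C) (Φ : E) :
    |X.pair c Φ| ≤ 9 * C * X.energy Φ := by
  unfold pair energy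
  rw [← integral_const_mul]
  refine norm_integral_le_of_norm_le (f := fun x => contr (c x) (X.stress Φ x))
    ((integrable_entry Φ 0 0).const_mul _) ?_
  filter_upwards [X.physical_ae Φ] with x hx
  refine (hx.abs_contr_le _).trans ?_
  have := mul_le_mul_of_nonneg_right (hC x) hx.energy_nonneg
  linarith

/-- Coefficients and states may vary together: the coefficients are treated by dominated convergence
at the fixed limit state, and the states by L¹ convergence with uniformly bounded coefficients. -/
theorem tendsto_pair {ι : Type*} {l : Filter ι} [l.IsCountablyGenerated]
    {c : ι → Plane → Fin 3 → Fin 3 → ℝ} {c' : Plane → Fin 3 → Fin 3 → ℝ} {Φ : ι → E} {Φ' : E}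
    (hc : ∀ᶠ n in l, AEStronglyMeasurable (c n)) (hC : ∀ᶠ n in l, ∀ x, ‖c n x‖ ≤ C)
    (hlim : ∀ᵐ x, Tendsto (fun n => c n x) l (𝓝 (c' x))) (hΦ : Tendsto Φ l (𝓝 Φ')) :
    Tendsto (fun n => X.pair (c n) (Φ n)) l (𝓝 (X.pair c' Φ')) := by
  have h1 : Tendsto (fun n => X.pair (c n) Φ') l (𝓝 (X.pair c' Φ')) := by
    refine tendsto_integral_filter_of_dominated_convergence
      (fun x => 9 * C * ‖X.stress Φ' x‖) ?_ ?_ ((X.integrable_stress Φ').norm.const_mul _) ?_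
    · filter_upwards [hc] with n hn
      exact aestronglyMeasurable_contr hn (X.integrable_stress Φ').1
    · filter_upwards [hC] with n hn
      refine .of_forall fun x => (abs_contr_le _ _).trans ?_
      have := mul_le_mul_of_nonneg_right (hn x) (norm_nonneg (X.stress Φ' x))
      linarith
    · filter_upwards [hlim] with x hx
      exact tendsto_contr hx tendsto_const_nhds
  have h2 : Tendsto (fun n => X.pair (c n) (Φ n) - X.pair (c n) Φ') l (𝓝 0) := by
    have h3 : Tendsto (fun n => 9 * C * ‖X.stress (Φ n) - X.stress Φ'‖) l (𝓝 0) := by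
      have := tendsto_iff_norm_sub_tendsto_zero.1 ((X.continuous_stress.tendsto Φ').comp hΦ)
      simpa using this.const_mul (9 * C)
    refine squeeze_zero_norm' ?_ h3
    filter_upwards [hc, hC] with n hn hn'
    unfold pair
    rw [← integral_sub (integrable_contr hn hn' _) (integrable_contr hn hn' _),
      L1.norm_eq_integral_norm, ← integral_const_mul]
    refine norm_integral_le_of_norm_le ((L1.integrable_coeFn _).norm.const_mul _) ?_
    filter_upwards [Lp.coeFn_sub (X.stress (Φ n)) (X.stress Φ')] with x hx
    rw [hx, Pi.sub_apply, ← contr_sub]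
    refine (abs_contr_le _ _).trans ?_
    have := mul_le_mul_of_nonneg_right (hn' x) (norm_nonneg (X.stress (Φ n) x - X.stress Φ' x))
    linarith
  simpa using h2.add h1

theorem continuous_pair (hc : AEStronglyMeasurable c) (hC : ∀ x, ‖c x‖ ≤ C) :
    Continuous (X.pair c) :=
  continuous_iff_continuousAt.2 fun _ => tendsto_pair (.of_forall fun _ => hc)
    (.of_forall fun _ => hC) (.of_forall fun _ => tendsto_const_nhds) tendsto_id

variable (X) in
theorem energy_eq_pair (Φ : E) :
    X.energy Φ = X.pair (fun _ α β => if α = 0 ∧ β = 0 then 1 else 0) Φ := by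
  unfold energy pair
  congr 1
  funext x
  simp [contr_eq, ite_and]

theorem continuous_energy : Continuous X.energy := by
  have : X.energy = X.pair (fun _ α β => if α = 0 ∧ β = 0 then 1 else 0) :=
    funext X.energy_eq_pair
  rw [this]
  refine continuous_pair (C := 1) aestronglyMeasurable_const fun x => ?_
  refine (pi_norm_le_iff_of_nonneg zero_le_one).2 fun α =>
    (pi_norm_le_iff_of_nonneg zero_le_one).2 fun β => ?_
  split_ifs <;> simp

theorem pair_ι (c : Plane → Fin 3 → Fin 3 → ℝ) (Φ : ClassicalData m) :
    X.pair c (X.ι Φ) = ∫ x, contr (c x) (Φ.stressEnergy x) := by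
  refine integral_congr_ae ?_
  filter_upwards [X.stress_ι Φ] with x hx
  rw [hx]

end EnergySpace

/-! ### The stress-energy tensor under the symmetries -/

theorem ClassicalData.stressEnergy_dil_trans (Φ : ClassicalData m) (l : Set.Ioi (0 : ℝ)) (y x : Plane)
    (α β : Fin 3) : ((Φ.trans y).dil l).stressEnergy x α β
      = ((l : ℝ) ^ 2)⁻¹ * Φ.stressEnergy ((l : ℝ)⁻¹ • x - y) α β := by
  have hpos : ((Φ.trans y).dil l).pos = fun x => Φ.pos ((l : ℝ)⁻¹ • x - y) := rfl
  have hd : ∀ α, ((Φ.trans y).dil l).partialD α x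
      = (l : ℝ)⁻¹ • Φ.partialD α ((l : ℝ)⁻¹ • x - y) := by
    intro α
    refine Fin.cases rfl (fun i => ?_) α
    have h1 : HasFDerivAt (fun x : Plane => (l : ℝ)⁻¹ • x - y)
        ((l : ℝ)⁻¹ • ContinuousLinearMap.id ℝ Plane) x :=
      ((hasFDerivAt_id x).const_smul (l : ℝ)⁻¹).sub_const y
    have h2 := (Φ.hasFDerivAt_pos ((l : ℝ)⁻¹ • x - y)).comp x h1
    simp only [partialD, Fin.cons_succ, hpos, (Φ.hasFDerivAt_pos _).fderiv]
    rw [Function.comp_def] at h2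
    rw [h2.fderiv]
    simp
  simp only [stressEnergy, hd, mink_smul_left, mink_smul_right, Fin.sum_univ_three]
  ring

theorem ClassicalData.stressEnergy_rev_zero (Φ : ClassicalData m) (x : Plane) :
    Φ.rev.stressEnergy x 0 0 = Φ.stressEnergy x 0 0 := by
  have h0 : Φ.rev.partialD 0 x = (-1 : ℝ) • Φ.partialD 0 x := by
    rw [neg_one_smul]
    rfl
  have h1 : Φ.rev.partialD 1 x = Φ.partialD 1 x := rfl
  have h2 : Φ.rev.partialD 2 x = Φ.partialD 2 x := rfl
  simp only [stressEnergy, Fin.sum_univ_three, h0, h1, h2, mink_smul_left, mink_smul_right, g]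
  simp

namespace EnergySpace

variable {X : EnergySpace m E}

/-- The tensor scales by l⁻² and the area element by l². They cancel because the plane has dimension
two, the energy-critical case. -/
theorem pair_act_ι {c : Plane → Fin 3 → Fin 3 → ℝ} (l : Set.Ioi (0 : ℝ)) (y : Plane)
    (Φ : ClassicalData m) :
    X.pair c (X.act l y (X.ι Φ)) = X.pair (fun z => c ((l : ℝ) • (z + y))) (X.ι Φ) := by
  have hl := coe_pos l
  rw [act, X.trans_ι, X.dil_ι, pair_ι, pair_ι]
  set f : Plane → ℝ := fun z => contr (c ((l : ℝ) • (z + y))) (Φ.stressEnergy z)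
  have h1 : ∀ x, contr (c x) (((Φ.trans y).dil l).stressEnergy x)
      = ((l : ℝ) ^ 2)⁻¹ * (fun z => f (z - y)) ((l : ℝ)⁻¹ • x) := by
    intro x
    have : (l : ℝ) • ((l : ℝ)⁻¹ • x - y + y) = x := by
      rw [sub_add_cancel, smul_smul, mul_inv_cancel₀ hl.ne', one_smul]
    simp only [f, this, contr_eq, Φ.stressEnergy_dil_trans, Finset.mul_sum]
    exact Finset.sum_congr rfl fun _ _ => Finset.sum_congr rfl fun _ _ => by ring
  simp only [h1]
  rw [integral_const_mul, Measure.integral_comp_smul volume (fun z => f (z - y)), integral_sub_right_eq_self]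
  simp only [finrank_euclideanSpace, Fintype.card_fin, smul_eq_mul]
  rw [abs_of_pos (by positivity), inv_pow, inv_inv, ← mul_assoc, inv_mul_cancel₀ (by positivity),
    one_mul]

theorem pair_act {c : Plane → Fin 3 → Fin 3 → ℝ} {C : ℝ} (hc : Measurable c)
    (hC : ∀ x, ‖c x‖ ≤ C) (l : Set.Ioi (0 : ℝ)) (y : Plane) (Φ : E) :
    X.pair c (X.act l y Φ) = X.pair (fun z => c ((l : ℝ) • (z + y))) Φ := by
  refine X.funext_of_ι (A := fun Φ => X.pair c (X.act l y Φ))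
    ((continuous_pair hc.aestronglyMeasurable hC).comp (X.continuous_act_right l y))
    (continuous_pair (C := C) ?_ fun x => hC _) (fun Φ => pair_act_ι l y Φ) Φ
  exact (hc.comp (by fun_prop)).aestronglyMeasurable

theorem energy_act (l : Set.Ioi (0 : ℝ)) (y : Plane) (Φ : E) :
    X.energy (X.act l y Φ) = X.energy Φ := by
  refine X.funext_of_ι (A := fun Φ => X.energy (X.act l y Φ))
    (continuous_energy.comp (X.continuous_act_right l y)) continuous_energy (fun Φ => ?_) Φ
  rw [X.energy_eq_pair, X.energy_eq_pair, pair_act_ι]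

theorem energy_rev (Φ : E) : X.energy (X.rev Φ) = X.energy Φ := by
  refine X.funext_of_ι (A := fun Φ => X.energy (X.rev Φ))
    (continuous_energy.comp X.isometry_rev.continuous) continuous_energy (fun Φ => ?_) Φ
  have h : ∀ Φ : ClassicalData m, X.energy (X.ι Φ) = ∫ x, Φ.stressEnergy x 0 0 := fun Φ => by
    refine integral_congr_ae ?_
    filter_upwards [X.stress_ι Φ] with x hx
    rw [hx]
  rw [X.rev_ι, h, h]
  simp only [Φ.stressEnergy_rev_zero]

end EnergySpace

end Stress

/-! ### The conservation law in the energy class -/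

/-- The coefficients of the density `T_{0β} Y^β` of a vector field `Y` at time `s`. -/
def momCoef (Y : Fin 3 → ℝ × Plane → ℝ) (s : ℝ) (x : Plane) (α β : Fin 3) : ℝ :=
  if α = 0 then Y β (s, x) else 0

/-- The coefficients of the source `-T^α_β ∂_α Y^β` of a vector field `Y` at time `s`. -/
def fluxCoef (Y : Fin 3 → ℝ × Plane → ℝ) (s : ℝ) (x : Plane) (α β : Fin 3) : ℝ :=
  (if α = 0 then 1 else -1) * fderiv ℝ (Y β) (s, x) (basisVec α)

theorem contr_momCoef (Y : Fin 3 → ℝ × Plane → ℝ) (s : ℝ) (x : Plane) (T : Fin 3 → Fin 3 → ℝ) :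
    contr (momCoef Y s x) T = ∑ β, Y β (s, x) * T 0 β := by
  simp [contr_eq, momCoef, Fin.sum_univ_three]

theorem contr_fluxCoef (Y : Fin 3 → ℝ × Plane → ℝ) (s : ℝ) (x : Plane) (T : Fin 3 → Fin 3 → ℝ) :
    contr (fluxCoef Y s x) T = ∑ β, (fderiv ℝ (Y β) (s, x) (basisVec 0) * T 0 β
      - fderiv ℝ (Y β) (s, x) (basisVec 1) * T 1 β
      - fderiv ℝ (Y β) (s, x) (basisVec 2) * T 2 β) := by
  simp [contr_eq, fluxCoef, Fin.sum_univ_three]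
  ring

/-- Coefficients which are continuous, and bounded locally uniformly in time. -/
structure GoodCoef (I : Set ℝ) (c : ℝ → Plane → Fin 3 → Fin 3 → ℝ) : Prop where
  continuousOn : ∀ α β, ContinuousOn (fun z : ℝ × Plane => c z.1 z.2 α β) (I ×ˢ Set.univ)
  bound : ∀ α β, WBound (fun _ => 1) I fun z => c z.1 z.2 α β

namespace GoodCoef

variable {I : Set ℝ} {c : ℝ → Plane → Fin 3 → Fin 3 → ℝ}

theorem continuous (h : GoodCoef I c) {s : ℝ} (hs : s ∈ I) : Continuous (c s) :=
  continuous_pi fun α => continuous_pi fun β => continuous_slice (h.continuousOn α β) hs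

theorem exists_bound (h : GoodCoef I c) {J : Set ℝ} (hJ : IsCompact J) (hJI : J ⊆ I) :
    ∃ C, 0 ≤ C ∧ ∀ s ∈ J, ∀ x, ‖c s x‖ ≤ C := by
  choose C hC0 hC using fun α β => (h.bound α β).exists_nonneg (fun _ => zero_le_one) hJ hJI
  simp only [mul_one] at hC
  have h0 : 0 ≤ ∑ α, ∑ β, C α β := Finset.sum_nonneg fun α _ => Finset.sum_nonneg fun β _ =>
    hC0 α β
  refine ⟨∑ α, ∑ β, C α β, h0, fun s hs x => ?_⟩
  refine (pi_norm_le_iff_of_nonneg h0).2 fun α => (pi_norm_le_iff_of_nonneg h0).2 fun β => ?_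
  refine (hC α β s hs x).trans ?_
  refine (Finset.single_le_sum (fun i _ => hC0 α i) (Finset.mem_univ β)).trans ?_
  exact Finset.single_le_sum (f := fun α => ∑ β, C α β)
    (fun i _ => Finset.sum_nonneg fun β _ => hC0 i β) (Finset.mem_univ α)

theorem mono {J : Set ℝ} (h : GoodCoef I c) (hJ : J ⊆ I) : GoodCoef J c :=
  ⟨fun α β => (h.continuousOn α β).mono (Set.prod_mono hJ le_rfl),
    fun α β K hK hKJ => h.bound α β K hK (hKJ.trans hJ)⟩

theorem momCoef {Y : Fin 3 → ℝ × Plane → ℝ} (hY : ∀ β, C1W (fun _ => 1) I (Y β)) :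
    GoodCoef I (momCoef Y) := by
  refine ⟨fun α β => ?_, fun α β => ?_⟩ <;> unfold WaveMap.momCoef <;> split_ifs
  · exact (hY β).contDiffOn.continuousOn
  · exact continuousOn_const
  · exact (hY β).bound
  · exact fun J _ _ => ⟨0, by simp⟩

theorem fluxCoef {Y : Fin 3 → ℝ × Plane → ℝ} (hI : IsOpen I)
    (hY : ∀ β, C1W (fun _ => 1) I (Y β)) : GoodCoef I (fluxCoef Y) := by
  refine ⟨fun α β => ?_, fun α β => ?_⟩ <;> unfold WaveMap.fluxCoef
  · exact continuousOn_const.mul (((hY β).continuousOn_fderiv hI).clm_apply continuousOn_const)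
  · refine (hY β).bound_fderiv.of_le (fun _ => zero_le_one) ‖basisVec α‖ fun t _ x => ?_
    rw [norm_mul, show ‖(if α = 0 then (1 : ℝ) else -1)‖ = 1 by split_ifs <;> simp, one_mul,
      mul_comm]
    exact ContinuousLinearMap.le_opNorm _ _

end GoodCoef

theorem C1W.mono_set {V : Type*} [NormedAddCommGroup V] [NormedSpace ℝ V] {ρ : Plane → ℝ}
    {I J : Set ℝ} {F : ℝ × Plane → V} (h : C1W ρ I F) (hJ : J ⊆ I) : C1W ρ J F :=
  ⟨h.contDiffOn.mono (Set.prod_mono hJ le_rfl), fun K hK hKJ => h.bound K hK (hKJ.trans hJ),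
    fun K hK hKJ => h.bound_fderiv K hK (hKJ.trans hJ)⟩

/-- By the product rule and the conservation law, ∂_0(T_{0β}Y^β) - ∑ ∂_i(T_{iβ}Y^β) = T_{0β}∂_0Y^β -
∑ T_{iβ}∂_iY^β. All multiplier identities below are instances of this. -/
theorem IsClassicalWaveMap.hasDerivAt_integral_contr {I : Set ℝ} {φ : ℝ × Plane → Ambient m}
    (h : IsClassicalWaveMap I φ) {Y : Fin 3 → ℝ × Plane → ℝ} (hY : ∀ β, C1W (fun _ => 1) I (Y β))
    {t : ℝ} (ht : t ∈ I) :
    HasDerivAt (fun s => ∫ x, contr (momCoef Y s x) (stressOf φ (s, x)))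
      (∫ x, contr (fluxCoef Y t x) (stressOf φ (t, x))) t := by
  have hp : ∀ α β, C1W wt I fun z => Y β z * stressOf φ z α β := fun α β =>
    C1W.bilin h.isOpen wt_nonneg (ContinuousLinearMap.mul ℝ ℝ) (hY β) (h.c1w_stress α β)
  have hs : ∀ α, C1W wt I fun z => ∑ β, Y β z * stressOf φ z α β := fun α =>
    C1W.sum _ h.isOpen wt_nonneg fun β _ => hp α β
  have hd : ∀ α x v, fderiv ℝ (fun z => ∑ β, Y β z * stressOf φ z α β) (t, x) v
      = ∑ β, (Y β (t, x) * fderiv ℝ (fun z => stressOf φ z α β) (t, x) v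
        + stressOf φ (t, x) α β * fderiv ℝ (Y β) (t, x) v) := by
    intro α x v
    rw [fderiv_fun_sum fun β _ => (hp α β).differentiableAt h.isOpen (z := (t, x)) ht,
      sum_apply]
    refine Finset.sum_congr rfl fun β _ => ?_
    rw [(((hY β).differentiableAt h.isOpen (z := (t, x)) ht).hasFDerivAt.fun_mul
      ((h.c1w_stress α β).differentiableAt h.isOpen (z := (t, x)) ht).hasFDerivAt).fderiv]
    simp
  simp only [contr_momCoef]
  refine hasDerivAt_integral_of_divergence h.isOpen (hs 0)
    (f := fun i z => ∑ β, Y β z * stressOf φ z i.succ β) (fun i => hs i.succ) ht fun x => ?_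
  simp only [Fin.sum_univ_two, hd, contr_fluxCoef]
  simp only [Fin.succ_zero_eq_one, Fin.succ_one_eq_two]
  rw [← Finset.sum_add_distrib, ← Finset.sum_add_distrib]
  refine Finset.sum_congr rfl fun β _ => ?_
  rw [h.fderiv_stress (z := (t, x)) ht]
  ring

section Law

variable {E : Type*} [MetricSpace E] {X : EnergySpace m E}

theorem GoodCoef.continuousOn_pair {I : Set ℝ} {c : ℝ → Plane → Fin 3 → Fin 3 → ℝ}
    (h : GoodCoef I c) (hI : IsOpen I) {φ : ℝ → E} (hφ : ContinuousOn φ I) :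
    ContinuousOn (fun s => X.pair (c s) (φ s)) I := by
  intro t ht
  refine ContinuousAt.continuousWithinAt ?_
  obtain ⟨r, hr, hrI⟩ := Metric.nhds_basis_closedBall.mem_iff.1 (hI.mem_nhds ht)
  obtain ⟨C, -, hC⟩ := h.exists_bound (isCompact_closedBall t r) hrI
  refine EnergySpace.tendsto_pair (C := C) ?_ ?_ (.of_forall fun x => ?_)
    (hφ.continuousAt (hI.mem_nhds ht))
  · filter_upwards [hI.mem_nhds ht] with s hs using (h.continuous hs).aestronglyMeasurable
  · filter_upwards [Metric.closedBall_mem_nhds t hr] with s hs using hC s hs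
  · refine tendsto_pi_nhds.2 fun α => tendsto_pi_nhds.2 fun β => ?_
    have h1 : ContinuousAt (fun z : ℝ × Plane => c z.1 z.2 α β) (t, x) :=
      (h.continuousOn α β).continuousAt ((hI.prod isOpen_univ).mem_nhds ⟨ht, Set.mem_univ _⟩)
    exact h1.tendsto.comp (Continuous.tendsto (by fun_prop : Continuous fun s : ℝ => (s, x)) t)

theorem LocalWellPosedness.law_classical (L : LocalWellPosedness X) (t₀ : ℝ)
    (Φ₀ : ClassicalData m) {J : Set ℝ} (hJ : IsOpen J) (hJ' : J.OrdConnected)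
    {Y : Fin 3 → ℝ × Plane → ℝ}
    (hY : ∀ β, C1W (fun _ => 1) J (Y β)) {a b : ℝ} (hab : Set.uIcc a b ⊆ J)
    (hab' : Set.uIcc a b ⊆ L.life t₀ (X.ι Φ₀)) :
    X.pair (momCoef Y b) (L.dev t₀ (X.ι Φ₀) b) - X.pair (momCoef Y a) (L.dev t₀ (X.ι Φ₀) a)
      = ∫ s in a..b, X.pair (fluxCoef Y s) (L.dev t₀ (X.ι Φ₀) s) := by
  obtain ⟨φ, h1, -, h3⟩ := L.classical t₀ Φ₀
  set I := L.life t₀ (X.ι Φ₀)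
  have hIJ : IsOpen (I ∩ J) := h1.isOpen.inter hJ
  have hφ := h1.mono hIJ (h1.ordConnected.inter hJ') Set.inter_subset_left
  have hY' : ∀ β, C1W (fun _ => 1) (I ∩ J) (Y β) := fun β => (hY β).mono_set Set.inter_subset_right
  have hpair : ∀ s ∈ I, ∀ c, X.pair c (L.dev t₀ (X.ι Φ₀) s)
      = ∫ x, contr (c x) (stressOf φ (s, x)) := by
    intro s hs c
    obtain ⟨Φ, hΦ, hΦ'⟩ := h3 s hs
    rw [hΦ', EnergySpace.pair_ι]
    simp only [h1.stressOf_eq hs hΦ]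
  have hd : ∀ t ∈ Set.uIcc a b, HasDerivAt
      (fun s => X.pair (momCoef Y s) (L.dev t₀ (X.ι Φ₀) s))
      (X.pair (fluxCoef Y t) (L.dev t₀ (X.ι Φ₀) t)) t := by
    intro t ht
    have htI : t ∈ I ∩ J := ⟨hab' ht, hab ht⟩
    rw [hpair t htI.1]
    refine (hφ.hasDerivAt_integral_contr hY' htI).congr_of_eventuallyEq ?_
    filter_upwards [hIJ.mem_nhds htI] with s hs using hpair s hs.1 _
  have hi : IntervalIntegrable (fun s => X.pair (fluxCoef Y s) (L.dev t₀ (X.ι Φ₀) s))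
      volume a b := (((GoodCoef.fluxCoef hIJ hY').continuousOn_pair hIJ ((L.continuousOn_dev _ _).mono
      Set.inter_subset_left)).mono fun s hs => ⟨hab' hs, hab hs⟩).intervalIntegrable
  exact (intervalIntegral.integral_eq_sub_of_hasDerivAt hd hi).symm

/-- The constant vector field `∂_t`. -/
def timeField (β : Fin 3) (_ : ℝ × Plane) : ℝ := if β = 0 then 1 else 0

theorem c1w_const (I : Set ℝ) (c : ℝ) : C1W (fun _ => 1) I fun _ => c :=
  ⟨contDiffOn_const, fun _ _ _ => ⟨|c|, by simp⟩, fun _ _ _ => ⟨0, by simp⟩⟩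

theorem c1w_timeField (I : Set ℝ) (β : Fin 3) : C1W (fun _ => 1) I (timeField β) :=
  c1w_const I _

theorem EnergySpace.pair_timeField (s : ℝ) (Φ : E) :
    X.pair (momCoef timeField s) Φ = X.energy Φ := by
  unfold pair energy
  congr 1
  funext x
  simp [contr_momCoef, timeField]

theorem fluxCoef_timeField (s : ℝ) : fluxCoef timeField s = 0 := by
  funext x α β
  have : timeField β = fun _ => if β = 0 then 1 else 0 := rfl
  simp [fluxCoef, this]

theorem EnergySpace.pair_zero (Φ : E) : X.pair 0 Φ = 0 := by
  simp [pair, contr_eq]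

/-- The multiplier is ∂_t. This case comes before the law in the energy class, where it supplies the
uniform energy bound for dominated convergence. -/
theorem LocalWellPosedness.energy_classical (L : LocalWellPosedness X) (t₀ : ℝ)
    (Φ₀ : ClassicalData m) {t : ℝ} (ht : t ∈ L.life t₀ (X.ι Φ₀)) :
    X.energy (L.dev t₀ (X.ι Φ₀) t) = X.energy (X.ι Φ₀) := by
  have h := L.law_classical t₀ Φ₀ isOpen_univ Set.ordConnected_univ
    (c1w_timeField Set.univ)
    (a := t₀) (b := t) (Set.subset_univ _)
    ((L.ordConnected_life _ _).uIcc_subset (L.mem_life _ _) ht)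
  simp only [EnergySpace.pair_timeField, fluxCoef_timeField, EnergySpace.pair_zero,
    intervalIntegral.integral_zero, L.dev_init] at h
  linarith

/-- The integrated form of `∂^α T_{αβ} = 0`. -/
theorem MaxSol.law (L : LocalWellPosedness X) {I : Set ℝ} {φ : ℝ → E} (h : MaxSol X I φ)
    {J : Set ℝ} (hJ : IsOpen J) (hJ' : J.OrdConnected) {Y : Fin 3 → ℝ × Plane → ℝ}
    (hY : ∀ β, C1W (fun _ => 1) J (Y β)) {a b : ℝ} (ha : a ∈ I) (hb : b ∈ I)
    (hab : Set.uIcc a b ⊆ J) :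
    X.pair (momCoef Y b) (φ b) - X.pair (momCoef Y a) (φ a)
      = ∫ s in a..b, X.pair (fluxCoef Y s) (φ s) := by
  -- Pass to the limit along developments from time `a` of classical data approximating φ(a): the
  -- boundary terms converge by continuity of the pairing, the time integral by dominated
  -- convergence.
  obtain ⟨s, hs, hlim⟩ := mem_closure_iff_seq_limit.1 (X.denseRange_ι (φ a))
  choose D hD using hs
  obtain rfl : (fun n => X.ι (D n)) = s := funext hD
  have hmax : ∀ n, MaxSol X (L.life a (X.ι (D n))) (L.dev a (X.ι (D n))) := fun n =>
    L.maxSol a (X.ι (D n))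
  have hconv : ∀ t ∈ I, (∀ᶠ n in atTop, t ∈ L.life a (X.ι (D n))) ∧
      Tendsto (fun n => L.dev a (X.ι (D n)) t) atTop (𝓝 (φ t)) := fun t ht =>
    h.tendsto L hmax ha (fun n => L.mem_life _ _) (by simpa only [L.dev_init] using hlim) ht
  have hsub : Set.uIcc a b ⊆ I := h.ordConnected.uIcc_subset ha hb
  have hev : ∀ᶠ n in atTop, Set.uIcc a b ⊆ L.life a (X.ι (D n)) := by
    filter_upwards [(hconv b hb).1] with n hn
    exact (L.ordConnected_life _ _).uIcc_subset (L.mem_life _ _) hn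
  obtain ⟨C, hC0, hC⟩ := (GoodCoef.fluxCoef hJ hY).exists_bound isCompact_uIcc hab
  have hmom : ∀ t ∈ Set.uIcc a b, Tendsto (fun n => X.pair (momCoef Y t)
      (L.dev a (X.ι (D n)) t)) atTop (𝓝 (X.pair (momCoef Y t) (φ t))) := by
    intro t ht
    obtain ⟨C, -, hC⟩ := (GoodCoef.momCoef hY).exists_bound (J := {t}) isCompact_singleton
      (by simpa using hab ht)
    exact ((EnergySpace.continuous_pair ((GoodCoef.momCoef hY).continuous
      (hab ht)).aestronglyMeasurable (hC t rfl)).tendsto _).comp (hconv t (hsub ht)).2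
  refine tendsto_nhds_unique ((hmom b Set.right_mem_uIcc).sub (hmom a Set.left_mem_uIcc)) ?_
  have hint : Tendsto (fun n => ∫ s in a..b, X.pair (fluxCoef Y s) (L.dev a (X.ι (D n)) s)) atTop
      (𝓝 (∫ s in a..b, X.pair (fluxCoef Y s) (φ s))) := by
    have hE : ∀ᶠ n in atTop, X.energy (X.ι (D n)) ≤ X.energy (φ a) + 1 :=
      ((EnergySpace.continuous_energy.tendsto (φ a)).comp hlim).eventually_le_const
        (lt_add_one _)
    refine intervalIntegral.tendsto_integral_filter_of_dominated_convergence
      (fun _ => 9 * C * (X.energy (φ a) + 1)) ?_ ?_ intervalIntegrable_const ?_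
    · filter_upwards [hev] with n hn
      have hIJ : IsOpen (L.life a (X.ι (D n)) ∩ J) := (L.isOpen_life _ _).inter hJ
      refine ContinuousOn.aestronglyMeasurable ?_ measurableSet_uIoc
      refine (((GoodCoef.fluxCoef hJ hY).mono Set.inter_subset_right).continuousOn_pair hIJ
        ((L.continuousOn_dev _ _).mono Set.inter_subset_left)).mono fun s hs => ?_
      exact ⟨hn (Set.uIoc_subset_uIcc hs), hab (Set.uIoc_subset_uIcc hs)⟩
    · filter_upwards [hev, hE] with n hn hn'
      refine .of_forall fun t ht => ?_
      have ht' := Set.uIoc_subset_uIcc ht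
      refine (EnergySpace.abs_pair_le (hC t ht') _).trans ?_
      rw [L.energy_classical a (D n) (hn ht')]
      exact mul_le_mul_of_nonneg_left hn' (by positivity)
    · refine .of_forall fun t ht => ?_
      have ht' := Set.uIoc_subset_uIcc ht
      exact ((EnergySpace.continuous_pair ((GoodCoef.fluxCoef hJ hY).continuous
        (hab ht')).aestronglyMeasurable (hC t ht')).tendsto _).comp (hconv t (hsub ht')).2
  refine hint.congr' ?_
  filter_upwards [hev] with n hn
  exact (L.law_classical a (D n) hJ hJ' hY hab hn).symm

/-- Conservation of energy. -/
theorem MaxSol.energy_eq (L : LocalWellPosedness X) {I : Set ℝ} {φ : ℝ → E} (h : MaxSol X I φ)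
    {a b : ℝ} (ha : a ∈ I) (hb : b ∈ I) : X.energy (φ b) = X.energy (φ a) := by
  have h := h.law L isOpen_univ Set.ordConnected_univ
    (c1w_timeField Set.univ) ha hb
    (Set.subset_univ _)
  simp only [EnergySpace.pair_timeField, fluxCoef_timeField, EnergySpace.pair_zero,
    intervalIntegral.integral_zero] at h
  linarith

end Law

/-! ### Finite speed of propagation -/

/-- The composition of a `C¹` function with bounded derivative and a bounded `C¹` function with
bounded derivative. -/
theorem c1w_comp {V : Type*} [NormedAddCommGroup V] [NormedSpace ℝ V] {J : Set ℝ}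
    {u : ℝ × Plane → V} {f : V → ℝ} (hu : ContDiffOn ℝ 1 u (J ×ˢ Set.univ))
    (hf : ContDiff ℝ 1 f) (hJ : IsOpen J) {A B C : ℝ} (hA : ∀ r, |f r| ≤ A)
    (hB : ∀ r, ‖fderiv ℝ f r‖ ≤ B) (hC : ∀ t ∈ J, ∀ x, ‖fderiv ℝ u (t, x)‖ ≤ C) :
    C1W (fun _ => 1) J fun z => f (u z) := by
  have hd : ∀ t ∈ J, ∀ x, fderiv ℝ (fun z => f (u z)) (t, x)
      = (fderiv ℝ f (u (t, x))).comp (fderiv ℝ u (t, x)) := by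
    intro t ht x
    have h1 : DifferentiableAt ℝ u (t, x) := (hu.differentiableOn one_ne_zero).differentiableAt
      ((hJ.prod isOpen_univ).mem_nhds ⟨ht, Set.mem_univ _⟩)
    have h2 := (hf.differentiable one_ne_zero (u (t, x))).hasFDerivAt
    exact (h2.comp (t, x) h1.hasFDerivAt).fderiv
  refine ⟨hf.comp_contDiffOn hu, fun K _ _ => ⟨A, fun t _ x => by simpa using hA _⟩,
    fun K _ hK => ⟨B * C, fun t ht x => ?_⟩⟩
  rw [hd t (hK ht), mul_one]
  refine (ContinuousLinearMap.opNorm_comp_le _ _).trans ?_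
  exact mul_le_mul (hB _) (hC t (hK ht) x) (norm_nonneg _) ((norm_nonneg _).trans (hB 0))

/-- A smooth nondecreasing function equal to `0` on `(-∞, 0]` and to `1` on `[1, ∞)` has bounded
derivative. -/
theorem exists_bound_deriv_smoothTransition :
    ∃ B, ∀ r, |deriv Real.smoothTransition r| ≤ B := by
  have hc : Continuous (deriv Real.smoothTransition) :=
    (Real.smoothTransition.contDiff (n := 1)).continuous_deriv le_rfl
  obtain ⟨B, hB⟩ := (isCompact_Icc (a := (0 : ℝ)) (b := 1)).exists_bound_of_continuousOn hc.continuousOn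
  have hB0 : 0 ≤ B := (norm_nonneg _).trans (hB 0 (by simp))
  refine ⟨B, fun r => ?_⟩
  rcases lt_or_ge r 0 with h | h
  · have : Real.smoothTransition =ᶠ[𝓝 r] fun _ => 0 := by
      filter_upwards [Iio_mem_nhds h] with s hs using Real.smoothTransition.zero_of_nonpos hs.le
    rw [this.deriv_eq]
    simpa using hB0
  rcases lt_or_ge 1 r with h' | h'
  · have : Real.smoothTransition =ᶠ[𝓝 r] fun _ => 1 := by
      filter_upwards [Ioi_mem_nhds h'] with s hs using Real.smoothTransition.one_of_one_le hs.le
    rw [this.deriv_eq]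
    simpa using hB0
  · exact hB r ⟨h, h'⟩

/-- The vector field `F ∂_γ`. -/
def compField (γ : Fin 3) (F : ℝ × Plane → ℝ) (β : Fin 3) (z : ℝ × Plane) : ℝ :=
  if β = γ then F z else 0

theorem compField_self (γ : Fin 3) (F : ℝ × Plane → ℝ) : compField γ F γ = F := by
  funext z
  simp [compField]

theorem compField_of_ne {γ β : Fin 3} (h : β ≠ γ) (F : ℝ × Plane → ℝ) :
    compField γ F β = fun _ => 0 := by
  funext z
  simp [compField, h]

theorem c1w_compField {J : Set ℝ} {F : ℝ × Plane → ℝ} (h : C1W (fun _ => 1) J F) (γ β : Fin 3) :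
    C1W (fun _ => 1) J (compField γ F β) := by
  by_cases hβ : β = γ
  · rwa [hβ, compField_self]
  · rw [compField_of_ne hβ]
    exact c1w_const J 0

theorem contr_momCoef_compField (γ : Fin 3) (F : ℝ × Plane → ℝ) (s : ℝ) (x : Plane)
    (T : Fin 3 → Fin 3 → ℝ) : contr (momCoef (compField γ F) s x) T = F (s, x) * T 0 γ := by
  simp [contr_momCoef, compField]

theorem contr_fluxCoef_compField (γ : Fin 3) (F : ℝ × Plane → ℝ) (s : ℝ) (x : Plane)
    (T : Fin 3 → Fin 3 → ℝ) : contr (fluxCoef (compField γ F) s x) T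
      = fderiv ℝ F (s, x) (basisVec 0) * T 0 γ - fderiv ℝ F (s, x) (basisVec 1) * T 1 γ
        - fderiv ℝ F (s, x) (basisVec 2) * T 2 γ := by
  rw [contr_fluxCoef, Finset.sum_eq_single γ]
  · rw [compField_self]
  · intro β _ hβ
    simp [compField_of_ne hβ]
  · simp

/-- The smoothed light cone function `√(κ² + |x - c|²) - σ t`. -/
def coneFun (κ : ℝ) (c : Plane) (σ : ℝ) (z : ℝ × Plane) : ℝ := √(κ ^ 2 + ‖z.2 - c‖ ^ 2) - σ * z.1

theorem hasFDerivAt_coneFun {κ : ℝ} (hκ : 0 < κ) (c : Plane) (σ : ℝ) (z : ℝ × Plane) :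
    HasFDerivAt (coneFun κ c σ) ((√(κ ^ 2 + ‖z.2 - c‖ ^ 2))⁻¹ •
      (innerSL ℝ (z.2 - c)).comp (ContinuousLinearMap.snd ℝ ℝ Plane)
        - σ • ContinuousLinearMap.fst ℝ ℝ Plane) z := by
  have h1 : HasFDerivAt (fun z : ℝ × Plane => z.2 - c) (ContinuousLinearMap.snd ℝ ℝ Plane) z :=
    hasFDerivAt_snd.sub_const c
  have h2 := (h1.norm_sq.const_add (κ ^ 2)).sqrt (by positivity)
  have h3 : HasFDerivAt (fun z : ℝ × Plane => σ * z.1) (σ • ContinuousLinearMap.fst ℝ ℝ Plane) z :=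
    hasFDerivAt_fst.const_mul σ
  refine (h2.sub h3).congr_fderiv ?_
  congr 1
  rw [← Nat.cast_smul_eq_nsmul ℝ, smul_smul]
  congr 1
  field_simp
  norm_num

theorem contDiff_coneFun {κ : ℝ} (hκ : 0 < κ) (c : Plane) (σ : ℝ) : ContDiff ℝ 1 (coneFun κ c σ) := by
  unfold coneFun
  refine ContDiff.sub (ContDiff.sqrt ?_ fun z => by positivity) (by fun_prop)
  exact contDiff_const.add ((contDiff_snd.sub contDiff_const).norm_sq ℝ)

theorem norm_fderiv_coneFun_le {κ : ℝ} (hκ : 0 < κ) (c : Plane) (σ : ℝ) (z : ℝ × Plane) :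
    ‖fderiv ℝ (coneFun κ c σ) z‖ ≤ 1 + |σ| := by
  rw [(hasFDerivAt_coneFun hκ c σ z).fderiv]
  refine (norm_sub_le _ _).trans (add_le_add ?_ ?_)
  · refine ContinuousLinearMap.opNorm_le_bound _ zero_le_one fun w => ?_
    have hs : 0 < √(κ ^ 2 + ‖z.2 - c‖ ^ 2) := Real.sqrt_pos.2 (by positivity)
    have h1 : ‖z.2 - c‖ ≤ √(κ ^ 2 + ‖z.2 - c‖ ^ 2) :=
      Real.le_sqrt_of_sq_le (by nlinarith [sq_nonneg κ])
    have h2 : ‖inner ℝ (z.2 - c) w.2‖ ≤ ‖z.2 - c‖ * ‖w.2‖ := norm_inner_le_norm _ _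
    have h3 : ‖w.2‖ ≤ ‖w‖ := norm_snd_le w
    simp only [_root_.smul_apply, ContinuousLinearMap.comp_apply, innerSL_apply_apply,
      ContinuousLinearMap.coe_snd', norm_smul, norm_inv, Real.norm_of_nonneg hs.le, one_mul]
    rw [inv_mul_le_iff₀ hs]
    exact h2.trans (mul_le_mul h1 h3 (norm_nonneg _) hs.le)
  · rw [norm_smul, Real.norm_eq_abs]
    exact mul_le_of_le_one_right (abs_nonneg σ) (ContinuousLinearMap.norm_fst_le ℝ ℝ Plane)

theorem norm_sq_plane (x : Plane) : ‖x‖ ^ 2 = x 0 ^ 2 + x 1 ^ 2 := by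
  rw [EuclideanSpace.norm_sq_eq]
  simp [Fin.sum_univ_two]

section Tail

variable {E : Type*} [MetricSpace E] {X : EnergySpace m E}

/-- The energy outside of the ball of radius `r` around `c`. -/
def EnergySpace.tail (X : EnergySpace m E) (c : Plane) (r : ℝ) (Φ : E) : ℝ :=
  ∫ x in {x | r ≤ ‖x - c‖}, X.stress Φ x 0 0

theorem measurableSet_tail (c : Plane) (r : ℝ) : MeasurableSet {x : Plane | r ≤ ‖x - c‖} :=
  (isClosed_le continuous_const (by fun_prop)).measurableSet

/-- Finite speed of propagation. -/
theorem MaxSol.tail_le (L : LocalWellPosedness X) {I : Set ℝ} {φ : ℝ → E} (h : MaxSol X I φ)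
    {s t : ℝ} (hs : s ∈ I) (ht : t ∈ I) (c : Plane) (R : ℝ) {δ : ℝ} (hδ : 0 < δ) :
    X.tail c (R + δ + |s - t|) (φ s) ≤ X.tail c R (φ t) := by
  -- The sign of the time direction from `t` to `s`; it treats past and future at once.
  obtain ⟨σ, hσ, hσ'⟩ : ∃ σ : ℝ, |σ| = 1 ∧ σ * (s - t) = |s - t| := by
    rcases le_total 0 (s - t) with h | h
    · exact ⟨1, by simp, by rw [abs_of_nonneg h, one_mul]⟩
    · exact ⟨-1, by simp, by rw [abs_of_nonpos h]; ring⟩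
  -- Half of δ pays for smoothing the norm, the other half for the width of the cutoff.
  set κ := δ / 2 with hκ
  have hκ0 : 0 < κ := by positivity
  set f : ℝ → ℝ := fun r => Real.smoothTransition (κ⁻¹ * (r - (R + κ - σ * t)))
  have hf : ContDiff ℝ 1 f := Real.smoothTransition.contDiff.comp (by fun_prop)
  have hfd : ∀ r, deriv f r
      = deriv Real.smoothTransition (κ⁻¹ * (r - (R + κ - σ * t))) * κ⁻¹ := by
    intro r
    have h1 : HasDerivAt (fun r => κ⁻¹ * (r - (R + κ - σ * t))) κ⁻¹ r := by
      simpa using ((hasDerivAt_id r).sub_const (R + κ - σ * t)).const_mul κ⁻¹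
    exact (((Real.smoothTransition.contDiff (n := 1)).differentiable one_ne_zero _).hasDerivAt.comp
      r h1).deriv
  have hfd0 : ∀ r, 0 ≤ deriv f r := fun r => by
    rw [hfd]
    exact mul_nonneg (Real.smoothTransition.monotone.deriv_nonneg) (by positivity)
  obtain ⟨B, hB⟩ := exists_bound_deriv_smoothTransition
  set F : ℝ × Plane → ℝ := fun z => f (coneFun κ c σ z)
  have hF : C1W (fun _ => 1) Set.univ F := by
    refine c1w_comp (A := 1) (B := B * κ⁻¹) (C := 1 + |σ|) (contDiff_coneFun hκ0 c σ).contDiffOn hf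
      isOpen_univ (fun r => ?_) (fun r => ?_) fun t _ x => norm_fderiv_coneFun_le hκ0 c σ _
    · rw [abs_of_nonneg (Real.smoothTransition.nonneg _)]
      exact Real.smoothTransition.le_one _
    · rw [← norm_deriv_eq_norm_fderiv, hfd, norm_mul, Real.norm_of_nonneg (inv_pos.2 hκ0).le]
      exact mul_le_mul_of_nonneg_right (hB _) (inv_pos.2 hκ0).le
  have hlaw := h.law L isOpen_univ Set.ordConnected_univ (c1w_compField hF 0) ht hs
    (Set.subset_univ _)
  have hsign : ∀ r, σ * X.pair (fluxCoef (compField 0 F) r) (φ r) ≤ 0 := by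
    intro r
    unfold EnergySpace.pair
    rw [← integral_const_mul]
    refine integral_nonpos_of_ae ?_
    filter_upwards [X.physical_ae (φ r)] with x hx
    have hz := hasFDerivAt_coneFun hκ0 c σ (r, x)
    have hz2 : fderiv ℝ F (r, x) = deriv f (coneFun κ c σ (r, x)) • _ :=
      ((hf.differentiable one_ne_zero _).hasDerivAt.comp_hasFDerivAt (r, x) hz).fderiv
    set q := √(κ ^ 2 + ‖x - c‖ ^ 2) with hq
    have hqp : 0 < q := Real.sqrt_pos.2 (by positivity)
    have hq2 : q ^ 2 = κ ^ 2 + ((x 0 - c 0) ^ 2 + (x 1 - c 1) ^ 2) := by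
      rw [hq, Real.sq_sqrt (by positivity), norm_sq_plane]
      simp
    -- The gradient of the smoothed norm has length at most one, so σ times the flux density is -f'
    -- times a quantity which the dominant energy condition makes nonnegative.
    have hD := hx.dominant (a := σ * (q⁻¹ * (x 0 - c 0))) (b := σ * (q⁻¹ * (x 1 - c 1))) (by
      have : σ ^ 2 = 1 := by rw [← sq_abs, hσ, one_pow]
      have h3 : q⁻¹ ^ 2 * ((x 0 - c 0) ^ 2 + (x 1 - c 1) ^ 2) ≤ 1 := by
        rw [inv_pow, inv_mul_le_iff₀ (by positivity)]
        nlinarith [sq_nonneg κ]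
      calc _ = σ ^ 2 * (q⁻¹ ^ 2 * ((x 0 - c 0) ^ 2 + (x 1 - c 1) ^ 2)) := by ring
        _ ≤ 1 := by rw [this, one_mul]; exact h3)
    rw [contr_fluxCoef_compField, hz2]
    have b0 : basisVec 0 = ((1 : ℝ), (0 : Plane)) := rfl
    have b1 : basisVec 1 = ((0 : ℝ), (EuclideanSpace.single 0 1 : Plane)) := rfl
    have b2 : basisVec 2 = ((0 : ℝ), (EuclideanSpace.single 1 1 : Plane)) := rfl
    have hσ2 : σ * σ = 1 := by rw [← abs_mul_abs_self, hσ, one_mul]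
    simp only [b0, b1, b2, _root_.smul_apply, sub_apply,
      ContinuousLinearMap.comp_apply, ContinuousLinearMap.coe_snd', ContinuousLinearMap.coe_fst',
      innerSL_apply_apply, smul_eq_mul, inner_zero_right, EuclideanSpace.inner_single_right,
      hx.1 1 0, hx.1 2 0]
    simp only [PiLp.sub_apply, conj_trivial, Pi.zero_apply]
    have := mul_nonneg (hfd0 (coneFun κ c σ (r, x))) hD
    linear_combination this + (deriv f (coneFun κ c σ (r, x)) * X.stress (φ r) x 0 0) * (-hσ2)
  have hle : X.pair (momCoef (compField 0 F) s) (φ s) ≤ X.pair (momCoef (compField 0 F) t) (φ t) := by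
    have h0 : ∫ r in t..s, X.pair (fluxCoef (compField 0 F) r) (φ r) ≤ 0 := by
      rcases lt_trichotomy t s with hts | rfl | hts
      · have h1 : σ = 1 := by
          rw [abs_of_pos (sub_pos.2 hts)] at hσ'
          exact mul_right_cancel₀ (sub_pos.2 hts).ne' (hσ'.trans (one_mul _).symm)
        simp only [h1, one_mul] at hsign
        have := intervalIntegral.integral_nonneg (μ := volume) hts.le fun r _ =>
          neg_nonneg.2 (hsign r)
        rw [intervalIntegral.integral_neg] at this
        linarith
      · simp
      · have h1 : σ = -1 := by
          rw [abs_of_neg (sub_neg.2 hts)] at hσ'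
          exact mul_right_cancel₀ (sub_neg.2 hts).ne (hσ'.trans (neg_one_mul _).symm)
        simp only [h1, neg_one_mul, neg_nonpos] at hsign
        rw [intervalIntegral.integral_symm, neg_nonpos]
        exact intervalIntegral.integral_nonneg hts.le fun r _ => hsign r
    linarith
  have hi : ∀ r, Integrable fun x => F (r, x) * X.stress (φ r) x 0 0 := by
    intro r
    have := EnergySpace.integrable_contr (X := X) ((GoodCoef.momCoef (c1w_compField hF 0)).continuous
      (Set.mem_univ r)).aestronglyMeasurable
      (fun x => ((GoodCoef.momCoef (c1w_compField hF 0)).exists_bound (isCompact_singleton (x := r))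
        (Set.subset_univ _)).choose_spec.2 r rfl x) (φ r)
    simpa only [contr_momCoef_compField] using this
  have hF0 : ∀ z, 0 ≤ F z := fun z => Real.smoothTransition.nonneg _
  calc X.tail c (R + δ + |s - t|) (φ s) ≤ X.pair (momCoef (compField 0 F) s) (φ s) := by
        unfold EnergySpace.tail EnergySpace.pair
        simp only [contr_momCoef_compField]
        rw [← integral_indicator (measurableSet_tail _ _)]
        refine integral_mono_ae ((EnergySpace.integrable_entry _ 0 0).indicator
          (measurableSet_tail _ _)) (hi s) ?_
        filter_upwards [X.physical_ae (φ s)] with x hx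
        have h0 := hx.energy_nonneg
        refine Set.indicator_apply_le' (fun hx' => ?_) fun _ => mul_nonneg (hF0 _) h0
        have h1 : ‖x - c‖ ≤ √(κ ^ 2 + ‖x - c‖ ^ 2) :=
          Real.le_sqrt_of_sq_le (by nlinarith [sq_nonneg κ])
        have h2 : F (s, x) = 1 := by
          refine Real.smoothTransition.one_of_one_le ?_
          rw [inv_mul_eq_div, le_div_iff₀ hκ0, one_mul]
          simp only [Set.mem_ofPred_eq] at hx'
          simp only [coneFun]
          linarith
        rw [h2, one_mul]
    _ ≤ _ := hle
    _ ≤ X.tail c R (φ t) := by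
        unfold EnergySpace.tail EnergySpace.pair
        simp only [contr_momCoef_compField]
        rw [← integral_indicator (measurableSet_tail _ _)]
        refine integral_mono_ae (hi t) ((EnergySpace.integrable_entry _ 0 0).indicator
          (measurableSet_tail _ _)) ?_
        filter_upwards [X.physical_ae (φ t)] with x hx
        have h0 := hx.energy_nonneg
        refine Set.le_indicator_apply (fun _ => ?_) fun hx' => ?_
        · exact mul_le_of_le_one_left h0 (Real.smoothTransition.le_one _)
        · have h1 : √(κ ^ 2 + ‖x - c‖ ^ 2) ≤ κ + ‖x - c‖ :=
            Real.sqrt_le_iff.2 ⟨by positivity, by nlinarith [norm_nonneg (x - c)]⟩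
          have h2 : F (t, x) = 0 := by
            refine Real.smoothTransition.zero_of_nonpos ?_
            refine mul_nonpos_of_nonneg_of_nonpos (inv_pos.2 hκ0).le ?_
            simp only [Set.mem_ofPred_eq, not_le] at hx'
            simp only [coneFun]
            linarith
          rw [h2, zero_mul]

end Tail

/-! ### Compactness modulo symmetries -/

section Compactness

variable {E : Type*} [MetricSpace E]

namespace EnergySpace

variable {X : EnergySpace m E}

theorem abs_setIntegral_sub_le (s : Set Plane) (Φ Ψ : E) :
    |(∫ x in s, X.stress Φ x 0 0) - ∫ x in s, X.stress Ψ x 0 0|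
      ≤ ‖X.stress Φ - X.stress Ψ‖ := by
  rw [← integral_sub (integrable_entry Φ 0 0).integrableOn (integrable_entry Ψ 0 0).integrableOn,
    L1.norm_eq_integral_norm]
  refine (norm_integral_le_of_norm_le (f := fun x => X.stress Φ x 0 0 - X.stress Ψ x 0 0)
    (L1.integrable_coeFn (X.stress Φ - X.stress Ψ)).norm.integrableOn ?_).trans
    (setIntegral_le_integral (L1.integrable_coeFn (X.stress Φ - X.stress Ψ)).norm
      (.of_forall fun x => norm_nonneg _))
  refine ae_restrict_of_ae ?_
  filter_upwards [Lp.coeFn_sub (X.stress Φ) (X.stress Ψ)] with x hx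
  rw [hx]
  exact (norm_le_pi_norm ((X.stress Φ x - X.stress Ψ x) 0) 0).trans (norm_le_pi_norm _ 0)

theorem continuous_setIntegral (s : Set Plane) :
    Continuous fun Φ => ∫ x in s, X.stress Φ x 0 0 := by
  refine continuous_iff_continuousAt.2 fun Φ => tendsto_iff_norm_sub_tendsto_zero.2 ?_
  refine squeeze_zero (fun _ => norm_nonneg _) (fun Ψ => abs_setIntegral_sub_le s Ψ Φ) ?_
  simpa using tendsto_iff_norm_sub_tendsto_zero.1 (X.continuous_stress.tendsto Φ)

theorem tail_nonneg (c : Plane) (r : ℝ) (Φ : E) : 0 ≤ X.tail c r Φ := by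
  refine integral_nonneg_of_ae (ae_restrict_of_ae ?_)
  filter_upwards [X.physical_ae Φ] with x hx using hx.energy_nonneg

theorem setIntegral_mono_stress {s t : Set Plane} (hst : s ⊆ t) (Φ : E) :
    ∫ x in s, X.stress Φ x 0 0 ≤ ∫ x in t, X.stress Φ x 0 0 := by
  refine setIntegral_mono_set (integrable_entry Φ 0 0).integrableOn (ae_restrict_of_ae ?_)
    hst.eventuallyLE
  filter_upwards [X.physical_ae Φ] with x hx using hx.energy_nonneg

theorem tail_le_tail {c c' : Plane} {r r' : ℝ} (h : r + ‖c - c'‖ ≤ r') (Φ : E) :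
    X.tail c' r' Φ ≤ X.tail c r Φ := by
  refine setIntegral_mono_stress (fun x hx => ?_) Φ
  have h1 : ‖x - c'‖ ≤ ‖x - c‖ + ‖c - c'‖ := by
    simpa using norm_add_le (x - c) (c - c')
  simp only [Set.mem_ofPred_eq] at hx ⊢
  linarith

theorem tail_anti {c : Plane} {r r' : ℝ} (h : r ≤ r') (Φ : E) : X.tail c r' Φ ≤ X.tail c r Φ :=
  tail_le_tail (by simpa using h) Φ

/-- The balls complementary to the two tail regions are disjoint, so two balls each carrying most of
the energy cannot be far apart. This is how centres of concentration are bounded. -/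
theorem energy_le_tail_add_tail {c c' : Plane} {r r' : ℝ} (h : r + r' ≤ ‖c - c'‖) (Φ : E) :
    X.energy Φ ≤ X.tail c r Φ + X.tail c' r' Φ := by
  have hi := integrable_entry (X := X) Φ 0 0
  unfold energy tail
  rw [← integral_indicator (measurableSet_tail _ _), ← integral_indicator (measurableSet_tail _ _),
    ← integral_add (hi.indicator (measurableSet_tail _ _)) (hi.indicator (measurableSet_tail _ _))]
  refine integral_mono_ae hi ((hi.indicator (measurableSet_tail _ _)).add
    (hi.indicator (measurableSet_tail _ _))) ?_
  filter_upwards [X.physical_ae Φ] with x hx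
  have h0 := hx.energy_nonneg
  have h1 : ‖c - c'‖ ≤ ‖x - c‖ + ‖x - c'‖ := by
    rw [norm_sub_rev x c]
    simpa using norm_add_le (c - x) (x - c')
  rcases le_or_gt r ‖x - c‖ with h2 | h2
  · rw [Set.indicator_of_mem (a := x) (by exact h2)]
    exact le_add_of_nonneg_right (Set.indicator_apply_nonneg fun _ => h0)
  · have h3 : x ∈ {x | r' ≤ ‖x - c'‖} := by
      simp only [Set.mem_ofPred_eq]
      linarith
    rw [Set.indicator_of_mem (a := x) h3]
    exact le_add_of_nonneg_left (Set.indicator_apply_nonneg fun _ => h0)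

theorem energy_eq_tail_add (c : Plane) (r : ℝ) (Φ : E) :
    X.energy Φ = X.tail c r Φ + ∫ x in Metric.ball c r, X.stress Φ x 0 0 := by
  have h : Metric.ball c r = {x | r ≤ ‖x - c‖}ᶜ := by
    ext x
    simp [dist_eq_norm]
  rw [h]
  exact (integral_add_compl (measurableSet_tail c r) (integrable_entry Φ 0 0)).symm

theorem tendsto_tail (c : Plane) (Φ : E) : Tendsto (fun n : ℕ => X.tail c n Φ) atTop (𝓝 0) := by
  have h : ⋂ n : ℕ, {x : Plane | (n : ℝ) ≤ ‖x - c‖} = ∅ := by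
    ext x
    simp only [Set.mem_iInter, Set.mem_ofPred_eq, Set.mem_empty_iff_false, iff_false, not_forall,
      not_le]
    exact exists_nat_gt _
  have := tendsto_setIntegral_of_antitone (μ := volume) (f := fun x => X.stress Φ x 0 0)
    (fun n : ℕ => measurableSet_tail c n) (fun a b hab x hx => ?_)
    ⟨0, (integrable_entry Φ 0 0).integrableOn⟩
  · rw [h, setIntegral_empty] at this
    exact this
  · have : (a : ℝ) ≤ b := by exact_mod_cast hab
    exact this.trans hx

theorem tail_act (c : Plane) (r : ℝ) (l : Set.Ioi (0 : ℝ)) (y : Plane) (Φ : E) :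
    X.tail c r (X.act l y Φ) = X.tail ((l : ℝ)⁻¹ • c - y) ((l : ℝ)⁻¹ * r) Φ := by
  have hl := coe_pos l
  set w : Plane → ℝ → Plane → Fin 3 → Fin 3 → ℝ := fun c r x α β =>
    if r ≤ ‖x - c‖ then (if α = 0 ∧ β = 0 then 1 else 0) else 0
  have hw : ∀ c r Φ, X.tail c r Φ = X.pair (w c r) Φ := by
    intro c r Φ
    unfold tail pair
    rw [← integral_indicator (measurableSet_tail c r)]
    congr 1
    funext x
    simp only [w, contr_eq, Set.indicator_apply, Set.mem_ofPred_eq]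
    split_ifs <;> simp [ite_and]
  rw [hw, hw, pair_act (C := 1)]
  · congr 1
    funext z
    have : r ≤ ‖(l : ℝ) • (z + y) - c‖ ↔ (l : ℝ)⁻¹ * r ≤ ‖z - ((l : ℝ)⁻¹ • c - y)‖ := by
      have : (l : ℝ) • (z + y) - c = (l : ℝ) • (z - ((l : ℝ)⁻¹ • c - y)) := by
        rw [sub_sub_eq_add_sub, smul_sub, smul_smul, mul_inv_cancel₀ hl.ne', one_smul]
      rw [this, norm_smul, Real.norm_of_nonneg hl.le, inv_mul_le_iff₀ hl]
    simp only [w, this]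
  · refine measurable_pi_iff.2 fun α => measurable_pi_iff.2 fun β => ?_
    exact Measurable.ite (measurableSet_tail c r) measurable_const measurable_const
  · intro x
    refine (pi_norm_le_iff_of_nonneg zero_le_one).2 fun α =>
      (pi_norm_le_iff_of_nonneg zero_le_one).2 fun β => ?_
    simp only [w]
    split_ifs <;> simp

/-- Compact sets are tight. -/
theorem exists_tail_le {K : Set E} (hK : IsCompact K) {ε : ℝ} (hε : 0 < ε) :
    ∃ R, 1 ≤ R ∧ ∀ Φ ∈ K, X.tail 0 R Φ ≤ ε := by
  -- A Dini argument: the tails are continuous in the state and decrease to zero in the radius.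
  obtain ⟨n, hn⟩ := hK.elim_directed_cover (fun n : ℕ => {Φ | X.tail 0 n Φ < ε})
    (fun n => isOpen_lt (continuous_setIntegral _) continuous_const)
    (fun Φ _ => Set.mem_iUnion.2 ((tendsto_tail 0 Φ).eventually_lt_const hε).exists)
    (directed_of_isDirected_le fun a b hab Φ hΦ => (tail_anti (by exact_mod_cast hab) Φ).trans_lt hΦ)
  exact ⟨max n 1, le_max_right _ _, fun Φ hΦ =>
    (tail_anti (le_max_left _ _) Φ).trans (le_of_lt (hn hΦ))⟩

/-- The energy does not concentrate on compact sets. -/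
theorem exists_energy_sub_tail_le {K : Set E} (hK : IsCompact K) {ε : ℝ} (hε : 0 < ε) :
    ∃ r, 0 < r ∧ ∀ Φ ∈ K, ∀ c, X.energy Φ ≤ X.tail c r Φ + ε := by
  refine hK.induction_on (p := fun s => ∃ r, 0 < r ∧ ∀ Φ ∈ s, ∀ c, X.energy Φ ≤ X.tail c r Φ + ε)
    ⟨1, one_pos, by simp⟩ (fun s t hst ⟨r, hr, h⟩ => ⟨r, hr, fun Φ hΦ => h Φ (hst hΦ)⟩) ?_ ?_
  · rintro s t ⟨r, hr, h⟩ ⟨r', hr', h'⟩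
    refine ⟨min r r', lt_min hr hr', fun Φ hΦ c => ?_⟩
    rcases hΦ with hΦ | hΦ
    · have := tail_anti (X := X) (c := c) (min_le_left r r') Φ
      linarith [h Φ hΦ c]
    · have := tail_anti (X := X) (c := c) (min_le_right r r') Φ
      linarith [h' Φ hΦ c]
  · intro Φ _
    -- The area of a ball depends on its radius only, so absolute continuity of the integral works
    -- uniformly in the centre; the filter `comap Prod.fst (𝓝 0)` leaves the centre free.
    have hvol : Tendsto (volume ∘ fun q : ℝ × Plane => Metric.ball q.2 q.1)
        (comap Prod.fst (𝓝 0)) (𝓝 0) := by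
      have : (volume ∘ fun q : ℝ × Plane => Metric.ball q.2 q.1)
          = (fun r : ℝ => volume (Metric.ball (0 : Plane) r)) ∘ Prod.fst := by
        funext q
        simp [EuclideanSpace.volume_ball]
      rw [this]
      refine Tendsto.comp ?_ tendsto_comap
      have hc : Continuous fun r : ℝ => volume (Metric.ball (0 : Plane) r) := by
        simp only [EuclideanSpace.volume_ball]
        exact ENNReal.continuous_mul_const (by simp) |>.comp
          ((ENNReal.continuous_pow _).comp ENNReal.continuous_ofReal)
      simpa using hc.tendsto 0
    have h1 := (integrable_entry (X := X) Φ 0 0).tendsto_setIntegral_nhds_zero hvol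
    have h2 := eventually_comap.1 (h1.eventually_le_const (half_pos hε))
    obtain ⟨r, hr, hr'⟩ := (h2.filter_mono (nhdsWithin_le_nhds (s := Set.Ioi 0))).and
      self_mem_nhdsWithin |>.exists
    have h3 : ∀ᶠ Ψ in 𝓝 Φ, ‖X.stress Ψ - X.stress Φ‖ < ε / 2 := by
      have := tendsto_iff_norm_sub_tendsto_zero.1 (X.continuous_stress.tendsto Φ)
      exact this.eventually_lt_const (half_pos hε)
    refine ⟨_, mem_nhdsWithin_of_mem_nhds h3, r, hr', fun Ψ hΨ c => ?_⟩
    have h4 := hr (r, c) rfl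
    have h5 := abs_le.1 (abs_setIntegral_sub_le (X := X) (Metric.ball c r) Ψ Φ)
    rw [energy_eq_tail_add c r]
    have h6 : ‖X.stress Ψ - X.stress Φ‖ < ε / 2 := hΨ
    simp only at h4
    linarith

/-- The symmetries mapping a compact set to another one are bounded, away from zero energy. -/
theorem exists_act_bound {K K' : Set E} (hK : IsCompact K) (hK' : IsCompact K') {e : ℝ} (he : 0 < e) :
    ∃ a b, 0 < a ∧ ∀ Φ ∈ K, e ≤ X.energy Φ → ∀ l y, X.act l y Φ ∈ K' →
      a ≤ (l : ℝ) ∧ (l : ℝ) ≤ b ∧ ‖y‖ ≤ b := by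
  obtain ⟨R, hR1, hR⟩ := exists_tail_le (X := X) hK (show 0 < e / 4 by positivity)
  obtain ⟨R', hR1', hR'⟩ := exists_tail_le (X := X) hK' (show 0 < e / 4 by positivity)
  obtain ⟨r, hr0, hr⟩ := exists_energy_sub_tail_le (X := X) hK (show 0 < e / 4 by positivity)
  obtain ⟨r', hr0', hr'⟩ := exists_energy_sub_tail_le (X := X) hK' (show 0 < e / 4 by positivity)
  have hR0 : 0 < R := by linarith
  have hR0' : 0 < R' := by linarith
  refine ⟨r' / R, max (R' / r) (R + R' / (r' / R)), by positivity, fun Φ hΦ hE l y hl => ?_⟩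
  have hl0 := coe_pos l
  -- A smaller dilation factor would squeeze the bulk of the energy of `Φ` into a ball of radius
  -- `r'`, against non-concentration on `K'`.
  have e1 : r' / R ≤ l := by
    rw [div_le_iff₀ hR0]
    by_contra! hlt
    have t1 := hR Φ hΦ
    have t2 := hr' _ hl ((l : ℝ) • y)
    rw [energy_act, tail_act, smul_smul, inv_mul_cancel₀ hl0.ne', one_smul, sub_self] at t2
    have t3 : X.tail 0 ((l : ℝ)⁻¹ * r') Φ ≤ X.tail 0 R Φ := by
      refine tail_anti ?_ Φ
      rw [← div_eq_inv_mul, le_div_iff₀ hl0]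
      linarith
    linarith
  have t1 := hR' _ hl
  rw [tail_act, smul_zero, zero_sub] at t1
  -- With a larger factor the bulk of the energy of `Φ` would lie in a ball of radius less than `r`,
  -- against non-concentration on `K`.
  have e2 : (l : ℝ) ≤ R' / r := by
    rw [le_div_iff₀ hr0]
    by_contra! hlt
    have t2 := hr Φ hΦ (-y)
    have t3 : X.tail (-y) r Φ ≤ X.tail (-y) ((l : ℝ)⁻¹ * R') Φ := by
      refine tail_anti ?_ Φ
      rw [inv_mul_le_iff₀ hl0]
      linarith
    linarith
  refine ⟨e1, e2.trans (le_max_left _ _), le_trans ?_ (le_max_right _ _)⟩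
  -- Otherwise the balls about 0 and -y, each missing at most a quarter of `e`, would be disjoint.
  by_contra! hlt
  have t2 := hR Φ hΦ
  have t3 : R + (l : ℝ)⁻¹ * R' ≤ ‖(0 : Plane) - (-y)‖ := by
    have : (l : ℝ)⁻¹ * R' ≤ R' / (r' / R) := by
      rw [← div_eq_inv_mul]
      exact div_le_div_of_nonneg_left hR0'.le (by positivity) e1
    simp only [zero_sub, neg_neg]
    linarith
  have := energy_le_tail_add_tail (X := X) t3 Φ
  linarith

/-- `Φ` is a rescaled translate of an element of `K`. -/
def InOrbit (X : EnergySpace m E) (K : Set E) (Φ : E) : Prop := ∃ l y, X.act l y Φ ∈ K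

theorem InOrbit.act {K : Set E} {Φ : E} (h : X.InOrbit K Φ) (l : Set.Ioi (0 : ℝ)) (y : Plane) :
    X.InOrbit K (X.act l y Φ) := by
  obtain ⟨l', y', h⟩ := h
  have := act_inv (X := X) l y Φ
  rw [← this, act_act] at h
  exact ⟨_, _, h⟩

/-- The chosen scale and centre functions are traded for membership in the orbit of a compact set, a
condition that is visibly invariant under the symmetries. -/
theorem almostPeriodic_iff {I : Set ℝ} {φ : ℝ → E} :
    X.AlmostPeriodic I φ ↔ ∃ K, IsCompact K ∧ ∀ t ∈ I, X.InOrbit K (φ t) := by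
  constructor
  · rintro ⟨N, y, K, hK, h⟩
    exact ⟨K, hK, fun t ht => ⟨N t, -y t, h t ht⟩⟩
  · rintro ⟨K, hK, h⟩
    choose! N y h using h
    exact ⟨N, fun t => -y t, K, hK, fun t ht => by
      simp only [neg_neg]
      exact h t ht⟩

theorem exists_subseq_act {K K' : Set E} (hK : IsCompact K) (hK' : IsCompact K') {e : ℝ}
    (he : 0 < e) {Φ : ℕ → E} (hΦ : ∀ n, Φ n ∈ K) (hE : ∀ n, e ≤ X.energy (Φ n))
    {l : ℕ → Set.Ioi (0 : ℝ)} {y : ℕ → Plane} (hly : ∀ n, X.act (l n) (y n) (Φ n) ∈ K') :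
    ∃ (l' : Set.Ioi (0 : ℝ)) (y' : Plane) (σ : ℕ → ℕ), StrictMono σ ∧
      Tendsto (fun n => l (σ n)) atTop (𝓝 l') ∧ Tendsto (fun n => y (σ n)) atTop (𝓝 y') := by
  obtain ⟨a, b, ha, hab⟩ := exists_act_bound hK hK' he
  have hc : IsCompact (Set.Icc a b ×ˢ Metric.closedBall (0 : Plane) b) :=
    isCompact_Icc.prod (isCompact_closedBall _ _)
  obtain ⟨⟨l', y'⟩, hmem, σ, hσ, hlim⟩ := hc.tendsto_subseq
    (x := fun n => ((l n : ℝ), y n)) fun n => by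
      obtain ⟨h1, h2, h3⟩ := hab _ (hΦ n) (hE n) _ _ (hly n)
      exact ⟨⟨h1, h2⟩, by simpa using h3⟩
  have h1 := (continuous_fst.tendsto _).comp hlim
  have h2 := (continuous_snd.tendsto _).comp hlim
  exact ⟨mkPos l' (ha.trans_le hmem.1.1), y', σ, hσ, tendsto_subtype_rng.2 h1, h2⟩

/-- The orbit of a compact set is closed, away from zero energy. -/
theorem InOrbit.of_tendsto {K : Set E} (hK : IsCompact K) {Φ : ℕ → E} {Ψ : E}
    (hlim : Tendsto Φ atTop (𝓝 Ψ)) (hΨ : X.energy Ψ ≠ 0) (h : ∀ n, X.InOrbit K (Φ n)) :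
    X.InOrbit K Ψ := by
  have hpos : 0 < X.energy Ψ := (energy_nonneg Ψ).lt_of_ne' hΨ
  -- The lower bound on the energy is what confines the symmetries to a compact set; constant states
  -- would be fixed by all of them.
  obtain ⟨N, hN⟩ := eventually_atTop.1 (((continuous_energy.tendsto Ψ).comp hlim).eventually_const_le
    (half_lt_self hpos))
  choose l y hly using h
  obtain ⟨l', y', σ, hσ, h1, h2⟩ := exists_subseq_act hlim.isCompact_insert_range hK (half_pos hpos)
    (Φ := fun n => Φ (n + N)) (fun n => Set.mem_insert_of_mem _ ⟨_, rfl⟩)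
    (fun n => hN _ (Nat.le_add_left _ _)) (fun n => hly (n + N))
  have h3 : Tendsto (fun n => Φ (σ n + N)) atTop (𝓝 Ψ) :=
    hlim.comp ((tendsto_add_atTop_nat N).comp hσ.tendsto_atTop)
  exact ⟨l', y', hK.isClosed.mem_of_tendsto (X.tendsto_act h1 h2 h3) (.of_forall fun n => hly _)⟩

end EnergySpace

end Compactness

/-! ### Almost periodic maximal solutions -/

section AlmostPeriodic

variable {E : Type*} [MetricSpace E] {X : EnergySpace m E}

/-- The energy density dominates all components, so the whole tensor vanishes where the density
does. -/
theorem EnergySpace.ae_eq_zero_of_tail {c : Plane} {ρ : ℝ} {Φ : E}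
    (h : ∀ η, 0 < η → X.tail c (ρ + η) Φ ≤ 0) :
    ∀ᵐ x : Plane, ρ < ‖x - c‖ → X.stress Φ x = 0 := by
  have hae : ∀ k : ℕ, ∀ᵐ x : Plane, ρ + 1 / ((k : ℝ) + 1) ≤ ‖x - c‖ → X.stress Φ x = 0 := by
    intro k
    have h0 : X.tail c (ρ + 1 / ((k : ℝ) + 1)) Φ = 0 :=
      le_antisymm (h _ (by positivity)) (EnergySpace.tail_nonneg _ _ _)
    have h1 := (setIntegral_eq_zero_iff_of_nonneg_ae (ae_restrict_of_ae
      ((X.physical_ae Φ).mono fun x hx => hx.energy_nonneg))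
      (EnergySpace.integrable_entry Φ 0 0).integrableOn).1 h0
    filter_upwards [(ae_restrict_iff' (measurableSet_tail _ _)).1 h1, X.physical_ae Φ]
      with x hx hx2 hx3
    exact hx2.eq_zero_of_energy_eq_zero (hx hx3)
  filter_upwards [ae_all_iff.2 hae] with x hx hx2
  obtain ⟨k, hk⟩ := exists_nat_one_div_lt (sub_pos.2 hx2)
  exact hx k (by linarith)

/-- The time of existence is bounded from below on compact sets, with the right scaling. -/
theorem LocalWellPosedness.exists_lifespan (L : LocalWellPosedness X) {K : Set E}
    (hK : IsCompact K) : ∃ δ, 0 < δ ∧ ∀ I φ, MaxSol X I φ → ∀ t ∈ I, ∀ l y, X.act l y (φ t) ∈ K →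
      ∀ r, |r - t| * l ≤ δ → r ∈ I := by
  -- At scale one and time 0, continuous dependence gives a lifespan that is locally uniform in the
  -- state; compactness makes it uniform, and rescaling brings in the factor `l`.
  have h0 : ∃ δ, 0 < δ ∧ ∀ Φ ∈ K, Set.Icc (-δ) δ ⊆ L.life 0 Φ := by
    refine hK.induction_on (p := fun s => ∃ δ, 0 < δ ∧ ∀ Φ ∈ s, Set.Icc (-δ) δ ⊆ L.life 0 Φ)
      ⟨1, one_pos, by simp⟩ (fun s t hst ⟨δ, hδ, h⟩ => ⟨δ, hδ, fun Φ hΦ => h Φ (hst hΦ)⟩) ?_ ?_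
    · rintro s t ⟨δ, hδ, h⟩ ⟨δ', hδ', h'⟩
      refine ⟨min δ δ', lt_min hδ hδ', fun Φ hΦ => ?_⟩
      rcases hΦ with hΦ | hΦ
      · exact (Set.Icc_subset_Icc (neg_le_neg (min_le_left _ _)) (min_le_left _ _)).trans (h Φ hΦ)
      · exact (Set.Icc_subset_Icc (neg_le_neg (min_le_right _ _)) (min_le_right _ _)).trans
          (h' Φ hΦ)
    · intro Φ _
      obtain ⟨δ, hδ, hsub⟩ := Metric.nhds_basis_closedBall.mem_iff.1
        ((L.isOpen_life 0 Φ).mem_nhds (L.mem_life 0 Φ))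
      rw [Real.closedBall_eq_Icc, zero_sub, zero_add] at hsub
      have : ∀ᶠ Ψ in 𝓝 Φ, Set.Icc (-δ) δ ⊆ L.life 0 Ψ := eventually_iff_seq_eventually.2
        fun s hs => (L.continuous_dependence 0 s Φ hs _ _ hsub).1
      exact ⟨_, mem_nhdsWithin_of_mem_nhds this, δ, hδ, fun Ψ hΨ => hΨ⟩
  obtain ⟨δ, hδ, h⟩ := h0
  refine ⟨δ, hδ, fun I φ hφ t ht l y hl r hr => ?_⟩
  have hl0 := coe_pos l
  have h1 := hφ.rescale l y t
  have h2 : (0 : ℝ) ∈ (fun s => (l : ℝ)⁻¹ * s + t) ⁻¹' I := by simpa using ht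
  have h3 : X.rescale l y t φ 0 ∈ K := by simpa [EnergySpace.rescale] using hl
  have h4 := h _ h3
  rw [h1.life_eq L h2] at h4
  have h5 : (l : ℝ) * (r - t) ∈ Set.Icc (-δ) δ := by
    rw [Set.mem_Icc, ← abs_le, abs_mul, abs_of_pos hl0, mul_comm]
    exact hr
  have h6 := h4 h5
  simpa [← mul_assoc, inv_mul_cancel₀ hl0.ne'] using h6

/-- Maximal solutions of positive energy `e` in the orbit of a compact set `K`. -/
structure APSol (X : EnergySpace m E) (K : Set E) (e : ℝ) (I : Set ℝ) (φ : ℝ → E) : Prop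
    extends MaxSol X I φ where
  isCompact : IsCompact K
  inOrbit : ∀ t ∈ I, X.InOrbit K (φ t)
  energy_pos : 0 < e
  energy_eq : ∀ t ∈ I, X.energy (φ t) = e

namespace APSol

variable {K : Set E} {e : ℝ} {I : Set ℝ} {φ : ℝ → E}

theorem almostPeriodic (h : APSol X K e I φ) {J : Set ℝ} (hJ : J ⊆ I) : X.AlmostPeriodic J φ :=
  EnergySpace.almostPeriodic_iff.2 ⟨K, h.isCompact, fun t ht => h.inOrbit t (hJ ht)⟩

theorem rescale (h : APSol X K e I φ) (l : Set.Ioi (0 : ℝ)) (y : Plane) (t₁ : ℝ) :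
    APSol X K e ((fun s => (l : ℝ)⁻¹ * s + t₁) ⁻¹' I) (X.rescale l y t₁ φ) where
  toMaxSol := h.toMaxSol.rescale l y t₁
  isCompact := h.isCompact
  inOrbit _ ht := (h.inOrbit _ ht).act l y
  energy_pos := h.energy_pos
  energy_eq _ ht := (EnergySpace.energy_act l y _).trans (h.energy_eq _ ht)

theorem rev (h : APSol X K e I φ) :
    APSol X (X.rev '' K) e (Neg.neg ⁻¹' I) fun s => X.rev (φ (-s)) where
  toMaxSol := h.toMaxSol.rev
  isCompact := h.isCompact.image X.isometry_rev.continuous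
  inOrbit t ht := by
    obtain ⟨l, y, hl⟩ := h.inOrbit _ ht
    exact ⟨l, y, _, hl, X.rev_dil_trans l y _⟩
  energy_pos := h.energy_pos
  energy_eq _ ht := (EnergySpace.energy_rev _).trans (h.energy_eq _ ht)

/-- Limits of almost periodic solutions are almost periodic. -/
theorem limit (L : LocalWellPosedness X) {J : ℕ → Set ℝ} {ψ : ℕ → ℝ → E}
    (h : ∀ n, APSol X K e (J n) (ψ n)) {s₀ : ℝ} (hs : ∀ n, s₀ ∈ J n) {Ψ : E}
    (hΨ : Tendsto (fun n => ψ n s₀) atTop (𝓝 Ψ)) :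
    APSol X K e (L.life s₀ Ψ) (L.dev s₀ Ψ) := by
  have hmax := L.maxSol s₀ Ψ
  have hΨE : X.energy Ψ = e := tendsto_nhds_unique
    ((EnergySpace.continuous_energy.tendsto Ψ).comp hΨ)
    (tendsto_const_nhds.congr fun n => ((h n).energy_eq s₀ (hs n)).symm)
  have hE : ∀ t ∈ L.life s₀ Ψ, X.energy (L.dev s₀ Ψ t) = e := fun t ht => by
    rw [hmax.energy_eq L (L.mem_life s₀ Ψ) ht, L.dev_init, hΨE]
  refine ⟨hmax, (h 0).isCompact, fun t ht => ?_, (h 0).energy_pos, hE⟩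
  obtain ⟨h1, h2⟩ := hmax.tendsto L (fun n => (h n).toMaxSol) (L.mem_life s₀ Ψ) hs
    (by rwa [L.dev_init]) ht
  obtain ⟨N, hN⟩ := eventually_atTop.1 h1
  refine EnergySpace.InOrbit.of_tendsto (h 0).isCompact
    (h2.comp (tendsto_add_atTop_nat N)) ?_ fun n => (h _).inOrbit t (hN _ (Nat.le_add_left _ _))
  rw [hE t ht]
  exact (h 0).energy_pos.ne'

/-- At a finite endpoint of the lifespan, the solution is supported in a light cone. -/
theorem exists_cone (L : LocalWellPosedness X) (h : APSol X K e I φ) {tstar : ℝ}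
    (ht : tstar ∈ frontier I) : ∃ xstar : Plane, ∀ s ∈ I, ∀ᵐ x : Plane,
      |s - tstar| < ‖x - xstar‖ → X.stress (φ s) x = 0 := by
  obtain ⟨t, htI, htlim⟩ := exists_seq_tendsto_frontier ht
  obtain ⟨δ, hδ, hlife⟩ := L.exists_lifespan h.isCompact
  choose l y hly using fun n => h.inOrbit (t n) (htI n)
  have htstar : tstar ∉ I := fun hI => by
    have := h.isOpen.inter_frontier_eq
    exact (this ▸ (⟨hI, ht⟩ : tstar ∈ I ∩ frontier I) : tstar ∈ (∅ : Set ℝ))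
  -- Otherwise the lifespan bound would carry the solution past its endpoint. So the length scales
  -- shrink to zero, and the energy at time `t n` concentrates near `-y n`.
  have hl : ∀ n, (l n : ℝ)⁻¹ ≤ δ⁻¹ * |tstar - t n| := fun n => by
    by_contra! hlt
    refine htstar (hlife I φ h.toMaxSol (t n) (htI n) (l n) (y n) (hly n) tstar ?_)
    rw [inv_mul_lt_iff₀ hδ, ← div_eq_mul_inv, lt_div_iff₀ (coe_pos _)] at hlt
    exact hlt.le
  have habs : Tendsto (fun n => |tstar - t n|) atTop (𝓝 0) := by
    have := (tendsto_const_nhds (x := tstar)).sub htlim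
    simpa using this.abs
  have hl0 : Tendsto (fun n => (l n : ℝ)⁻¹) atTop (𝓝 0) := by
    refine squeeze_zero (fun n => inv_nonneg.2 (coe_pos _).le) hl ?_
    simpa using habs.const_mul δ⁻¹
  have htight : ∀ ε, 0 < ε → ∃ R, 1 ≤ R ∧ ∀ n, X.tail (-y n) ((l n : ℝ)⁻¹ * R) (φ (t n)) ≤ ε := by
    intro ε hε
    obtain ⟨R, hR, hR'⟩ := EnergySpace.exists_tail_le (X := X) h.isCompact hε
    refine ⟨R, hR, fun n => ?_⟩
    have := hR' _ (hly n)
    rwa [EnergySpace.tail_act, smul_zero, zero_sub] at this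
  -- Finite speed carries the concentration from `t n` to a fixed time `s`: all but ε of the energy
  -- lies in a ball about `-y n` of radius |s - tstar| + η.
  have hprop : ∀ ε, 0 < ε → ∀ s ∈ I, ∀ η, 0 < η → ∀ᶠ n in atTop,
      X.tail (-y n) (|s - tstar| + η) (φ s) ≤ ε := by
    intro ε hε s hs η hη
    obtain ⟨R, hR, hR'⟩ := htight ε hε
    have h1 : Tendsto (fun n => (l n : ℝ)⁻¹ * R + |tstar - t n|) atTop (𝓝 0) := by
      simpa using (hl0.mul_const R).add habs
    filter_upwards [h1.eventually_lt_const (half_pos hη)] with n hn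
    refine le_trans ?_ (hR' n)
    refine le_trans ?_ (h.tail_le L hs (htI n) (-y n) ((l n : ℝ)⁻¹ * R) (half_pos hη))
    refine EnergySpace.tail_anti ?_ _
    have := abs_sub_le s tstar (t n)
    linarith
  -- The concentration balls have to meet a fixed ball which holds most of the energy of one fixed
  -- state. The tip of the cone is then a limit point of their centres.
  have hb : ∃ B, ∀ᶠ n in atTop, ‖-y n‖ ≤ B := by
    obtain ⟨s, hs⟩ := h.nonempty
    have hn := (EnergySpace.tendsto_tail (X := X) 0 (φ s)).eventually_le_const
      (show 0 < e / 4 by linarith [h.energy_pos])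
    obtain ⟨R, hR⟩ := hn.exists
    refine ⟨R + (|s - tstar| + 1), ?_⟩
    filter_upwards [hprop (e / 4) (by linarith [h.energy_pos]) s hs 1 one_pos] with n hn
    by_contra! hlt
    have h1 := EnergySpace.energy_le_tail_add_tail (X := X) (c := 0) (c' := -y n) (r := R)
      (r' := |s - tstar| + 1) (by rw [zero_sub, norm_neg]; exact hlt.le) (φ s)
    rw [h.energy_eq s hs] at h1
    linarith [h.energy_pos]
  obtain ⟨B, hB⟩ := hb
  obtain ⟨N, hN⟩ := eventually_atTop.1 hB
  obtain ⟨xstar, -, σ, hσ, hlim⟩ := (isCompact_closedBall (0 : Plane) B).tendsto_subseq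
    (x := fun n => -y (n + N)) fun n => by simpa using hN _ (Nat.le_add_left N n)
  refine ⟨xstar, fun s hs => ?_⟩
  have hzero : ∀ η, 0 < η → X.tail xstar (|s - tstar| + η) (φ s) ≤ 0 := by
    intro η hη
    refine le_of_forall_pos_le_add fun ε hε => ?_
    have h1 := ((tendsto_add_atTop_nat N).comp hσ.tendsto_atTop).eventually
      (hprop ε hε s hs (η / 2) (half_pos hη))
    have h2 : ∀ᶠ n in atTop, ‖-y (σ n + N) - xstar‖ < η / 2 :=
      (tendsto_iff_norm_sub_tendsto_zero.1 hlim).eventually_lt_const (half_pos hη)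
    obtain ⟨n, hn1, hn2⟩ := (h1.and h2).exists
    rw [zero_add]
    refine le_trans (EnergySpace.tail_le_tail ?_ _) hn1
    simp only [Function.comp_apply]
    linarith
  exact EnergySpace.ae_eq_zero_of_tail hzero

end APSol

end AlmostPeriodic

/-! ### Transport of the Lagrangian density along degenerate vector fields -/

@[simp] theorem spacetimeVec_zero (s : ℝ) (v : Plane) : spacetimeVec s v 0 = s := rfl

@[simp] theorem spacetimeVec_one (s : ℝ) (v : Plane) : spacetimeVec s v 1 = v 0 := rfl

@[simp] theorem spacetimeVec_two (s : ℝ) (v : Plane) : spacetimeVec s v 2 = v 1 := rfl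

theorem spacetimeVec_inv_smul {t : ℝ} (ht : t ≠ 0) (x : Plane) :
    spacetimeVec 1 (t⁻¹ • x) = t⁻¹ • spacetimeVec t x := by
  funext β
  refine Fin.cases ?_ (fun i => ?_) β
  · exact (inv_mul_cancel₀ ht).symm
  · simp [spacetimeVec]

theorem basisVec_one : basisVec 1 = ((0 : ℝ), (EuclideanSpace.single 0 1 : Plane)) := rfl

theorem basisVec_two : basisVec 2 = ((0 : ℝ), (EuclideanSpace.single 1 1 : Plane)) := rfl

theorem map_plane (D : Plane →L[ℝ] ℝ) (v : Plane) :
    D v = v 0 * D (EuclideanSpace.single 0 1) + v 1 * D (EuclideanSpace.single 1 1) := by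
  have : v = v 0 • EuclideanSpace.single 0 1 + v 1 • EuclideanSpace.single 1 (1 : ℝ) := by
    ext i
    fin_cases i <;> simp
  conv_lhs => rw [this]
  simp

/-- A field of class `C¹` which vanishes outside of a fixed compact set. -/
theorem c1w_of_eq_zero {J : Set ℝ} (hJ : IsOpen J) {F : ℝ × Plane → ℝ}
    (hF : ContDiffOn ℝ 1 F (J ×ˢ Set.univ)) {R : ℝ}
    (hR : ∀ t ∈ J, ∀ x, R < ‖x‖ → F (t, x) = 0) : C1W (fun _ => 1) J F := by
  have hd : ∀ t ∈ J, ∀ x, R < ‖x‖ → fderiv ℝ F (t, x) = 0 := by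
    intro t ht x hx
    have hU : IsOpen (J ×ˢ {x : Plane | R < ‖x‖}) :=
      hJ.prod (isOpen_lt continuous_const continuous_norm)
    have : F =ᶠ[𝓝 (t, x)] fun _ => 0 := by
      filter_upwards [hU.mem_nhds (⟨ht, hx⟩ : (t, x) ∈ J ×ˢ {x : Plane | R < ‖x‖})] with z hz
      exact hR z.1 hz.1 z.2 hz.2
    rw [this.fderiv_eq]
    simp
  have key : ∀ (V : Type) [NormedAddCommGroup V] (G : ℝ × Plane → V),
      ContinuousOn G (J ×ˢ Set.univ) → (∀ t ∈ J, ∀ x, R < ‖x‖ → G (t, x) = 0) →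
      ∀ K, IsCompact K → K ⊆ J → ∃ C, ∀ t ∈ K, ∀ x, ‖G (t, x)‖ ≤ C * 1 := by
    intro V _ G hG hG0 K hK hKJ
    obtain ⟨C, hC⟩ := (hK.prod (isCompact_closedBall (0 : Plane) R)).exists_bound_of_continuousOn
      (hG.mono (Set.prod_mono hKJ (Set.subset_univ _)))
    refine ⟨max C 0, fun t ht x => ?_⟩
    rw [mul_one]
    rcases lt_or_ge R ‖x‖ with hx | hx
    · rw [hG0 t (hKJ ht) x hx, norm_zero]
      exact le_max_right _ _
    · exact (hC (t, x) ⟨ht, by simpa using hx⟩).trans (le_max_left _ _)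
  exact ⟨hF, fun K => key ℝ F hF.continuousOn hR K,
    fun K => key _ _ (hF.continuousOn_fderiv_of_isOpen (hJ.prod isOpen_univ) le_rfl) hd K⟩

section Transport

variable {E : Type*} [MetricSpace E] {X : EnergySpace m E}

theorem quad_smul (T : Fin 3 → Fin 3 → ℝ) (w : Fin 3 → ℝ) (c : ℝ) :
    quad T (c • w) = c ^ 2 * quad T w := by
  simp only [quad, Finset.mul_sum, Pi.smul_apply, smul_eq_mul]
  exact Finset.sum_congr rfl fun _ _ => Finset.sum_congr rfl fun _ _ => by ring

/-- The integral of the Lagrangian density `⟨∂^γ φ, ∂_γ φ⟩`, with a weight. -/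
def EnergySpace.lagrInt (X : EnergySpace m E) (w : Plane → ℝ) (Φ : E) : ℝ :=
  ∫ x, w x * lagr (X.stress Φ x)

/-- The vector field `ζ (x - t v) w`. -/
def travelField (ζ : Plane → ℝ) (v : Plane) (w : Fin 3 → ℝ) (β : Fin 3) (z : ℝ × Plane) : ℝ :=
  w β * ζ (z.2 - z.1 • v)

theorem c1w_travelField {ζ : Plane → ℝ} (hζ : ContDiff ℝ 1 ζ) {A B : ℝ} (hA : ∀ y, |ζ y| ≤ A)
    (hB : ∀ y, ‖fderiv ℝ ζ y‖ ≤ B) (v : Plane) (w : Fin 3 → ℝ) (β : Fin 3) :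
    C1W (fun _ => 1) Set.univ (travelField ζ v w β) := by
  set u : ℝ × Plane →L[ℝ] Plane := ContinuousLinearMap.snd ℝ ℝ Plane
    - (ContinuousLinearMap.fst ℝ ℝ Plane).smulRight v
  refine C1W.const_mul isOpen_univ (fun _ => zero_le_one) (F := fun z => ζ (u z)) ?_ (w β)
  refine c1w_comp (C := ‖u‖) u.contDiff.contDiffOn hζ isOpen_univ hA hB fun t _ x => ?_
  rw [u.fderiv]

theorem contr_fluxCoef_travelField {ζ : Plane → ℝ} (hζ : ContDiff ℝ 1 ζ) (v : Plane) (w : Fin 3 → ℝ)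
    (s : ℝ) (x : Plane) (T : Fin 3 → Fin 3 → ℝ) :
    contr (fluxCoef (travelField ζ v w) s x) T = -∑ β, w β *
      (fderiv ℝ ζ (x - s • v) (EuclideanSpace.single 0 1) * (v 0 * T 0 β + T 1 β)
        + fderiv ℝ ζ (x - s • v) (EuclideanSpace.single 1 1) * (v 1 * T 0 β + T 2 β)) := by
  have hd : ∀ β, fderiv ℝ (travelField ζ v w β) (s, x)
      = w β • (fderiv ℝ ζ (x - s • v)).comp (ContinuousLinearMap.snd ℝ ℝ Plane
        - (ContinuousLinearMap.fst ℝ ℝ Plane).smulRight v) := by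
    intro β
    have h1 : HasFDerivAt (fun z : ℝ × Plane => z.2 - z.1 • v) (ContinuousLinearMap.snd ℝ ℝ Plane
        - (ContinuousLinearMap.fst ℝ ℝ Plane).smulRight v) (s, x) :=
      (ContinuousLinearMap.snd ℝ ℝ Plane
        - (ContinuousLinearMap.fst ℝ ℝ Plane).smulRight v).hasFDerivAt
    have h2 : HasFDerivAt ζ (fderiv ℝ ζ (x - s • v)) (x - s • v) :=
      (hζ.differentiable one_ne_zero _).hasFDerivAt
    exact ((HasFDerivAt.comp (s, x) h2 h1).const_mul (w β)).fderiv
  rw [contr_fluxCoef, ← Finset.sum_neg_distrib]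
  refine Finset.sum_congr rfl fun β _ => ?_
  have hv := map_plane (fderiv ℝ ζ (x - s • v)) v
  simp only [hd, basisVec_zero, basisVec_one, basisVec_two, _root_.smul_apply,
    ContinuousLinearMap.comp_apply, sub_apply, ContinuousLinearMap.coe_snd',
    ContinuousLinearMap.smulRight_apply, ContinuousLinearMap.coe_fst', zero_smul, one_smul,
    sub_zero, zero_sub, smul_eq_mul, map_neg, hv]
  ring

/-- If `|∂_t φ + v · ∇ φ|² = 0`, the Lagrangian density is transported with velocity `v`. -/
theorem MaxSol.lagrInt_travelling (L : LocalWellPosedness X) {I : Set ℝ} {φ : ℝ → E}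
    (h : MaxSol X I φ) {v : Plane} (hv : X.Travelling I φ v) {ζ : Plane → ℝ} (hζ : ContDiff ℝ 1 ζ)
    {A B : ℝ} (hA : ∀ y, |ζ y| ≤ A) (hB : ∀ y, ‖fderiv ℝ ζ y‖ ≤ B) {a b : ℝ} (ha : a ∈ I)
    (hb : b ∈ I) :
    X.lagrInt (fun x => ζ (x - b • v)) (φ b) = X.lagrInt (fun x => ζ (x - a • v)) (φ a) := by
  -- With w = (1, v) null, T_{0β}w^β = L/2, so the multiplier ζ(x - t v) w has density ζL/2. Its
  -- flux is proportional to L times the derivative of ζ(x - t v) along w, which is zero.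
  have hlaw := h.law L isOpen_univ Set.ordConnected_univ
    (c1w_travelField hζ hA hB v (spacetimeVec 1 v)) ha hb (Set.subset_univ _)
  have hmom : ∀ t ∈ I, X.pair (momCoef (travelField ζ v (spacetimeVec 1 v)) t) (φ t)
      = 2⁻¹ * X.lagrInt (fun x => ζ (x - t • v)) (φ t) := by
    intro t ht
    unfold EnergySpace.pair EnergySpace.lagrInt
    rw [← integral_const_mul]
    refine integral_congr_ae ?_
    filter_upwards [X.physical_ae (φ t), hv t ht] with x hx hq
    obtain ⟨h0, -, -⟩ := hx.contract_eq hq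
    simp only [spacetimeVec_zero, spacetimeVec_one, spacetimeVec_two] at h0
    simp only [contr_momCoef, travelField, Fin.sum_univ_three, spacetimeVec_zero, spacetimeVec_one,
      spacetimeVec_two]
    linear_combination ζ (x - t • v) * h0
  have hflux : ∫ s in a..b, X.pair (fluxCoef (travelField ζ v (spacetimeVec 1 v)) s) (φ s) = 0 := by
    rw [intervalIntegral.integral_congr (g := fun _ => 0), intervalIntegral.integral_zero]
    intro s hs
    refine integral_eq_zero_of_ae ?_
    have hsI := h.ordConnected.uIcc_subset ha hb hs
    filter_upwards [X.physical_ae (φ s), hv s hsI] with x hx hq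
    obtain ⟨h0, h1, h2⟩ := hx.contract_eq hq
    simp only [spacetimeVec_zero, spacetimeVec_one, spacetimeVec_two] at h0 h1 h2
    simp only [contr_fluxCoef_travelField hζ, Fin.sum_univ_three, spacetimeVec_zero,
      spacetimeVec_one, spacetimeVec_two, Pi.zero_apply]
    set d0 := fderiv ℝ ζ (x - s • v) (EuclideanSpace.single 0 1)
    set d1 := fderiv ℝ ζ (x - s • v) (EuclideanSpace.single 1 1)
    linear_combination (-(d0 * v 0) - d1 * v 1) * h0 - d0 * h1 - d1 * h2
  rw [hmom a ha, hmom b hb, hflux] at hlaw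
  linarith

/-- The vector field `ζ (x / t) (1, x / t)`. -/
def homField (ζ : Plane → ℝ) (β : Fin 3) (z : ℝ × Plane) : ℝ :=
  ζ (z.1⁻¹ • z.2) * spacetimeVec 1 (z.1⁻¹ • z.2) β

theorem hasFDerivAt_inv_smul {t : ℝ} (ht : t ≠ 0) (x : Plane) :
    HasFDerivAt (fun z : ℝ × Plane => z.1⁻¹ • z.2) (t⁻¹ • (ContinuousLinearMap.snd ℝ ℝ Plane
      - (ContinuousLinearMap.fst ℝ ℝ Plane).smulRight (t⁻¹ • x))) (t, x) := by
  have h0 : HasFDerivAt (fun z : ℝ × Plane => z.1) (ContinuousLinearMap.fst ℝ ℝ Plane) (t, x) :=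
    hasFDerivAt_fst
  have h1 := (hasDerivAt_inv (show ((t, x) : ℝ × Plane).1 ≠ 0 from ht)).comp_hasFDerivAt (t, x) h0
  have h2 : HasFDerivAt (fun z : ℝ × Plane => z.2) (ContinuousLinearMap.snd ℝ ℝ Plane) (t, x) :=
    hasFDerivAt_snd
  refine (h1.fun_smul h2).congr_fderiv ?_
  refine ContinuousLinearMap.ext fun w => ?_
  simp only [Function.comp_apply, add_apply, _root_.smul_apply, ContinuousLinearMap.smulRight_apply, sub_apply,
    ContinuousLinearMap.coe_snd', ContinuousLinearMap.coe_fst', smul_eq_mul, smul_sub, smul_smul]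
  rw [sub_eq_add_neg, ← neg_smul]
  congr 2
  field_simp

/-- The components of the linear part of `y ↦ (1, y)`. -/
def coordL (β : Fin 3) : Plane →L[ℝ] ℝ :=
  Fin.cons (α := fun _ => Plane →L[ℝ] ℝ) 0 (fun i : Fin 2 => EuclideanSpace.proj i) β

theorem hasFDerivAt_spacetimeVec (y : Plane) (β : Fin 3) :
    HasFDerivAt (fun y => spacetimeVec 1 y β) (coordL β) y := by
  refine Fin.cases ?_ (fun i => ?_) β
  · exact hasFDerivAt_const _ _
  · exact (EuclideanSpace.proj (𝕜 := ℝ) i : Plane →L[ℝ] ℝ).hasFDerivAt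

theorem hasFDerivAt_homField {ζ : Plane → ℝ} (hζ : ContDiff ℝ 1 ζ) {t : ℝ} (ht : t ≠ 0) (x : Plane)
    (β : Fin 3) : HasFDerivAt (homField ζ β)
      ((ζ (t⁻¹ • x) • coordL β + spacetimeVec 1 (t⁻¹ • x) β • fderiv ℝ ζ (t⁻¹ • x)).comp
        (t⁻¹ • (ContinuousLinearMap.snd ℝ ℝ Plane
          - (ContinuousLinearMap.fst ℝ ℝ Plane).smulRight (t⁻¹ • x)))) (t, x) := by
  have h1 : HasFDerivAt ζ (fderiv ℝ ζ (t⁻¹ • x)) (t⁻¹ • x) :=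
    (hζ.differentiable one_ne_zero _).hasFDerivAt
  exact HasFDerivAt.comp (t, x) (h1.fun_mul (hasFDerivAt_spacetimeVec (t⁻¹ • x) β))
    (hasFDerivAt_inv_smul ht x)

theorem contDiff_spacetimeVec (β : Fin 3) : ContDiff ℝ 1 fun y : Plane => spacetimeVec 1 y β := by
  refine Fin.cases ?_ (fun i => ?_) β
  · exact contDiff_const
  · exact (EuclideanSpace.proj (𝕜 := ℝ) i : Plane →L[ℝ] ℝ).contDiff

theorem c1w_homField {ζ : Plane → ℝ} (hζ : ContDiff ℝ 1 ζ) (hζ' : HasCompactSupport ζ) {c d : ℝ}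
    (hd : d < 0) (β : Fin 3) : C1W (fun _ => 1) (Set.Ioo c d) (homField ζ β) := by
  obtain ⟨R, hR⟩ := hζ'.isCompact.isBounded.exists_norm_le
  refine c1w_of_eq_zero isOpen_Ioo (R := max R 0 * |c|) ?_ fun t ht x hx => ?_
  · have h1 : ContDiffOn ℝ 1 (fun z : ℝ × Plane => z.1⁻¹ • z.2) (Set.Ioo c d ×ˢ Set.univ) := by
      refine ContDiffOn.smul (ContDiffOn.inv contDiffOn_fst fun z hz => ?_) contDiffOn_snd
      exact (hz.1.2.trans hd).ne
    exact (hζ.mul (contDiff_spacetimeVec β)).comp_contDiffOn h1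
  · have ht0 : t < 0 := ht.2.trans hd
    have h2 : R < ‖t⁻¹ • x‖ := by
      rw [norm_smul, norm_inv, Real.norm_eq_abs, ← div_eq_inv_mul, lt_div_iff₀ (abs_pos.2 ht0.ne)]
      refine lt_of_le_of_lt ?_ hx
      refine mul_le_mul (le_max_left _ _) ?_ (abs_nonneg _) (le_max_right _ _)
      rw [abs_of_neg ht0, abs_of_neg (ht.1.trans ht0)]
      linarith [ht.1]
    have h3 : ζ (t⁻¹ • x) = 0 := by
      by_contra h
      exact absurd (hR _ (subset_tsupport _ h)) (not_le.2 h2)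
    simp [homField, h3]

/-- If `|t ∂_t φ + x · ∇ φ|² = 0`, the Lagrangian density is homogeneous. -/
theorem MaxSol.lagrInt_homogeneous (L : LocalWellPosedness X) {I : Set ℝ} {φ : ℝ → E}
    (h : MaxSol X I φ) (hI : ∀ t ∈ I, t < 0 → ∀ᵐ x, quad (X.stress (φ t) x) (spacetimeVec t x) = 0)
    {ζ : Plane → ℝ} (hζ : ContDiff ℝ 1 ζ) (hζ' : HasCompactSupport ζ) {a b : ℝ} (ha : a ∈ I)
    (hb : b ∈ I) (ha0 : a < 0) (hb0 : b < 0) :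
    X.lagrInt (fun x => ζ (b⁻¹ • x)) (φ b) = X.lagrInt (fun x => ζ (a⁻¹ • x)) (φ a) := by
  -- The multiplier is singular at t = 0, and its support in `x` is bounded only for bounded `t`, so
  -- an open interval strictly below zero is needed.
  have hc : ∃ c d, d < 0 ∧ Set.uIcc a b ⊆ Set.Ioo c d := by
    refine ⟨min a b - 1, max a b / 2, ?_, fun s hs => ⟨?_, ?_⟩⟩
    · linarith [max_lt ha0 hb0]
    · have : min a b ≤ s := hs.1
      linarith
    · have : s ≤ max a b := hs.2
      linarith [max_lt ha0 hb0]
  obtain ⟨c, d, hd, hcd⟩ := hc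
  have hlaw := h.law L isOpen_Ioo Set.ordConnected_Ioo (c1w_homField hζ hζ' (c := c) hd) ha hb hcd
  have hq : ∀ t ∈ I, t < 0 → ∀ᵐ x, quad (X.stress (φ t) x) (spacetimeVec 1 (t⁻¹ • x)) = 0 := by
    intro t ht ht0
    filter_upwards [hI t ht ht0] with x hx
    rw [spacetimeVec_inv_smul ht0.ne, quad_smul, hx, mul_zero]
  have hmom : ∀ t ∈ I, t < 0 → X.pair (momCoef (homField ζ) t) (φ t)
      = 2⁻¹ * X.lagrInt (fun x => ζ (t⁻¹ • x)) (φ t) := by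
    intro t ht ht0
    unfold EnergySpace.pair EnergySpace.lagrInt
    rw [← integral_const_mul]
    refine integral_congr_ae ?_
    filter_upwards [X.physical_ae (φ t), hq t ht ht0] with x hx hq
    obtain ⟨h0, -, -⟩ := hx.contract_eq hq
    simp only [spacetimeVec_zero, spacetimeVec_one, spacetimeVec_two] at h0
    simp only [contr_momCoef, homField, Fin.sum_univ_three, spacetimeVec_zero, spacetimeVec_one,
      spacetimeVec_two]
    linear_combination ζ (t⁻¹ • x) * h0
  -- Write w = (1, x/t). The derivative of ζ(x/t) along w vanishes, and ∂_αw^β = (δ_α^β - δ_α^0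
  -- w^β)/t contributes the trace of T minus T^0_β w^β. Both equal -L/2, so they cancel.
  have hflux : ∫ s in a..b, X.pair (fluxCoef (homField ζ) s) (φ s) = 0 := by
    rw [intervalIntegral.integral_congr (g := fun _ => 0), intervalIntegral.integral_zero]
    intro s hs
    refine integral_eq_zero_of_ae ?_
    have hs0 : s < 0 := (hcd hs).2.trans hd
    filter_upwards [X.physical_ae (φ s), hq s (h.ordConnected.uIcc_subset ha hb hs) hs0]
      with x hx hq
    obtain ⟨h0, h1, h2⟩ := hx.contract_eq hq
    simp only [spacetimeVec_zero, spacetimeVec_one, spacetimeVec_two] at h0 h1 h2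
    obtain ⟨y, hy⟩ : ∃ y, y = s⁻¹ • x := ⟨_, rfl⟩
    have hv := map_plane (fderiv ℝ ζ y) y
    have c0 : ∀ w, coordL 0 w = 0 := fun _ => rfl
    have c1 : ∀ w, coordL 1 w = w 0 := fun _ => rfl
    have c2 : ∀ w, coordL 2 w = w 1 := fun _ => rfl
    have e00 : (EuclideanSpace.single 0 1 : Plane) 0 = 1 := by simp
    have e01 : (EuclideanSpace.single 0 1 : Plane) 1 = 0 := by simp
    have e10 : (EuclideanSpace.single 1 1 : Plane) 0 = 0 := by simp
    have e11 : (EuclideanSpace.single 1 1 : Plane) 1 = 1 := by simp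
    simp only [contr_fluxCoef, (hasFDerivAt_homField hζ hs0.ne x _).fderiv, Fin.sum_univ_three,
      basisVec_zero, basisVec_one, basisVec_two, ← hy] at h0 h1 h2 ⊢
    simp only [_root_.smul_apply, add_apply, ContinuousLinearMap.comp_apply, sub_apply,
      ContinuousLinearMap.coe_snd', map_smul, ContinuousLinearMap.smulRight_apply,
      ContinuousLinearMap.coe_fst', zero_smul, one_smul, sub_zero, zero_sub, smul_eq_mul, map_neg,
      spacetimeVec_zero, spacetimeVec_one, spacetimeVec_two, c0, c1, c2, Pi.zero_apply, e00, e01,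
      e10, e11, hv]
    set d0 := fderiv ℝ ζ y (EuclideanSpace.single 0 1)
    set d1 := fderiv ℝ ζ y (EuclideanSpace.single 1 1)
    unfold lagr at *
    linear_combination s⁻¹ * ((-(d0 * y 0) - d1 * y 1 - ζ y) * h0 - d0 * h1 - d1 * h2)
  rw [hmom a ha ha0, hmom b hb hb0, hflux] at hlaw
  linarith

/-- A density which is transported along curves focussing at the tip of the light cone containing
its support vanishes. -/
theorem lagr_eq_zero_of_transport {I : Set ℝ} {φ : ℝ → E} {tstar : ℝ} {xstar : Plane}
    (hcone : ∀ s ∈ I, ∀ᵐ x : Plane, |s - tstar| < ‖x - xstar‖ → X.stress (φ s) x = 0)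
    (htstar : tstar ∈ closure I) {a : ℝ} {P : ℝ × Plane → Plane} (hP : ContinuousAt P (tstar, xstar))
    {V : Set ℝ} (hV : V ∈ 𝓝 tstar)
    (htrans : ∀ ζ : Plane → ℝ, ContDiff ℝ ∞ ζ → HasCompactSupport ζ → ∀ t ∈ I ∩ V,
      X.lagrInt (fun x => ζ (P (t, x))) (φ t) = X.lagrInt ζ (φ a)) :
    ∀ᵐ x, lagr (X.stress (φ a) x) = 0 := by
  have hint : Integrable fun x => lagr (X.stress (φ a) x) := by
    unfold lagr
    exact (((EnergySpace.integrable_entry _ 0 0).sub (EnergySpace.integrable_entry _ 1 1)).sub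
      (EnergySpace.integrable_entry _ 2 2)).const_mul 2
  -- One point is negligible, so it suffices to test with `ζ` supported away from the image of the
  -- tip. Near `tstar` the cone is so narrow that `ζ` composed with `P` vanishes on it.
  have hU : IsOpen ({P (tstar, xstar)}ᶜ : Set Plane) := isOpen_compl_singleton
  have h1 := hU.ae_eq_zero_of_integral_contDiff_smul_eq_zero
    (hint.locallyIntegrable.locallyIntegrableOn _) fun ζ hζ hζ' hsupp => ?_
  · filter_upwards [h1, compl_mem_ae_iff.2 (measure_singleton (μ := volume) (P (tstar, xstar)))]
      with x hx hx' using hx hx'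
  · have h2 : (tsupport ζ)ᶜ ∈ 𝓝 (P (tstar, xstar)) :=
      (isClosed_tsupport ζ).isOpen_compl.mem_nhds fun hmem => hsupp hmem rfl
    obtain ⟨ε, hε, hball⟩ := Metric.mem_nhds_iff.1 (hP h2)
    obtain ⟨t, ht, htI⟩ := mem_closure_iff_nhds.1 htstar (V ∩ Metric.ball tstar ε)
      (Filter.inter_mem hV (Metric.ball_mem_nhds _ hε))
    have h3 := htrans ζ hζ hζ' t ⟨htI, ht.1⟩
    simp only [smul_eq_mul]
    unfold EnergySpace.lagrInt at h3
    rw [← h3]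
    refine integral_eq_zero_of_ae ?_
    filter_upwards [hcone t htI] with x hx
    have h4 : |t - tstar| < ε := by simpa [Real.dist_eq] using ht.2
    rcases lt_or_ge |t - tstar| ‖x - xstar‖ with h5 | h5
    · rw [hx h5]
      simp [lagr]
    · have h6 : (t, x) ∈ Metric.ball (tstar, xstar) ε := by
        rw [Metric.mem_ball, Prod.dist_eq, Real.dist_eq, dist_eq_norm]
        exact max_lt h4 (h5.trans_lt h4)
      have h7 : ζ (P (t, x)) = 0 := image_eq_zero_of_notMem_tsupport (hball h6)
      simp [h7]

end Transport

/-! ### Exclusion of travelling and of self-similar solutions -/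

section Exclusion

variable {E : Type*} [MetricSpace E] {X : EnergySpace m E}

/-- With L = 0 the null relation says T₀₀ = -(v₀T₀₁ + v₁T₀₂), and the momentum bound leaves T₀₀ ≤
|v| T₀₀. -/
theorem Physical.eq_zero_of_travelling {T : Fin 3 → Fin 3 → ℝ} (h : Physical T) {v : Plane}
    (hv : ‖v‖ < 1) (hq : quad T (spacetimeVec 1 v) = 0) (hl : lagr T = 0) : T = 0 := by
  refine h.eq_zero_of_energy_eq_zero ?_
  obtain ⟨h0, -, -⟩ := h.contract_eq hq
  simp only [spacetimeVec_zero, spacetimeVec_one, spacetimeVec_two, hl] at h0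
  have h1 := _root_.abs_le.1 (h.abs_momentum_le (v 0) (v 1))
  have h2 : √(v 0 ^ 2 + v 1 ^ 2) = ‖v‖ := by
    rw [← norm_sq_plane, Real.sqrt_sq (norm_nonneg v)]
  rw [h2] at h1
  have h3 := h.energy_nonneg
  nlinarith

/-- The vector `v` rotated by a right angle. -/
def perp (v : Plane) : Plane := !₂[-v 1, v 0]

@[simp] theorem perp_zero (v : Plane) : perp v 0 = -v 1 := rfl

@[simp] theorem perp_one (v : Plane) : perp v 1 = v 0 := rfl

theorem exists_eq_smul_perp {v w : Plane} (hv : ‖v‖ = 1) (hw : inner ℝ w v = 0) :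
    ∃ k : ℝ, w = k • perp v := by
  have h1 := norm_sq_plane v
  rw [hv] at h1
  have h2 : v 0 * w 0 + v 1 * w 1 = 0 := by
    simpa [PiLp.inner_apply, Fin.sum_univ_two] using hw
  refine ⟨-(w 0 * v 1) + w 1 * v 0, ?_⟩
  ext i
  fin_cases i
  · simp
    linear_combination w 0 * h1 + v 0 * h2
  · simp
    linear_combination w 1 * h1 + v 1 * h2

/-- If (1, v) is lightlike and null for the Gram matrix, its time entry cancels the entry along v in
L, and the square of the derivative perpendicular to v remains. Hence L ≥ 0, and L = 0 is the second
condition for shift invariance. -/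
theorem Physical.quad_perp {T : Fin 3 → Fin 3 → ℝ} (h : Physical T) {v : Plane}
    (hv : ‖v‖ = 1) (hq : quad T (spacetimeVec 1 v) = 0) (k : ℝ) :
    quad T (spacetimeVec 0 (k • perp v)) = k ^ 2 * lagr T := by
  obtain ⟨h0, h1, h2⟩ := h.contract_eq hq
  have h3 := norm_sq_plane v
  rw [hv] at h3
  simp only [spacetimeVec_zero, spacetimeVec_one, spacetimeVec_two, h.1 1 0, h.1 2 0, h.1 2 1]
    at h0 h1 h2
  rw [quad_explicit T h.1]
  simp only [spacetimeVec_zero, spacetimeVec_one, spacetimeVec_two, PiLp.smul_apply, smul_eq_mul,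
    perp_zero, perp_one]
  linear_combination k ^ 2 * (h0 - v 0 * h1 - v 1 * h2 + (-(lagr T / 2) - T 0 0) * h3)

theorem norm_fderiv_comp_inner_le {r r' : ℝ → ℝ} (hr : ∀ s, HasDerivAt r (r' s) s) {B : ℝ}
    (hB : ∀ s, |r' s| ≤ B) (w y : Plane) : ‖fderiv ℝ (fun y => r (inner ℝ w y)) y‖ ≤ B * ‖w‖ := by
  have h1 : HasFDerivAt (fun y => inner ℝ w y) (innerSL ℝ w) y := (innerSL ℝ w).hasFDerivAt
  have h2 : HasFDerivAt (fun y => r (inner ℝ w y)) (r' (inner ℝ w y) • innerSL ℝ w) y :=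
    (hr _).comp_hasFDerivAt y h1
  rw [h2.fderiv, norm_smul, innerSL_apply_norm]
  exact mul_le_mul_of_nonneg_right (hB _) (norm_nonneg w)

theorem energy_eq_zero_of_ae {Φ : E} (h : ∀ᵐ x, X.stress Φ x = 0) : X.energy Φ = 0 := by
  refine integral_eq_zero_of_ae ?_
  filter_upwards [h] with x hx
  rw [hx]
  rfl

theorem EnergySpace.integrable_lagr (Φ : E) : Integrable fun x => lagr (X.stress Φ x) := by
  unfold lagr
  exact (((EnergySpace.integrable_entry _ 0 0).sub (EnergySpace.integrable_entry _ 1 1)).sub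
    (EnergySpace.integrable_entry _ 2 2)).const_mul 2

/-- Travelling data with vanishing Lagrangian density have zero energy. -/
theorem EnergySpace.energy_eq_zero_of_travelling (hshift : X.NoShiftInvariantClaim) {Φ : E}
    {v : Plane} (hv : ‖v‖ ≤ 1) (hq : ∀ᵐ x, quad (X.stress Φ x) (spacetimeVec 1 v) = 0)
    (hl : ∀ᵐ x, lagr (X.stress Φ x) = 0) : X.energy Φ = 0 := by
  rcases hv.lt_or_eq with hv | hv
  · refine energy_eq_zero_of_ae ?_
    filter_upwards [hq, hl, X.physical_ae Φ] with x h1 h2 h3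
    exact h3.eq_zero_of_travelling hv h1 h2
  · refine hshift v Φ hv hq fun w hw => ?_
    obtain ⟨k, rfl⟩ := exists_eq_smul_perp hv hw
    filter_upwards [hq, hl, X.physical_ae Φ] with x h1 h2 h3
    rw [h3.quad_perp hv h1, h2, mul_zero]

/-- Let w be orthogonal to v. The multiplier arctan(w·(x - t v)) w has momentum bounded by the
energy, while the rate of change of this momentum is -1/2 times the integral of L against (1 + (w·(x
- t v))²)⁻¹. That integral is constant in time by transport, so it must vanish; as L ≥ 0 and the
weight is positive, L = 0. -/
theorem MaxSol.lagr_eq_zero_of_travelling (L : LocalWellPosedness X) {φ : ℝ → E}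
    (h : MaxSol X Set.univ φ) {v : Plane} (hv : ‖v‖ = 1) (hT : X.Travelling Set.univ φ v) :
    ∀ᵐ x, lagr (X.stress (φ 0) x) = 0 := by
  set w := perp v with hw
  have hv2 := norm_sq_plane v
  rw [hv] at hv2
  have hw1 : ‖w‖ = 1 := by
    have := norm_sq_plane w
    rw [hw, perp_zero, perp_one] at this
    have h2 : ‖w‖ ^ 2 = 1 := by linarith
    exact (pow_eq_one_iff_of_nonneg (norm_nonneg w) two_ne_zero).1 h2
  set r : ℝ → ℝ := fun s => (1 + s ^ 2)⁻¹
  have hr : ∀ s, HasDerivAt r (-(2 * s) / (1 + s ^ 2) ^ 2) s := fun s => by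
    have h1 : HasDerivAt (fun s : ℝ => 1 + s ^ 2) (2 * s) s := by
      simpa using (hasDerivAt_pow 2 s).const_add 1
    exact h1.inv (by positivity)
  have hr' : ∀ s : ℝ, |-(2 * s) / (1 + s ^ 2) ^ 2| ≤ 1 := fun s => by
    rw [abs_div, abs_of_pos (show 0 < (1 + s ^ 2) ^ 2 by positivity), div_le_one (by positivity),
      abs_le]
    constructor <;> nlinarith [sq_nonneg (s - 1), sq_nonneg (s + 1), sq_nonneg s, sq_nonneg (s ^ 2)]
  have hr1 : ∀ s, 0 < r s ∧ r s ≤ 1 := fun s =>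
    ⟨by positivity, inv_le_one_of_one_le₀ (by nlinarith [sq_nonneg s])⟩
  have hinner : ContDiff ℝ 1 fun y : Plane => inner ℝ w y := (innerSL ℝ w).contDiff
  have hρ : ContDiff ℝ 1 fun y : Plane => r (inner ℝ w y) := by
    refine ContDiff.inv (by fun_prop) fun y => by positivity
  have hA : ∀ t, X.lagrInt (fun x => r (inner ℝ w (x - t • v))) (φ t)
      = X.lagrInt (fun x => r (inner ℝ w (x - (0 : ℝ) • v))) (φ 0) := fun t =>
    h.lagrInt_travelling L hT hρ (A := 1) (B := 1 * ‖w‖)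
      (fun y => by rw [abs_of_pos (hr1 _).1]; exact (hr1 _).2)
      (norm_fderiv_comp_inner_le hr hr' w) (Set.mem_univ _) (Set.mem_univ _)
  set A := X.lagrInt (fun x => r (inner ℝ w (x - (0 : ℝ) • v))) (φ 0) with hAdef
  set ζ : Plane → ℝ := fun y => Real.arctan (inner ℝ w y)
  have hζ : ContDiff ℝ 1 ζ := Real.contDiff_arctan.comp hinner
  have hζd : ∀ y u, fderiv ℝ ζ y u = r (inner ℝ w y) * inner ℝ w u := fun y u => by
    have h1 : HasFDerivAt (fun y => inner ℝ w y) (innerSL ℝ w) y := (innerSL ℝ w).hasFDerivAt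
    have h2 : HasFDerivAt ζ ((1 / (1 + inner ℝ w y ^ 2)) • innerSL ℝ w) y :=
      (Real.hasDerivAt_arctan _).comp_hasFDerivAt y h1
    rw [h2.fderiv]
    simp [r]
  have hζ1 : ∀ y, |ζ y| ≤ 2 := fun y => by
    have h1 := Real.neg_pi_div_two_lt_arctan (inner ℝ w y)
    have h2 := Real.arctan_lt_pi_div_two (inner ℝ w y)
    have h3 := Real.pi_lt_four
    exact abs_le.2 ⟨by simp only [ζ]; linarith, by simp only [ζ]; linarith⟩
  have hζ2 : ∀ y, ‖fderiv ℝ ζ y‖ ≤ 1 * ‖w‖ := by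
    refine norm_fderiv_comp_inner_le (r' := fun s => 1 / (1 + s ^ 2)) Real.hasDerivAt_arctan
      (fun s => ?_) w
    rw [one_div, abs_of_pos (hr1 s).1]
    exact (hr1 s).2
  have hY : ∀ β, C1W (fun _ => 1) Set.univ (travelField ζ v (spacetimeVec 0 w) β) :=
    c1w_travelField hζ hζ1 hζ2 v _
  have hflux : ∀ s, X.pair (fluxCoef (travelField ζ v (spacetimeVec 0 w)) s) (φ s)
      = -(A / 2) := by
    intro s
    rw [← hA s]
    unfold EnergySpace.pair EnergySpace.lagrInt
    rw [← integral_div, ← integral_neg]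
    refine integral_congr_ae ?_
    filter_upwards [X.physical_ae (φ s), hT s (Set.mem_univ s)] with x hx hq
    obtain ⟨h0, h1, h2⟩ := hx.contract_eq hq
    simp only [spacetimeVec_zero, spacetimeVec_one, spacetimeVec_two, hx.1 1 0, hx.1 2 0, hx.1 2 1]
      at h0 h1 h2
    rw [contr_fluxCoef_travelField hζ]
    simp only [hζd, EuclideanSpace.inner_single_right, Fin.sum_univ_three, spacetimeVec_zero,
      spacetimeVec_one, spacetimeVec_two, hw, perp_zero, perp_one, conj_trivial, hx.1 2 1]
    set ρ := r (inner ℝ (perp v) (x - s • v))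
    unfold lagr at *
    linear_combination -ρ * (h0 - v 0 * h1 - v 1 * h2) + ρ * X.stress (φ s) x 0 0 * hv2
  have hbound : ∀ t, |X.pair (momCoef (travelField ζ v (spacetimeVec 0 w)) t) (φ t)|
      ≤ 9 * 2 * X.energy (φ 0) := by
    intro t
    rw [← h.energy_eq L (Set.mem_univ 0) (Set.mem_univ t)]
    refine EnergySpace.abs_pair_le (fun x => ?_) _
    refine (pi_norm_le_iff_of_nonneg zero_le_two).2 fun α =>
      (pi_norm_le_iff_of_nonneg zero_le_two).2 fun β => ?_
    unfold momCoef travelField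
    split_ifs
    · have h1 : |spacetimeVec 0 w β| ≤ 1 := by
        refine Fin.cases ?_ (fun i => ?_) β
        · simp
        · exact (PiLp.norm_apply_le w i).trans hw1.le
      rw [norm_mul, Real.norm_eq_abs, Real.norm_eq_abs]
      calc _ ≤ 1 * 2 := mul_le_mul h1 (hζ1 _) (abs_nonneg _) zero_le_one
        _ = 2 := one_mul 2
    · simp
  have hA0 : A = 0 := by
    by_contra hne
    -- At this time the linear term is -2(18E + 1), whereas two momenta bounded by 18E differ by at
    -- most 36E.
    have hlaw := h.law L isOpen_univ Set.ordConnected_univ hY (Set.mem_univ (0 : ℝ))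
      (Set.mem_univ ((9 * 2 * X.energy (φ 0) + 1) * 4 / A)) (Set.subset_univ _)
    simp only [hflux, intervalIntegral.integral_const, sub_zero, smul_eq_mul] at hlaw
    have h1 := abs_le.1 (hbound 0)
    have h2 := abs_le.1 (hbound ((9 * 2 * X.energy (φ 0) + 1) * 4 / A))
    have h3 : (9 * 2 * X.energy (φ 0) + 1) * 4 / A * -(A / 2)
        = -(2 * (9 * 2 * X.energy (φ 0) + 1)) := by
      field_simp
      ring
    linarith
  have hnn : ∀ᵐ x, 0 ≤ lagr (X.stress (φ 0) x) := by
    filter_upwards [X.physical_ae (φ 0), hT 0 (Set.mem_univ 0)] with x hx hq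
    have := hx.quad_perp hv hq 1
    rw [one_pow, one_mul] at this
    rw [← this]
    exact hx.2 _
  have hz := (integral_eq_zero_iff_of_nonneg_ae (μ := volume)
    (f := fun x => r (inner ℝ w (x - (0 : ℝ) • v)) * lagr (X.stress (φ 0) x)) (by
      filter_upwards [hnn] with x hx using mul_nonneg (hr1 _).1.le hx)
    ((EnergySpace.integrable_lagr (φ 0)).bdd_mul (c := 1)
      (hρ.continuous.comp (by fun_prop)).aestronglyMeasurable (.of_forall fun x => by
        rw [Real.norm_of_nonneg (hr1 _).1.le]
        exact (hr1 _).2))).1 hA0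
  filter_upwards [hz] with x hx
  exact (mul_eq_zero.1 hx).resolve_left (hr1 _).1.ne'

/-- Bounds for test functions. -/
theorem exists_bound_of_compactSupport {ζ : Plane → ℝ} (hζ : ContDiff ℝ ∞ ζ)
    (hζ' : HasCompactSupport ζ) : (∃ A, ∀ y, |ζ y| ≤ A) ∧ ∃ B, ∀ y, ‖fderiv ℝ ζ y‖ ≤ B :=
  ⟨hζ'.exists_bound_of_continuous hζ.continuous,
    (hζ'.fderiv ℝ).exists_bound_of_continuous (hζ.continuous_fderiv (by simp))⟩

/-- There are no travelling almost periodic solutions of positive energy. -/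
theorem APSol.not_travelling (L : LocalWellPosedness X)
    (hsol : L.NoTravellingOrSelfSimilarClaim) (hshift : X.NoShiftInvariantClaim) {K : Set E} {e : ℝ}
    {I : Set ℝ} {φ : ℝ → E} (h : APSol X K e I φ) {v : Plane} (hv : ‖v‖ ≤ 1) :
    ¬ X.Travelling I φ v := by
  intro hT
  obtain ⟨a, ha⟩ := h.nonempty
  have hq := hT a ha
  have hfin : (∀ᵐ x, lagr (X.stress (φ a) x) = 0) → False := fun hl => h.energy_pos.ne' <| by
    rw [← h.energy_eq a ha]
    exact EnergySpace.energy_eq_zero_of_travelling hshift hv hq hl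
  by_cases hI : I = Set.univ
  · subst hI
    rcases hv.lt_or_eq with hv' | hv'
    · have := hsol.1 φ v (h.isEnergySolution L Set.ordConnected_univ le_rfl)
        (h.almostPeriodic le_rfl) hv' hT 0
      rw [h.energy_eq 0 (Set.mem_univ 0)] at this
      exact h.energy_pos.ne' this
    · have hl := h.lagr_eq_zero_of_travelling L hv' hT
      have := EnergySpace.energy_eq_zero_of_travelling hshift hv (hT 0 (Set.mem_univ 0)) hl
      rw [h.energy_eq 0 (Set.mem_univ 0)] at this
      exact h.energy_pos.ne' this
  -- In the cone at a finite endpoint, following lines of velocity `v` towards the tip squeezes L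
  -- onto one point, so L = 0 at time `a`.
  · obtain ⟨b, hb⟩ := (Set.ne_univ_iff_exists_notMem I).1 hI
    obtain ⟨tstar, -, htstar⟩ := exists_mem_frontier h.isOpen ha hb
    obtain ⟨xstar, hcone⟩ := h.exists_cone L htstar
    refine hfin (lagr_eq_zero_of_transport hcone htstar.1 (P := fun z => z.2 - (z.1 - a) • v)
      (by fun_prop) univ_mem fun ζ hζ hζ' t ht => ?_)
    obtain ⟨⟨A, hA⟩, B, hB⟩ := exists_bound_of_compactSupport hζ hζ'
    have := h.lagrInt_travelling L hT (ζ := fun y => ζ (y + a • v))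
      ((hζ.of_le (by simp)).comp (by fun_prop)) (A := A) (B := B) (fun y => hA _) (fun y => by
        rw [fderiv_comp_add_right]
        exact hB _) ha ht.1
    simp only [sub_add_cancel] at this
    rw [← this]
    congr 1
    funext x
    rw [sub_smul, sub_sub_eq_add_sub, add_sub_right_comm]

/-- There are no almost periodic solutions of positive energy which are self-similar up to the
time zero. -/
theorem APSol.not_selfSimilar (L : LocalWellPosedness X)
    (hsol : L.NoTravellingOrSelfSimilarClaim) {K : Set E} {e : ℝ}
    {I : Set ℝ} {φ : ℝ → E} (h : APSol X K e I φ) {a : ℝ} (ha : a ∈ I) (ha0 : a < 0)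
    (hcone : ∀ t ∈ I, t < 0 → ∀ᵐ x : Plane, |t| < ‖x‖ → X.stress (φ t) x = 0)
    (hq : ∀ t ∈ I, t < 0 → ∀ᵐ x, quad (X.stress (φ t) x) (spacetimeVec t x) = 0) : False := by
  by_cases hsub : Set.Iio 0 ⊆ I
  · have := hsol.2 φ (h.isEnergySolution L Set.ordConnected_Iio hsub) (h.almostPeriodic hsub)
      ⟨fun t ht => hcone t (hsub ht) ht, fun t ht => hq t (hsub ht) ht⟩ a ha0
    rw [h.energy_eq a ha] at this
    exact h.energy_pos.ne' this
  -- If the lifespan has an endpoint `tstar` below zero, L is transported along the rays of constant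
  -- x/t, and the cone with tip at `tstar` forces it to vanish.
  · obtain ⟨b, hb0, hb⟩ := Set.not_subset.1 hsub
    obtain ⟨tstar, ht, htstar⟩ := exists_mem_frontier h.isOpen ha hb
    have ht0 : tstar < 0 := ht.2.trans_lt (max_lt ha0 hb0)
    obtain ⟨xstar, hcone'⟩ := h.exists_cone L htstar
    have hl : ∀ᵐ x, lagr (X.stress (φ a) x) = 0 := by
      refine lagr_eq_zero_of_transport hcone' htstar.1 (P := fun z => a • z.1⁻¹ • z.2)
        (ContinuousAt.const_smul (ContinuousAt.smul (continuousAt_fst.inv₀ ht0.ne) continuousAt_snd) a)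
        (Iio_mem_nhds ht0) fun ζ hζ hζ' t ht => ?_
      have hc : HasCompactSupport fun y => ζ (a • y) :=
        hζ'.comp_homeomorph (Homeomorph.smulOfNeZero a ha0.ne)
      have := h.lagrInt_homogeneous L hq (ζ := fun y => ζ (a • y))
        ((hζ.of_le (by simp)).comp (by fun_prop)) hc ha ht.1 ha0 ht.2
      simp only [smul_smul, mul_inv_cancel₀ ha0.ne, one_smul] at this
      simp only [smul_smul]
      exact this
    have hsphere : ∀ᵐ x : Plane, ‖x‖ ≠ |a| := by
      have : volume (Metric.sphere (0 : Plane) |a|) = 0 := Measure.addHaar_sphere _ _ _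
      filter_upwards [compl_mem_ae_iff.2 this] with x hx hx'
      exact hx (by simpa using hx')
    refine h.energy_pos.ne' ?_
    rw [← h.energy_eq a ha]
    refine energy_eq_zero_of_ae ?_
    filter_upwards [hl, hsphere, hcone a ha ha0, hq a ha ha0, X.physical_ae (φ a)]
      with x h1 h2 h3 h4 h5
    -- At a point of the open cone the null vector has velocity x/a of length below one, so L = 0
    -- kills the tensor; outside the cone it vanishes by assumption.
    rcases lt_or_gt_of_ne h2 with h6 | h6
    · refine h5.eq_zero_of_travelling (v := a⁻¹ • x) ?_ ?_ h1
      · rw [norm_smul, norm_inv, Real.norm_eq_abs, inv_mul_lt_iff₀ (abs_pos.2 ha0.ne), mul_one]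
        exact h6
      · rw [spacetimeVec_inv_smul ha0.ne, quad_smul, h4, mul_zero]
    · exact h3 h6

end Exclusion

/-! ### A Morawetz identity in the light cone -/

section Morawetz

variable {E : Type*} [MetricSpace E] {X : EnergySpace m E}

/-- A smooth function equal to `s ^ (-1/2)` for `s ≥ ε ^ 2`, and vanishing for `s ≤ 0`. -/
def invSqrt (ε s : ℝ) : ℝ := Real.smoothTransition (2 * s / ε ^ 2 - 1) * (√s)⁻¹

theorem invSqrt_of_nonpos {ε s : ℝ} (hs : s ≤ 0) : invSqrt ε s = 0 := by
  rw [invSqrt, Real.sqrt_eq_zero'.2 hs, inv_zero, mul_zero]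

theorem contDiff_invSqrt {ε : ℝ} (hε : 0 < ε) : ContDiff ℝ 1 (invSqrt ε) := by
  refine contDiff_iff_contDiffAt.2 fun s => ?_
  -- The cutoff vanishes for s ≤ ε²/2, and the square root is smooth from there on.
  rcases lt_or_ge s (ε ^ 2 / 2) with h | h
  · refine contDiffAt_const (c := (0 : ℝ)) |>.congr_of_eventuallyEq ?_
    filter_upwards [Iio_mem_nhds h] with r hr
    rw [invSqrt, Real.smoothTransition.zero_of_nonpos, zero_mul]
    rw [sub_nonpos, div_le_one (by positivity)]
    linarith [Set.mem_Iio.1 hr]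
  · have hs : 0 < s := lt_of_lt_of_le (by positivity) h
    refine ContDiffAt.mul ?_ ((contDiffAt_id.sqrt hs.ne').inv (Real.sqrt_pos.2 hs).ne')
    exact Real.smoothTransition.contDiff.contDiffAt.comp s (by fun_prop)

theorem invSqrt_eq {ε s : ℝ} (hε : 0 < ε) (hs : ε ^ 2 ≤ s) : invSqrt ε s = (√s)⁻¹ := by
  rw [invSqrt, Real.smoothTransition.one_of_one_le, one_mul]
  rw [le_sub_iff_add_le, le_div_iff₀ (by positivity)]
  linarith

theorem deriv_invSqrt {ε s : ℝ} (hε : 0 < ε) (hs : ε ^ 2 < s) :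
    deriv (invSqrt ε) s = -((√s)⁻¹ / (2 * s)) := by
  have hs0 : 0 < s := lt_trans (by positivity) hs
  have h1 : invSqrt ε =ᶠ[𝓝 s] fun s => (√s)⁻¹ := by
    filter_upwards [Ioi_mem_nhds hs] with r hr using invSqrt_eq hε (le_of_lt hr)
  rw [h1.deriv_eq, ((Real.hasDerivAt_sqrt hs0.ne').fun_inv (Real.sqrt_pos.2 hs0).ne').deriv,
    Real.sq_sqrt hs0.le]
  field_simp

/-- The function `(t - ε) ^ 2 - |x| ^ 2`. -/
def hyp (ε : ℝ) (z : ℝ × Plane) : ℝ := (z.1 - ε) ^ 2 - ‖z.2‖ ^ 2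

theorem hasFDerivAt_hyp (ε : ℝ) (z : ℝ × Plane) : HasFDerivAt (hyp ε)
    ((2 * (z.1 - ε)) • ContinuousLinearMap.fst ℝ ℝ Plane
      - (2 : ℝ) • (innerSL ℝ z.2).comp (ContinuousLinearMap.snd ℝ ℝ Plane)) z := by
  have h0 : HasFDerivAt (fun z : ℝ × Plane => z.2) (ContinuousLinearMap.snd ℝ ℝ Plane) z :=
    hasFDerivAt_snd
  have h1 : HasFDerivAt (fun z : ℝ × Plane => z.1 - ε) (ContinuousLinearMap.fst ℝ ℝ Plane) z :=
    hasFDerivAt_fst.sub_const ε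
  refine ((h1.pow 2).sub h0.norm_sq).congr_fderiv ?_
  refine ContinuousLinearMap.ext fun w => ?_
  simp [← Nat.cast_smul_eq_nsmul ℝ]

/-- The vector field `h ((t - ε) ^ 2 - |x| ^ 2) (t - ε, x)`. -/
def radField (ε : ℝ) (β : Fin 3) (z : ℝ × Plane) : ℝ :=
  invSqrt ε (hyp ε z) * spacetimeVec (z.1 - ε) z.2 β

theorem hasFDerivAt_spacetimeVec_sub (ε : ℝ) (β : Fin 3) (z : ℝ × Plane) :
    HasFDerivAt (fun z : ℝ × Plane => spacetimeVec (z.1 - ε) z.2 β)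
      (if β = 0 then ContinuousLinearMap.fst ℝ ℝ Plane
        else (coordL β).comp (ContinuousLinearMap.snd ℝ ℝ Plane)) z := by
  refine Fin.cases ?_ (fun i => ?_) β
  · rw [if_pos rfl]
    exact hasFDerivAt_fst.sub_const ε
  · rw [if_neg (Fin.succ_ne_zero i)]
    exact ((coordL i.succ).comp (ContinuousLinearMap.snd ℝ ℝ Plane)).hasFDerivAt

theorem c1w_radField {ε : ℝ} (hε : 0 < ε) (c d : ℝ) (β : Fin 3) :
    C1W (fun _ => 1) (Set.Ioo c d) (radField ε β) := by
  have h1 : ContDiff ℝ 1 (hyp ε) := by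
    unfold hyp
    exact ((contDiff_fst.sub contDiff_const).pow 2).sub (contDiff_snd.norm_sq ℝ)
  have h2 : ContDiff ℝ 1 fun z : ℝ × Plane => spacetimeVec (z.1 - ε) z.2 β := by
    refine Fin.cases ?_ (fun i => ?_) β
    · exact contDiff_fst.sub contDiff_const
    · exact ((coordL i.succ).comp (ContinuousLinearMap.snd ℝ ℝ Plane)).contDiff
  refine c1w_of_eq_zero isOpen_Ioo (R := |c| + |d| + ε)
    (((contDiff_invSqrt hε).comp h1).mul h2).contDiffOn fun t ht x hx => ?_
  have h3 : |t - ε| ≤ |c| + |d| + ε := by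
    have := ht.1
    have := ht.2
    rw [abs_le]
    constructor <;> linarith [neg_abs_le c, le_abs_self d, abs_nonneg c, abs_nonneg d]
  have h4 : (t - ε) ^ 2 ≤ ‖x‖ ^ 2 := sq_le_sq' (by linarith [neg_abs_le (t - ε)])
    (by linarith [le_abs_self (t - ε)])
  simp only [radField]
  rw [invSqrt_of_nonpos, zero_mul]
  simp only [hyp]
  linarith

/-- Put X = (t - ε, x) and σ = -g(X, X). The derivative of σ^(-1/2) X, with the index lowered, is
σ^(-1/2) g + σ^(-3/2) X ⊗ X. Contracted with T this is σ^(-3/2) (T(X, X) - g(X, X) tr T), a multiple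
of the Gram form and therefore of one sign. -/
theorem contr_fluxCoef_radField {ε s : ℝ} {x : Plane} (hε : 0 < ε) (hσ : ε ^ 2 < hyp ε (s, x))
    {T : Fin 3 → Fin 3 → ℝ} (hT : Physical T) : contr (fluxCoef (radField ε) s x) T
      = -((√(hyp ε (s, x)))⁻¹ / hyp ε (s, x) * quad T (spacetimeVec (s - ε) x)) := by
  have hσ0 : 0 < hyp ε (s, x) := lt_trans (by positivity) hσ
  have h1 : HasFDerivAt (fun z => invSqrt ε (hyp ε z)) _ (s, x) :=
    ((contDiff_invSqrt hε).differentiable one_ne_zero _).hasDerivAt.comp_hasFDerivAt (s, x)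
      (hasFDerivAt_hyp ε (s, x))
  have h2 : ∀ β, fderiv ℝ (radField ε β) (s, x) = _ := fun β =>
    (h1.fun_mul (hasFDerivAt_spacetimeVec_sub ε β (s, x))).fderiv
  have c1 : ∀ w, coordL 1 w = w 0 := fun _ => rfl
  have c2 : ∀ w, coordL 2 w = w 1 := fun _ => rfl
  have e00 : (EuclideanSpace.single 0 1 : Plane) 0 = 1 := by simp
  have e01 : (EuclideanSpace.single 0 1 : Plane) 1 = 0 := by simp
  have e10 : (EuclideanSpace.single 1 1 : Plane) 0 = 0 := by simp
  have e11 : (EuclideanSpace.single 1 1 : Plane) 1 = 1 := by simp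
  have hn : hyp ε (s, x) = (s - ε) ^ 2 - (x 0 ^ 2 + x 1 ^ 2) := by
    rw [← norm_sq_plane]
    rfl
  rw [contr_fluxCoef, quad_explicit T hT.1]
  simp only [h2, Fin.sum_univ_three, basisVec_zero, basisVec_one, basisVec_two,
    if_neg (show (1 : Fin 3) ≠ 0 by decide), if_neg (show (2 : Fin 3) ≠ 0 by decide),
    _root_.smul_apply, add_apply, ContinuousLinearMap.comp_apply, sub_apply,
    ContinuousLinearMap.coe_snd', ContinuousLinearMap.coe_fst', innerSL_apply_apply,
    inner_zero_right, EuclideanSpace.inner_single_right, conj_trivial, smul_eq_mul,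
    spacetimeVec_zero, spacetimeVec_one, spacetimeVec_two, c1, c2, e00, e01, e10, e11,
    hT.1 1 0, hT.1 2 0, hT.1 2 1, PiLp.zero_apply, deriv_invSqrt hε hσ, invSqrt_eq hε hσ.le]
  generalize hyp ε (s, x) = σ at *
  obtain ⟨q, hq⟩ : ∃ q, q = (√σ)⁻¹ / σ := ⟨_, rfl⟩
  have hq1 : (√σ)⁻¹ = q * σ := by rw [hq, div_mul_cancel₀ _ hσ0.ne']
  have hq2 : (√σ)⁻¹ / (2 * σ) = q / 2 := by rw [hq, div_div, mul_comm]
  rw [hq2, ← hq, hq1, hn]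
  simp only [if_true, ContinuousLinearMap.coe_fst']
  ring

theorem quad_add_le {T : Fin 3 → Fin 3 → ℝ} (hT : Physical T) (u w : Fin 3 → ℝ) :
    quad T (u + w) ≤ 2 * quad T u + 2 * quad T w := by
  have h1 := hT.quad_add_smul u w 1
  have h2 := hT.quad_add_smul u w (-1)
  have h3 := hT.2 (u + (-1 : ℝ) • w)
  rw [one_smul] at h1
  linarith

/-- The scaling invariant density controlled by the Morawetz identity. -/
def EnergySpace.radInt (X : EnergySpace m E) (s : ℝ) (Φ : E) : ℝ :=
  ∫ x, |s|⁻¹ ^ 3 * quad (X.stress Φ x) (spacetimeVec s x)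

/-- Truncation of the coordinates of a vector. -/
def clampP (R : ℝ) (x : Plane) : Plane := WithLp.toLp 2 fun i => max (-R) (min R (x i))

theorem continuous_clampP (R : ℝ) : Continuous (clampP R) := by
  unfold clampP
  fun_prop

theorem clampP_of_le {R : ℝ} {x : Plane} (hx : ‖x‖ ≤ R) : clampP R x = x := by
  ext i
  have h := abs_le.1 ((PiLp.norm_apply_le x i).trans hx)
  simp only [clampP]
  rw [min_eq_right h.2, max_eq_right h.1]

theorem clampP_mem (R : ℝ) : ∃ K : Set Plane, IsCompact K ∧ ∀ x, clampP R x ∈ K := by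
  refine ⟨(fun y : Fin 2 → ℝ => (WithLp.toLp 2 y : Plane)) '' Set.univ.pi fun _ => Set.Icc (-|R|) |R|,
    (isCompact_univ_pi fun _ => isCompact_Icc).image (by fun_prop), fun x => ⟨_, ?_, rfl⟩⟩
  intro i _
  refine ⟨le_trans (neg_le_neg (le_abs_self R)) (le_max_left _ _), max_le (neg_le_abs R) ?_⟩
  exact (min_le_left _ _).trans (le_abs_self R)

/-- The coefficients of the quadratic form `T ↦ |s|⁻³ |s ∂_t φ + x · ∇ φ|²`, truncated in `x`. -/
def radCoef (R s : ℝ) (x : Plane) (α β : Fin 3) : ℝ :=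
  |s|⁻¹ ^ 3 * (spacetimeVec s (clampP R x) α * spacetimeVec s (clampP R x) β
    - g α β * ∑ γ, ∑ δ, g γ δ * (spacetimeVec s (clampP R x) γ * spacetimeVec s (clampP R x) δ))

theorem contr_radCoef {R s : ℝ} {x : Plane} (hx : ‖x‖ ≤ R) (T : Fin 3 → Fin 3 → ℝ) :
    contr (radCoef R s x) T = |s|⁻¹ ^ 3 * quad T (spacetimeVec s x) := by
  simp only [contr_eq, radCoef, clampP_of_le hx, quad, Fin.sum_univ_three]
  ring

/-- The true coefficients grow quadratically in `x`. Truncation makes them bounded, as the pairing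
requires, and does not affect tensors supported in the ball of radius `R`. -/
theorem goodCoef_radCoef (R : ℝ) : GoodCoef (Set.Iio 0) (radCoef R) := by
  set G : Fin 3 → Fin 3 → ℝ × Plane → ℝ := fun α β z => |z.1|⁻¹ ^ 3 * (spacetimeVec z.1 z.2 α
    * spacetimeVec z.1 z.2 β - g α β * ∑ γ, ∑ δ, g γ δ * (spacetimeVec z.1 z.2 γ
      * spacetimeVec z.1 z.2 δ))
  have hv : ∀ α, Continuous fun z : ℝ × Plane => spacetimeVec z.1 z.2 α := fun α => by
    refine Fin.cases ?_ (fun i => ?_) α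
    · exact continuous_fst
    · exact ((coordL i.succ).comp (ContinuousLinearMap.snd ℝ ℝ Plane)).continuous
  have hG : ∀ α β, ContinuousOn (G α β) (Set.Iio 0 ×ˢ Set.univ) := by
    intro α β
    refine ContinuousOn.mul ?_ (Continuous.continuousOn (by fun_prop))
    refine ContinuousOn.pow (ContinuousOn.inv₀ (by fun_prop) fun z hz => ?_) 3
    exact (abs_pos.2 (ne_of_lt hz.1)).ne'
  have hc : ∀ α β (z : ℝ × Plane), radCoef R z.1 z.2 α β = G α β (z.1, clampP R z.2) :=
    fun _ _ _ => rfl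
  refine ⟨fun α β => ?_, fun α β J hJ hJI => ?_⟩
  · simp only [hc]
    refine (hG α β).comp (Continuous.continuousOn ?_) fun z hz => ⟨hz.1, Set.mem_univ _⟩
    exact continuous_fst.prodMk ((continuous_clampP R).comp continuous_snd)
  · obtain ⟨K, hK, hmem⟩ := clampP_mem R
    obtain ⟨C, hC⟩ := (hJ.prod hK).exists_bound_of_continuousOn
      ((hG α β).mono (Set.prod_mono hJI (Set.subset_univ _)))
    exact ⟨C, fun t ht x => by
      rw [mul_one]
      exact hC (t, clampP R x) ⟨ht, hmem x⟩⟩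

theorem EnergySpace.radInt_eq_pair {R s : ℝ} (hs : |s| ≤ R) {Φ : E}
    (hΦ : ∀ᵐ x : Plane, |s| < ‖x‖ → X.stress Φ x = 0) : X.radInt s Φ = X.pair (radCoef R s) Φ := by
  refine integral_congr_ae ?_
  filter_upwards [hΦ] with x hx
  rcases le_or_gt ‖x‖ |s| with h | h
  · rw [contr_radCoef (h.trans hs)]
  · rw [hx h]
    simp [contr_eq, quad]

theorem EnergySpace.radInt_nonneg (s : ℝ) (Φ : E) : 0 ≤ X.radInt s Φ := by
  refine integral_nonneg_of_ae ?_
  filter_upwards [X.physical_ae Φ] with x hx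
  exact mul_nonneg (by positivity) (hx.2 _)

theorem MaxSol.continuousOn_radInt {I : Set ℝ} {φ : ℝ → E} (h : MaxSol X I φ)
    (hcone : ∀ t ∈ I, t < 0 → ∀ᵐ x : Plane, |t| < ‖x‖ → X.stress (φ t) x = 0) :
    ContinuousOn (fun s => X.radInt s (φ s)) (I ∩ Set.Iio 0) := by
  intro t ht
  have hI : IsOpen (I ∩ Set.Iio 0) := h.isOpen.inter isOpen_Iio
  refine ContinuousAt.continuousWithinAt ?_
  have h1 := (((goodCoef_radCoef (|t| + 1)).mono (Set.inter_subset_right (s := I))).continuousOn_pair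
    (X := X) hI (h.continuousOn.mono Set.inter_subset_left)).continuousAt (hI.mem_nhds ht)
  refine h1.congr ?_
  have h2 : ∀ᶠ s in 𝓝 t, |s| < |t| + 1 :=
    (continuous_abs.tendsto t).eventually_lt_const (lt_add_one _)
  filter_upwards [h2, hI.mem_nhds ht] with s hs hsI
  exact (EnergySpace.radInt_eq_pair hs.le (hcone s hsI.1 hsI.2)).symm

/-- The Morawetz estimate in the backward light cone. -/
theorem MaxSol.integral_radInt_le (L : LocalWellPosedness X) {I : Set ℝ} {φ : ℝ → E}
    (h : MaxSol X I φ) (hcone : ∀ t ∈ I, t < 0 → ∀ᵐ x : Plane, |t| < ‖x‖ → X.stress (φ t) x = 0)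
    {a b : ℝ} (ha : a ∈ I) (hb : b ∈ I) (hab : a ≤ b) (hb0 : b < 0) :
    ∫ s in a..b, X.radInt s (φ s) ≤ 50 * X.energy (φ a) := by
  -- The centre of the radial field is moved to time ε = -b. On the cone |x| ≤ |s| with s ≤ -ε one
  -- then has (s - ε)² - |x|² > ε², so the cutoff is never felt.
  obtain ⟨ε, rfl⟩ : ∃ ε, b = -ε := ⟨-b, (neg_neg b).symm⟩
  have hε : 0 < ε := by linarith
  have hsub : Set.uIcc a (-ε) ⊆ I := h.ordConnected.uIcc_subset ha hb
  have hneg : ∀ s ∈ Set.Icc a (-ε), s < 0 := fun s hs => hs.2.trans_lt hb0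
  rw [Set.uIcc_of_le hab] at hsub
  have hJ : Set.uIcc a (-ε) ⊆ Set.Ioo (a - 1) (-ε + 1) := by
    rw [Set.uIcc_of_le hab]
    exact fun s hs => ⟨by linarith [hs.1], by linarith [hs.2]⟩
  have hY := c1w_radField hε (a - 1) (-ε + 1)
  have hlaw := h.law L isOpen_Ioo Set.ordConnected_Ioo hY ha hb hJ
  have hE : ∀ s ∈ Set.Icc a (-ε), X.energy (φ s) = X.energy (φ a) := fun s hs =>
    h.energy_eq L ha (hsub hs)
  have hσ : ∀ s ∈ Set.Icc a (-ε), ∀ x : Plane, ‖x‖ ≤ |s| → ε ^ 2 < hyp ε (s, x)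
      ∧ hyp ε (s, x) ≤ (2 * |s|) ^ 2 := by
    intro s hs x hx
    have hs0 := hneg s hs
    have h1 := mul_self_le_mul_self (norm_nonneg x) hx
    rw [abs_of_neg hs0] at h1 ⊢
    simp only [hyp]
    constructor <;> nlinarith [hs.2, sq_nonneg ‖x‖]
  have hint : ∀ s ∈ Set.Icc a (-ε), Integrable fun x =>
      contr (fluxCoef (radField ε) s x) (X.stress (φ s) x) := fun s hs => by
    have hsJ := hJ (Set.uIcc_of_le hab ▸ hs)
    have hg := GoodCoef.fluxCoef isOpen_Ioo hY
    obtain ⟨C, -, hC⟩ := hg.exists_bound (isCompact_singleton (x := s)) (by simpa using hsJ)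
    exact EnergySpace.integrable_contr (hg.continuous hsJ).aestronglyMeasurable (hC s rfl) _
  -- Since √σ ≤ 2|s|, the weight |s|⁻³ is at most 8 σ^(-3/2). Passing from (s - ε, x) to (s, x)
  -- doubles the form and adds twice 2ε²T₀₀, hence the constants 16 and 4ε².
  have hpt : ∀ s ∈ Set.Icc a (-ε), X.radInt s (φ s)
      ≤ -16 * X.pair (fluxCoef (radField ε) s) (φ s) + 4 * ε ^ 2 * X.energy (φ a) * |s|⁻¹ ^ 3 := by
    intro s hs
    have hs0 := hneg s hs
    have hsp : 0 < |s| := abs_pos.2 hs0.ne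
    rw [← hE s hs]
    have hrhs : -16 * X.pair (fluxCoef (radField ε) s) (φ s) + 4 * ε ^ 2 * X.energy (φ s) * |s|⁻¹ ^ 3
        = ∫ x, (-16 * contr (fluxCoef (radField ε) s x) (X.stress (φ s) x)
          + 4 * ε ^ 2 * |s|⁻¹ ^ 3 * X.stress (φ s) x 0 0) := by
      rw [integral_add ((hint s hs).const_mul _)
        ((EnergySpace.integrable_entry _ 0 0).const_mul _), integral_const_mul, integral_const_mul]
      unfold EnergySpace.pair EnergySpace.energy
      ring
    rw [hrhs]
    refine integral_mono_of_nonneg ?_ (((hint s hs).const_mul _).add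
        ((EnergySpace.integrable_entry _ 0 0).const_mul _)) ?_
    · filter_upwards [X.physical_ae (φ s)] with x hx
      exact mul_nonneg (by positivity) (hx.2 _)
    · filter_upwards [X.physical_ae (φ s), hcone s (hsub hs) hs0] with x hx hc
      rcases lt_or_ge |s| ‖x‖ with hxs | hxs
      · simp [hc hxs, quad, contr_eq]
      obtain ⟨h1, h2⟩ := hσ s hs x hxs
      rw [contr_fluxCoef_radField hε h1 hx]
      set σ := hyp ε (s, x)
      have hσ0 : 0 < σ := lt_trans (by positivity) h1
      have h3 : √σ ≤ 2 * |s| := Real.sqrt_le_iff.2 ⟨by positivity, h2⟩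
      have h4 : |s|⁻¹ ^ 3 ≤ 8 * ((√σ)⁻¹ / σ) := by
        have h5 : √σ * σ ≤ 2 * |s| * (2 * |s|) ^ 2 :=
          mul_le_mul h3 h2 hσ0.le (by positivity)
        have h6 : 0 < √σ * σ := mul_pos (Real.sqrt_pos.2 hσ0) hσ0
        rw [div_eq_mul_inv, ← mul_inv, inv_pow, ← div_eq_mul_inv, inv_eq_one_div,
          div_le_div_iff₀ (by positivity) h6]
        nlinarith
      have h5 : spacetimeVec s x = spacetimeVec (s - ε) x + spacetimeVec ε 0 := by
        funext β
        refine Fin.cases ?_ (fun i => ?_) β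
        · exact (sub_add_cancel s ε).symm
        · simp [spacetimeVec]
      have h6 := quad_add_le hx (spacetimeVec (s - ε) x) (spacetimeVec ε 0)
      have h7 : quad (X.stress (φ s) x) (spacetimeVec ε 0) ≤ 2 * ε ^ 2 * X.stress (φ s) x 0 0 := by
        rw [quad_explicit _ hx.1]
        simp only [spacetimeVec_zero, spacetimeVec_one, spacetimeVec_two, PiLp.zero_apply]
        have b1 := (_root_.abs_le.1 (hx.abs_le 1 1)).2
        have b2 := (_root_.abs_le.1 (hx.abs_le 2 2)).2
        nlinarith [sq_nonneg ε]
      rw [← h5] at h6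
      have h8 := hx.2 (spacetimeVec (s - ε) x)
      calc |s|⁻¹ ^ 3 * quad (X.stress (φ s) x) (spacetimeVec s x)
          ≤ |s|⁻¹ ^ 3 * (2 * quad (X.stress (φ s) x) (spacetimeVec (s - ε) x)
            + 2 * (2 * ε ^ 2 * X.stress (φ s) x 0 0)) :=
            mul_le_mul_of_nonneg_left (by linarith) (by positivity)
        _ ≤ _ := by nlinarith [mul_le_mul_of_nonneg_right h4 h8]
  -- On the cone the field is causal and points to the past, so the dominant energy condition fixes
  -- the sign.
  have hmoma : X.pair (momCoef (radField ε) a) (φ a) ≤ 0 := by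
    have hs : a ∈ Set.Icc a (-ε) := ⟨le_rfl, hab⟩
    refine integral_nonpos_of_ae ?_
    filter_upwards [X.physical_ae (φ a), hcone a ha (hneg a hs)] with x hx hc
    rcases lt_or_ge |a| ‖x‖ with hxs | hxs
    · simp [hc hxs, contr_eq]
    have h1 := (_root_.abs_le.1 (hx.abs_momentum_le (x 0) (x 1))).2
    rw [← norm_sq_plane, Real.sqrt_sq (norm_nonneg x)] at h1
    have h2 := hx.energy_nonneg
    rw [abs_of_neg (hneg a hs)] at hxs
    have h3 : 0 ≤ invSqrt ε (hyp ε (a, x)) :=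
      mul_nonneg (Real.smoothTransition.nonneg _) (by positivity)
    simp only [contr_momCoef, radField, Fin.sum_univ_three, spacetimeVec_zero, spacetimeVec_one,
      spacetimeVec_two, Pi.zero_apply]
    have h4 : (a - ε) * X.stress (φ a) x 0 0 + (x 0 * X.stress (φ a) x 0 1
        + x 1 * X.stress (φ a) x 0 2) ≤ 0 := by
      nlinarith [mul_le_mul_of_nonneg_right hxs h2, mul_nonneg hε.le h2]
    linarith [mul_nonpos_of_nonneg_of_nonpos h3 h4]
  -- Here the vector is (-2ε, x) with |x| ≤ ε and the factor σ^(-1/2) is at most 1/ε, so the bound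
  -- does not depend on ε.
  have hmomb : -3 * X.energy (φ a) ≤ X.pair (momCoef (radField ε) (-ε)) (φ (-ε)) := by
    have hs : -ε ∈ Set.Icc a (-ε) := ⟨hab, le_rfl⟩
    rw [← hE _ hs, EnergySpace.energy, ← integral_const_mul]
    have hsJ := hJ (Set.uIcc_of_le hab ▸ hs)
    have hg := GoodCoef.momCoef hY
    obtain ⟨C, -, hC⟩ := hg.exists_bound (isCompact_singleton (x := -ε)) (by simpa using hsJ)
    refine integral_mono_ae ((EnergySpace.integrable_entry _ 0 0).const_mul _)
      (EnergySpace.integrable_contr (hg.continuous hsJ).aestronglyMeasurable (hC _ rfl) _) ?_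
    filter_upwards [X.physical_ae (φ (-ε)), hcone _ hb hb0] with x hx hc
    rcases lt_or_ge |(-ε)| ‖x‖ with hxs | hxs
    · simp [hc hxs, contr_eq]
    have h1 := (_root_.abs_le.1 (hx.abs_momentum_le (x 0) (x 1))).1
    rw [← norm_sq_plane, Real.sqrt_sq (norm_nonneg x)] at h1
    have h2 := hx.energy_nonneg
    have h5 := (hσ _ hs x hxs).1
    rw [abs_neg, abs_of_pos hε] at hxs
    simp only [contr_momCoef, radField, Fin.sum_univ_three, spacetimeVec_zero, spacetimeVec_one,
      spacetimeVec_two, invSqrt_eq hε h5.le]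
    set σ := hyp ε (-ε, x)
    have h6 : (√σ)⁻¹ * ε ≤ 1 := by
      rw [inv_mul_le_iff₀ (Real.sqrt_pos.2 (lt_trans (by positivity) h5)), mul_one]
      exact Real.le_sqrt_of_sq_le h5.le
    have h7 : 0 ≤ (√σ)⁻¹ := by positivity
    have h4 : -(3 * ε * X.stress (φ (-ε)) x 0 0) ≤ (-ε - ε) * X.stress (φ (-ε)) x 0 0
        + (x 0 * X.stress (φ (-ε)) x 0 1 + x 1 * X.stress (φ (-ε)) x 0 2) := by
      nlinarith [mul_le_mul_of_nonneg_right hxs h2]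
    have h8 := mul_le_mul_of_nonneg_left h4 h7
    have h9 := mul_le_mul_of_nonneg_right h6 h2
    nlinarith
  have hi1 : IntervalIntegrable (fun s => X.radInt s (φ s)) volume a (-ε) := by
    refine ((h.continuousOn_radInt hcone).mono ?_).intervalIntegrable
    rw [Set.uIcc_of_le hab]
    exact fun s hs => ⟨hsub hs, hneg s hs⟩
  have hi2 : IntervalIntegrable (fun s => X.pair (fluxCoef (radField ε) s) (φ s)) volume a (-ε) := by
    have hIJ : IsOpen (I ∩ Set.Ioo (a - 1) (-ε + 1)) := h.isOpen.inter isOpen_Ioo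
    refine ((((GoodCoef.fluxCoef isOpen_Ioo hY).mono Set.inter_subset_right).continuousOn_pair hIJ
      (h.continuousOn.mono Set.inter_subset_left)).mono fun s hs => ⟨?_, hJ hs⟩).intervalIntegrable
    exact hsub (Set.uIcc_of_le hab ▸ hs)
  have hderiv : ∀ s ∈ Set.uIcc a (-ε), HasDerivAt (fun s : ℝ => s⁻¹ ^ 2 / 2) (|s|⁻¹ ^ 3) s := by
    intro s hs
    rw [Set.uIcc_of_le hab] at hs
    have hs0 := hneg s hs
    have h1 := ((hasDerivAt_inv hs0.ne).pow 2).div_const 2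
    refine h1.congr_deriv ?_
    rw [abs_of_neg hs0]
    have := hs0.ne
    field_simp
    rw [Nat.cast_ofNat, show 2 - 1 = 1 from rfl, pow_one]
    field_simp
  have hi3 : IntervalIntegrable (fun s : ℝ => |s|⁻¹ ^ 3) volume a (-ε) := by
    refine ContinuousOn.intervalIntegrable ((ContinuousOn.inv₀ (by fun_prop) fun s hs => ?_).pow 3)
    rw [Set.uIcc_of_le hab] at hs
    exact (abs_pos.2 (hneg s hs).ne).ne'
  have hmono := intervalIntegral.integral_mono_on hab hi1
    ((hi2.const_mul (-16)).add (hi3.const_mul (4 * ε ^ 2 * X.energy (φ a)))) hpt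
  rw [intervalIntegral.integral_add (hi2.const_mul _) (hi3.const_mul _),
    intervalIntegral.integral_const_mul, intervalIntegral.integral_const_mul,
    intervalIntegral.integral_eq_sub_of_hasDerivAt hderiv hi3, ← hlaw] at hmono
  have hE0 := EnergySpace.energy_nonneg (X := X) (φ a)
  -- The integral of |s|⁻³ up to -ε is at most 1/(2ε²), which the factor ε² absorbs. Altogether 16·3
  -- + 2 = 50.
  have hlast : 4 * ε ^ 2 * X.energy (φ a) * ((-ε)⁻¹ ^ 2 / 2 - a⁻¹ ^ 2 / 2) ≤ 2 * X.energy (φ a) := by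
    have h1 : ε ^ 2 * (-ε)⁻¹ ^ 2 = 1 := by
      rw [← mul_pow, inv_neg, mul_neg, mul_inv_cancel₀ hε.ne']
      norm_num
    have h2 : 0 ≤ ε ^ 2 * X.energy (φ a) * a⁻¹ ^ 2 := by positivity
    nlinarith
  linarith

end Morawetz

/-! ### The self-similar limit -/

section SelfSimilarLimit

variable {E : Type*} [MetricSpace E] {X : EnergySpace m E}

/-- The stress-energy tensor vanishes outside of the ball of radius `ρ` around the origin. -/
def EnergySpace.SuppIn (X : EnergySpace m E) (ρ : ℝ) (Φ : E) : Prop :=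
  ∀ r, ρ < r → X.tail 0 r Φ = 0

namespace EnergySpace

theorem SuppIn.ae {ρ : ℝ} {Φ : E} (h : X.SuppIn ρ Φ) :
    ∀ᵐ x : Plane, ρ < ‖x‖ → X.stress Φ x = 0 := by
  have := ae_eq_zero_of_tail (X := X) (c := 0) (ρ := ρ) (Φ := Φ) fun η hη =>
    (h _ (lt_add_of_pos_right ρ hη)).le
  simpa only [sub_zero] using this

theorem SuppIn.act {ρ : ℝ} {Φ : E} (h : X.SuppIn ρ Φ) (l : Set.Ioi (0 : ℝ)) :
    X.SuppIn (l * ρ) (X.act l 0 Φ) := by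
  intro r hr
  rw [tail_act, smul_zero, sub_zero]
  refine h _ ?_
  rwa [← div_eq_inv_mul, lt_div_iff₀' (coe_pos l)]

theorem SuppIn.of_tendsto {ρ : ℝ} {Φ : ℕ → E} {Ψ : E} (hlim : Tendsto Φ atTop (𝓝 Ψ))
    (h : ∀ᶠ n in atTop, X.SuppIn ρ (Φ n)) : X.SuppIn ρ Ψ := fun r hr =>
  tendsto_nhds_unique (((continuous_setIntegral _).tendsto Ψ).comp hlim)
    (tendsto_const_nhds.congr' (h.mono fun _ hn => (hn r hr).symm))

/-- The factor l⁻¹ is the Jacobian in time, so the time integral of `radInt` is scale invariant. -/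
theorem radInt_act {s : ℝ} (hs : s < 0) (l : Set.Ioi (0 : ℝ)) {Φ : E}
    (h : X.SuppIn |(l : ℝ)⁻¹ * s| Φ) :
    X.radInt s (X.act l 0 Φ) = (l : ℝ)⁻¹ * X.radInt ((l : ℝ)⁻¹ * s) Φ := by
  have hl := coe_pos l
  have habs : (l : ℝ) * |(l : ℝ)⁻¹ * s| = |s| := by
    rw [abs_mul, abs_of_pos (inv_pos.2 hl), mul_inv_cancel_left₀ hl.ne']
  have h1 := h.act l
  rw [habs] at h1
  have hg := goodCoef_radCoef |s|
  obtain ⟨C, -, hC⟩ := hg.exists_bound (isCompact_singleton (x := s)) (by simpa using hs)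
  rw [radInt_eq_pair le_rfl h1.ae, pair_act (hg.continuous hs).measurable (hC s rfl)]
  unfold pair radInt
  rw [← integral_const_mul]
  refine integral_congr_ae ?_
  filter_upwards [h.ae] with z hz
  rcases le_or_gt ‖z‖ |(l : ℝ)⁻¹ * s| with hz' | hz'
  · have h2 : ‖(l : ℝ) • (z + 0)‖ ≤ |s| := by
      rw [add_zero, norm_smul, Real.norm_of_nonneg hl.le, ← habs]
      exact mul_le_mul_of_nonneg_left hz' hl.le
    rw [contr_radCoef h2]
    have h3 : spacetimeVec s ((l : ℝ) • (z + 0)) = (l : ℝ) • spacetimeVec ((l : ℝ)⁻¹ * s) z := by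
      funext β
      refine Fin.cases ?_ (fun i => ?_) β
      · exact (mul_inv_cancel_left₀ hl.ne' s).symm
      · simp [spacetimeVec]
    rw [h3, quad_smul, ← habs, mul_inv, mul_pow]
    field_simp
  · simp [hz hz', contr_eq, quad]

end EnergySpace

/-- A bounded monotone integral satisfies the Cauchy criterion. -/
theorem exists_integral_le_of_bounded {F : ℝ → ℝ} {a C : ℝ} (ha : a < 0)
    (hF : ContinuousOn F (Set.Ico a 0)) (hF0 : ∀ s, 0 ≤ F s)
    (hC : ∀ b ∈ Set.Ico a 0, ∫ s in a..b, F s ≤ C) {η : ℝ} (hη : 0 < η) :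
    ∃ b₀ ∈ Set.Ico a 0, ∀ b c, b₀ ≤ b → b ≤ c → c < 0 → ∫ s in b..c, F s ≤ η := by
  have hi : ∀ b c, a ≤ b → b ≤ c → c < 0 → IntervalIntegrable F volume b c := fun b c hb hbc hc => by
    refine (hF.mono fun s hs => ?_).intervalIntegrable
    rw [Set.uIcc_of_le hbc] at hs
    exact ⟨hb.trans hs.1, hs.2.trans_lt hc⟩
  set S := (fun b => ∫ s in a..b, F s) '' Set.Ico a 0
  have hS : BddAbove S := ⟨C, by rintro _ ⟨b, hb, rfl⟩; exact hC b hb⟩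
  have hne : S.Nonempty := ⟨_, a, ⟨le_rfl, ha⟩, rfl⟩
  obtain ⟨_, ⟨b₀, hb₀, rfl⟩, hlt⟩ := exists_lt_of_lt_csSup hne (sub_lt_self (sSup S) hη)
  refine ⟨b₀, hb₀, fun b c hb hbc hc => ?_⟩
  have hab : a ≤ b := hb₀.1.trans hb
  have h1 : ∫ s in a..c, F s ≤ sSup S := le_csSup hS ⟨c, ⟨hab.trans hbc, hc⟩, rfl⟩
  have h2 := intervalIntegral.integral_add_adjacent_intervals
    (hi a b₀ le_rfl hb₀.1 hb₀.2) (hi b₀ b hb₀.1 hb (hbc.trans_lt hc))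
  have h3 := intervalIntegral.integral_add_adjacent_intervals
    (hi a b le_rfl hab (hbc.trans_lt hc)) (hi b c hab hbc hc)
  have h4 : 0 ≤ ∫ s in b₀..b, F s := intervalIntegral.integral_nonneg hb fun s _ => hF0 s
  simp only at hlt
  linarith

theorem MaxSol.continuousOn_radInt' {I : Set ℝ} {φ : ℝ → E} (h : MaxSol X I φ)
    (hsupp : ∀ t ∈ I, t < 0 → X.SuppIn |t| (φ t)) :
    ContinuousOn (fun s => X.radInt s (φ s)) (I ∩ Set.Iio 0) :=
  h.continuousOn_radInt fun t ht ht0 => (hsupp t ht ht0).ae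

/-- A limit of rescalings towards the tip of the light cone is self-similar. -/
theorem MaxSol.radInt_eq_zero_of_rescale (L : LocalWellPosedness X) {I J : Set ℝ} {φ ψ : ℝ → E}
    (h : MaxSol X I φ) (hψ : MaxSol X J ψ) {a : ℝ} (ha : a < 0) (hI : Set.Ico a 0 ⊆ I)
    (hsupp : ∀ t ∈ I, t < 0 → X.SuppIn |t| (φ t)) {l : ℕ → Set.Ioi (0 : ℝ)}
    (hl : Tendsto (fun n => (l n : ℝ)⁻¹) atTop (𝓝 0))
    (hlim : ∀ s ∈ J, (∀ᶠ n in atTop, s ∈ (fun s => (l n : ℝ)⁻¹ * s + 0) ⁻¹' I) ∧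
      Tendsto (fun n => X.rescale (l n) 0 0 φ s) atTop (𝓝 (ψ s))) :
    (∀ t ∈ J, t < 0 → X.SuppIn |t| (ψ t)) ∧ ∀ t ∈ J, t < 0 → X.radInt t (ψ t) = 0 := by
  have hsupp_n : ∀ n s, (l n : ℝ)⁻¹ * s + 0 ∈ I → s < 0 →
      X.SuppIn |(l n : ℝ)⁻¹ * s| (φ ((l n : ℝ)⁻¹ * s + 0)) := by
    intro n s hs hs0
    have := hsupp _ hs (by rw [add_zero]; exact mul_neg_of_pos_of_neg (inv_pos.2 (coe_pos _)) hs0)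
    rwa [add_zero] at this ⊢
  have hsupp_n' : ∀ n s, (l n : ℝ)⁻¹ * s + 0 ∈ I → s < 0 →
      X.SuppIn |s| (X.rescale (l n) 0 0 φ s) := by
    intro n s hs hs0
    have := (hsupp_n n s hs hs0).act (l n)
    rwa [abs_mul, abs_of_pos (inv_pos.2 (coe_pos (l n))), mul_inv_cancel_left₀ (coe_pos (l n)).ne']
      at this
  have hsuppψ : ∀ t ∈ J, t < 0 → X.SuppIn |t| (ψ t) := fun t ht ht0 =>
    EnergySpace.SuppIn.of_tendsto (hlim t ht).2 ((hlim t ht).1.mono fun n hn => hsupp_n' n t hn ht0)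
  refine ⟨hsuppψ, fun t ht ht0 => ?_⟩
  -- A positive value in the limit would give a positive integral over a window [c, d]. The
  -- corresponding integrals of φ run over [l⁻¹c, l⁻¹d], which moves into the tip, where the bounded
  -- Morawetz integral has small tails.
  by_contra hne
  have hpos : 0 < X.radInt t (ψ t) := (EnergySpace.radInt_nonneg _ _).lt_of_ne' hne
  have hJ0 : IsOpen (J ∩ Set.Iio 0) := hψ.isOpen.inter isOpen_Iio
  have hcont := hψ.continuousOn_radInt' hsuppψ
  have hev : ∀ᶠ s in 𝓝 t, s ∈ J ∩ Set.Iio 0 ∧ 0 < X.radInt s (ψ s) :=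
    (hJ0.eventually_mem ⟨ht, ht0⟩).and
      ((hcont.continuousAt (hJ0.mem_nhds ⟨ht, ht0⟩)).eventually_const_lt hpos)
  obtain ⟨r, hr, hball⟩ := Metric.nhds_basis_closedBall.mem_iff.1 hev
  rw [Real.closedBall_eq_Icc] at hball
  set c := t - r
  set d := t + r
  have hcd : c < d := by simp only [c, d]; linarith
  have hsub : Set.Icc c d ⊆ J ∩ Set.Iio 0 := fun s hs => (hball hs).1
  have hcJ := hsub (Set.left_mem_Icc.2 hcd.le)
  have hdJ := hsub (Set.right_mem_Icc.2 hcd.le)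
  have hc0 : c < 0 := hcJ.2
  have hd0 : d < 0 := hdJ.2
  have hη : 0 < ∫ s in c..d, X.radInt s (ψ s) := by
    refine intervalIntegral.intervalIntegral_pos_of_pos_on
      ((hcont.mono ?_).intervalIntegrable) (fun s hs => (hball (Set.Ioo_subset_Icc_self hs)).2) hcd
    rwa [Set.uIcc_of_le hcd.le]
  have hev2 : ∀ᶠ n in atTop, ∀ s ∈ Set.Icc c d, (l n : ℝ)⁻¹ * s + 0 ∈ I := by
    filter_upwards [(hlim c hcJ.1).1, (hlim d hdJ.1).1] with n h1 h2 s hs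
    refine h.ordConnected.out h1 h2 ⟨?_, ?_⟩
    · simpa using mul_le_mul_of_nonneg_left hs.1 (inv_nonneg.2 (coe_pos (l n)).le)
    · simpa using mul_le_mul_of_nonneg_left hs.2 (inv_nonneg.2 (coe_pos (l n)).le)
  have habs : ∀ s ∈ Set.Icc c d, |s| ≤ |c| := fun s hs => by
    rw [abs_of_neg (hsub hs).2, abs_of_neg hc0]
    linarith [hs.1]
  have hg := goodCoef_radCoef |c|
  obtain ⟨C, hC0, hC⟩ := hg.exists_bound (J := Set.Icc c d) isCompact_Icc fun s hs => (hsub hs).2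
  have hmax := fun n => h.rescale (l n) 0 0
  have hint : Tendsto (fun n => ∫ s in c..d, X.radInt s (X.rescale (l n) 0 0 φ s)) atTop
      (𝓝 (∫ s in c..d, X.radInt s (ψ s))) := by
    have haI : a ∈ I := hI ⟨le_rfl, ha⟩
    refine intervalIntegral.tendsto_integral_filter_of_dominated_convergence
      (fun _ => 9 * C * X.energy (φ a)) ?_ ?_ intervalIntegrable_const ?_
    · filter_upwards [hev2] with n hn
      refine ContinuousOn.aestronglyMeasurable ?_ measurableSet_uIoc
      refine ((hmax n).continuousOn_radInt' fun s hs hs0 => hsupp_n' n s hs hs0).mono fun s hs => ?_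
      rw [Set.uIoc_of_le hcd.le] at hs
      have hs' := Set.Ioc_subset_Icc_self hs
      exact ⟨hn s hs', (hsub hs').2⟩
    · filter_upwards [hev2] with n hn
      refine .of_forall fun s hs => ?_
      rw [Set.uIoc_of_le hcd.le] at hs
      have hs' := Set.Ioc_subset_Icc_self hs
      rw [EnergySpace.radInt_eq_pair (habs s hs') (hsupp_n' n s (hn s hs') (hsub hs').2).ae]
      refine (EnergySpace.abs_pair_le (hC s hs') _).trans_eq ?_
      rw [EnergySpace.rescale, EnergySpace.energy_act, h.energy_eq L haI (hn s hs')]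
    · refine .of_forall fun s hs => ?_
      rw [Set.uIoc_of_le hcd.le] at hs
      have hs' := Set.Ioc_subset_Icc_self hs
      rw [EnergySpace.radInt_eq_pair (habs s hs') (hsuppψ s (hsub hs').1 (hsub hs').2).ae]
      refine Tendsto.congr' ?_ (((EnergySpace.continuous_pair (X := X)
        (hg.continuous (hsub hs').2).aestronglyMeasurable (hC s hs')).tendsto _).comp
        (hlim s (hsub hs').1).2)
      filter_upwards [hev2] with n hn
      exact (EnergySpace.radInt_eq_pair (habs s hs') (hsupp_n' n s (hn s hs') (hsub hs').2).ae).symm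
  have hscale : ∀ᶠ n in atTop, ∫ s in c..d, X.radInt s (X.rescale (l n) 0 0 φ s)
      = ∫ s in (l n : ℝ)⁻¹ * c..(l n : ℝ)⁻¹ * d, X.radInt s (φ s) := by
    filter_upwards [hev2] with n hn
    rw [← intervalIntegral.smul_integral_comp_mul_left (fun s => X.radInt s (φ s)), smul_eq_mul,
      ← intervalIntegral.integral_const_mul]
    refine intervalIntegral.integral_congr fun s hs => ?_
    rw [Set.uIcc_of_le hcd.le] at hs
    have := EnergySpace.radInt_act (hsub hs).2 (l n) (hsupp_n n s (hn s hs) (hsub hs).2)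
    rw [EnergySpace.rescale, this, add_zero]
  obtain ⟨b₀, hb₀, hsmall⟩ := exists_integral_le_of_bounded (F := fun s => X.radInt s (φ s)) ha
    ((h.continuousOn_radInt' hsupp).mono fun s hs => ⟨hI hs, hs.2⟩)
    (fun s => EnergySpace.radInt_nonneg _ _)
    (fun b hb => h.integral_radInt_le L (fun t ht ht0 => (hsupp t ht ht0).ae) (hI ⟨le_rfl, ha⟩)
      (hI hb) hb.1 hb.2) (half_pos hη)
  have hb : ∀ᶠ n in atTop, b₀ < (l n : ℝ)⁻¹ * c := by
    have : Tendsto (fun n => (l n : ℝ)⁻¹ * c) atTop (𝓝 0) := by simpa using hl.mul_const c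
    exact this.eventually_const_lt hb₀.2
  have hle : ∀ᶠ n in atTop, ∫ s in c..d, X.radInt s (X.rescale (l n) 0 0 φ s)
      ≤ (∫ s in c..d, X.radInt s (ψ s)) / 2 := by
    filter_upwards [hscale, hb] with n h1 h2
    have hln := inv_pos.2 (coe_pos (l n))
    rw [h1]
    exact hsmall _ _ h2.le (mul_le_mul_of_nonneg_left hcd.le hln.le)
      (mul_neg_of_pos_of_neg hln hd0)
  have := le_of_tendsto hint hle
  linarith

/-- At a singularity the frequency scale is much larger than the self-similar one. -/
theorem APSol.eventually_le_scale (L : LocalWellPosedness X)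
    (hsol : L.NoTravellingOrSelfSimilarClaim) {K : Set E} {e : ℝ} {I : Set ℝ} {φ : ℝ → E}
    (h : APSol X K e I φ) (h0 : (0 : ℝ) ∉ I) {a : ℝ} (ha : a < 0) (hI : Set.Ico a 0 ⊆ I)
    (hsupp : ∀ t ∈ I, t < 0 → X.SuppIn |t| (φ t)) (M : ℝ) :
    ∃ t₀ < 0, ∀ t ∈ Set.Ioo t₀ 0, ∀ l y, X.act l y (φ t) ∈ K → M ≤ l * |t| := by
  -- Otherwise l|t| < M along times tending to 0, while the lifespan bound gives l|t| ≥ δ. Rescaling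
  -- by |t|⁻¹ is then comparable to the normalisation into `K`, so a limit exists.
  by_contra! hcon
  obtain ⟨δ, hδ, hlife⟩ := L.exists_lifespan h.isCompact
  have hseq : ∀ n : ℕ, max a (-1 / ((n : ℝ) + 1)) < 0 := fun n =>
    max_lt ha (div_neg_of_neg_of_pos (by norm_num) (by positivity))
  choose t ht l y hK hM using fun n => hcon _ (hseq n)
  have ht0 : ∀ n, t n < 0 := fun n => (ht n).2
  have htI : ∀ n, t n ∈ I := fun n => hI ⟨((le_max_left _ _).trans_lt (ht n).1).le, ht0 n⟩
  have htabs : ∀ n, 0 < |t n| := fun n => abs_pos.2 (ht0 n).ne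
  have hδl : ∀ n, δ ≤ l n * |t n| := fun n => by
    by_contra! hlt
    refine h0 (hlife I φ h.toMaxSol (t n) (htI n) (l n) (y n) (hK n) 0 ?_)
    rw [zero_sub, abs_neg, mul_comm]
    exact hlt.le
  have hM0 : 0 < M := hδ.trans_le ((hδl 0).trans (hM 0).le)
  set s : ℕ → Set.Ioi (0 : ℝ) := fun n => mkPos |t n|⁻¹ (inv_pos.2 (htabs n))
  have hs : ∀ n, (s n : ℝ)⁻¹ = |t n| := fun n => inv_inv _
  have hslim : Tendsto (fun n => (s n : ℝ)⁻¹) atTop (𝓝 0) := by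
    simp only [hs]
    refine squeeze_zero (fun n => abs_nonneg _) (fun n => ?_) tendsto_one_div_add_atTop_nhds_zero_nat
    have := (le_max_right a (-1 / ((n : ℝ) + 1))).trans_lt (ht n).1
    rw [abs_of_neg (ht0 n)]
    rw [neg_div] at this
    linarith
  have hm1 : ∀ n, (s n : ℝ)⁻¹ * (-1) + 0 = t n := fun n => by
    rw [hs, abs_of_neg (ht0 n)]
    ring
  have hψ1 : ∀ n, X.rescale (s n) 0 0 φ (-1) = X.act (s n) 0 (φ (t n)) := fun n => by
    rw [EnergySpace.rescale, hm1]
  set k : ℕ → E := fun n => X.act (l n) (y n) (φ (t n))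
  set l' : ℕ → Set.Ioi (0 : ℝ) := fun n => mkPos (s n * EnergySpace.invIoi (l n))
    (mul_pos (coe_pos _) (coe_pos _))
  set y' : ℕ → Plane := fun n => -((l n : ℝ) • y n)
  have hk : ∀ n, X.rescale (s n) 0 0 φ (-1) = X.act (l' n) (y' n) (k n) := fun n => by
    rw [hψ1]
    conv_lhs => rw [← EnergySpace.act_inv (X := X) (l n) (y n) (φ (t n)), EnergySpace.act_act,
      smul_zero, zero_add]
  have hl' : ∀ n, (l' n : ℝ) = (l n * |t n|)⁻¹ := fun n => by
    rw [mul_inv_rev]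
    rfl
  have hl'1 : ∀ n, (l' n : ℝ) ≤ δ⁻¹ := fun n => by
    rw [hl']
    exact inv_anti₀ hδ (hδl n)
  have hl'2 : ∀ n, M⁻¹ ≤ (l' n : ℝ) := fun n => by
    rw [hl']
    exact inv_anti₀ (mul_pos (coe_pos _) (htabs n)) (hM n).le
  obtain ⟨R, hR1, hR⟩ := EnergySpace.exists_tail_le (X := X) h.isCompact
    (show 0 < e / 4 by linarith [h.energy_pos])
  -- At time -1 the rescaled state is supported in the unit ball, and `k n` has its bulk in the ball
  -- of radius `R`, so the centres stay close. The radius 2 is used because the support condition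
  -- speaks of radii above 1.
  have hy' : ∀ n, ‖y' n‖ ≤ R + M * 2 := fun n => by
    by_contra! hlt
    have h1 : X.SuppIn 1 (X.rescale (s n) 0 0 φ (-1)) := by
      have := (hsupp _ (htI n) (ht0 n)).act (s n)
      rwa [← hψ1, ← hs, mul_inv_cancel₀ (coe_pos (s n)).ne'] at this
    have h2 := h1 2 one_lt_two
    rw [hk, EnergySpace.tail_act, smul_zero, zero_sub] at h2
    have h3 : (l' n : ℝ)⁻¹ * 2 ≤ M * 2 := by
      refine mul_le_mul_of_nonneg_right ?_ zero_le_two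
      rw [inv_le_comm₀ (coe_pos _) hM0]
      exact hl'2 n
    have h4 := EnergySpace.energy_le_tail_add_tail (X := X) (c := 0) (c' := -y' n) (r := R)
      (r' := (l' n : ℝ)⁻¹ * 2) (by rw [zero_sub, neg_neg]; linarith) (k n)
    rw [h2, EnergySpace.energy_act, h.energy_eq _ (htI n)] at h4
    linarith [hR _ (hK n), h.energy_pos]
  have hcpt : IsCompact (K ×ˢ Set.Icc M⁻¹ δ⁻¹ ×ˢ Metric.closedBall (0 : Plane) (R + M * 2)) :=
    h.isCompact.prod (isCompact_Icc.prod (isCompact_closedBall _ _))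
  obtain ⟨⟨k₁, l₁, y₁⟩, hmem, σ, hσ, hlim⟩ := hcpt.tendsto_subseq
    (x := fun n => (k n, (l' n : ℝ), y' n))
    fun n => ⟨hK n, ⟨hl'2 n, hl'1 n⟩, by simpa using hy' n⟩
  have h1 := (continuous_fst.tendsto _).comp hlim
  have h2 := ((continuous_fst.comp continuous_snd).tendsto _).comp hlim
  have h3 := ((continuous_snd.comp continuous_snd).tendsto _).comp hlim
  have hl₁ : 0 < l₁ := (inv_pos.2 hM0).trans_le hmem.2.1.1
  have h2' : Tendsto (fun n => l' (σ n)) atTop (𝓝 (mkPos l₁ hl₁)) := tendsto_subtype_rng.2 h2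
  have hΨ := X.tendsto_act h2' h3 h1
  simp only [Function.comp_apply, ← hk] at hΨ
  set Ψ := X.act (mkPos l₁ hl₁) y₁ k₁
  have hAPn : ∀ n, APSol X K e _ (X.rescale (s (σ n)) 0 0 φ) := fun n => h.rescale (s (σ n)) 0 0
  have hmemn : ∀ n, (-1 : ℝ) ∈ (fun r => (s (σ n) : ℝ)⁻¹ * r + 0) ⁻¹' I := fun n => by
    rw [Set.mem_preimage, hm1]
    exact htI _
  have hAP := APSol.limit L hAPn hmemn hΨ
  obtain ⟨hsuppψ, hrad⟩ := h.toMaxSol.radInt_eq_zero_of_rescale L hAP.toMaxSol ha hI hsupp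
    (hslim.comp hσ.tendsto_atTop) fun r hr => hAP.toMaxSol.tendsto L
      (fun n => (hAPn n).toMaxSol) (L.mem_life (-1) Ψ) hmemn (by rwa [L.dev_init]) hr
  -- The lifespan of the limit is not known to contain all negative times, so the extended form of
  -- the exclusion is needed.
  refine hAP.not_selfSimilar L hsol (L.mem_life (-1) Ψ) (by norm_num)
    (fun r hr hr0 => (hsuppψ r hr hr0).ae) fun r hr hr0 => ?_
  have hz := (integral_eq_zero_iff_of_nonneg_ae (by
    filter_upwards [X.physical_ae (L.dev (-1) Ψ r)] with x hx
    exact mul_nonneg (by positivity) (hx.2 _)) ?_).1 (hrad r hr hr0)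
  · filter_upwards [hz] with x hx
    exact (mul_eq_zero.1 hx).resolve_left (pow_pos (inv_pos.2 (abs_pos.2 hr0.ne)) 3).ne'
  · have hg := goodCoef_radCoef |r|
    obtain ⟨C, -, hC⟩ := hg.exists_bound (isCompact_singleton (x := r)) (by simpa using hr0)
    refine (EnergySpace.integrable_contr (X := X) (hg.continuous hr0).aestronglyMeasurable (hC r rfl)
      (L.dev (-1) Ψ r)).congr ?_
    filter_upwards [(hsuppψ r hr hr0).ae] with x hx
    rcases le_or_gt ‖x‖ |r| with hx' | hx'
    · rw [contr_radCoef hx']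
    · simp [hx hx', contr_eq, quad]

end SelfSimilarLimit

/-! ### The total stress-energy tensor -/

/-- The quadratic form `T ↦ quad T w`, as a linear functional of the tensor. -/
def quadL (w : Fin 3 → ℝ) : (Fin 3 → Fin 3 → ℝ) →L[ℝ] ℝ :=
  LinearMap.toContinuousLinearMap
    { toFun := fun T => quad T w
      map_add' := fun S T => by
        simp only [quad, Pi.add_apply, Fin.sum_univ_three]
        ring
      map_smul' := fun c T => by
        simp only [quad, Pi.smul_apply, smul_eq_mul, Fin.sum_univ_three, RingHom.id_apply]
        ring }

section Total

variable {E : Type*} [MetricSpace E] {X : EnergySpace m E}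

/-- The integral of the stress-energy tensor. -/
def EnergySpace.total (X : EnergySpace m E) (Φ : E) : Fin 3 → Fin 3 → ℝ := ∫ x, X.stress Φ x

namespace EnergySpace

theorem continuous_total : Continuous X.total :=
  continuous_integral.comp X.continuous_stress

theorem total_apply (Φ : E) (α β : Fin 3) : X.total Φ α β = ∫ x, X.stress Φ x α β := by
  have h := ((ContinuousLinearMap.proj (R := ℝ) (φ := fun _ : Fin 3 => ℝ) β).comp
    (ContinuousLinearMap.proj (R := ℝ) (φ := fun _ : Fin 3 => Fin 3 → ℝ) α)).integral_comp_comm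
    (X.integrable_stress Φ)
  exact h.symm

theorem quad_total (Φ : E) (w : Fin 3 → ℝ) :
    quad (X.total Φ) w = ∫ x, quad (X.stress Φ x) w :=
  ((quadL w).integral_comp_comm (X.integrable_stress Φ)).symm

theorem total_zero_zero (Φ : E) : X.total Φ 0 0 = X.energy Φ := total_apply Φ 0 0

/-- The physical conditions are linear equations and linear inequalities in the tensor, so they
survive integration. -/
theorem physical_total (Φ : E) : Physical (X.total Φ) := by
  refine ⟨fun α β => ?_, fun w => ?_⟩
  · rw [total_apply, total_apply]
    refine integral_congr_ae ?_
    filter_upwards [X.physical_ae Φ] with x hx using hx.1 α β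
  · rw [quad_total]
    refine integral_nonneg_of_ae ?_
    filter_upwards [X.physical_ae Φ] with x hx using hx.2 w

theorem total_act (l : Set.Ioi (0 : ℝ)) (y : Plane) (Φ : E) :
    X.total (X.act l y Φ) = X.total Φ := by
  funext α β
  have h : ∀ Φ, X.total Φ α β
      = X.pair (fun _ α' β' => if α' = α ∧ β' = β then 1 else 0) Φ := fun Φ => by
    rw [total_apply, pair]
    congr 1
    funext x
    simp [contr_eq, ite_and]
  rw [h, h]
  exact pair_act measurable_const (fun _ => le_rfl) l y Φ

/-- The stress-energy tensor, weighted by a function which is almost constant where most of the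
energy is located. -/
theorem abs_integral_mul_stress_sub_le {u : Plane → ℝ} (hu : Continuous u) {B u₀ κ r : ℝ}
    {c : Plane} (hκ : 0 ≤ κ) (hB : ∀ x, |u x| ≤ B) (hB₀ : |u₀| ≤ B)
    (hr : ∀ x, ‖x - c‖ < r → |u x - u₀| ≤ κ) (Φ : E) (α β : Fin 3) :
    |(∫ x, u x * X.stress Φ x α β) - u₀ * X.total Φ α β|
      ≤ κ * X.energy Φ + 2 * B * X.tail c r Φ := by
  have hi := integrable_entry (X := X) Φ
  have hi1 : Integrable fun x => u x * X.stress Φ x α β :=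
    (hi α β).bdd_mul (c := B) hu.aestronglyMeasurable (.of_forall hB)
  have hi2 : Integrable ({x | r ≤ ‖x - c‖}.indicator fun x => 2 * B * X.stress Φ x 0 0) :=
    ((hi 0 0).const_mul _).indicator (measurableSet_tail c r)
  rw [total_apply, ← integral_const_mul, ← integral_sub hi1 ((hi α β).const_mul _)]
  unfold energy tail
  rw [← integral_const_mul, ← integral_const_mul, ← integral_indicator (measurableSet_tail c r),
    ← integral_add ((hi 0 0).const_mul _) hi2]
  refine norm_integral_le_of_norm_le (f := fun x => u x * X.stress Φ x α β
    - u₀ * X.stress Φ x α β) (((hi 0 0).const_mul _).add hi2) ?_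
  filter_upwards [X.physical_ae Φ] with x hx
  have h0 := hx.energy_nonneg
  rw [← sub_mul, norm_mul, Real.norm_eq_abs, Real.norm_eq_abs]
  have h1 := hx.abs_le α β
  have h2 : |u x - u₀| * |X.stress Φ x α β| ≤ |u x - u₀| * X.stress Φ x 0 0 :=
    mul_le_mul_of_nonneg_left h1 (abs_nonneg _)
  refine h2.trans ?_
  by_cases hx' : x ∈ {x | r ≤ ‖x - c‖}
  · rw [Set.indicator_of_mem hx']
    have h3 : |u x - u₀| ≤ 2 * B := (abs_sub _ _).trans (by linarith [hB x])
    have := mul_le_mul_of_nonneg_right h3 h0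
    nlinarith [mul_nonneg hκ h0]
  · rw [Set.indicator_of_notMem hx', add_zero]
    simp only [Set.mem_ofPred_eq, not_le] at hx'
    exact mul_le_mul_of_nonneg_right (hr x hx') h0

end EnergySpace

/-- A bounded smooth function which is the identity near the origin. -/
theorem exists_truncation : ∃ (θ : ℝ → ℝ) (B : ℝ), 1 ≤ B ∧ ContDiff ℝ 1 θ ∧ θ 0 = 0 ∧
    (∀ u, |θ u| ≤ B) ∧ (∀ u, |deriv θ u| ≤ B) ∧ (∀ u, |u| < 2 → deriv θ u = 1) ∧
    ∀ u v, |θ u - θ v| ≤ B * |u - v| := by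
  let f : ContDiffBump (0 : ℝ) := ⟨2, 3, by norm_num, by norm_num⟩
  set θ : ℝ → ℝ := fun u => f u * u
  have hθ : ContDiff ℝ 1 θ := f.contDiff.mul contDiff_id
  have hc : HasCompactSupport θ := f.hasCompactSupport.mul_right
  obtain ⟨A, hA⟩ := hc.exists_bound_of_continuous hθ.continuous
  obtain ⟨C, hC⟩ := hc.deriv.exists_bound_of_continuous (hθ.continuous_deriv le_rfl)
  have hC' : ∀ u, ‖deriv θ u‖ ≤ max 1 (max A C) := fun u =>
    (hC u).trans ((le_max_right _ _).trans (le_max_right _ _))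
  refine ⟨θ, max 1 (max A C), le_max_left _ _, hθ, by simp [θ], fun u => (hA u).trans
    ((le_max_left _ _).trans (le_max_right _ _)), hC', fun u hu => ?_, fun u v => ?_⟩
  · have : θ =ᶠ[𝓝 u] id := by
      filter_upwards [(isOpen_lt continuous_abs continuous_const).mem_nhds hu] with r hr
      have : f r = 1 := f.one_of_mem_closedBall (by
        simpa [f] using (le_of_lt hr : |r| ≤ 2))
      simp [θ, this]
    rw [this.deriv_eq]
    exact deriv_id u
  · exact convex_univ.norm_image_sub_le_of_norm_deriv_le
      (fun x _ => hθ.differentiable one_ne_zero x) (fun x _ => hC' x) (Set.mem_univ v)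
      (Set.mem_univ u)

/-! ### Conservation of momentum and the virial identity -/

theorem hasFDerivAt_comp_coord {θ : ℝ → ℝ} (hθ : ContDiff ℝ 1 θ) (i : Fin 2) (z : ℝ × Plane) :
    HasFDerivAt (fun z : ℝ × Plane => θ (z.2 i)) (deriv θ (z.2 i) •
      (coordL i.succ).comp (ContinuousLinearMap.snd ℝ ℝ Plane)) z :=
  (hθ.differentiable one_ne_zero _).hasDerivAt.comp_hasFDerivAt z
    ((coordL i.succ).comp (ContinuousLinearMap.snd ℝ ℝ Plane)).hasFDerivAt

namespace MaxSol

variable {I : Set ℝ} {φ : ℝ → E}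

/-- Conservation of momentum. -/
theorem total_zero_eq (L : LocalWellPosedness X) (h : MaxSol X I φ) (γ : Fin 3) {a b : ℝ}
    (ha : a ∈ I) (hb : b ∈ I) : X.total (φ b) 0 γ = X.total (φ a) 0 γ := by
  have := h.law L isOpen_univ Set.ordConnected_univ (c1w_compField (c1w_const Set.univ 1) γ) ha hb
    (Set.subset_univ _)
  simp only [EnergySpace.pair, contr_momCoef_compField, contr_fluxCoef_compField, one_mul,
    fderiv_fun_const, Pi.zero_apply, _root_.zero_apply, zero_mul, sub_self,
    integral_zero, intervalIntegral.integral_zero] at this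
  rw [EnergySpace.total_apply, EnergySpace.total_apply]
  linarith

/-- The virial identity for the truncated coordinate `x_i`. -/
theorem virial_eq (L : LocalWellPosedness X) (h : MaxSol X I φ) {θ : ℝ → ℝ} (hθ : ContDiff ℝ 1 θ)
    {B : ℝ} (hB : ∀ u, |θ u| ≤ B) (hB' : ∀ u, |deriv θ u| ≤ B) (i : Fin 2) (γ : Fin 3) {a b : ℝ}
    (ha : a ∈ I) (hb : b ∈ I) :
    ContinuousOn (fun s => ∫ x : Plane, deriv θ (x i) * X.stress (φ s) x i.succ γ) I ∧
    (∫ x : Plane, θ (x i) * X.stress (φ b) x 0 γ) - ∫ x : Plane, θ (x i) * X.stress (φ a) x 0 γ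
      = -∫ s in a..b, ∫ x : Plane, deriv θ (x i) * X.stress (φ s) x i.succ γ := by
  set F : ℝ × Plane → ℝ := fun z => θ (z.2 i) with hF
  have hd := hasFDerivAt_comp_coord hθ i
  have hc : C1W (fun _ => 1) Set.univ F := by
    refine c1w_comp (A := B) (B := B)
      (C := ‖(coordL i.succ).comp (ContinuousLinearMap.snd ℝ ℝ Plane)‖)
      ((coordL i.succ).comp (ContinuousLinearMap.snd ℝ ℝ Plane)).contDiff.contDiffOn hθ
      isOpen_univ hB (fun u => ?_) fun t _ x => ?_
    · rw [← norm_deriv_eq_norm_fderiv]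
      exact hB' u
    · exact (congrArg norm ((coordL i.succ).comp
        (ContinuousLinearMap.snd ℝ ℝ Plane)).hasFDerivAt.fderiv).le
  have hflux : ∀ s Φ, X.pair (fluxCoef (compField γ F) s) Φ
      = -∫ x : Plane, deriv θ (x i) * X.stress Φ x i.succ γ := by
    intro s Φ
    rw [EnergySpace.pair, ← integral_neg]
    congr 1
    funext x
    rw [contr_fluxCoef_compField, (hd (s, x)).fderiv]
    have c1 : ∀ w, coordL 1 w = w 0 := fun _ => rfl
    have c2 : ∀ w, coordL 2 w = w 1 := fun _ => rfl
    have b0 : basisVec 0 = ((1 : ℝ), (0 : Plane)) := rfl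
    fin_cases i <;> simp [c1, c2, b0, basisVec_one, basisVec_two]
  have hcont := (GoodCoef.fluxCoef isOpen_univ fun β => c1w_compField hc γ β).mono
    (Set.subset_univ I) |>.continuousOn_pair (X := X) h.isOpen h.continuousOn
  simp only [hflux] at hcont
  refine ⟨hcont.neg.congr fun s _ => (neg_neg _).symm, ?_⟩
  have := h.law L isOpen_univ Set.ordConnected_univ (c1w_compField hc γ) ha hb (Set.subset_univ _)
  simp only [hflux, intervalIntegral.integral_neg] at this
  simpa only [EnergySpace.pair, contr_momCoef_compField] using this

end MaxSol

end Total

/-! ### The virial estimate -/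

section Virial

variable {E : Type*} [MetricSpace E] {X : EnergySpace m E}

/-- The velocity of the center of energy. -/
def EnergySpace.velocity (X : EnergySpace m E) (Φ : E) : Plane :=
  WithLp.toLp 2 fun i => -(X.total Φ 0 i.succ / X.energy Φ)

/-- The integral of `|∂_t φ + v · ∇ φ|²`. -/
def EnergySpace.drift (X : EnergySpace m E) (v : Plane) (Φ : E) : ℝ :=
  quad (X.total Φ) (spacetimeVec 1 v)

namespace EnergySpace

/-- The momentum bound for the total tensor, applied in the direction of the velocity itself. At
zero energy the velocity is 0 by the convention for division. -/
theorem norm_velocity_le (Φ : E) : ‖X.velocity Φ‖ ≤ 1 := by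
  rcases (energy_nonneg (X := X) Φ).eq_or_lt with h | h
  · have : X.velocity Φ = 0 := by
      ext i
      simp [velocity, ← h]
    simp [this]
  set v := X.velocity Φ with hv
  have hv0 : X.total Φ 0 1 = -(v 0 * X.energy Φ) := by
    simp only [hv, velocity, Fin.succ_zero_eq_one]
    field_simp
  have hv1 : X.total Φ 0 2 = -(v 1 * X.energy Φ) := by
    simp only [hv, velocity, Fin.succ_one_eq_two]
    field_simp
  have h1 := (physical_total (X := X) Φ).abs_momentum_le (-v 0) (-v 1)
  rw [hv0, hv1, total_zero_zero, neg_sq, neg_sq, ← norm_sq_plane, Real.sqrt_sq (norm_nonneg v)] at h1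
  have h2 := norm_sq_plane v
  have h3 : ‖v‖ ^ 2 * X.energy Φ ≤ ‖v‖ * X.energy Φ := by
    refine le_trans (le_of_eq ?_) ((le_abs_self _).trans h1)
    rw [h2]
    ring
  have h4 := le_of_mul_le_mul_right h3 h
  nlinarith [norm_nonneg v]

theorem velocity_act (l : Set.Ioi (0 : ℝ)) (y : Plane) (Φ : E) :
    X.velocity (X.act l y Φ) = X.velocity Φ := by
  simp only [velocity, total_act, energy_act]

theorem drift_act (v : Plane) (l : Set.Ioi (0 : ℝ)) (y : Plane) (Φ : E) :
    X.drift v (X.act l y Φ) = X.drift v Φ := by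
  simp only [drift, total_act]

theorem drift_nonneg (v : Plane) (Φ : E) : 0 ≤ X.drift v Φ := (physical_total Φ).2 _

theorem continuous_drift (v : Plane) : Continuous (X.drift v) :=
  (quadL (spacetimeVec 1 v)).continuous.comp continuous_total

theorem ae_quad_eq_zero {v : Plane} {Φ : E} (h : X.drift v Φ = 0) :
    ∀ᵐ x, quad (X.stress Φ x) (spacetimeVec 1 v) = 0 := by
  rw [drift, quad_total] at h
  exact (integral_eq_zero_iff_of_nonneg_ae ((X.physical_ae Φ).mono fun x hx => hx.2 _)
    ((quadL _).integrable_comp (X.integrable_stress Φ))).1 h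

end EnergySpace

/-- If the time averages of the momentum fluxes nearly agree with those of a point mass, then the
tensor nearly travels with the velocity of the mass. -/
theorem quad_le_of_virial {S : Fin 3 → Fin 3 → ℝ} (hS : Physical S) {v : Plane}
    (hv : ‖v‖ ≤ 1) (hv0 : S 0 1 = -(v 0 * S 0 0)) (hv1 : S 0 2 = -(v 1 * S 0 0)) {z : Fin 2 → ℝ}
    {κ : ℝ} (hκ : ∀ i γ, |z i * S 0 γ + S i.succ γ| ≤ κ) :
    quad S (spacetimeVec 1 v) ≤ 8 * κ := by
  have hv2 : v 0 ^ 2 + v 1 ^ 2 ≤ 1 := by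
    rw [← norm_sq_plane]
    exact pow_le_one₀ (norm_nonneg v) hv
  have a0 : |v 0| ≤ 1 := abs_le_one_iff_mul_self_le_one.2 (by nlinarith [sq_nonneg (v 1)])
  have a1 : |v 1| ≤ 1 := abs_le_one_iff_mul_self_le_one.2 (by nlinarith [sq_nonneg (v 0)])
  have hκ0 : 0 ≤ κ := (abs_nonneg _).trans (hκ 0 0)
  set d : Fin 2 → Fin 3 → ℝ := fun i γ => z i * S 0 γ + S i.succ γ with hd
  have herr : ∀ (i γ) (a : ℝ), |a| ≤ 1 → |d i γ + d i 0 * a| ≤ 2 * κ := fun i γ a ha => by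
    refine (abs_add_le _ _).trans ?_
    rw [abs_mul, two_mul]
    exact add_le_add (hκ i γ) ((mul_le_of_le_one_right (abs_nonneg _) ha).trans (hκ i 0))
  have e11 := abs_le.1 (herr 0 1 (v 0) a0)
  have e12 := abs_le.1 (herr 0 2 (v 1) a1)
  have e22 := abs_le.1 (herr 1 2 (v 1) a1)
  -- Since S₀ⱼ = -vⱼS₀₀, the unknown displacement `z` drops out of d_{ij} + d_{i0}vⱼ, leaving S_{ij}
  -- - vᵢvⱼS₀₀. The form at (1, v) is a combination of these small quantities.
  have key : quad S (spacetimeVec 1 v) = (1 - v 1 ^ 2) * (d 0 1 + d 0 0 * v 0)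
      + (1 - v 0 ^ 2) * (d 1 2 + d 1 0 * v 1) + 2 * (v 0 * v 1) * (d 0 2 + d 0 0 * v 1) := by
    rw [quad_explicit S hS.1]
    simp only [spacetimeVec_zero, spacetimeVec_one, spacetimeVec_two, hd, Fin.succ_zero_eq_one,
      Fin.succ_one_eq_two, hv0, hv1, hS.1 1 0, hS.1 2 0]
    ring
  rw [key]
  have b1 : (1 - v 1 ^ 2) * (d 0 1 + d 0 0 * v 0) ≤ 2 * κ := by nlinarith [sq_nonneg (v 0)]
  have b2 : (1 - v 0 ^ 2) * (d 1 2 + d 1 0 * v 1) ≤ 2 * κ := by nlinarith [sq_nonneg (v 1)]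
  have hv3 : 2 * |v 0 * v 1| ≤ 1 := by
    rw [abs_mul]
    nlinarith [sq_nonneg (|v 0| - |v 1|), sq_abs (v 0), sq_abs (v 1)]
  have b3 : 2 * (v 0 * v 1) * (d 0 2 + d 0 0 * v 1) ≤ 2 * κ := by
    refine (le_abs_self _).trans ?_
    rw [abs_mul, abs_mul, abs_two]
    exact (mul_le_of_le_one_left (abs_nonneg _) hv3).trans (herr 0 2 (v 1) a1)
  linarith

/-- The virial estimate on the unit time interval: if the solution is concentrated at both ends,
it nearly travels. -/
theorem APSol.exists_integral_drift_le_unit (L : LocalWellPosedness X) {K : Set E}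
    (hK : IsCompact K) {e : ℝ} (he : 0 < e) {ε : ℝ} (hε : 0 < ε) :
    ∃ M, ∀ (I : Set ℝ) (φ : ℝ → E), APSol X K e I φ → 0 ∈ I → 1 ∈ I → ∀ l l' y',
      X.act l 0 (φ 0) ∈ K → X.act l' y' (φ 1) ∈ K → M ≤ (l : ℝ) → M ≤ (l' : ℝ) →
      ∫ s in (0 : ℝ)..1, X.drift (X.velocity (φ 0)) (φ s) ≤ ε := by
  obtain ⟨θ, B, hB1, hθ, hθ0, hθB, hθB', hθ1, hθL⟩ := exists_truncation
  have hB0 : 0 < B := one_pos.trans_le hB1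
  -- Chosen so that 6Bε₁ = ε/16; then κ below is ε/8, and `quad_le_of_virial` returns exactly ε.
  set ε₁ := ε / (96 * B) with hε₁
  obtain ⟨R, hR1, hR⟩ := EnergySpace.exists_tail_le (X := X) hK (show 0 < ε₁ by positivity)
  have hR0 : 0 < R := one_pos.trans_le hR1
  -- The first entry keeps the concentration radius R/l below 1/2, the second keeps the variation of
  -- the truncated coordinate over that ball, times the energy, below ε/32.
  refine ⟨max (2 * R) (32 * B * R * e / ε), fun I φ h h0 h1 l l' y' hl hl' hMl hMl' => ?_⟩
  have hsub : Set.Icc (0 : ℝ) 1 ⊆ I := h.ordConnected.out h0 h1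
  have hsub' : Set.uIcc (0 : ℝ) 1 ⊆ I := h.ordConnected.uIcc_subset h0 h1
  have hscale : ∀ l : Set.Ioi (0 : ℝ), max (2 * R) (32 * B * R * e / ε) ≤ (l : ℝ) →
      (l : ℝ)⁻¹ * R ≤ 1 / 2 ∧ B * ((l : ℝ)⁻¹ * R) * e ≤ ε / 32 := fun l hl => by
    have hlp := coe_pos l
    have h1 := (le_max_left _ _).trans hl
    have h2 := (le_max_right _ _).trans hl
    rw [div_le_iff₀ hε] at h2
    constructor
    · rw [inv_mul_le_iff₀ hlp]
      linarith
    · rw [show B * ((l : ℝ)⁻¹ * R) * e = (l : ℝ)⁻¹ * (B * R * e) by ring, inv_mul_le_iff₀ hlp]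
      linarith
  obtain ⟨hl1, hl2⟩ := hscale l hMl
  obtain ⟨hl1', hl2'⟩ := hscale l' hMl'
  have ht0 : X.tail 0 ((l : ℝ)⁻¹ * R) (φ 0) ≤ ε₁ := by
    have := hR _ hl
    rwa [EnergySpace.tail_act, smul_zero, sub_zero] at this
  have ht1 : X.tail (-y') ((l' : ℝ)⁻¹ * R) (φ 1) ≤ ε₁ := by
    have := hR _ hl'
    rwa [EnergySpace.tail_act, smul_zero, zero_sub] at this
  -- Starting within radius 1/2 at time 0, the bulk stays for unit time in the ball of radius 2,
  -- where the truncation is the identity.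
  have hts : ∀ s ∈ Set.Icc (0 : ℝ) 1, X.tail 0 2 (φ s) ≤ ε₁ := fun s hs => by
    have h2 := h.toMaxSol.tail_le L (hsub hs) h0 0 (1 / 2) (δ := 3 / 2 - s) (by linarith [hs.2])
    rw [sub_zero, abs_of_nonneg hs.1] at h2
    rw [show 1 / 2 + (3 / 2 - s) + s = 2 by ring] at h2
    exact h2.trans ((EnergySpace.tail_anti hl1 _).trans ht0)
  have hcoord : ∀ (i : Fin 2) (c x : Plane), |x i - c i| ≤ ‖x - c‖ := fun i c x =>
    PiLp.norm_apply_le (x - c) i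
  have hθc : ∀ i : Fin 2, Continuous fun x : Plane => θ (x i) := fun i =>
    hθ.continuous.comp (coordL i.succ).continuous
  have hθc' : ∀ i : Fin 2, Continuous fun x : Plane => deriv θ (x i) := fun i =>
    (hθ.continuous_deriv le_rfl).comp (coordL i.succ).continuous
  set κ := ε / 32 + ε / 32 + 6 * B * ε₁ with hκ
  have hκε : 8 * κ = ε := by
    rw [hκ, hε₁]
    field_simp
    norm_num
  set S : Fin 3 → Fin 3 → ℝ := ∫ s in (0 : ℝ)..1, X.total (φ s) with hSdef
  have hcont : ContinuousOn (fun s => X.total (φ s)) (Set.uIcc 0 1) :=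
    EnergySpace.continuous_total.comp_continuousOn (h.continuousOn.mono hsub')
  have hSe : ∀ α β, S α β = ∫ s in (0 : ℝ)..1, X.total (φ s) α β := fun α β =>
    (((ContinuousLinearMap.proj (R := ℝ) (φ := fun _ : Fin 3 => ℝ) β).comp
      (ContinuousLinearMap.proj (R := ℝ) (φ := fun _ : Fin 3 => Fin 3 → ℝ)
        α)).intervalIntegral_comp_comm hcont.intervalIntegrable).symm
  have hSq : ∀ w, quad S w = ∫ s in (0 : ℝ)..1, quad (X.total (φ s)) w := fun w =>
    ((quadL w).intervalIntegral_comp_comm hcont.intervalIntegrable).symm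
  have hSphys : Physical S := by
    refine ⟨fun α β => ?_, fun w => ?_⟩
    · rw [hSe, hSe]
      simp only [(EnergySpace.physical_total _).1 α β]
    · rw [hSq]
      exact intervalIntegral.integral_nonneg zero_le_one fun s _ =>
        (EnergySpace.physical_total _).2 w
  have hS0 : ∀ γ, ∀ s ∈ Set.uIcc (0 : ℝ) 1, X.total (φ s) 0 γ = S 0 γ := fun γ => by
    have h2 : ∀ s ∈ Set.uIcc (0 : ℝ) 1, X.total (φ s) 0 γ = X.total (φ 0) 0 γ := fun s hs =>
      h.toMaxSol.total_zero_eq L γ h0 (hsub' hs)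
    have h3 : S 0 γ = X.total (φ 0) 0 γ := by
      rw [hSe, intervalIntegral.integral_congr h2]
      simp
    exact fun s hs => (h2 s hs).trans h3.symm
  have hSe0 : S 0 0 = e := by
    rw [← hS0 0 0 Set.left_mem_uIcc, EnergySpace.total_zero_zero, h.energy_eq 0 h0]
  have hv : ∀ i : Fin 2, S 0 i.succ = -(X.velocity (φ 0) i * S 0 0) := fun i => by
    rw [hSe0, ← hS0 _ 0 Set.left_mem_uIcc]
    simp only [EnergySpace.velocity, h.energy_eq 0 h0]
    field_simp
  -- The truncated first moment of T₀γ goes from about 0 to about θ(-y'ᵢ) S₀γ, and its total change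
  -- is minus the time integral of θ'T_{iγ}, nearly -S_{iγ}. Each of the three approximations loses
  -- a tail term 2Bε₁.
  have main : ∀ i γ, |θ ((-y') i) * S 0 γ + S i.succ γ| ≤ κ := by
    intro i γ
    obtain ⟨hvc, hvir⟩ := h.toMaxSol.virial_eq L hθ hθB hθB' i γ h0 h1
    have k0 := EnergySpace.abs_integral_mul_stress_sub_le (X := X) (hθc i) (κ := B * ((l : ℝ)⁻¹ * R))
      (by have := inv_pos.2 (coe_pos l); positivity) (fun x => hθB (x i))
      (u₀ := 0) (by simpa using hB0.le) (c := 0) (r := (l : ℝ)⁻¹ * R) (fun x hx => by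
        have h2 := hθL (x i) 0
        have h3 := hcoord i 0 x
        rw [hθ0] at h2
        simp only [PiLp.zero_apply] at h3
        exact h2.trans (mul_le_mul_of_nonneg_left (h3.trans hx.le) hB0.le)) (φ 0) 0 γ
    have k1 := EnergySpace.abs_integral_mul_stress_sub_le (X := X) (hθc i) (κ := B * ((l' : ℝ)⁻¹ * R))
      (by have := inv_pos.2 (coe_pos l'); positivity) (fun x => hθB (x i))
      (u₀ := θ ((-y') i)) (hθB _) (c := -y') (r := (l' : ℝ)⁻¹ * R) (fun x hx =>
        (hθL _ _).trans (mul_le_mul_of_nonneg_left ((hcoord i _ x).trans hx.le) hB0.le)) (φ 1) 0 γ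
    rw [h.energy_eq 0 h0, zero_mul, sub_zero] at k0
    rw [h.energy_eq 1 h1, hS0 γ 1 Set.right_mem_uIcc] at k1
    have ks : |(∫ s in (0 : ℝ)..1, ∫ x : Plane, deriv θ (x i) * X.stress (φ s) x i.succ γ)
        - S i.succ γ| ≤ 2 * B * ε₁ := by
      have hvc' := (hvc.mono hsub').intervalIntegrable (μ := volume)
      have hc2 : IntervalIntegrable (fun s => X.total (φ s) i.succ γ) volume 0 1 :=
        (((continuous_apply γ).comp (continuous_apply i.succ)).comp_continuousOn
          hcont).intervalIntegrable
      rw [hSe, ← intervalIntegral.integral_sub hvc' hc2, ← Real.norm_eq_abs]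
      refine le_of_le_of_eq (b := 2 * B * ε₁ * |(1 : ℝ) - 0|)
        (intervalIntegral.norm_integral_le_of_norm_le_const fun s hs => ?_) (by simp)
      rw [Set.uIoc_of_le zero_le_one] at hs
      have hs' : s ∈ Set.Icc (0 : ℝ) 1 := Set.Ioc_subset_Icc_self hs
      have k := EnergySpace.abs_integral_mul_stress_sub_le (X := X) (hθc' i) (κ := 0) le_rfl
        (fun x => hθB' (x i)) (u₀ := 1) (by simpa using hB1) (c := 0) (r := 2) (fun x hx => by
          have h3 := hcoord i 0 x
          simp only [PiLp.zero_apply, sub_zero] at h3 hx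
          simp [hθ1 _ (h3.trans_lt hx)]) (φ s) i.succ γ
      rw [one_mul, zero_mul, zero_add] at k
      exact k.trans (mul_le_mul_of_nonneg_left (hts s hs') (by positivity))
    have p0 := mul_le_mul_of_nonneg_left ht0 (by positivity : 0 ≤ 2 * B)
    have p1 := mul_le_mul_of_nonneg_left ht1 (by positivity : 0 ≤ 2 * B)
    rw [abs_le] at k0 k1 ks ⊢
    constructor <;> linarith [k0.1, k0.2, k1.1, k1.2, ks.1, ks.2]
  have hfin := quad_le_of_virial hSphys (EnergySpace.norm_velocity_le (φ 0)) (hv 0)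
    (hv 1) main
  rw [hSq, hκε] at hfin
  exact hfin

/-- The virial estimate: if the frequency scales at both ends of a time interval are large compared
to its length, then the solution nearly travels. -/
theorem APSol.exists_integral_drift_le (L : LocalWellPosedness X) {K : Set E}
    (hK : IsCompact K) {e : ℝ} (he : 0 < e) {ε : ℝ} (hε : 0 < ε) :
    ∃ M, ∀ (I : Set ℝ) (φ : ℝ → E), APSol X K e I φ → ∀ a b, a < b → a ∈ I → b ∈ I → ∀ l l' y y',
      X.act l y (φ a) ∈ K → X.act l' y' (φ b) ∈ K → M ≤ l * (b - a) → M ≤ l' * (b - a) →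
      ∫ s in a..b, X.drift (X.velocity (φ a)) (φ s) ≤ ε * (b - a) := by
  obtain ⟨M, hM⟩ := APSol.exists_integral_drift_le_unit L hK he hε
  refine ⟨M, fun I φ h a b hab ha hb l l' y y' hl hl' hMl hMl' => ?_⟩
  have hba : 0 < b - a := sub_pos.2 hab
  -- Rescaling by (b - a)⁻¹ and translating by `y` turn the interval into [0, 1] and move the centre
  -- at time `a` to the origin.
  set k : Set.Ioi (0 : ℝ) := mkPos (b - a)⁻¹ (inv_pos.2 hba)
  have hk : (k : ℝ)⁻¹ = b - a := inv_inv _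
  have e0 : (k : ℝ)⁻¹ * 0 + a = a := by ring
  have e1 : (k : ℝ)⁻¹ * 1 + a = b := by rw [hk]; ring
  have hψ0 : X.rescale k y a φ 0 = X.act k y (φ a) := by rw [EnergySpace.rescale, e0]
  have hψ1 : X.rescale k y a φ 1 = X.act k y (φ b) := by rw [EnergySpace.rescale, e1]
  have conj : ∀ (l : Set.Ioi (0 : ℝ)) (y' : Plane) (Φ : E), X.act l y' Φ
      = X.act (mkPos (l * EnergySpace.invIoi k) (mul_pos (coe_pos _) (coe_pos _)))
        ((EnergySpace.invIoi k : ℝ)⁻¹ • y' + -((k : ℝ) • y)) (X.act k y Φ) := fun l y' Φ => by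
    conv_lhs => rw [← EnergySpace.act_inv (X := X) k y Φ, EnergySpace.act_act]
  have hz : (EnergySpace.invIoi k : ℝ)⁻¹ • y + -((k : ℝ) • y) = 0 := by
    rw [show (EnergySpace.invIoi k : ℝ)⁻¹ = k from inv_inv _, add_neg_cancel]
  rw [conj, hz, ← hψ0] at hl
  rw [conj, ← hψ1] at hl'
  have hs : ∀ l : Set.Ioi (0 : ℝ), (l : ℝ) * EnergySpace.invIoi k = l * (b - a) := fun l => by
    rw [← hk]
    rfl
  have h2 := hM _ _ (h.rescale k y a) (by rwa [Set.mem_preimage, e0]) (by rwa [Set.mem_preimage, e1])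
    _ _ _ hl hl' (by rwa [coe_mkPos, hs]) (by rwa [coe_mkPos, hs])
  rw [hψ0] at h2
  simp only [EnergySpace.velocity_act, EnergySpace.rescale, EnergySpace.drift_act] at h2
  rw [intervalIntegral.integral_comp_mul_add (fun s => X.drift (X.velocity (φ a)) (φ s))
    (inv_pos.2 (coe_pos k)).ne' a, e0, e1, smul_eq_mul, inv_inv] at h2
  rw [← hk]
  rwa [← div_eq_mul_inv, le_div_iff₀' (coe_pos k)]

end Virial

/-! ### Limits at small scales are travelling -/

/-- A weak type maximal inequality on the real line. -/
theorem mul_volume_le_of_closedBall {f : ℝ → ENNReal} {η : ENNReal} {S W : Set ℝ} {r : ℝ → ℝ} {R : ℝ}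
    (hr : ∀ t ∈ S, 0 < r t) (hR : ∀ t ∈ S, r t ≤ R)
    (hW : ∀ t ∈ S, Metric.closedBall t (r t) ⊆ W)
    (hf : ∀ t ∈ S, η * volume (Metric.closedBall t (r t)) ≤ ∫⁻ s in Metric.closedBall t (r t), f s) :
    η * volume S ≤ 5 * ∫⁻ s in W, f s := by
  -- The fivefold enlargements of the disjoint subfamily cover `S`, which is the source of the
  -- constant 5.
  obtain ⟨u, huS, hdisj, hcov⟩ := Vitali.exists_disjoint_subfamily_covering_enlargement_closedBall S
    id r R hR 5 (by norm_num)
  simp only [id] at hdisj hcov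
  have hu : u.Countable := hdisj.countable_of_nonempty_interior fun t ht => by
    rw [interior_closedBall _ (hr t (huS ht)).ne']
    exact Metric.nonempty_ball.2 (hr t (huS ht))
  have hsub : S ⊆ ⋃ t ∈ u, Metric.closedBall t (5 * r t) := fun t ht => by
    obtain ⟨b, hb, hsub⟩ := hcov t ht
    exact Set.mem_biUnion hb (hsub (Metric.mem_closedBall_self (hr t ht).le))
  have hvol : ∀ t : ℝ, volume (Metric.closedBall t (5 * r t))
      = 5 * volume (Metric.closedBall t (r t)) := fun t => by
    rw [Real.volume_closedBall, Real.volume_closedBall, mul_left_comm,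
      ENNReal.ofReal_mul (by norm_num)]
    norm_num
  calc η * volume S ≤ η * ∑' t : u, 5 * volume (Metric.closedBall (t : ℝ) (r t)) := by
        gcongr
        refine (measure_mono hsub).trans ((measure_biUnion_le volume hu _).trans_eq ?_)
        simp only [hvol]
    _ = 5 * ∑' t : u, η * volume (Metric.closedBall (t : ℝ) (r t)) := by
        rw [ENNReal.tsum_mul_left, ENNReal.tsum_mul_left]
        ring
    _ ≤ 5 * ∑' t : u, ∫⁻ s in Metric.closedBall (t : ℝ) (r t), f s := by
        gcongr with t
        exact hf t (huS t.2)
    _ = 5 * ∫⁻ s in ⋃ t ∈ u, Metric.closedBall t (r t), f s := by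
        rw [lintegral_biUnion hu (fun t _ => Metric.isClosed_closedBall.measurableSet) hdisj]
    _ ≤ 5 * ∫⁻ s in W, f s := by
        gcongr
        exact Set.iUnion₂_subset fun t ht => hW t (huS ht)

/-- If a nonnegative function has a small integral over an interval, then among given intervals
around the points of a large set there is one on which its average is small. -/
theorem exists_integral_le_of_integral_lt {f : ℝ → ℝ} {a b c d : ℝ} (hab : a ≤ b)
    (hf : ContinuousOn f (Set.Icc a b)) (hf0 : ∀ s, 0 ≤ f s) {η : ℝ} (hη : 0 ≤ η) {r : ℝ → ℝ} {R : ℝ}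
    (hr : ∀ t ∈ Set.Icc c d, 0 < r t) (hR : ∀ t ∈ Set.Icc c d, r t ≤ R)
    (hsub : ∀ t ∈ Set.Icc c d, Set.Icc (t - r t) (t + r t) ⊆ Set.Icc a b)
    (hint : 5 * ∫ s in a..b, f s < η * (d - c)) :
    ∃ t ∈ Set.Icc c d, ∫ s in (t - r t)..(t + r t), f s ≤ η * (2 * r t) := by
  by_contra! hcon
  have hconv : ∀ a' b', a' ≤ b' → Set.Icc a' b' ⊆ Set.Icc a b →
      ∫⁻ s in Set.Icc a' b', ENNReal.ofReal (f s) = ENNReal.ofReal (∫ s in a'..b', f s) := by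
    intro a' b' hab' hs
    rw [intervalIntegral.integral_of_le hab', ← integral_Icc_eq_integral_Ioc,
      ofReal_integral_eq_lintegral_ofReal ((hf.mono hs).integrableOn_compact isCompact_Icc)
        (.of_forall hf0)]
  have h := mul_volume_le_of_closedBall (f := fun s => ENNReal.ofReal (f s)) (η := ENNReal.ofReal η)
    (W := Set.Icc a b) hr hR (fun t ht => by rw [Real.closedBall_eq_Icc]; exact hsub t ht)
    fun t ht => by
      rw [Real.volume_closedBall, Real.closedBall_eq_Icc, hconv _ _ (by linarith [hr t ht])
        (hsub t ht), ← ENNReal.ofReal_mul hη]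
      exact ENNReal.ofReal_le_ofReal (hcon t ht).le
  have h0 : 0 ≤ ∫ s in a..b, f s := intervalIntegral.integral_nonneg hab fun s _ => hf0 s
  rw [Real.volume_Icc, hconv a b hab le_rfl, ← ENNReal.ofReal_mul hη,
    show (5 : ENNReal) = ENNReal.ofReal 5 by norm_num, ← ENNReal.ofReal_mul (by norm_num),
    ENNReal.ofReal_le_ofReal_iff (by positivity)] at h
  linarith

section TravellingLimit

variable {E : Type*} [MetricSpace E] {X : EnergySpace m E}

theorem APSol.velocity_eq (L : LocalWellPosedness X) {K : Set E} {e : ℝ} {I : Set ℝ} {φ : ℝ → E}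
    (h : APSol X K e I φ) {a b : ℝ} (ha : a ∈ I) (hb : b ∈ I) :
    X.velocity (φ b) = X.velocity (φ a) := by
  simp only [EnergySpace.velocity, h.toMaxSol.total_zero_eq L _ ha hb, h.energy_eq _ ha,
    h.energy_eq _ hb]

/-- Between times at which the frequency scale is large there are times around which the solution
nearly travels, on long intervals at the frequency scale. -/
theorem APSol.exists_integral_drift_le_of_scale (L : LocalWellPosedness X) {K : Set E} {e : ℝ}
    {I : Set ℝ} {φ : ℝ → E} (h : APSol X K e I φ) {a : ℝ} (ha : a ∈ I)
    (H : ∀ M : ℝ, ∃ τ > 0, Set.Icc (-(4 * τ)) (-τ) ⊆ I ∧ ∀ t ∈ Set.Icc (-(4 * τ)) (-τ), ∀ l y,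
      X.act l y (φ t) ∈ K → M ≤ l * |t|) {A η : ℝ} (hA : 0 < A) (hη : 0 < η) :
    ∃ t l y, X.act l y (φ t) ∈ K ∧ Set.Icc (t - A / l) (t + A / l) ⊆ I ∧
      ∫ s in (t - A / l)..(t + A / l), X.drift (X.velocity (φ a)) (φ s) ≤ η * (2 * (A / l)) := by
  -- The covering loses 5 and the interval [-4τ, -τ] is three times as long as [-3τ, -2τ] where the
  -- centres lie; 16 is larger than 15.
  obtain ⟨M, hM⟩ := APSol.exists_integral_drift_le L h.isCompact h.energy_pos
    (show 0 < η / 16 by positivity)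
  -- As |t| ≤ 4τ, the bound 2|M| meets the virial hypothesis on an interval of length 3τ. As |t| ≤
  -- 3τ on the inner interval, 3A makes the windows A/l no longer than τ.
  obtain ⟨τ, hτ, hsub, hτM⟩ := H (max (2 * |M|) (3 * A))
  have hIcc : Set.Icc (-(3 * τ)) (-(2 * τ)) ⊆ Set.Icc (-(4 * τ)) (-τ) :=
    Set.Icc_subset_Icc (by linarith) (by linarith)
  have hl4 : -(4 * τ) ∈ Set.Icc (-(4 * τ)) (-τ) := ⟨le_rfl, by linarith⟩
  have hl1 : -τ ∈ Set.Icc (-(4 * τ)) (-τ) := ⟨by linarith, le_rfl⟩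
  have hscale : ∀ t ∈ Set.Icc (-(4 * τ)) (-τ), ∀ l y, X.act l y (φ t) ∈ K →
      M ≤ l * (-τ - -(4 * τ)) ∧ (t ∈ Set.Icc (-(3 * τ)) (-(2 * τ)) → A / l ≤ τ) := by
    intro t ht l y hly
    have hlp := coe_pos l
    have h1 := hτM t ht l y hly
    have h2 := (le_max_left _ _).trans h1
    have h3 := (le_max_right _ _).trans h1
    have habs : |t| = -t := abs_of_nonpos (by linarith [ht.2])
    rw [habs] at h2 h3
    have h4 : (l : ℝ) * -t ≤ l * (4 * τ) := mul_le_mul_of_nonneg_left (by linarith [ht.1]) hlp.le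
    refine ⟨by nlinarith [le_abs_self M, abs_nonneg M], fun ht' => ?_⟩
    have h5 : (l : ℝ) * -t ≤ l * (3 * τ) := mul_le_mul_of_nonneg_left (by linarith [ht'.1]) hlp.le
    rw [div_le_iff₀ hlp]
    linarith
  have horb : ∀ t, ∃ l y, t ∈ Set.Icc (-(4 * τ)) (-τ) → X.act l y (φ t) ∈ K := fun t => by
    by_cases ht : t ∈ Set.Icc (-(4 * τ)) (-τ)
    · obtain ⟨l, y, hl⟩ := h.inOrbit t (hsub ht)
      exact ⟨l, y, fun _ => hl⟩
    · exact ⟨mkPos 1 one_pos, 0, fun ht' => absurd ht' ht⟩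
  choose l y hly using horb
  have hint := hM I φ h (-(4 * τ)) (-τ) (by linarith) (hsub hl4) (hsub hl1) _ _ _ _ (hly _ hl4)
    (hly _ hl1) (hscale _ hl4 _ _ (hly _ hl4)).1 (hscale _ hl1 _ _ (hly _ hl1)).1
  rw [h.velocity_eq L ha (hsub hl4)] at hint
  have hle : ∀ t ∈ Set.Icc (-(3 * τ)) (-(2 * τ)), A / l t ≤ τ := fun t ht =>
    (hscale t (hIcc ht) _ _ (hly t (hIcc ht))).2 ht
  have hball : ∀ t ∈ Set.Icc (-(3 * τ)) (-(2 * τ)),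
      Set.Icc (t - A / l t) (t + A / l t) ⊆ Set.Icc (-(4 * τ)) (-τ) := fun t ht =>
    Set.Icc_subset_Icc (by linarith [hle t ht, ht.1]) (by linarith [hle t ht, ht.2])
  obtain ⟨t, ht, hti⟩ := exists_integral_le_of_integral_lt
    (f := fun s => X.drift (X.velocity (φ a)) (φ s)) (a := -(4 * τ)) (b := -τ) (c := -(3 * τ))
    (d := -(2 * τ)) (r := fun t => A / l t) (η := η) (by linarith)
    ((EnergySpace.continuous_drift _).comp_continuousOn (h.continuousOn.mono hsub))
    (fun s => EnergySpace.drift_nonneg _ _) hη.le (fun t _ => div_pos hA (coe_pos _)) hle hball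
    (by nlinarith)
  exact ⟨t, l t, y t, hly t (hIcc ht), (hball t ht).trans hsub, hti⟩

/-- The frequency scale of an almost periodic solution can not be large on long time intervals. -/
theorem APSol.false_of_scale (L : LocalWellPosedness X) (hsol : L.NoTravellingOrSelfSimilarClaim)
    (hshift : X.NoShiftInvariantClaim) {K : Set E} {e : ℝ} {I : Set ℝ} {φ : ℝ → E}
    (h : APSol X K e I φ)
    (H : ∀ M : ℝ, ∃ τ > 0, Set.Icc (-(4 * τ)) (-τ) ⊆ I ∧ ∀ t ∈ Set.Icc (-(4 * τ)) (-τ), ∀ l y,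
      X.act l y (φ t) ∈ K → M ≤ l * |t|) : False := by
  obtain ⟨a, ha⟩ := h.nonempty
  set v := X.velocity (φ a)
  -- In rescaled time the windows [-(n+1), n+1] exhaust the line, while the drift integrals 2/(n+1)
  -- still tend to zero, so the limit travels on its whole lifespan.
  choose t l y hK hsub hint using fun n : ℕ => h.exists_integral_drift_le_of_scale L ha H
    (A := n + 1) (η := 1 / ((n : ℝ) + 1) ^ 2) (by positivity) (by positivity)
  set ψ : ℕ → ℝ → E := fun n => X.rescale (l n) (y n) (t n) φ
  have hψ : ∀ n, APSol X K e _ (ψ n) := fun n => h.rescale (l n) (y n) (t n)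
  have h0 : ∀ n, ψ n 0 = X.act (l n) (y n) (φ (t n)) := fun n => by
    simp only [ψ, EnergySpace.rescale, mul_zero, zero_add]
  have hmem : ∀ n : ℕ, ∀ s ∈ Set.Icc (-((n : ℝ) + 1)) (n + 1),
      s ∈ (fun s => (l n : ℝ)⁻¹ * s + t n) ⁻¹' I := fun n s hs => by
    have hl := inv_pos.2 (coe_pos (l n))
    have h1 := mul_le_mul_of_nonneg_left hs.1 hl.le
    have h2 := mul_le_mul_of_nonneg_left hs.2 hl.le
    exact hsub n ⟨by rw [div_eq_inv_mul]; simp only; linarith, by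
      rw [div_eq_inv_mul]; simp only; linarith⟩
  have h0mem : ∀ n : ℕ, (0 : ℝ) ∈ Set.Icc (-((n : ℝ) + 1)) (n + 1) := fun n =>
    ⟨by linarith [n.cast_nonneg (α := ℝ)], by positivity⟩
  have hint' : ∀ n : ℕ, ∫ s in -((n : ℝ) + 1)..(n + 1), X.drift v (ψ n s) ≤ 2 * (1 / ((n : ℝ) + 1)) := by
    intro n
    have hl := coe_pos (l n)
    simp only [ψ, EnergySpace.rescale, EnergySpace.drift_act]
    rw [intervalIntegral.integral_comp_mul_add (fun s => X.drift v (φ s)) (inv_pos.2 hl).ne' (t n),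
      smul_eq_mul, inv_inv, ← le_div_iff₀' hl]
    refine le_of_eq_of_le ?_ ((hint n).trans_eq ?_)
    · congr 1 <;> ring
    · field_simp
  obtain ⟨Ψ, -, σ, hσ, hΨ⟩ := h.isCompact.tendsto_subseq fun n => (h0 n ▸ hK n : ψ n 0 ∈ K)
  have hlim := APSol.limit L (fun n => hψ (σ n)) (fun n => hmem _ 0 (h0mem _)) hΨ
  refine hlim.not_travelling L hsol hshift (v := v) (EnergySpace.norm_velocity_le _) fun s hs =>
    EnergySpace.ae_quad_eq_zero ?_
  by_contra hne
  have hpos : 0 < X.drift v (L.dev 0 Ψ s) := (EnergySpace.drift_nonneg _ _).lt_of_ne' hne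
  have hcont : ContinuousOn (fun s => X.drift v (L.dev 0 Ψ s)) (L.life 0 Ψ) :=
    (EnergySpace.continuous_drift v).comp_continuousOn hlim.continuousOn
  have hev : ∀ᶠ r in 𝓝 s, r ∈ L.life 0 Ψ ∧ 0 < X.drift v (L.dev 0 Ψ r) :=
    (hlim.isOpen.eventually_mem hs).and
      ((hcont.continuousAt (hlim.isOpen.mem_nhds hs)).eventually_const_lt hpos)
  obtain ⟨r, hr, hball⟩ := Metric.nhds_basis_closedBall.mem_iff.1 hev
  rw [Real.closedBall_eq_Icc] at hball
  set c := s - r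
  set d := s + r
  have hcd : c < d := by simp only [c, d]; linarith
  have hη : 0 < ∫ s in c..d, X.drift v (L.dev 0 Ψ s) := by
    refine intervalIntegral.intervalIntegral_pos_of_pos_on
      ((hcont.mono fun s hs => ?_).intervalIntegrable)
      (fun s hs => (hball (Set.Ioo_subset_Icc_self hs)).2) hcd
    rw [Set.uIcc_of_le hcd.le] at hs
    exact (hball hs).1
  have hbig : ∀ᶠ n in atTop, Set.Icc c d ⊆ Set.Icc (-((σ n : ℝ) + 1)) (σ n + 1) := by
    filter_upwards [(tendsto_natCast_atTop_atTop.comp hσ.tendsto_atTop).eventually_ge_atTop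
      (max |c| |d|)] with n hn
    have h1 := (le_max_left _ _).trans hn
    have h2 := (le_max_right _ _).trans hn
    simp only [Function.comp_apply] at h1 h2
    exact Set.Icc_subset_Icc (by linarith [neg_abs_le c]) (by linarith [le_abs_self d])
  have hconv : Tendsto (fun n => ∫ s in c..d, X.drift v (ψ (σ n) s)) atTop
      (𝓝 (∫ s in c..d, X.drift v (L.dev 0 Ψ s))) := by
    refine intervalIntegral.tendsto_integral_filter_of_dominated_convergence
      (fun _ => 4 * (1 ^ 2 + v 0 ^ 2 + v 1 ^ 2) * e) ?_ ?_ intervalIntegrable_const ?_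
    · filter_upwards [hbig] with n hn
      refine ContinuousOn.aestronglyMeasurable ?_ measurableSet_uIoc
      refine (EnergySpace.continuous_drift v).comp_continuousOn
        ((hψ (σ n)).continuousOn.mono fun s hs => ?_)
      rw [Set.uIoc_of_le hcd.le] at hs
      exact hmem _ s (hn (Set.Ioc_subset_Icc_self hs))
    · filter_upwards [hbig] with n hn
      refine .of_forall fun s hs => ?_
      rw [Set.uIoc_of_le hcd.le] at hs
      rw [Real.norm_of_nonneg (EnergySpace.drift_nonneg _ _)]
      have := (EnergySpace.physical_total (X := X) (ψ (σ n) s)).abs_quad_le (spacetimeVec 1 v)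
      rwa [EnergySpace.total_zero_zero, (hψ (σ n)).energy_eq s
        (hmem _ s (hn (Set.Ioc_subset_Icc_self hs)))] at this
    · refine .of_forall fun s hs => ?_
      rw [Set.uIoc_of_le hcd.le] at hs
      exact ((EnergySpace.continuous_drift v).tendsto _).comp (hlim.toMaxSol.tendsto L
        (fun n => (hψ (σ n)).toMaxSol) (L.mem_life 0 Ψ) (fun n => hmem _ 0 (h0mem _))
        (by rwa [L.dev_init]) (hball (Set.Ioc_subset_Icc_self hs)).1).2
  have hzero : Tendsto (fun n => 2 * (1 / ((σ n : ℝ) + 1))) atTop (𝓝 0) := by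
    simpa using (tendsto_one_div_add_atTop_nhds_zero_nat.comp hσ.tendsto_atTop).const_mul (2 : ℝ)
  refine hη.not_ge (le_of_tendsto_of_tendsto hconv hzero ?_)
  filter_upwards [hbig] with n hn
  refine le_trans ?_ (hint' (σ n))
  have hc := hn (Set.left_mem_Icc.2 hcd.le)
  have hd := hn (Set.right_mem_Icc.2 hcd.le)
  refine intervalIntegral.integral_mono_interval hc.1 hcd.le hd.2
    (.of_forall fun s => EnergySpace.drift_nonneg _ _) ?_
  refine ((EnergySpace.continuous_drift v).comp_continuousOn
    ((hψ (σ n)).continuousOn.mono fun s hs => hmem _ s ?_)).intervalIntegrable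
  rwa [Set.uIcc_of_le ((h0mem _).1.trans (h0mem _).2)] at hs

end TravellingLimit

/-! ### Exclusion of almost periodic solutions -/

section Exclusion

variable {E : Type*} [MetricSpace E] {X : EnergySpace m E} {K : Set E} {e : ℝ} {I : Set ℝ}
  {φ : ℝ → E}

/-- Almost periodic solutions do not become singular in finite time. -/
theorem APSol.le_of_mem_frontier (L : LocalWellPosedness X)
    (hsol : L.NoTravellingOrSelfSimilarClaim) (hshift : X.NoShiftInvariantClaim)
    (h : APSol X K e I φ) {a c : ℝ} (ha : a ∈ I) (hc : c ∈ frontier I) : c ≤ a := by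
  by_contra! hac
  have hcI : c ∉ I := fun hcI => by
    have := h.isOpen.inter_frontier_eq
    exact (this ▸ (⟨hcI, hc⟩ : c ∈ I ∩ frontier I) : c ∈ (∅ : Set ℝ))
  have hIco : Set.Ico a c ⊆ I := fun s hs => by
    obtain ⟨r, hr, hrI⟩ := mem_closure_iff_nhds.1 hc.1 _ (Ioi_mem_nhds hs.2)
    exact h.ordConnected.out ha hrI ⟨hs.1, le_of_lt hr⟩
  obtain ⟨xc, hxc⟩ := h.exists_cone L hc
  -- This moves the tip of the cone to the origin of spacetime without changing the scale.
  have hψ := h.rescale (mkPos 1 one_pos) (-xc) c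
  have hmem : ∀ s, s ∈ (fun s => (mkPos 1 one_pos : ℝ)⁻¹ * s + c) ⁻¹' I ↔ s + c ∈ I := fun s => by
    simp
  have hval : ∀ s, X.rescale (mkPos 1 one_pos) (-xc) c φ s
      = X.act (mkPos 1 one_pos) (-xc) (φ (s + c)) := fun s => by
    simp [EnergySpace.rescale]
  have hsub : Set.Ico (a - c) 0 ⊆ (fun s => (mkPos 1 one_pos : ℝ)⁻¹ * s + c) ⁻¹' I := fun s hs =>
    (hmem s).2 (hIco ⟨by linarith [hs.1], by linarith [hs.2]⟩)
  have hscale := hψ.eventually_le_scale L hsol (by rwa [hmem, zero_add]) (sub_neg.2 hac) hsub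
    fun t ht _ r hr => by
      rw [hval, EnergySpace.tail_act, coe_mkPos, inv_one, one_smul, one_mul, zero_sub, neg_neg]
      refine setIntegral_eq_zero_of_ae_eq_zero ?_
      filter_upwards [hxc _ ((hmem t).1 ht)] with x hx hxr
      rw [hx (by rw [add_sub_cancel_right]; exact hr.trans_le hxr)]
      rfl
  refine hψ.false_of_scale L hsol hshift fun M => ?_
  obtain ⟨t₀, ht₀, hM⟩ := hscale M
  have hmin : 0 < min (-t₀) (c - a) := lt_min (neg_pos.2 ht₀) (sub_pos.2 hac)
  have h1 := min_le_left (-t₀) (c - a)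
  have h2 := min_le_right (-t₀) (c - a)
  -- Dividing by 5 keeps [-4τ, -τ] strictly after both `t₀` and `a - c`.
  exact ⟨min (-t₀) (c - a) / 5, by positivity,
    fun s hs => hsub ⟨by linarith [hs.1], by linarith [hs.2]⟩,
    fun t ht => hM t ⟨by linarith [ht.1], by linarith [ht.2]⟩⟩

/-- Almost periodic solutions are global. -/
theorem APSol.eq_univ (L : LocalWellPosedness X) (hsol : L.NoTravellingOrSelfSimilarClaim)
    (hshift : X.NoShiftInvariantClaim) (h : APSol X K e I φ) : I = Set.univ := by
  obtain ⟨a, ha⟩ := h.nonempty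
  refine Set.eq_univ_of_forall fun b => by_contra fun hb => ?_
  obtain ⟨c, -, hc⟩ := exists_mem_frontier h.isOpen ha hb
  have h1 := h.le_of_mem_frontier L hsol hshift ha hc
  have hc' : -c ∈ frontier (Neg.neg ⁻¹' I) := by
    have := (Homeomorph.neg ℝ).preimage_frontier I
    rw [← show (Homeomorph.neg ℝ : ℝ → ℝ) = Neg.neg from rfl, ← this]
    simpa using hc
  -- Time reversal gives the opposite inequality, so the frontier point would be `a` itself, which
  -- is interior.
  have h2 := h.rev.le_of_mem_frontier L hsol hshift (a := -a) (by simpa using ha) hc'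
  obtain rfl : c = a := by linarith
  have := h.isOpen.inter_frontier_eq
  exact (this ▸ (⟨ha, hc⟩ : c ∈ I ∩ frontier I) : c ∈ (∅ : Set ℝ))

/-- There are no almost periodic solutions of positive energy. -/
theorem APSol.elim (L : LocalWellPosedness X) (hsol : L.NoTravellingOrSelfSimilarClaim)
    (hshift : X.NoShiftInvariantClaim) (h : APSol X K e I φ) : False := by
  obtain rfl := h.eq_univ L hsol hshift
  refine h.false_of_scale L hsol hshift fun M => ?_
  -- Otherwise there are times t n ≤ -(n + 1) with l|t| < M. After rescaling at `t n`, time 0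
  -- becomes the bounded time `s n`.
  by_contra! hcon
  choose t ht l y hK hM using fun n : ℕ => hcon ((n : ℝ) + 1) (by positivity) (Set.subset_univ _)
  have ht0 : ∀ n, t n < 0 := fun n => (ht n).2.trans_lt (by
    have := n.cast_nonneg (α := ℝ)
    linarith)
  set s : ℕ → ℝ := fun n => l n * |t n|
  have hs : ∀ n, s n ∈ Set.Icc 0 M := fun n =>
    ⟨mul_nonneg (coe_pos _).le (abs_nonneg _), (hM n).le⟩
  set ψ : ℕ → ℝ → E := fun n => X.rescale (l n) (y n) (t n) φ
  have hψ : ∀ n, APSol X K e Set.univ (ψ n) := fun n => h.rescale (l n) (y n) (t n)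
  have hψ0 : ∀ n, ψ n 0 ∈ K := fun n => by
    simp only [ψ, EnergySpace.rescale, mul_zero, zero_add]
    exact hK n
  have hψs : ∀ n, ψ n (s n) = X.act (l n) (y n) (φ 0) := fun n => by
    simp only [ψ, EnergySpace.rescale, s]
    rw [inv_mul_cancel_left₀ (coe_pos (l n)).ne', abs_of_neg (ht0 n), neg_add_cancel]
  obtain ⟨⟨Ψ, s'⟩, hmem, σ, hσ, hlim⟩ := (h.isCompact.prod (isCompact_Icc (a := 0) (b := M))).tendsto_subseq
    (x := fun n => (ψ n 0, s n)) fun n => ⟨hψ0 n, hs n⟩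
  have hΨ : Tendsto (fun n => ψ (σ n) 0) atTop (𝓝 Ψ) := (continuous_fst.tendsto _).comp hlim
  have hs' : Tendsto (fun n => s (σ n)) atTop (𝓝 s') := (continuous_snd.tendsto _).comp hlim
  have hlimit := APSol.limit L (fun n => hψ (σ n)) (fun n => Set.mem_univ 0) hΨ
  -- The limit is almost periodic, hence global, so convergence holds on all of [0, M] and in
  -- particular at the times `s n`.
  have hglobal := hlimit.eq_univ L hsol hshift
  have hunif := (L.continuous_dependence 0 _ Ψ hΨ 0 M (hglobal ▸ Set.subset_univ _)).2
  have hdev : ∀ n, L.dev 0 (ψ (σ n) 0) = ψ (σ n) := fun n => funext fun r =>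
    (hψ (σ n)).toMaxSol.dev_eqOn L (Set.mem_univ 0) (Set.mem_univ r)
  simp only [hdev] at hunif
  have hact : Tendsto (fun n => X.act (l (σ n)) (y (σ n)) (φ 0)) atTop (𝓝 (L.dev 0 Ψ s')) := by
    simp only [← hψs]
    refine hunif.tendsto_comp ((hlimit.continuousOn s' (hglobal ▸ Set.mem_univ s')).mono
      (hglobal ▸ Set.subset_univ _)) (tendsto_nhdsWithin_iff.2 ⟨hs', .of_forall fun n => hs _⟩)
  -- The symmetries carry the fixed state φ(0) along a convergent sequence, so their dilation
  -- factors are bounded below by `a`. Since |t| tends to infinity, l|t| < M fails.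
  obtain ⟨a, b, ha, hab⟩ := EnergySpace.exists_act_bound (X := X) (isCompact_singleton (x := φ 0))
    hact.isCompact_insert_range h.energy_pos
  obtain ⟨n, hn⟩ := exists_nat_gt (M / a)
  rw [div_lt_iff₀ ha] at hn
  have h1 := (hab (φ 0) rfl (h.energy_eq 0 (Set.mem_univ 0)).ge (l (σ n)) (y (σ n))
    (Set.mem_insert_of_mem _ ⟨n, rfl⟩)).1
  have h2 : (n : ℝ) ≤ |t (σ n)| := by
    have h3 : (n : ℝ) ≤ σ n := by exact_mod_cast hσ.id_le n
    rw [abs_of_neg (ht0 _)]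
    linarith [(ht (σ n)).2]
  have h3 : (n : ℝ) * a ≤ |t (σ n)| * l (σ n) :=
    mul_le_mul h2 h1 ha.le (abs_nonneg _)
  linarith [hM (σ n)]

theorem LocalWellPosedness.isGlobal_of_claims (L : LocalWellPosedness X)
    (hminimal : L.MinimalBlowupClaim) (hsol : L.NoTravellingOrSelfSimilarClaim)
    (hshift : X.NoShiftInvariantClaim) : L.IsGlobal := by
  by_contra hcon
  obtain ⟨t₀, Φ₀, hap, hE⟩ := hminimal hcon
  obtain ⟨K, hK, horb⟩ := EnergySpace.almostPeriodic_iff.1 hap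
  have hmax := L.maxSol t₀ Φ₀
  have h : APSol X K (X.energy Φ₀) (L.life t₀ Φ₀) (L.dev t₀ Φ₀) :=
    { toMaxSol := hmax
      isCompact := hK
      inOrbit := horb
      energy_pos := (EnergySpace.energy_nonneg Φ₀).lt_of_ne' hE
      energy_eq := fun t ht => by rw [hmax.energy_eq L (L.mem_life t₀ Φ₀) ht, L.dev_init] }
  exact h.elim L hsol hshift

theorem LocalWellPosedness.IsGlobal.globalRegularity {L : LocalWellPosedness X} (h : L.IsGlobal) :
    GlobalRegularity m := by
  intro Φ₀
  obtain ⟨φ, h1, h2, -⟩ := L.classical 0 Φ₀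
  rw [h] at h1
  exact ⟨φ, ⟨h1, h2⟩, fun ψ hψ => funext fun z =>
    hψ.1.unique h1 (Set.mem_univ 0) (fun x => (hψ.2 x).1.trans (h2 x).1.symm)
      (fun x => (hψ.2 x).2.trans (h2 x).2.symm) (Set.mem_univ z.1) z.2⟩

end Exclusion

end WaveMap

end

theorem mainTheorem1 (m : ℕ) (hm : 1 ≤ m) {E : Type*} [MetricSpace E] [CompleteSpace E]
    (X : EnergySpace m E) (L : LocalWellPosedness X)
    (hminimal : L.MinimalBlowupClaim)
    (hselfsim : L.NoTravellingOrSelfSimilarClaim)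
    (hnondeg : X.NoShiftInvariantClaim) :
    L.IsGlobal ∧ GlobalRegularity m := by
  have h := L.isGlobal_of_claims hminimal hselfsim hnondeg
  exact ⟨h, h.globalRegularity⟩
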